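/- Let $K$ be a field of characteristic $0$, let $\mathfrak g$ be a Lie algebra over $K$, $\mathfrak h\subset\mathfrak g$ a Lie subalgebra, and let $\mathfrak m\subset\mathfrak g$ be a linear subspace with $\mathfrak g=\mathfrak h\oplus\mathfrak m$ and $[\mathfrak h,\mathfrak m]\subset\mathfrak m$ (the reductive case). **Notation.** Put $ADT=\bigoplus_{k\ge 0}(U\mathfrak g)^{\otimes k}\otimes U\mathfrak h$, where the $k$-th summand has degree $|P|=k$. For $P\in (U\mathfrak g)^{\otimes k}\otimes U\mathfrak h$ and disjoint index sets $I_1,\dots,I_{k+1}\subset\{1,\dots,n+1\}$ with $n+1\in I_{k+1}$, let $P^{I_1,\dots,I_{k+1}}\in(U\mathfrak g)^{\otimes n}\otimes U\mathfrak h$ be obtained by applying iterated coproducts that spread the $j$-th tensor factor of $P$ over the positions in $I_j$ (the counit if $I_j=\emptyset$), with $1$ in the remaining positions. Set $$b(P)=P^{2,\dots,k+2}+\sum_{i=1}^{k+1}(-1)^iP^{1,\dots,i\,i+1,\dots,k+2},$$ $$\{P|Q\}=\sum_{0\le i,\ i+|Q|\le n}(-1)^{(|Q|-1)i}\,P^{1,\dots,i+1\cdots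 i+|Q|,\dots,n+1}\,Q^{i+1,\dots,i+|Q|,\,i+|Q|+1\cdots n+1},\qquad n=|P|+|Q|-1,$$ $$[P,Q]_G=\{P|Q\}-(-1)^{(|P|-1)(|Q|-1)}\{Q|P\}.$$ Let $\mathfrak g_2=ADT^{\mathfrak h}$ be the subspace of invariants for the adjoint action of $\mathfrak h$ on all tensor factors. It is filtered by $(\mathfrak g_2)_{\le n}=\mathfrak g_2\cap\bigoplus_k (U\mathfrak g)^{\otimes k}\otimes (U\mathfrak h)_{\le n}$, where $(U\mathfrak h)_{\le n}=\ker\big((\mathrm{id}-\eta\varepsilon)^{\otimes (n+1)}\circ\Delta^{(n)}\big)$, with $\varepsilon$ and $\eta$ the counit and unit and $\Delta^{(n)}:U\mathfrak h\to (U\mathfrak h)^{\otimes (n+1)}$ the iterated coproduct. Let $U\mathfrak m=\mathrm{sym}(S\mathfrak m)\subset U\mathfrak g$ be the span of the symmetrized products of elements of $\mathfrak m$, let $T^*U\mathfrak m=\bigoplus_k(U\mathfrak m)^{\otimes k}$, regarded as a subspace of $ADT$ through $P\mapsto P\otimes 1$, and let $(T^*U\mathfrak m)^{\mathfrak h}$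 be its subspace of $\mathfrak h$-invariants. Let $p:U\mathfrak g\to U\mathfrak m$ be the projection along $U\mathfrak g\cdot\mathfrak h$, let $b_{\mathfrak m}$ be the Hochschild coboundary operator (the restriction of $b$ to $T^*U\mathfrak m$), and let $[\,,]_{G,\mathfrak m}=(\otimes p)\circ[\,,]_G$ on $(T^*U\mathfrak m)^{\mathfrak h}$. **Statement.** One has $U\mathfrak g=U\mathfrak m\oplus U\mathfrak g\cdot\mathfrak h$, so that $p$ is well defined. Both $\mathfrak g_2[1]$, with bracket $[\,,]_G$ and differential $P\mapsto(-1)^{|P|-1}b(P)$, and $(T^*U\mathfrak m)^{\mathfrak h}[1]$, with bracket $[\,,]_{G,\mathfrak m}$ and differential $P\mapsto(-1)^{|P|-1}b_{\mathfrak m}(P)$, are differential graded Lie algebras, and there is an $L_\infty$-quasi-isomorphism $$\mathcal Q_2:(T^*U\mathfrak m)^{\mathfrak h}[1]\longrightarrow\mathfrak g_2[1]$$ whose first structure map $\mathcal Q_2^1$ is the natural inclusion $P\mapsto P\otimes 1$ and whose $n$-th structure map $\mathcal Q_2^n$ takes values in $(\mathfrak g_2)_{\le n-1}$ for every $n\ge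 1$. -/

import Mathlib

open scoped TensorProduct DirectSum

noncomputable section

namespace DynTwist

/-! ## Differential graded Lie algebras and `L_∞`-morphisms between them -/

/-- A differential graded Lie algebra structure on a vector space `V`: a `ℤ`-grading, a
differential of degree `1` and a graded Lie bracket of degree `0`. -/
structure DGLA (K V : Type*) [Field K] [AddCommGroup V] [Module K V] where
  deg : ℤ → Submodule K V
  isInternal : DirectSum.IsInternal deg
  d : V →ₗ[K] V
  br : V →ₗ[K] V →ₗ[K] V
  d_mem : ∀ i, ∀ x ∈ deg i, d x ∈ deg (i + 1)
  br_mem : ∀ i j, ∀ x ∈ deg i, ∀ y ∈ deg j, br x y ∈ deg (i + j)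
  d_d : ∀ x, d (d x) = 0
  skew : ∀ i j, ∀ x ∈ deg i, ∀ y ∈ deg j, br x y = -((i * j).negOnePow • br y x)
  leibniz : ∀ i j, ∀ x ∈ deg i, ∀ y ∈ deg j,
    d (br x y) = br (d x) y + i.negOnePow • br x (d y)
  jacobi : ∀ i j k, ∀ x ∈ deg i, ∀ y ∈ deg j, ∀ z ∈ deg k,
    br x (br y z) = br (br x y) z + (i * j).negOnePow • br y (br x z)

/-- The Koszul sign of the permutation `(x_1, …, x_n) ↦ (x_{σ 1}, …, x_{σ n})`, where `x_i` has
degree `e i` in the differential graded Lie algebra, hence degree `e i - 1` in its shift. -/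
def permSign {n : ℕ} (e : Fin n → ℤ) (σ : Equiv.Perm (Fin n)) : ℤˣ :=
  ∏ i, ∏ j ∈ Finset.univ.filter (fun j => i < j ∧ σ j < σ i),
    ((e (σ i) - 1) * (e (σ j) - 1)).negOnePow

/-- The Koszul sign (for the shifted degrees) of moving the entries with index in `I` in front of
the others, the order inside `I` and inside its complement being preserved. -/
def shuffleSign {n : ℕ} (e : Fin n → ℤ) (I : Finset (Fin n)) : ℤˣ :=
  ∏ i ∈ I, ∏ j ∈ Iᶜ.filter (fun j => j < i), ((e i - 1) * (e j - 1)).negOnePow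

/-- The subfamily of `x` with indices in `I`, in increasing order. -/
def sub {V : Type*} {n : ℕ} (x : Fin n → V) (I : Finset (Fin n)) : Fin I.card → V :=
  x ∘ I.orderEmbOfFin rfl

/-- An `L_∞`-morphism between differential graded Lie algebras `A` and `B`, given by its structure
maps `map n : Λⁿ A → B[1 - n]`, which are regarded as graded symmetric maps of degree `0` on the
shifted space `A[1]`.

On `A[1]` the codifferential has the Taylor coefficients `q₁ x = d x` and
`q₂ (x, y) = (-1)^{|x|} [x, y]`, with `|x|` the degree of `x` in `A`, and likewise on `B[1]`.
The field `comm` says that the coalgebra morphism of the cofree cocommutative coalgebras with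
Taylor coefficients `map n` commutes with the codifferentials. As `map 0 = 0`, the terms with `I`
empty or full vanish in the first sum. -/
structure LInftyHom {K V W : Type*} [Field K] [AddCommGroup V] [Module K V] [AddCommGroup W]
    [Module K W] (A : DGLA K V) (B : DGLA K W) where
  map : (n : ℕ) → MultilinearMap K (fun _ : Fin n => V) W
  map_zero : map 0 = 0
  map_mem : ∀ (n : ℕ) (e : Fin n → ℤ) (x : Fin n → V), (∀ i, x i ∈ A.deg (e i)) →
    map n x ∈ B.deg (∑ i, e i + 1 - n)
  symm : ∀ (n : ℕ) (e : Fin n → ℤ) (x : Fin n → V), (∀ i, x i ∈ A.deg (e i)) →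
    ∀ σ : Equiv.Perm (Fin n), map n (x ∘ σ) = permSign e σ • map n x
  comm : ∀ (n : ℕ) (e : Fin n → ℤ) (x : Fin n → V), (∀ i, x i ∈ A.deg (e i)) →
    B.d (map n x) +
      (2 : K)⁻¹ • ∑ I : Finset (Fin n),
        (shuffleSign e I * (∑ i ∈ I, (e i - 1) + 1).negOnePow) •
          B.br (map I.card (sub x I)) (map Iᶜ.card (sub x Iᶜ)) =
    (∑ i, shuffleSign e {i} •
        map (({i}ᶜ : Finset (Fin n)).card + 1)
          (Fin.cons (α := fun _ => V) (A.d (x i)) (sub x {i}ᶜ))) +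
      ∑ i, ∑ j ∈ Finset.univ.filter (fun j => i < j),
        (shuffleSign e {i, j} * (e i).negOnePow) •
          map (({i, j}ᶜ : Finset (Fin n)).card + 1)
            (Fin.cons (α := fun _ => V) (A.br (x i) (x j)) (sub x {i, j}ᶜ))

/-- An `L_∞`-morphism is an `L_∞`-quasi-isomorphism if its first structure map induces a
bijection (the two conjuncts: injectivity and surjectivity) in cohomology. -/
def LInftyHom.IsQuasiIso {K V W : Type*} [Field K] [AddCommGroup V] [Module K V]
    [AddCommGroup W] [Module K W] {A : DGLA K V} {B : DGLA K W} (F : LInftyHom A B) : Prop :=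
  (∀ x, A.d x = 0 → (∃ w, B.d w = F.map 1 ![x]) → ∃ v, A.d v = x) ∧
    ∀ w, B.d w = 0 → ∃ x, A.d x = 0 ∧ ∃ w', w - F.map 1 ![x] = B.d w'

/-! ## The algebras `⊗ᵏ U𝔤 ⊗ U𝔥` and the superscript notation -/

attribute [local instance 100] LieRing.ofAssociativeRing

variable (K : Type*) [Field K] {𝔤 : Type*} [LieRing 𝔤] [LieAlgebra K 𝔤] (𝔥 : LieSubalgebra K 𝔤)

/-- The degree `k` part `⊗ᵏ U𝔤 ⊗ U𝔥` of the graded vector space `ADT = T^*U𝔤 ⊗ U𝔥`,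
an associative algebra for the factorwise product. -/
def ADT (k : ℕ) : Type _ :=
  (⨂[K] _ : Fin k, UniversalEnvelopingAlgebra K 𝔤) ⊗[K] UniversalEnvelopingAlgebra K 𝔥

instance (k : ℕ) : Ring (ADT K 𝔥 k) :=
  inferInstanceAs (Ring
    ((⨂[K] _ : Fin k, UniversalEnvelopingAlgebra K 𝔤) ⊗[K] UniversalEnvelopingAlgebra K 𝔥))

instance (k : ℕ) : Algebra K (ADT K 𝔥 k) :=
  inferInstanceAs (Algebra K
    ((⨂[K] _ : Fin k, UniversalEnvelopingAlgebra K 𝔤) ⊗[K] UniversalEnvelopingAlgebra K 𝔥))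

/-- The identity map from the tensor product to `ADT K 𝔥 k`. -/
def toADT (k : ℕ) :
    ((⨂[K] _ : Fin k, UniversalEnvelopingAlgebra K 𝔤) ⊗[K] UniversalEnvelopingAlgebra K 𝔥) ≃ₐ[K]
      ADT K 𝔥 k :=
  AlgEquiv.refl

/-- The embedding of `U𝔤` as the `i`-th tensor factor. -/
def leg {k : ℕ} (i : Fin k) : UniversalEnvelopingAlgebra K 𝔤 →ₐ[K] ADT K 𝔥 k :=
  ((toADT K 𝔥 k).toAlgHom.comp Algebra.TensorProduct.includeLeft).comp
    (PiTensorProduct.singleAlgHom (R := K) (A := fun _ : Fin k => UniversalEnvelopingAlgebra K 𝔤) i)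

/-- The embedding of `U𝔥` as the last tensor factor. -/
def tail (k : ℕ) : UniversalEnvelopingAlgebra K 𝔥 →ₐ[K] ADT K 𝔥 k :=
  (toADT K 𝔥 k).toAlgHom.comp Algebra.TensorProduct.includeRight

theorem leg_commute {k : ℕ} {i j : Fin k} (hij : i ≠ j) (u v : UniversalEnvelopingAlgebra K 𝔤) :
    Commute (leg K 𝔥 i u) (leg K 𝔥 j v) := by
  have h : Commute (PiTensorProduct.singleAlgHom (R := K)
      (A := fun _ : Fin k => UniversalEnvelopingAlgebra K 𝔤) i u)
      (PiTensorProduct.singleAlgHom (R := K)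
      (A := fun _ : Fin k => UniversalEnvelopingAlgebra K 𝔤) j v) := by
    simp only [PiTensorProduct.singleAlgHom_apply]
    exact Commute.tprod (Pi.mulSingle_commute (f := fun _ => UniversalEnvelopingAlgebra K 𝔤) hij u v)
  exact h.map ((toADT K 𝔥 k).toAlgHom.comp Algebra.TensorProduct.includeLeft)

theorem leg_tail_commute {k : ℕ} (i : Fin k) (u : UniversalEnvelopingAlgebra K 𝔤)
    (v : UniversalEnvelopingAlgebra K 𝔥) : Commute (leg K 𝔥 i u) (tail K 𝔥 k v) := by
  have h : Commute (PiTensorProduct.singleAlgHom (R := K)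
      (A := fun _ : Fin k => UniversalEnvelopingAlgebra K 𝔤) i u ⊗ₜ[K]
        (1 : UniversalEnvelopingAlgebra K 𝔥)) (1 ⊗ₜ[K] v) := by
    rw [Commute, SemiconjBy, Algebra.TensorProduct.tmul_mul_tmul,
      Algebra.TensorProduct.tmul_mul_tmul, mul_one, one_mul, one_mul, mul_one]
  exact h.map (toADT K 𝔥 k).toAlgHom

theorem lie_sum_leg {k : ℕ} (I : Finset (Fin k)) (x y : 𝔤) :
    ⁅∑ i ∈ I, leg K 𝔥 i (UniversalEnvelopingAlgebra.ι K x),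
      ∑ i ∈ I, leg K 𝔥 i (UniversalEnvelopingAlgebra.ι K y)⁆ =
    ∑ i ∈ I, leg K 𝔥 i (UniversalEnvelopingAlgebra.ι K ⁅x, y⁆) := by
  rw [LieRing.of_associative_ring_bracket, Finset.sum_mul_sum, Finset.sum_mul_sum,
    Finset.sum_comm (f := fun i j => leg K 𝔥 i (UniversalEnvelopingAlgebra.ι K y) *
      leg K 𝔥 j (UniversalEnvelopingAlgebra.ι K x)), ← Finset.sum_sub_distrib]
  refine Finset.sum_congr rfl fun i hi => ?_
  rw [← Finset.sum_sub_distrib, Finset.sum_eq_single_of_mem i hi]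
  · rw [LieHom.map_lie, LieRing.of_associative_ring_bracket, map_sub, map_mul, map_mul]
  · intro j _ hj
    rw [(leg_commute K 𝔥 hj.symm _ _).eq, sub_self]

/-- The iterated coproduct `U𝔤 → ⊗^{|I|} U𝔤`, with values in the tensor factors with index in `I`:
the algebra morphism with `x ↦ ∑_{i ∈ I} x_i` for `x ∈ 𝔤`. For empty `I` it is the counit. -/
def spread {k : ℕ} (I : Finset (Fin k)) : UniversalEnvelopingAlgebra K 𝔤 →ₐ[K] ADT K 𝔥 k :=
  UniversalEnvelopingAlgebra.lift K
    { toLinearMap := ∑ i ∈ I,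
        (leg K 𝔥 i).toLinearMap ∘ₗ (UniversalEnvelopingAlgebra.ι K : 𝔤 →ₗ⁅K⁆ _).toLinearMap
      map_lie' := by
        intro x y
        simpa using (lie_sum_leg K 𝔥 I x y).symm }

/-- The iterated coproduct `U𝔥 → ⊗^{|I|} U𝔤 ⊗ U𝔥`, with values in the tensor factors with index
in `I` and in the last one: the algebra morphism with `y ↦ ∑_{i ∈ I} y_i + y_last`, `y ∈ 𝔥`. -/
def spreadTail {k : ℕ} (I : Finset (Fin k)) : UniversalEnvelopingAlgebra K 𝔥 →ₐ[K] ADT K 𝔥 k :=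
  UniversalEnvelopingAlgebra.lift K
    { toLinearMap := ∑ i ∈ I,
        (leg K 𝔥 i).toLinearMap ∘ₗ (UniversalEnvelopingAlgebra.ι K : 𝔤 →ₗ⁅K⁆ _).toLinearMap ∘ₗ
          𝔥.toSubmodule.subtype +
        (tail K 𝔥 k).toLinearMap ∘ₗ (UniversalEnvelopingAlgebra.ι K : 𝔥 →ₗ⁅K⁆ _).toLinearMap
      map_lie' := by
        intro x y
        have h := lie_sum_leg K 𝔥 I (x : 𝔤) (y : 𝔤)
        have hc : ∀ x y : 𝔥, Commute
            (∑ i ∈ I, leg K 𝔥 i (UniversalEnvelopingAlgebra.ι K (x : 𝔤)))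
            (tail K 𝔥 k (UniversalEnvelopingAlgebra.ι K y)) := fun x y =>
          Commute.sum_left _ _ _ fun i _ => leg_tail_commute K 𝔥 i _ _
        have h1 := (hc x y).eq
        have h2 := (hc y x).eq
        rw [LieRing.of_associative_ring_bracket] at h
        simp only [AddHom.toFun_eq_coe, LinearMap.coe_toAddHom, LinearMap.add_apply,
          LinearMap.sum_apply, LinearMap.comp_apply, AlgHom.toLinearMap_apply,
          LieHom.coe_toLinearMap,
          LieHom.map_lie (UniversalEnvelopingAlgebra.ι K : 𝔥 →ₗ⁅K⁆ _),
          LieRing.of_associative_ring_bracket, map_sub, map_mul]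
        change ∑ i ∈ I, leg K 𝔥 i (UniversalEnvelopingAlgebra.ι K ⁅(x : 𝔤), (y : 𝔤)⁆) + _ =
          (∑ i ∈ I, leg K 𝔥 i (UniversalEnvelopingAlgebra.ι K (x : 𝔤)) + _) *
            (∑ i ∈ I, leg K 𝔥 i (UniversalEnvelopingAlgebra.ι K (y : 𝔤)) + _) -
          (∑ i ∈ I, leg K 𝔥 i (UniversalEnvelopingAlgebra.ι K (y : 𝔤)) + _) *
            (∑ i ∈ I, leg K 𝔥 i (UniversalEnvelopingAlgebra.ι K (x : 𝔤)) + _)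
        rw [← h]
        simp only [add_mul, mul_add, h1, h2]
        abel }

/-- The superscript notation: `P ↦ P^{I_1, …, I_k, J ∪ {last}}`, that is, the iterated coproduct
spreads the `j`-th tensor factor of `P` over the factors in `I_j`, and the last one over the
factors in `J` and the last one. It is used for pairwise disjoint index sets only (so that the
order of the product is immaterial); the factors that do not occur in any of the sets are `1`. -/
def sup {k n : ℕ} (I : Fin k → Finset (Fin n)) (J : Finset (Fin n)) :
    ADT K 𝔥 k →ₗ[K] ADT K 𝔥 n :=
  TensorProduct.lift
    ((LinearMap.mul K (ADT K 𝔥 n)).compl₁₂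
      (PiTensorProduct.lift ((MultilinearMap.mkPiAlgebraFin K k (ADT K 𝔥 n)).compLinearMap
        fun j => (spread K 𝔥 (I j)).toLinearMap))
      (spreadTail K 𝔥 J).toLinearMap) ∘ₗ
    (toADT K 𝔥 k).symm.toLinearMap

/-! ## The operations on `ADT` -/

/-- The coboundary operator
`b P = P^{2, …, k+2} + ∑_{i=1}^{k+1} (-1)^i P^{1, …, i i+1, …, k+2}` on `⊗ᵏ U𝔤 ⊗ U𝔥`
(positions are counted from `0` in the code, so `i` is shifted by one). -/
def b (k : ℕ) : ADT K 𝔥 k →ₗ[K] ADT K 𝔥 (k + 1) :=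
  sup K 𝔥 (fun j => {j.succ}) ∅ +
    ∑ i ∈ Finset.range (k + 1), (-1 : ℤ) ^ (i + 1) •
      sup K 𝔥
        (fun j : Fin k => Finset.univ.filter fun l : Fin (k + 1) =>
          ((l : ℕ) = j ∧ (j : ℕ) ≤ i) ∨ ((l : ℕ) = j + 1 ∧ i ≤ (j : ℕ)))
        (Finset.univ.filter fun l : Fin (k + 1) => (l : ℕ) = k ∧ i = k)

/-- The brace `{P | Q}` of `P` of degree `p` and `Q` of degree `q`, an element of degree
`n = p + q - 1`:
`∑_{0 ≤ i, i + q ≤ n} (-1)^{(q-1) i} P^{1, …, i+1 … i+q, …, n+1} Q^{i+1, …, i+q, i+q+1 … n+1}`. -/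
def brace (p q n : ℕ) : ADT K 𝔥 p →ₗ[K] ADT K 𝔥 q →ₗ[K] ADT K 𝔥 n :=
  ∑ i ∈ Finset.range p, (-1 : ℤ) ^ ((q + 1) * i) •
    (LinearMap.mul K (ADT K 𝔥 n)).compl₁₂
      (sup K 𝔥
        (fun j : Fin p => Finset.univ.filter fun l : Fin n =>
          ((l : ℕ) = j ∧ (j : ℕ) < i) ∨ ((j : ℕ) = i ∧ i ≤ (l : ℕ) ∧ (l : ℕ) < i + q) ∨
            ((l : ℕ) + 1 = j + q ∧ i < (j : ℕ)))
        ∅)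
      (sup K 𝔥
        (fun j : Fin q => Finset.univ.filter fun l : Fin n => (l : ℕ) = i + j)
        (Finset.univ.filter fun l : Fin n => i + q ≤ (l : ℕ)))

/-- The bracket `[P, Q]_G = {P | Q} - (-1)^{(|P|-1)(|Q|-1)} {Q | P}`, of degree `|P| + |Q| - 1`
(both braces are zero if `|P| = |Q| = 0`). -/
def bracket (p q : ℕ) : ADT K 𝔥 p →ₗ[K] ADT K 𝔥 q →ₗ[K] ADT K 𝔥 (p + q - 1) :=
  brace K 𝔥 p q (p + q - 1) - (-1 : ℤ) ^ ((p + 1) * (q + 1)) • (brace K 𝔥 q p (p + q - 1)).flip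

/-- The graded vector space `ADT = ⨁_k ⊗ᵏ U𝔤 ⊗ U𝔥`. -/
abbrev ADTTot : Type _ := ⨁ k, ADT K 𝔥 k

/-- The differential `P ↦ (-1)^{|P|-1} b P = [1^{⊗3}, P]_G` on `ADT`. (The sign is the one for
which the Leibniz rule holds in the form `d[P, Q] = [dP, Q] + (-1)^{|P|-1} [P, dQ]`. The operator
`b` itself satisfies it in the form `b[P, Q] = [P, bQ] + (-1)^{|Q|-1} [bP, Q]`.) -/
def dTot : ADTTot K 𝔥 →ₗ[K] ADTTot K 𝔥 :=
  DirectSum.toModule K ℕ _ fun k =>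
    (-1 : ℤ) ^ (k + 1) • (DirectSum.lof K ℕ (ADT K 𝔥) (k + 1) ∘ₗ b K 𝔥 k)

/-- The bracket `[ , ]_G` on `ADT`. -/
def bracketTot : ADTTot K 𝔥 →ₗ[K] ADTTot K 𝔥 →ₗ[K] ADTTot K 𝔥 :=
  DirectSum.toModule K ℕ _ fun p => LinearMap.flip <|
    DirectSum.toModule K ℕ _ fun q => LinearMap.flip <|
      (bracket K 𝔥 p q).compr₂ (DirectSum.lof K ℕ (ADT K 𝔥) (p + q - 1))

/-- The subspace of `𝔥`-invariants of `ADT`; `y ∈ 𝔥` acts on `⊗ᵏ U𝔤 ⊗ U𝔥` by the adjoint action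
in all tensor factors, that is, by the commutator with `y_1 + ⋯ + y_k + y_{k+1}`, so that `P` is
invariant if and only if it commutes with these elements. -/
def invariants : Submodule K (ADTTot K 𝔥) where
  carrier := {P | ∀ (y : 𝔥) (k : ℕ),
    Commute (spreadTail K 𝔥 Finset.univ (UniversalEnvelopingAlgebra.ι K y)) (P k)}
  zero_mem' := by intro y k; simp
  add_mem' := by
    intro P Q hP hQ y k
    rw [DirectSum.add_apply]
    exact (hP y k).add_right (hQ y k)
  smul_mem' := by
    intro c P hP y k
    rw [DirectSum.smul_apply]
    exact (hP y k).smul_right c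

/-- The endomorphism `η ∘ ε` of `U𝔥`, with `ε` the counit and `η` the unit. -/
def unitCounit : UniversalEnvelopingAlgebra K 𝔥 →ₐ[K] UniversalEnvelopingAlgebra K 𝔥 :=
  (Algebra.ofId K _).comp (UniversalEnvelopingAlgebra.lift K (0 : 𝔥 →ₗ⁅K⁆ K))

theorem lie_sum_single {n : ℕ} (x y : 𝔥) :
    ⁅∑ i, PiTensorProduct.singleAlgHom (R := K)
        (A := fun _ : Fin n => UniversalEnvelopingAlgebra K 𝔥) i
        (UniversalEnvelopingAlgebra.ι K x),
      ∑ i, PiTensorProduct.singleAlgHom (R := K)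
        (A := fun _ : Fin n => UniversalEnvelopingAlgebra K 𝔥) i
        (UniversalEnvelopingAlgebra.ι K y)⁆ =
    ∑ i, PiTensorProduct.singleAlgHom (R := K)
        (A := fun _ : Fin n => UniversalEnvelopingAlgebra K 𝔥) i
        (UniversalEnvelopingAlgebra.ι K ⁅x, y⁆) := by
  rw [LieRing.of_associative_ring_bracket, Finset.sum_mul_sum, Finset.sum_mul_sum,
    Finset.sum_comm (f := fun i j => PiTensorProduct.singleAlgHom (R := K)
        (A := fun _ : Fin n => UniversalEnvelopingAlgebra K 𝔥) i
        (UniversalEnvelopingAlgebra.ι K y) * PiTensorProduct.singleAlgHom (R := K)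
        (A := fun _ : Fin n => UniversalEnvelopingAlgebra K 𝔥) j
        (UniversalEnvelopingAlgebra.ι K x)), ← Finset.sum_sub_distrib]
  refine Finset.sum_congr rfl fun i hi => ?_
  rw [← Finset.sum_sub_distrib, Finset.sum_eq_single_of_mem i hi]
  · rw [LieHom.map_lie, LieRing.of_associative_ring_bracket, map_sub, map_mul, map_mul]
  · intro j _ hj
    have h : Commute (PiTensorProduct.singleAlgHom (R := K)
        (A := fun _ : Fin n => UniversalEnvelopingAlgebra K 𝔥) i
        (UniversalEnvelopingAlgebra.ι K x)) (PiTensorProduct.singleAlgHom (R := K)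
        (A := fun _ : Fin n => UniversalEnvelopingAlgebra K 𝔥) j
        (UniversalEnvelopingAlgebra.ι K y)) := by
      simp only [PiTensorProduct.singleAlgHom_apply]
      exact Commute.tprod
        (Pi.mulSingle_commute (f := fun _ => UniversalEnvelopingAlgebra K 𝔥) hj.symm _ _)
    rw [h.eq, sub_self]

/-- The iterated coproduct `U𝔥 → ⊗ⁿ U𝔥`, the algebra morphism with `y ↦ ∑_i y_i` for `y ∈ 𝔥`. -/
def iterCoproduct (n : ℕ) :
    UniversalEnvelopingAlgebra K 𝔥 →ₐ[K] ⨂[K] _ : Fin n, UniversalEnvelopingAlgebra K 𝔥 :=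
  UniversalEnvelopingAlgebra.lift K
    { toLinearMap := ∑ i, (PiTensorProduct.singleAlgHom (R := K)
        (A := fun _ : Fin n => UniversalEnvelopingAlgebra K 𝔥) i).toLinearMap ∘ₗ
          (UniversalEnvelopingAlgebra.ι K : 𝔥 →ₗ⁅K⁆ _).toLinearMap
      map_lie' := by
        intro x y
        simpa using (lie_sum_single K 𝔥 (n := n) x y).symm }

/-- The filtration `(U𝔥)_{≤ n} = ker ((id - η ∘ ε)^{⊗ n+1} ∘ Δ^{(n)})`. -/
def filtU (n : ℕ) : Submodule K (UniversalEnvelopingAlgebra K 𝔥) :=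
  LinearMap.ker
    (PiTensorProduct.map (fun _ : Fin (n + 1) =>
        (LinearMap.id - (unitCounit K 𝔥).toLinearMap :
          UniversalEnvelopingAlgebra K 𝔥 →ₗ[K] UniversalEnvelopingAlgebra K 𝔥)) ∘ₗ
      (iterCoproduct K 𝔥 (n + 1)).toLinearMap)

/-- The filtration of `ADT` induced by the one of `U𝔥`:
the degree `k` part of `ADT_{≤ n}` is `⊗ᵏ U𝔤 ⊗ (U𝔥)_{≤ n}`. -/
def filtADT (n : ℕ) : Submodule K (ADTTot K 𝔥) where
  carrier := {P | ∀ k, P k ∈ LinearMap.range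
    ((toADT K 𝔥 k).toLinearMap ∘ₗ LinearMap.lTensor (⨂[K] _ : Fin k, UniversalEnvelopingAlgebra K 𝔤) (filtU K 𝔥 n).subtype)}
  zero_mem' := fun _ => Submodule.zero_mem _
  add_mem' := fun hP hQ k => by
    rw [DirectSum.add_apply]; exact Submodule.add_mem _ (hP k) (hQ k)
  smul_mem' := fun c P hP k => by
    rw [DirectSum.smul_apply]; exact Submodule.smul_mem _ c (hP k)

/-! ## The reductive case -/

/-- `U𝔪 = sym (S𝔪) ⊆ U𝔤`, the span of the symmetrized products
`1/n! ∑_σ x_{σ 1} ⋯ x_{σ n}` of elements of `𝔪`. -/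
def Um (𝔪 : Submodule K 𝔤) : Submodule K (UniversalEnvelopingAlgebra K 𝔤) :=
  Submodule.span K {u | ∃ (n : ℕ) (x : Fin n → 𝔪), u = (n.factorial : K)⁻¹ •
    ∑ σ : Equiv.Perm (Fin n),
      (List.ofFn fun i => UniversalEnvelopingAlgebra.ι K (x (σ i) : 𝔤)).prod}

/-- `U𝔤 · 𝔥`, the left ideal of `U𝔤` generated by `𝔥`. -/
def Ugh : Submodule K (UniversalEnvelopingAlgebra K 𝔤) :=
  (Ideal.span ((UniversalEnvelopingAlgebra.ι K : 𝔤 → _) '' (𝔥 : Set 𝔤))).restrictScalars K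

open Classical in
/-- The projection `p : U𝔤 → U𝔪` along `U𝔤 · 𝔥`, regarded as an endomorphism of `U𝔤`
(it exists if and only if `U𝔤 = U𝔪 ⊕ U𝔤 · 𝔥`, and is replaced by zero otherwise). -/
def proj (𝔪 : Submodule K 𝔤) : UniversalEnvelopingAlgebra K 𝔤 →ₗ[K] UniversalEnvelopingAlgebra K 𝔤 :=
  if hc : IsCompl (Um K 𝔪) (Ugh K 𝔥) then
    (Um K 𝔪).projection (Ugh K 𝔥) hc
  else 0

/-- The map `(⊗ᵏ p) ⊗ ε : ⊗ᵏ U𝔤 ⊗ U𝔥 → ⊗ᵏ U𝔪`, followed by the inclusion `P ↦ P ⊗ 1`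
of `⊗ᵏ U𝔪` into `⊗ᵏ U𝔤 ⊗ U𝔥`, in all degrees `k`. -/
def projTot (𝔪 : Submodule K 𝔤) : ADTTot K 𝔥 →ₗ[K] ADTTot K 𝔥 :=
  DirectSum.toModule K ℕ _ fun k => DirectSum.lof K ℕ (ADT K 𝔥) k ∘ₗ
    (toADT K 𝔥 k).toLinearMap ∘ₗ
    TensorProduct.map (PiTensorProduct.map fun _ : Fin k => proj K 𝔥 𝔪)
      (unitCounit K 𝔥).toLinearMap ∘ₗ
    (toADT K 𝔥 k).symm.toLinearMap

/-- `T^*U𝔪 = ⨁_k ⊗ᵏ U𝔪`, identified with its image in `ADT` under the natural inclusion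
`P ↦ P ⊗ 1`. On this image `b` is the Hochschild coboundary operator of `T^*U𝔤`, and `[ , ]_G` is
the Gerstenhaber bracket of `T^*U𝔤`. -/
def TUm (𝔪 : Submodule K 𝔤) : Submodule K (ADTTot K 𝔥) where
  carrier := {P | ∀ k, P k ∈ LinearMap.range
    ((toADT K 𝔥 k).toLinearMap ∘ₗ (TensorProduct.mk K (⨂[K] _ : Fin k, UniversalEnvelopingAlgebra K 𝔤)
        (UniversalEnvelopingAlgebra K 𝔥)).flip 1 ∘ₗ
      PiTensorProduct.map fun _ : Fin k => (Um K 𝔪).subtype)}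
  zero_mem' := fun _ => Submodule.zero_mem _
  add_mem' := fun hP hQ k => by
    rw [DirectSum.add_apply]; exact Submodule.add_mem _ (hP k) (hQ k)
  smul_mem' := fun c P hP k => by
    rw [DirectSum.smul_apply]; exact Submodule.smul_mem _ c (hP k)

/-- `𝔤₂ = ADT^𝔥`. -/
abbrev g₂ : Submodule K (ADTTot K 𝔥) := invariants K 𝔥

/-- `(T^*U𝔪)^𝔥`. -/
abbrev TUmInv (𝔪 : Submodule K 𝔤) : Submodule K (ADTTot K 𝔥) := TUm K 𝔥 𝔪 ⊓ invariants K 𝔥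

/-- The grading of `L[1]`, for a graded subspace `L` of `ADT`: the part of degree `n` of `L[1]`
consists of the elements of `L` that are homogeneous of degree `n + 1` in `ADT`. -/
def shiftedDeg (L : Submodule K (ADTTot K 𝔥)) (n : ℤ) : Submodule K L where
  carrier := {P | ∀ k : ℕ, (k : ℤ) ≠ n + 1 → (P : ADTTot K 𝔥) k = 0}
  zero_mem' := fun _ _ => rfl
  add_mem' := fun {P Q} hP hQ k hk => by
    rw [Submodule.coe_add, DirectSum.add_apply, hP k hk, hQ k hk, add_zero]
  smul_mem' := fun c P hP k hk => by
    rw [Submodule.coe_smul, DirectSum.smul_apply, hP k hk, smul_zero]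

end DynTwist

end

noncomputable section

namespace DynTwist

attribute [local instance 100] LieRing.ofAssociativeRing

section

/-! ## Koszul signs of ordered partitions -/

section Sign

variable {ι : Type*} [LinearOrder ι]

/-! Write `A` for `(T^*U𝔪)^𝔥[1]` and `B` for `𝔤₂[1]`. The inclusion `A → B` is a chain map but does
not respect brackets. The projection does. The kernel of `projTot`, that is of `(⊗ p) ⊗ ε`, consists
in each degree of the left ideal generated by the copies of `𝔥` in all tensor factors, and
bracketing an element of this kernel with an invariant element stays in the kernel
(`circ_mem_hIdeal_left`): invariance is what allows a letter of `𝔥` to be moved past the other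
factor. So `B → A` is a strict surjection of differential graded Lie algebras, and the bracket of
`A` satisfies the Jacobi identity as a quotient bracket.

Suppose moreover that there is a homotopy `h` on `B` with `d h + h d = 1 - incl pr` and `pr h = 0`
(a `StrictContraction`). Solve `F = incl x - 1/2 h [F, F]` recursively, which amounts to a sum over
binary trees; the part of `F` that is linear in each of `x_1, …, x_n` is the `n`-th structure map.
By the Leibniz rule, the Jacobi identity and `pr F = x`, the curvature `R = dF + 1/2 [F, F]`
satisfies `R = incl r - h [R, F]`, with `r` the curvature of `x` in `A` (`curvature_transfer`). The
derivative of `F` in the direction `r` satisfies the same linear equation (`insertions_eq`), whose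
solution is unique. The equality of the two is the equation of an `L_∞`-morphism. Its first
structure map is the inclusion, a quasi-isomorphism because `pr` inverts it up to homotopy. A tree
with `n` leaves contains `h` exactly `n - 1` times; as brackets add filtration degrees and `h`
raises them by one, the filtration statement follows.

It remains to construct `h`. The algebra `⊗ᵏ U𝔤 ⊗ U𝔥` is the enveloping algebra of `𝔤ᵏ × 𝔥`. By the
Poincaré–Birkhoff–Witt theorem it is identified with the symmetric algebra through `Psi`, which
symmetrizes the `𝔪`-part and the `𝔥`-part separately and multiplies them in this order. The same
argument for `𝔤` alone gives `U𝔤 = U𝔪 ⊕ U𝔤 · 𝔥`. Under `Psi` the iterated coproducts become linear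
substitutions, so `b` becomes an alternating sum of substitutions (`cob`), and `projTot` becomes the
substitution that kills the `𝔥`-components.

On the symmetric side, Euler's identity writes `1` minus this projection as a sum over the positions
`0, …, k` of a normalized derivative in the `𝔥`-direction at the position, followed by
multiplication (`sum_mulBy_der_ninv`). It thus factors, compatibly with the differentials, through
the complex of families indexed by positions. That complex is contractible: leaving out a position
gives a homotopy `zs` with `zs zd + zd zs = ν - 1`, where `ν` shifts positions and is therefore
nilpotent, so that `1 - ν` is invertible and commutes with the differential. The resulting homotopy
is `𝔥`-equivariant and adds at most one letter in the last tensor factor. -/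

theorem negOnePow_mul_self (a : ℤ) : a.negOnePow * a.negOnePow = 1 := by
  rw [← Int.negOnePow_add, ← two_mul, Int.negOnePow_two_mul]

theorem negOnePow_sum {α : Type*} (s : Finset α) (f : α → ℤ) :
    (∑ i ∈ s, f i).negOnePow = ∏ i ∈ s, (f i).negOnePow := by
  classical
  induction s using Finset.induction_on with
  | empty => simp
  | insert a s ha ih => rw [Finset.sum_insert ha, Finset.prod_insert ha, Int.negOnePow_add, ih]

theorem negOnePow_eq_of_even {a b : ℤ} (h : Even (a - b)) : a.negOnePow = b.negOnePow := by
  have : a = (a - b) + b := by ring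
  rw [this, Int.negOnePow_add, Int.negOnePow_even _ h, one_mul]

/-- The Koszul sign of moving the entries with index in `J` in front of those with index in `L`. -/
def eps (u : ι → ℤ) (J L : Finset ι) : ℤˣ :=
  ∏ i ∈ J, ∏ j ∈ L, if j < i then (u i * u j).negOnePow else 1

variable (u : ι → ℤ)

theorem eps_union_left {J J' : Finset ι} (h : Disjoint J J') (L : Finset ι) :
    eps u (J ∪ J') L = eps u J L * eps u J' L := by
  rw [eps, Finset.prod_union h]; rfl

theorem eps_union_right (J : Finset ι) {L L' : Finset ι} (h : Disjoint L L') :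
    eps u J (L ∪ L') = eps u J L * eps u J L' := by
  simp only [eps, Finset.prod_union h, Finset.prod_mul_distrib]

@[simp] theorem eps_empty_right (J : Finset ι) : eps u J ∅ = 1 := by simp [eps]

@[simp] theorem eps_empty_left (J : Finset ι) : eps u ∅ J = 1 := by simp [eps]

/-- Each pair in `J × L` is out of order in exactly one of the two arrangements, so the product of
the two signs collects every pair once. -/
theorem eps_swap {J L : Finset ι} (h : Disjoint J L) :
    eps u L J = eps u J L * ((∑ i ∈ J, u i) * ∑ i ∈ L, u i).negOnePow := by
  have h1 : eps u L J * eps u J L = ((∑ i ∈ J, u i) * ∑ i ∈ L, u i).negOnePow := by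
    rw [Finset.sum_mul_sum, negOnePow_sum, eps, Finset.prod_comm, eps, ← Finset.prod_mul_distrib]
    refine Finset.prod_congr rfl fun i hi => ?_
    rw [negOnePow_sum, ← Finset.prod_mul_distrib]
    refine Finset.prod_congr rfl fun j hj => ?_
    have hij : i ≠ j := fun e => Finset.disjoint_left.1 h hi (e ▸ hj)
    rcases lt_or_gt_of_ne hij with h' | h'
    · simp [h', h'.not_gt, mul_comm]
    · simp [h', h'.not_gt]
  rw [← h1, mul_comm, mul_assoc, Int.units_mul_self, mul_one]

theorem eps_congr {u v : ι → ℤ} (h : ∀ i, Even (u i - v i)) (J L : Finset ι) :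
    eps u J L = eps v J L := by
  refine Finset.prod_congr rfl fun i _ => Finset.prod_congr rfl fun j _ => ?_
  have : (u i * u j).negOnePow = (v i * v j).negOnePow := by
    apply negOnePow_eq_of_even
    have : u i * u j - v i * v j = (u i - v i) * u j + v i * (u j - v j) := by ring
    rw [this]
    exact ((h i).mul_right _).add ((h j).mul_left _)
  rw [this]

/-- The Koszul sign of the restriction to `I` of an injection of index sets. -/
def injSign {ι' : Type*} [LinearOrder ι'] (u : ι → ℤ) (σ : ι' ↪ ι) (I : Finset ι') : ℤˣ :=
  ∏ i ∈ I, ∏ j ∈ I, if i < j ∧ σ j < σ i then (u (σ i) * u (σ j)).negOnePow else 1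

/-- Checked pair by pair, over the four relative orders of `i, j` and of their images. This cocycle
identity is what makes the tree sums equivariant under reindexing. -/
theorem injSign_union {ι' : Type*} [LinearOrder ι'] (u : ι → ℤ) (σ : ι' ↪ ι) {J L : Finset ι'}
    (h : Disjoint J L) :
    injSign u σ J * injSign u σ L * eps (u ∘ σ) J L =
      injSign u σ (J ∪ L) * eps u (J.map σ) (L.map σ) := by
  have h1 : injSign u σ (J ∪ L) = injSign u σ J * injSign u σ L *
      ((∏ i ∈ J, ∏ j ∈ L, if i < j ∧ σ j < σ i then (u (σ i) * u (σ j)).negOnePow else 1) *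
      ∏ i ∈ J, ∏ j ∈ L, if j < i ∧ σ i < σ j then (u (σ j) * u (σ i)).negOnePow else 1) := by
    simp only [injSign]
    rw [Finset.prod_union h]
    simp only [Finset.prod_union h, Finset.prod_mul_distrib]
    rw [Finset.prod_comm (s := L) (t := J)]
    have h0 : ∀ a b c d : ℤˣ, a * b * (c * d) = a * d * (b * c) := fun a b c d => by ac_rfl
    exact h0 _ _ _ _
  rw [h1, mul_assoc _ _ (eps u _ _)]
  congr 1
  simp only [eps, Finset.prod_map, Function.comp_apply]
  rw [← Finset.prod_mul_distrib, ← Finset.prod_mul_distrib]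
  refine Finset.prod_congr rfl fun i hi => ?_
  rw [← Finset.prod_mul_distrib, ← Finset.prod_mul_distrib]
  refine Finset.prod_congr rfl fun j hj => ?_
  have hij : i ≠ j := fun e => Finset.disjoint_left.1 h hi (e ▸ hj)
  have hs : σ i ≠ σ j := fun e => hij (σ.injective e)
  have hv := negOnePow_mul_self (u (σ i) * u (σ j))
  rcases lt_or_gt_of_ne hij with h' | h' <;> rcases lt_or_gt_of_ne hs with h'' | h'' <;>
    simp [h', h'', h'.not_gt, h''.not_gt, mul_comm (u (σ j)), hv]

theorem injSign_orderEmb {ι' : Type*} [LinearOrder ι'] (u : ι → ℤ) (σ : ι' ↪o ι) (I : Finset ι') :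
    injSign u σ.toEmbedding I = 1 := by
  refine Finset.prod_eq_one fun i _ => Finset.prod_eq_one fun j _ => if_neg ?_
  rintro ⟨h1, h2⟩
  exact h2.not_gt (σ.strictMono h1)

/-- Pairs of disjoint subsets of `I`, that is, ordered partitions of `I` into three parts. -/
def disjPairs (I : Finset ι) : Finset (Finset ι × Finset ι) :=
  (I.powerset ×ˢ I.powerset).filter fun p => Disjoint p.1 p.2

theorem mem_disjPairs {I : Finset ι} {p : Finset ι × Finset ι} :
    p ∈ disjPairs I ↔ p.1 ⊆ I ∧ p.2 ⊆ I ∧ Disjoint p.1 p.2 := by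
  simp [disjPairs, and_assoc]

/-- Together with `sum_powerset_compl`, this brings nested sums over subsets into the common form of
a sum over ordered partitions into three blocks, in which iterated convolutions can be compared. -/
theorem sum_powerset_powerset {W : Type*} [AddCommMonoid W] (I : Finset ι)
    (f : Finset ι → Finset ι → Finset ι → W) :
    ∑ J ∈ I.powerset, ∑ S ∈ J.powerset, f S (J \ S) (I \ J) =
      ∑ p ∈ disjPairs I, f p.1 p.2 (I \ (p.1 ∪ p.2)) := by
  rw [Finset.sum_sigma']
  refine Finset.sum_nbij' (fun x => (x.2, x.1 \ x.2)) (fun p => ⟨p.1 ∪ p.2, p.1⟩) ?_ ?_ ?_ ?_ ?_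
  · rintro ⟨J, S⟩ h
    simp only [Finset.mem_sigma, Finset.mem_powerset] at h
    exact mem_disjPairs.2 ⟨h.2.trans h.1, Finset.sdiff_subset.trans h.1, Finset.disjoint_sdiff⟩
  · rintro ⟨S, T⟩ h
    obtain ⟨h1, h2, h3⟩ := mem_disjPairs.1 h
    simp only [Finset.mem_sigma, Finset.mem_powerset]
    exact ⟨Finset.union_subset h1 h2, Finset.subset_union_left⟩
  · rintro ⟨J, S⟩ h
    simp only [Finset.mem_sigma, Finset.mem_powerset] at h
    simp [Finset.union_sdiff_of_subset h.2]
  · rintro ⟨S, T⟩ h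
    obtain ⟨h1, h2, h3⟩ := mem_disjPairs.1 h
    simp [Finset.union_sdiff_cancel_left h3]
  · rintro ⟨J, S⟩ h
    simp only [Finset.mem_sigma, Finset.mem_powerset] at h
    simp [Finset.union_sdiff_of_subset h.2]

theorem sum_powerset_compl {W : Type*} [AddCommMonoid W] (I : Finset ι)
    (f : Finset ι → Finset ι → Finset ι → W) :
    ∑ S ∈ I.powerset, ∑ J ∈ (I \ S).powerset, f S J ((I \ S) \ J) =
      ∑ p ∈ disjPairs I, f p.1 p.2 (I \ (p.1 ∪ p.2)) := by
  rw [Finset.sum_sigma']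
  refine Finset.sum_nbij' (fun x => (x.1, x.2)) (fun p => ⟨p.1, p.2⟩) ?_ ?_ ?_ ?_ ?_
  · rintro ⟨S, J⟩ h
    simp only [Finset.mem_sigma, Finset.mem_powerset] at h
    exact mem_disjPairs.2 ⟨h.1, h.2.trans Finset.sdiff_subset,
      (Finset.disjoint_of_subset_left h.2 Finset.sdiff_disjoint).symm⟩
  · rintro ⟨S, T⟩ h
    obtain ⟨h1, h2, h3⟩ := mem_disjPairs.1 h
    simp only [Finset.mem_sigma, Finset.mem_powerset]
    exact ⟨h1, Finset.subset_sdiff.2 ⟨h2, h3.symm⟩⟩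
  · rintro ⟨J, S⟩ _; rfl
  · rintro ⟨S, T⟩ _; rfl
  · rintro ⟨S, J⟩ _
    simp [sdiff_sdiff_left]

/-- The ordered partitions into three blocks are permuted by cyclic rotation of the blocks; this
symmetry is what the Jacobi identity is summed over. -/
theorem sum_disjPairs_rotate {W : Type*} [AddCommMonoid W] (I : Finset ι)
    (f : Finset ι → Finset ι → Finset ι → W) :
    ∑ p ∈ disjPairs I, f p.1 p.2 (I \ (p.1 ∪ p.2)) =
      ∑ p ∈ disjPairs I, f p.2 (I \ (p.1 ∪ p.2)) p.1 := by
  symm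
  refine Finset.sum_nbij' (fun p => (p.2, I \ (p.1 ∪ p.2))) (fun p => (I \ (p.1 ∪ p.2), p.1))
    ?_ ?_ ?_ ?_ ?_
  · rintro ⟨S, T⟩ h
    obtain ⟨h1, h2, h3⟩ := mem_disjPairs.1 h
    refine mem_disjPairs.2 ⟨h2, Finset.sdiff_subset, ?_⟩
    exact Finset.disjoint_of_subset_left Finset.subset_union_right Finset.disjoint_sdiff
  · rintro ⟨S, T⟩ h
    obtain ⟨h1, h2, h3⟩ := mem_disjPairs.1 h
    refine mem_disjPairs.2 ⟨Finset.sdiff_subset, h1, ?_⟩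
    exact (Finset.disjoint_of_subset_left Finset.subset_union_left Finset.disjoint_sdiff).symm
  all_goals
    rintro ⟨S, T⟩ h
    obtain ⟨h1, h2, h3⟩ := mem_disjPairs.1 h
    simp only at h1 h2 h3
    have h4 := Finset.disjoint_left.1 h3
    try simp only [Prod.mk.injEq, true_and, and_true]
    try ext a
    try have := @h1 a
    try have := @h2 a
    try have := @h4 a
  · simp only [Finset.mem_sdiff, Finset.mem_union]; tauto
  · simp only [Finset.mem_sdiff, Finset.mem_union]; tauto
  · congr 1
    ext a
    have := @h1 a
    have := @h2 a
    have := @h4 a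
    simp only [Finset.mem_sdiff, Finset.mem_union]; tauto

end Sign

end

section

/-! ## Transfer along a contraction onto a quotient differential graded Lie algebra -/

/-- A contraction of a differential graded Lie algebra `B` onto `A` whose projection is a strict
morphism of Lie algebras. -/
structure StrictContraction {K V W : Type*} [Field K] [AddCommGroup V] [Module K V]
    [AddCommGroup W] [Module K W] (A : DGLA K V) (B : DGLA K W) where
  incl : V →ₗ[K] W
  pr : W →ₗ[K] V
  htpy : W →ₗ[K] W
  incl_mem : ∀ n, ∀ x ∈ A.deg n, incl x ∈ B.deg n
  htpy_mem : ∀ n, ∀ w ∈ B.deg n, htpy w ∈ B.deg (n - 1)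
  incl_d : ∀ x, incl (A.d x) = B.d (incl x)
  pr_incl : ∀ x, pr (incl x) = x
  pr_htpy : ∀ w, pr (htpy w) = 0
  pr_br : ∀ w w', pr (B.br w w') = A.br (pr w) (pr w')
  d_htpy : ∀ w, B.d (htpy w) + htpy (B.d w) = w - incl (pr w)

theorem map_units_int_smul {K V W : Type*} [Field K] [AddCommGroup V] [Module K V]
    [AddCommGroup W] [Module K W] (f : V →ₗ[K] W) (a : ℤˣ) (x : V) : f (a • x) = a • f x := by
  rw [Units.smul_def, Units.smul_def, map_zsmul]

/-! ### Convolution of families indexed by finite sets -/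

section Conv

variable {K V W : Type*} [Field K] [AddCommGroup V] [Module K V]
    [AddCommGroup W] [Module K W] {A : DGLA K V} (B : DGLA K W)
    {ι : Type*} [LinearOrder ι]

theorem DGLA.br_units_smul_left (a : ℤˣ) (x y : W) : B.br (a • x) y = a • B.br x y := by
  rw [map_units_int_smul, Units.smul_def, Units.smul_def, LinearMap.smul_apply]

theorem DGLA.br_units_smul_right (a : ℤˣ) (x y : W) : B.br x (a • y) = a • B.br x y :=
  map_units_int_smul _ _ _

/-- The convolution of two families indexed by finite sets with respect to the bracket. The family
`Φ` is supposed to have degrees `∑ i ∈ J, u i + c`. -/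
def conv (u : ι → ℤ) (c : ℤ) (Φ Γ : Finset ι → W) (I : Finset ι) : W :=
  ∑ J ∈ I.powerset, (eps u J (I \ J) * (∑ i ∈ J, u i + c).negOnePow) • B.br (Φ J) (Γ (I \ J))

variable {B}

/-- The families of degrees `∑ i ∈ J, u i + c`. -/
def IsHomog (B : DGLA K W) (u : ι → ℤ) (c : ℤ) (Φ : Finset ι → W) : Prop :=
  ∀ J, Φ J ∈ B.deg (∑ i ∈ J, u i + c)

/-- The term `J = I` is paired with `Γ ∅ = 0`, so only proper subsets matter. This turns the
uniqueness of solutions of the fixed-point equations into an induction. -/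
theorem conv_congr_left {u : ι → ℤ} {c : ℤ} {Φ Φ' Γ : Finset ι → W} (h0 : Γ ∅ = 0) {I : Finset ι}
    (h : ∀ J ⊂ I, Φ J = Φ' J) : conv B u c Φ Γ I = conv B u c Φ' Γ I := by
  refine Finset.sum_congr rfl fun J hJ => ?_
  rcases eq_or_ne J I with rfl | hne
  · simp [h0]
  · rw [h J (lt_of_le_of_ne (Finset.mem_powerset.1 hJ) hne)]

theorem conv_add_left (u : ι → ℤ) (c : ℤ) (Φ Φ' Γ : Finset ι → W) (I : Finset ι) :
    conv B u c (fun J => Φ J + Φ' J) Γ I = conv B u c Φ Γ I + conv B u c Φ' Γ I := by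
  simp only [conv, map_add, LinearMap.add_apply, smul_add, Finset.sum_add_distrib]

theorem conv_smul_left (u : ι → ℤ) (c : ℤ) (a : K) (Φ Γ : Finset ι → W) (I : Finset ι) :
    conv B u c (fun J => a • Φ J) Γ I = a • conv B u c Φ Γ I := by
  rw [conv, conv, Finset.smul_sum]
  refine Finset.sum_congr rfl fun J _ => ?_
  rw [map_smul, LinearMap.smul_apply, smul_comm]


omit [LinearOrder ι] in
theorem IsHomog.d {u : ι → ℤ} {c : ℤ} {Φ : Finset ι → W} (h : IsHomog B u c Φ) :
    IsHomog B u (c + 1) (fun J => B.d (Φ J)) := fun J => by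
  rw [← add_assoc]; exact B.d_mem _ _ (h J)

theorem conv_mem {u : ι → ℤ} {c c' : ℤ} {Φ Γ : Finset ι → W} (h : IsHomog B u c Φ)
    (h' : IsHomog B u c' Γ) : IsHomog B u (c + c') (conv B u c Φ Γ) := fun I => by
  refine Submodule.sum_mem _ fun J hJ => ?_
  rw [Units.smul_def]
  refine zsmul_mem ?_ _
  have := B.br_mem _ _ _ (h J) _ (h' (I \ J))
  rw [← Finset.sum_sdiff (Finset.mem_powerset.1 hJ)]
  convert this using 2
  ring

theorem neg_units_smul (a : ℤˣ) (x : W) : -(a • x) = (a * (1 : ℤ).negOnePow) • x := by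
  rw [Int.negOnePow_one, mul_neg_one, Units.neg_smul]

/-- The graded symmetry of the summands of a convolution of homogeneous families. -/
theorem conv_term_swap {u : ι → ℤ} {Φ Γ : Finset ι → W} (h : IsHomog B u 1 Φ)
    (h' : IsHomog B u 1 Γ) {J L : Finset ι} (hJ : Disjoint J L) :
    (eps u J L * (∑ i ∈ J, u i + 1).negOnePow) • B.br (Φ J) (Γ L) =
      (eps u L J * (∑ i ∈ L, u i + 1).negOnePow) • B.br (Γ L) (Φ J) := by
  rw [B.skew _ _ _ (h J) _ (h' L), eps_swap u hJ, neg_units_smul, smul_smul]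
  congr 1
  simp only [mul_assoc, ← Int.negOnePow_add]
  congr 1
  apply negOnePow_eq_of_even
  simp only [Int.even_add, Int.even_sub, Int.even_mul, Int.not_even_one]
  tauto

/-- The analogue of `conv_term_swap` for a family paired with one of the shape of its differential,
where the parities differ by one. -/
theorem conv_term_swap' {u : ι → ℤ} {Φ Γ : Finset ι → W} (h : IsHomog B u 1 Φ)
    (h' : IsHomog B u 2 Γ) {J L : Finset ι} (hJ : Disjoint J L) :
    eps u J L • B.br (Φ J) (Γ L) =
      (eps u L J * (∑ i ∈ L, u i + 1).negOnePow) • B.br (Γ L) (Φ J) := by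
  rw [B.skew _ _ _ (h J) _ (h' L), eps_swap u hJ, neg_units_smul, smul_smul]
  congr 1
  simp only [mul_assoc, ← Int.negOnePow_add]
  congr 1
  apply negOnePow_eq_of_even
  simp only [Int.even_add, Int.even_sub, Int.even_mul, Int.not_even_one, even_two]
  tauto

theorem sum_powerset_sdiff {X : Type*} [AddCommMonoid X] (I : Finset ι)
    (f : Finset ι → Finset ι → X) :
    ∑ J ∈ I.powerset, f (I \ J) J = ∑ J ∈ I.powerset, f J (I \ J) := by
  refine Finset.sum_nbij' (fun J => I \ J) (fun J => I \ J) ?_ ?_ ?_ ?_ ?_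
  · intro J _; simp
  · intro J _; simp
  · intro J hJ; simp [Finset.inter_eq_right.2 (Finset.mem_powerset.1 hJ)]
  · intro J hJ; simp [Finset.inter_eq_right.2 (Finset.mem_powerset.1 hJ)]
  · intro J hJ; simp [Finset.inter_eq_right.2 (Finset.mem_powerset.1 hJ)]

/-- The Leibniz rule for the square of a family of odd degrees. -/
theorem d_conv_self {u : ι → ℤ} {Φ : Finset ι → W} (h : IsHomog B u 1 Φ) (I : Finset ι) :
    B.d (conv B u 1 Φ Φ I) = -((2 : K) • conv B u 2 (fun J => B.d (Φ J)) Φ I) := by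
  have hd : IsHomog B u 2 (fun J => B.d (Φ J)) := h.d
  have h1 : B.d (conv B u 1 Φ Φ I) =
      ∑ J ∈ I.powerset, (eps u J (I \ J) * (∑ i ∈ J, u i + 1).negOnePow) •
        B.br (B.d (Φ J)) (Φ (I \ J)) +
      ∑ J ∈ I.powerset, eps u J (I \ J) • B.br (Φ J) (B.d (Φ (I \ J))) := by
    rw [conv, map_sum, ← Finset.sum_add_distrib]
    refine Finset.sum_congr rfl fun J _ => ?_
    rw [map_units_int_smul, B.leibniz _ _ _ (h J) _ (h (I \ J)), smul_add, smul_smul, mul_assoc,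
      negOnePow_mul_self, mul_one]
  -- Exchanging the two blocks turns the terms with the differential on the second factor into those
  -- with it on the first.
  have h2 : ∑ J ∈ I.powerset, eps u J (I \ J) • B.br (Φ J) (B.d (Φ (I \ J))) =
      ∑ J ∈ I.powerset, (eps u J (I \ J) * (∑ i ∈ J, u i + 1).negOnePow) •
        B.br (B.d (Φ J)) (Φ (I \ J)) := by
    rw [← sum_powerset_sdiff I fun J L => (eps u J L * (∑ i ∈ J, u i + 1).negOnePow) •
        B.br (B.d (Φ J)) (Φ L)]
    exact Finset.sum_congr rfl fun J _ => conv_term_swap' h hd Finset.disjoint_sdiff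
  have h3 : ∑ J ∈ I.powerset, (eps u J (I \ J) * (∑ i ∈ J, u i + 1).negOnePow) •
        B.br (B.d (Φ J)) (Φ (I \ J)) = -conv B u 2 (fun J => B.d (Φ J)) Φ I := by
    rw [conv, ← Finset.sum_neg_distrib]
    refine Finset.sum_congr rfl fun J _ => ?_
    rw [neg_units_smul, mul_assoc, ← Int.negOnePow_add]
    congr 2
    apply negOnePow_eq_of_even
    exact ⟨-1, by ring⟩
  rw [h1, h2, h3, two_smul, neg_add]

/-- The Jacobi identity for the cube of a family of odd degrees. -/
theorem conv_conv_self [CharZero K] {u : ι → ℤ} {Φ : Finset ι → W} (h : IsHomog B u 1 Φ)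
    (I : Finset ι) : conv B u 2 (conv B u 1 Φ Φ) Φ I = 0 := by
  let T : Finset ι → Finset ι → Finset ι → W := fun J₁ J₂ J₃ =>
    (eps u J₁ J₂ * eps u J₁ J₃ * eps u J₂ J₃ * (∑ i ∈ J₂, u i + 1).negOnePow) •
      B.br (B.br (Φ J₁) (Φ J₂)) (Φ J₃)
  have h1 : conv B u 2 (conv B u 1 Φ Φ) Φ I =
      ∑ p ∈ disjPairs I, T p.1 p.2 (I \ (p.1 ∪ p.2)) := by
    rw [← sum_powerset_powerset, conv]
    refine Finset.sum_congr rfl fun J _ => ?_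
    rw [conv, map_sum, LinearMap.sum_apply, Finset.smul_sum]
    refine Finset.sum_congr rfl fun S hS => ?_
    have hS' := Finset.mem_powerset.1 hS
    rw [B.br_units_smul_left, smul_smul]
    congr 1
    have hu := eps_union_left u (Finset.disjoint_sdiff (s := S) (t := J)) (I \ J)
    rw [Finset.union_sdiff_of_subset hS'] at hu
    rw [hu, ← Finset.sum_sdiff hS']
    have : ∀ a b c x y z : ℤˣ, x * y = z → a * b * x * (c * y) = c * a * b * z := by
      rintro a b c x y z rfl; ac_rfl
    apply this
    rw [← Int.negOnePow_add]
    apply negOnePow_eq_of_even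
    simp only [Int.even_add, Int.even_sub, Int.not_even_one, even_two]
    tauto
  -- The graded Jacobi identity, with signs arranged so that the three summands of a cyclic orbit of
  -- blocks cancel.
  have h2 : ∀ J₁ J₂ J₃ : Finset ι, Disjoint J₁ J₂ → Disjoint J₁ J₃ → Disjoint J₂ J₃ →
      T J₁ J₂ J₃ + T J₂ J₃ J₁ + T J₃ J₁ J₂ = 0 := by
    intro J₁ J₂ J₃ h12 h13 h23
    have hj := B.jacobi _ _ _ _ (h J₁) _ (h J₂) _ (h J₃)
    have hs1 := B.skew _ _ _ (h J₁) _ (B.br_mem _ _ _ (h J₂) _ (h J₃))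
    have hs2 := B.skew _ _ _ (h J₂) _ (B.br_mem _ _ _ (h J₁) _ (h J₃))
    have hs3 := B.skew _ _ _ (h J₁) _ (h J₃)
    rw [hs1, hs2, hs3, map_neg, LinearMap.neg_apply, B.br_units_smul_left] at hj
    simp only [T]
    rw [eps_swap u h12, eps_swap u h13, eps_swap u h23]
    generalize ∑ i ∈ J₁, u i = a at *
    generalize ∑ i ∈ J₂, u i = b at *
    generalize ∑ i ∈ J₃, u i = c at *
    have hj' : B.br (B.br (Φ J₁) (Φ J₂)) (Φ J₃) =
      -(((a + 1) * (b + 1 + (c + 1))).negOnePow • B.br (B.br (Φ J₂) (Φ J₃)) (Φ J₁)) -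
      ((a + 1) * (b + 1)).negOnePow • -(((b + 1) * (a + 1 + (c + 1))).negOnePow •
        -(((a + 1) * (c + 1)).negOnePow • B.br (B.br (Φ J₃) (Φ J₁)) (Φ J₂))) := by
      rw [eq_sub_iff_add_eq]; exact hj.symm
    rw [hj']
    generalize B.br (B.br (Φ J₂) (Φ J₃)) (Φ J₁) = X
    generalize B.br (B.br (Φ J₃) (Φ J₁)) (Φ J₂) = Y
    generalize eps u J₁ J₂ = e1
    generalize eps u J₁ J₃ = e2
    generalize eps u J₂ J₃ = e3
    have key : ∀ (e x1 x2 x3 y1 y2 : ℤˣ), x1 * x2 * (1 : ℤ).negOnePow = y1 →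
        x1 * x3 * (1 : ℤ).negOnePow = y2 →
        (e * x1) • (x2 • X + x3 • Y) + (e * y1) • X + (e * y2) • Y = 0 := by
      rintro e x1 x2 x3 y1 y2 rfl rfl
      simp only [← mul_assoc, ← neg_units_smul, smul_add, smul_smul]
      abel
    have r1 : ∀ p q r : ℤˣ, e3 * (e1 * p) * (e2 * q) * r = e1 * e2 * e3 * (p * q * r) :=
      fun p q r => by ac_rfl
    have r2 : ∀ p q r : ℤˣ, e2 * p * (e3 * q) * e1 * r = e1 * e2 * e3 * (p * q * r) :=
      fun p q r => by ac_rfl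
    rw [r1, r2, sub_eq_add_neg]
    simp only [neg_units_smul, smul_smul]
    apply key
    · simp only [← Int.negOnePow_add]
      apply negOnePow_eq_of_even
      by_cases ha : Even a <;> by_cases hb : Even b <;> by_cases hc : Even c <;>
        simp only [Int.even_add, Int.even_sub, Int.even_mul, Int.not_even_one, ha, hb, hc] <;>
        decide
    · simp only [← Int.negOnePow_add]
      apply negOnePow_eq_of_even
      by_cases ha : Even a <;> by_cases hb : Even b <;> by_cases hc : Even c <;>
        simp only [Int.even_add, Int.even_sub, Int.even_mul, Int.not_even_one, ha, hb, hc] <;>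
        decide
  -- Rotating the blocks does not change the sum, so three copies of it form a sum of Jacobi
  -- triples; characteristic `0` removes the factor.
  have h3 : (3 : K) • ∑ p ∈ disjPairs I, T p.1 p.2 (I \ (p.1 ∪ p.2)) = 0 := by
    have e : (3 : K) = 1 + 1 + 1 := by norm_num
    have e1 := sum_disjPairs_rotate I T
    have e2 := e1.trans (sum_disjPairs_rotate I fun a b c => T b c a)
    rw [e, add_smul, add_smul, one_smul]
    nth_rw 2 [e1]
    nth_rw 2 [e2]
    rw [← Finset.sum_add_distrib, ← Finset.sum_add_distrib]
    refine Finset.sum_eq_zero fun p hp => ?_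
    obtain ⟨h1, h2', h3⟩ := mem_disjPairs.1 hp
    refine h2 _ _ _ h3 ?_ ?_
    · exact Finset.disjoint_of_subset_left Finset.subset_union_left Finset.disjoint_sdiff
    · exact Finset.disjoint_of_subset_left Finset.subset_union_right Finset.disjoint_sdiff
  rw [h1]
  exact (smul_eq_zero.1 h3).resolve_left (by norm_num)

end Conv

end

section

/-! ### The tree recursion, its symmetries and its curvature -/

section Transfer

variable {K V W : Type*} [Field K] [AddCommGroup V] [Module K V]
    [AddCommGroup W] [Module K W] {A : DGLA K V} {B : DGLA K W} (C : StrictContraction A B)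
    {ι : Type*} [LinearOrder ι]

/-- The family supported on one element sets with value `x i` on `{i}`. -/
def singles (x : ι → V) (I : Finset ι) : V := if I.card = 1 then ∑ j ∈ I, x j else 0

omit [LinearOrder ι] in
theorem singles_singleton (x : ι → V) (i : ι) : singles x {i} = x i := by simp [singles]

omit [LinearOrder ι] in
theorem singles_of_card_ne (x : ι → V) {I : Finset ι} (h : I.card ≠ 1) : singles x I = 0 :=
  if_neg h

/-- The family solving `F = incl x - 1/2 htpy [F, F]`, given by sums over binary trees. -/
def transfer (u : ι → ℤ) (x : ι → V) (I : Finset ι) : W :=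
  C.incl (singles x I) - (2 : K)⁻¹ • C.htpy (∑ J ∈ (I.ssubsets.filter (·.Nonempty)).attach,
    (eps u J.1 (I \ J.1) * (∑ i ∈ J.1, u i + 1).negOnePow) •
      B.br (transfer u x J.1) (transfer u x (I \ J.1)))
termination_by I.card
decreasing_by
  · have := J.2
    simp only [Finset.mem_filter, Finset.mem_ssubsets] at this
    exact Finset.card_lt_card this.1
  · have := J.2
    simp only [Finset.mem_filter, Finset.mem_ssubsets] at this
    exact Finset.card_lt_card (Finset.sdiff_ssubset this.1.1 this.2)

theorem transfer_empty (u : ι → ℤ) (x : ι → V) : transfer C u x ∅ = 0 := by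
  rw [transfer, singles_of_card_ne _ (by simp)]
  have : ((∅ : Finset ι).ssubsets.filter (·.Nonempty)) = ∅ := by
    ext J; simp [Finset.mem_ssubsets]
  rw [Finset.sum_attach _ (fun J => (eps u J (∅ \ J) * (∑ i ∈ J, u i + 1).negOnePow) •
      B.br (transfer C u x J) (transfer C u x (∅ \ J))), this]
  simp

theorem conv_eq_sum_ssubsets (u : ι → ℤ) (c : ℤ) {Φ Γ : Finset ι → W} (h : Φ ∅ = 0) (h' : Γ ∅ = 0)
    (I : Finset ι) : conv B u c Φ Γ I = ∑ J ∈ I.ssubsets.filter (·.Nonempty),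
      (eps u J (I \ J) * (∑ i ∈ J, u i + c).negOnePow) • B.br (Φ J) (Γ (I \ J)) := by
  symm
  refine Finset.sum_subset (fun J hJ => ?_) fun J hJ hJ' => ?_
  · simp only [Finset.mem_filter, Finset.mem_ssubsets] at hJ
    exact Finset.mem_powerset.2 hJ.1.1
  · simp only [Finset.mem_filter, Finset.mem_ssubsets, not_and, Finset.not_nonempty_iff_eq_empty]
      at hJ'
    rcases eq_or_ne J I with rfl | hne
    · simp [h']
    · rw [hJ' (lt_of_le_of_ne (Finset.mem_powerset.1 hJ) hne)]
      simp [h]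

/-- The family vanishes on `∅`, so the full convolution agrees with the sum over proper nonempty
subsets to which the well-founded recursion is restricted. -/
theorem transfer_eq (u : ι → ℤ) (x : ι → V) (I : Finset ι) :
    transfer C u x I = C.incl (singles x I) -
      (2 : K)⁻¹ • C.htpy (conv B u 1 (transfer C u x) (transfer C u x) I) := by
  rw [transfer, conv_eq_sum_ssubsets u 1 (transfer_empty C u x) (transfer_empty C u x),
    ← Finset.sum_attach (I.ssubsets.filter (·.Nonempty))]

/-- Induction along the recursion for `transfer`: convolutions need only be understood for the
proper nonempty subsets and their complements. -/
theorem conv_rec (u : ι → ℤ) (x : ι → V) (I : Finset ι) {p : W → Prop} (h0 : p 0)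
    (hadd : ∀ a b, p a → p b → p (a + b))
    (h : ∀ J ⊆ I, J ≠ I → J.Nonempty → p ((eps u J (I \ J) * (∑ i ∈ J, u i + 1).negOnePow) •
      B.br (transfer C u x J) (transfer C u x (I \ J)))) :
    p (conv B u 1 (transfer C u x) (transfer C u x) I) := by
  rw [conv_eq_sum_ssubsets u 1 (transfer_empty C u x) (transfer_empty C u x)]
  refine Finset.sum_induction _ p hadd h0 fun J hJ => ?_
  simp only [Finset.mem_filter, Finset.mem_ssubsets] at hJ
  exact h J hJ.1.1 hJ.1.ne hJ.2

theorem card_sdiff_lt {I J : Finset ι} (h : J ⊆ I) (h' : J.Nonempty) : (I \ J).card < I.card :=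
  Finset.card_lt_card (Finset.sdiff_ssubset h h')

omit [LinearOrder ι] in
theorem card_lt_of_ne {I J : Finset ι} (h : J ⊆ I) (h' : J ≠ I) : J.card < I.card :=
  Finset.card_lt_card (lt_of_le_of_ne h h')

theorem transfer_homog {u : ι → ℤ} {x : ι → V} (hx : ∀ i, x i ∈ A.deg (u i + 1)) :
    IsHomog B u 1 (transfer C u x) := by
  intro I
  induction hn : I.card using Nat.strong_induction_on generalizing I with
  | _ n ih =>
    subst hn
    rw [transfer_eq]
    refine Submodule.sub_mem _ (C.incl_mem _ _ ?_) (Submodule.smul_mem _ _ ?_)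
    · by_cases h : I.card = 1
      · obtain ⟨i, rfl⟩ := Finset.card_eq_one.1 h
        simpa [singles] using hx i
      · rw [singles_of_card_ne _ h]; exact Submodule.zero_mem _
    · have : conv B u 1 (transfer C u x) (transfer C u x) I ∈ B.deg (∑ i ∈ I, u i + 2) := by
        refine conv_rec C u x I (p := (· ∈ B.deg (∑ i ∈ I, u i + 2))) (Submodule.zero_mem _)
          (fun _ _ => Submodule.add_mem _) fun J hJ hne hJ' => ?_
        rw [Units.smul_def]
        refine zsmul_mem ?_ _
        have := B.br_mem _ _ _ (ih _ (card_lt_of_ne hJ hne) J rfl) _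
          (ih _ (card_sdiff_lt hJ hJ') (I \ J) rfl)
        rw [← Finset.sum_sdiff hJ]
        convert this using 2
        ring
      have h2 := C.htpy_mem _ _ this
      convert h2 using 2
      ring

/-- Only the leading term survives, since the homotopy takes values in the kernel of the projection.
-/
theorem pr_transfer (u : ι → ℤ) (x : ι → V) (I : Finset ι) :
    C.pr (transfer C u x I) = singles x I := by
  rw [transfer_eq, map_sub, map_smul, C.pr_htpy, smul_zero, sub_zero, C.pr_incl]

theorem transfer_congr {u : ι → ℤ} {x x' : ι → V} {I : Finset ι} (h : ∀ i ∈ I, x i = x' i) :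
    transfer C u x I = transfer C u x' I := by
  induction hn : I.card using Nat.strong_induction_on generalizing I with
  | _ n ih =>
    subst hn
    rw [transfer_eq, transfer_eq, conv_eq_sum_ssubsets u 1 (transfer_empty C u x)
      (transfer_empty C u x), conv_eq_sum_ssubsets u 1 (transfer_empty C u x')
      (transfer_empty C u x')]
    have : singles x I = singles x' I := by
      rw [singles, singles, Finset.sum_congr rfl h]
    rw [this]
    congr 3
    refine Finset.sum_congr rfl fun J hJ => ?_
    simp only [Finset.mem_filter, Finset.mem_ssubsets] at hJ
    rw [ih _ (Finset.card_lt_card hJ.1) (fun i hi => h i (hJ.1.1 hi)) rfl,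
      ih _ (card_sdiff_lt hJ.1.1 hJ.2) (fun i hi => h i (Finset.sdiff_subset hi)) rfl]

/-- The degrees enter through signs only. This allows the structure maps to be defined with parities
in place of degrees. -/
theorem transfer_congr_parity {u v : ι → ℤ} (h : ∀ i, Even (u i - v i)) (x : ι → V)
    (I : Finset ι) : transfer C u x I = transfer C v x I := by
  induction hn : I.card using Nat.strong_induction_on generalizing I with
  | _ n ih =>
    subst hn
    rw [transfer_eq, transfer_eq, conv_eq_sum_ssubsets u 1 (transfer_empty C u x)
      (transfer_empty C u x), conv_eq_sum_ssubsets v 1 (transfer_empty C v x)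
      (transfer_empty C v x)]
    congr 3
    refine Finset.sum_congr rfl fun J hJ => ?_
    simp only [Finset.mem_filter, Finset.mem_ssubsets] at hJ
    rw [ih _ (Finset.card_lt_card hJ.1) J rfl,
      ih _ (card_sdiff_lt hJ.1.1 hJ.2) (I \ J) rfl, eps_congr h]
    congr 2
    apply negOnePow_eq_of_even
    rw [add_sub_add_right_eq_sub, ← Finset.sum_sub_distrib]
    exact Finset.even_sum _ fun i _ => h i

theorem sdiff_map_embedding {ι' : Type*} [LinearOrder ι'] (σ : ι' ↪ ι) (I J : Finset ι') :
    I.map σ \ J.map σ = (I \ J).map σ := by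
  ext a; simp only [Finset.mem_sdiff, Finset.mem_map]
  constructor
  · rintro ⟨⟨b, hb, rfl⟩, h⟩
    exact ⟨b, ⟨hb, fun hb' => h ⟨b, hb', rfl⟩⟩, rfl⟩
  · rintro ⟨b, ⟨hb, hb'⟩, rfl⟩
    exact ⟨⟨b, hb, rfl⟩, fun ⟨c, hc, e⟩ => hb' (σ.injective e ▸ hc)⟩

omit [LinearOrder ι] in
theorem sum_powerset_map {ι' X : Type*} [AddCommMonoid X] (σ : ι' ↪ ι)
    (I : Finset ι') (f : Finset ι → X) :
    ∑ J ∈ (I.map σ).powerset, f J = ∑ J ∈ I.powerset, f (J.map σ) := by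
  symm
  refine Finset.sum_bij (fun J _ => J.map σ) ?_ ?_ ?_ ?_
  · intro J hJ
    exact Finset.mem_powerset.2 (Finset.map_subset_map.2 (Finset.mem_powerset.1 hJ))
  · intro J _ J' _ h
    exact Finset.map_injective σ h
  · intro L hL
    obtain ⟨J, hJ, rfl⟩ := Finset.subset_map_iff.1 (Finset.mem_powerset.1 hL)
    exact ⟨J, Finset.mem_powerset.2 hJ, rfl⟩
  · intro J _; rfl

/-- By induction over the splittings into two blocks, for which `injSign_union` says that the signs
of the blocks combine to the sign of the whole. A permutation gives the graded symmetry of the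
structure maps; an order embedding contributes no sign. -/
theorem transfer_map {ι' : Type*} [LinearOrder ι'] (σ : ι' ↪ ι) (u : ι → ℤ) (x : ι → V)
    (I : Finset ι') :
    transfer C (u ∘ σ) (x ∘ σ) I = injSign u σ I • transfer C u x (I.map σ) := by
  induction hn : I.card using Nat.strong_induction_on generalizing I with
  | _ n ih =>
    subst hn
    have h1 : C.incl (singles (x ∘ σ) I) = injSign u σ I • C.incl (singles x (I.map σ)) := by
      by_cases h : I.card = 1
      · obtain ⟨i, rfl⟩ := Finset.card_eq_one.1 h
        simp [singles, injSign]
      · rw [singles_of_card_ne _ h, singles_of_card_ne _ (by simpa using h)]; simp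
    have h2 : conv B (u ∘ σ) 1 (transfer C (u ∘ σ) (x ∘ σ)) (transfer C (u ∘ σ) (x ∘ σ)) I =
        injSign u σ I • conv B u 1 (transfer C u x) (transfer C u x) (I.map σ) := by
      rw [conv, conv, sum_powerset_map, Finset.smul_sum]
      refine Finset.sum_congr rfl fun J hJ => ?_
      have hJ := Finset.mem_powerset.1 hJ
      rcases eq_or_ne J I with rfl | hne
      · simp [transfer_empty]
      rcases J.eq_empty_or_nonempty with rfl | hJ'
      · simp [transfer_empty]
      rw [ih _ (card_lt_of_ne hJ hne) J rfl, ih _ (card_sdiff_lt hJ hJ') (I \ J) rfl,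
        sdiff_map_embedding, B.br_units_smul_left, B.br_units_smul_right, smul_smul, smul_smul,
        smul_smul, Finset.sum_map]
      congr 1
      have := injSign_union u σ (Finset.disjoint_sdiff (s := J) (t := I))
      rw [Finset.union_sdiff_of_subset hJ] at this
      rw [← mul_assoc (injSign u σ I), ← this]
      simp only [Function.comp_apply]
      ac_rfl
    rw [transfer_eq, transfer_eq, h1, h2, map_units_int_smul, smul_sub]
    congr 1
    rw [smul_comm]

theorem transfer_orderEmb {ι' : Type*} [LinearOrder ι'] (σ : ι' ↪o ι) (u : ι → ℤ) (x : ι → V)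
    (I : Finset ι') :
    transfer C (u ∘ σ) (x ∘ σ) I = transfer C u x (I.map σ.toEmbedding) := by
  have := transfer_map C σ.toEmbedding u x I
  rw [injSign_orderEmb, one_smul] at this
  exact this

/-- In every splitting exactly one block contains `j`, and the other factor of the bracket does not
see the change; hence each tree is linear in the entry at `j`. -/
theorem transfer_update_combination {u : ι → ℤ} {x : ι → V} {j : ι} {I : Finset ι} (hj : j ∈ I)
    (a b : V) (r : K) :
    transfer C u (Function.update x j (a + r • b)) I =
      transfer C u (Function.update x j a) I + r • transfer C u (Function.update x j b) I := by
  induction hn : I.card using Nat.strong_induction_on generalizing I with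
  | _ n ih =>
    subst hn
    have hc : ∀ c d : V, ∀ J, j ∉ J → transfer C u (Function.update x j c) J =
        transfer C u (Function.update x j d) J := fun c d J hJ =>
      transfer_congr C fun i hi => by
        have : i ≠ j := fun e => hJ (e ▸ hi)
        simp [this]
    have h1 : singles (Function.update x j (a + r • b)) I =
        singles (Function.update x j a) I + r • singles (Function.update x j b) I := by
      by_cases h : I.card = 1
      · obtain ⟨i, rfl⟩ := Finset.card_eq_one.1 h
        obtain rfl := Finset.mem_singleton.1 hj
        simp [singles]
      · simp [singles_of_card_ne _ h]
    have h2 : ∀ c, conv B u 1 (transfer C u (Function.update x j c))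
        (transfer C u (Function.update x j c)) I = ∑ J ∈ I.ssubsets.filter (·.Nonempty),
        (eps u J (I \ J) * (∑ i ∈ J, u i + 1).negOnePow) •
          B.br (transfer C u (Function.update x j c) J)
            (transfer C u (Function.update x j c) (I \ J)) := fun c =>
      conv_eq_sum_ssubsets u 1 (transfer_empty C u _) (transfer_empty C u _) I
    have h3 : ∀ y z : V, ∀ w w' : W, C.incl (y + r • z) - (2 : K)⁻¹ • C.htpy (w + r • w') =
        C.incl y - (2 : K)⁻¹ • C.htpy w + r • (C.incl z - (2 : K)⁻¹ • C.htpy w') := by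
      intro y z w w'
      simp only [map_add, map_smul, smul_add, smul_sub, smul_comm (2 : K)⁻¹ r]
      abel
    rw [transfer_eq, transfer_eq, transfer_eq, ← h3, h1, h2, h2, h2, Finset.smul_sum,
      ← Finset.sum_add_distrib]
    congr 3
    refine Finset.sum_congr rfl fun J hJ => ?_
    simp only [Finset.mem_filter, Finset.mem_ssubsets] at hJ
    rw [smul_comm r, ← smul_add]
    congr 1
    by_cases hjJ : j ∈ J
    · have : j ∉ I \ J := by simp [hjJ]
      rw [ih _ (Finset.card_lt_card hJ.1) hjJ rfl, hc _ a _ this, hc b a _ this]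
      simp
    · have : j ∈ I \ J := by simp [hj, hjJ]
      rw [ih _ (card_sdiff_lt hJ.1.1 hJ.2) this rfl, hc _ a _ hjJ, hc b a _ hjJ]
      simp

/-- A binary tree with `n` leaves has `n - 1` inner vertices. Each carries one bracket, which adds
filtration degrees, and one homotopy, which raises them by one. -/
theorem transfer_mem_filtration {F : ℕ → Submodule K W} (hF0 : ∀ x, C.incl x ∈ F 0)
    (hF : ∀ m n x y, x ∈ F m → y ∈ F n → B.br x y ∈ F (m + n))
    (hF1 : ∀ n x, x ∈ F n → C.htpy x ∈ F (n + 1)) (u : ι → ℤ) (x : ι → V) (I : Finset ι) :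
    transfer C u x I ∈ F (I.card - 1) := by
  induction hn : I.card using Nat.strong_induction_on generalizing I with
  | _ n ih =>
    subst hn
    rcases Nat.lt_or_ge I.card 2 with h | h
    · have h0 : I.card - 1 = 0 := by omega
      rw [h0, transfer_eq]
      refine Submodule.sub_mem _ (hF0 _) (Submodule.smul_mem _ _ ?_)
      have : conv B u 1 (transfer C u x) (transfer C u x) I = 0 := by
        refine conv_rec C u x I (p := (· = 0)) rfl (fun a b ha hb => by rw [ha, hb, add_zero])
          fun J hJ hne hJ' => ?_
        have := card_lt_of_ne hJ hne
        have := hJ'.card_pos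
        omega
      rw [this, map_zero]
      exact Submodule.zero_mem _
    · rw [transfer_eq, singles_of_card_ne _ (by omega), map_zero, zero_sub]
      refine Submodule.neg_mem _ (Submodule.smul_mem _ _ ?_)
      have e : I.card - 1 = I.card - 2 + 1 := by omega
      rw [e]
      refine hF1 _ _ ?_
      refine conv_rec C u x I (p := (· ∈ F (I.card - 2))) (Submodule.zero_mem _)
          (fun _ _ => Submodule.add_mem _) fun J hJ hne hJ' => ?_
      rw [Units.smul_def]
      refine zsmul_mem ?_ _
      have h1 := card_lt_of_ne hJ hne
      have h2 := hJ'.card_pos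
      have h3 := Finset.card_sdiff_of_subset hJ
      have := hF _ _ _ _ (ih _ h1 J rfl) (ih _ (card_sdiff_lt hJ hJ') (I \ J) rfl)
      convert this using 2
      omega

/-- The recursion for the curvature of `transfer`. -/
theorem curvature_transfer [CharZero K] {u : ι → ℤ} {x : ι → V}
    (hx : ∀ i, x i ∈ A.deg (u i + 1)) (I : Finset ι) :
    B.d (transfer C u x I) + (2 : K)⁻¹ • conv B u 1 (transfer C u x) (transfer C u x) I =
      C.incl (A.d (singles x I) + (2 : K)⁻¹ • conv A u 1 (singles x) (singles x) I) -
        C.htpy (conv B u 2 (fun J => B.d (transfer C u x J) +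
          (2 : K)⁻¹ • conv B u 1 (transfer C u x) (transfer C u x) J) (transfer C u x) I) := by
  have hh := transfer_homog C hx
  -- The homotopy identity at `[F, F]` splits off the projected bracket, and `d_conv_self` rewrites
  -- `d [F, F]` as `-2 [dF, F]`. Completing `dF` to the curvature costs nothing, because `[[F, F],
  -- F] = 0` by `conv_conv_self`.
  have h1 := C.d_htpy (conv B u 1 (transfer C u x) (transfer C u x) I)
  have h2 := d_conv_self hh I
  have h3 : C.pr (conv B u 1 (transfer C u x) (transfer C u x) I) =
      conv A u 1 (singles x) (singles x) I := by
    rw [conv, conv, map_sum]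
    refine Finset.sum_congr rfl fun J _ => ?_
    rw [map_units_int_smul, C.pr_br, pr_transfer, pr_transfer]
  have h4 := conv_conv_self hh I
  rw [conv_add_left u 2 (fun J => B.d (transfer C u x J)) (fun J =>
    (2 : K)⁻¹ • conv B u 1 (transfer C u x) (transfer C u x) J), conv_smul_left, h4, smul_zero,
    add_zero]
  rw [h2, h3] at h1
  nth_rw 1 [transfer_eq]
  rw [map_sub, map_smul, ← C.incl_d, map_add, map_smul]
  rw [map_neg, map_smul] at h1
  have h5 : B.d (C.htpy (conv B u 1 (transfer C u x) (transfer C u x) I)) =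
      conv B u 1 (transfer C u x) (transfer C u x) I -
        C.incl (conv A u 1 (singles x) (singles x) I) +
      (2 : K) • C.htpy (conv B u 2 (fun J => B.d (transfer C u x J)) (transfer C u x) I) := by
    rw [← h1]; abel
  rw [h5]
  simp only [smul_add, smul_sub, smul_smul]
  norm_num
  abel

end Transfer

end

section

/-! ### Insertion of the curvature of the source -/

section Insertion

variable {K V W : Type*} [Field K] [AddCommGroup V] [Module K V]
    [AddCommGroup W] [Module K W] {A : DGLA K V} {B : DGLA K W} (C : StrictContraction A B)
    {n : ℕ}

/-- The value of `transfer` on the index set `I`, extended by one entry `η` in front. -/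
def transferCons (u : Fin n → ℤ) (x : Fin n → V) (c : ℤ) (η : V) (I : Finset (Fin n)) : W :=
  transfer C (Fin.cons c u : Fin (n + 1) → ℤ) (Fin.cons η x : Fin (n + 1) → V)
    (insert 0 (I.map (Fin.succOrderEmb n).toEmbedding))

theorem zero_notMem_map_succ (I : Finset (Fin n)) :
    (0 : Fin (n + 1)) ∉ I.map (Fin.succOrderEmb n).toEmbedding := by
  simp [Fin.succ_ne_zero]

theorem eps_cons (u : Fin n → ℤ) (c : ℤ) (J L : Finset (Fin n)) :
    eps (Fin.cons c u : Fin (n + 1) → ℤ) (insert 0 (J.map (Fin.succOrderEmb n).toEmbedding))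
      (L.map (Fin.succOrderEmb n).toEmbedding) = eps u J L := by
  rw [eps, Finset.prod_insert (zero_notMem_map_succ J)]
  simp [eps, Finset.prod_map]

theorem transfer_cons_map_succ (u : Fin n → ℤ) (x : Fin n → V) (c : ℤ) (η : V)
    (I : Finset (Fin n)) :
    transfer C (Fin.cons c u : Fin (n + 1) → ℤ) (Fin.cons η x : Fin (n + 1) → V)
      (I.map (Fin.succOrderEmb n).toEmbedding) = transfer C u x I := by
  rw [← transfer_orderEmb]
  rfl

/-- This is the derivative of the recursion for `transfer` in the direction `η`. In `1/2 [F, F]` the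
new index lies in the first or in the second block; the two contributions agree by graded symmetry
and absorb the factor `1/2`. -/
theorem transferCons_eq [CharZero K] {u : Fin n → ℤ} {x : Fin n → V}
    (hx : ∀ i, x i ∈ A.deg (u i + 1)) {c : ℤ} {η : V} (hη : η ∈ A.deg (c + 1))
    (I : Finset (Fin n)) :
    transferCons C u x c η I = (if I = ∅ then C.incl η else 0) -
      C.htpy (conv B u (c + 1) (transferCons C u x c η) (transfer C u x) I) := by
  have hh : IsHomog B (Fin.cons c u : Fin (n + 1) → ℤ) 1 (transfer C
      (Fin.cons c u : Fin (n + 1) → ℤ) (Fin.cons η x : Fin (n + 1) → V)) := by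
    refine transfer_homog C fun i => ?_
    refine Fin.cases ?_ (fun j => ?_) i
    · exact hη
    · exact hx j
  have h1 : C.incl (singles (Fin.cons η x : Fin (n + 1) → V)
      (insert 0 (I.map (Fin.succOrderEmb n).toEmbedding))) = if I = ∅ then C.incl η else 0 := by
    rw [singles, Finset.card_insert_of_notMem (zero_notMem_map_succ I), Finset.card_map]
    by_cases h : I = ∅
    · simp [h]
    · simp [h]
  have hs : ∀ J : Finset (Fin n), insert 0 (I.map (Fin.succOrderEmb n).toEmbedding) \
      insert 0 (J.map (Fin.succOrderEmb n).toEmbedding) =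
      (I \ J).map (Fin.succOrderEmb n).toEmbedding := by
    intro J
    rw [← sdiff_map_embedding, Finset.insert_sdiff_insert, Finset.sdiff_insert_of_notMem]
    exact zero_notMem_map_succ I
  have hs' : ∀ J : Finset (Fin n), insert 0 (I.map (Fin.succOrderEmb n).toEmbedding) \
      J.map (Fin.succOrderEmb n).toEmbedding =
      insert 0 ((I \ J).map (Fin.succOrderEmb n).toEmbedding) := by
    intro J
    rw [← sdiff_map_embedding, Finset.insert_sdiff_of_notMem _ (zero_notMem_map_succ J)]
  have h2 : conv B (Fin.cons c u : Fin (n + 1) → ℤ) 1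
      (transfer C (Fin.cons c u : Fin (n + 1) → ℤ) (Fin.cons η x : Fin (n + 1) → V))
      (transfer C (Fin.cons c u : Fin (n + 1) → ℤ) (Fin.cons η x : Fin (n + 1) → V))
      (insert 0 (I.map (Fin.succOrderEmb n).toEmbedding)) =
      (2 : K) • conv B u (c + 1) (transferCons C u x c η) (transfer C u x) I := by
    let g : Finset (Fin n) → Finset (Fin n) → W := fun J L =>
      (eps u J L * (∑ i ∈ J, u i + (c + 1)).negOnePow) •
        B.br (transferCons C u x c η J) (transfer C u x L)
    have hg : ∀ J L, g J L = (eps (Fin.cons c u : Fin (n + 1) → ℤ)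
        (insert 0 (J.map (Fin.succOrderEmb n).toEmbedding))
        (L.map (Fin.succOrderEmb n).toEmbedding) *
        (∑ i ∈ insert 0 (J.map (Fin.succOrderEmb n).toEmbedding),
          (Fin.cons c u : Fin (n + 1) → ℤ) i + 1).negOnePow) •
        B.br (transfer C (Fin.cons c u : Fin (n + 1) → ℤ) (Fin.cons η x : Fin (n + 1) → V)
          (insert 0 (J.map (Fin.succOrderEmb n).toEmbedding)))
        (transfer C (Fin.cons c u : Fin (n + 1) → ℤ) (Fin.cons η x : Fin (n + 1) → V)
          (L.map (Fin.succOrderEmb n).toEmbedding)) := by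
      intro J L
      rw [eps_cons, transfer_cons_map_succ, Finset.sum_insert (zero_notMem_map_succ J),
        Finset.sum_map]
      simp only [g]
      congr 3
      simp only [Fin.cons_zero, RelEmbedding.coe_toEmbedding, Fin.coe_succOrderEmb, Fin.cons_succ]
      ring
    have hg' : ∑ J ∈ I.powerset, g J (I \ J) =
        conv B u (c + 1) (transferCons C u x c η) (transfer C u x) I := rfl
    rw [← hg', two_smul, conv, Finset.sum_powerset_insert (zero_notMem_map_succ I),
      sum_powerset_map, sum_powerset_map]
    congr 1
    · rw [← sum_powerset_sdiff]
      refine Finset.sum_congr rfl fun J _ => ?_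
      rw [hs', hg]
      refine conv_term_swap hh hh ?_
      rw [Finset.disjoint_insert_right]
      refine ⟨zero_notMem_map_succ J, ?_⟩
      rw [Finset.disjoint_map]
      exact Finset.disjoint_sdiff
    · refine Finset.sum_congr rfl fun J _ => ?_
      rw [hs, hg]
  rw [transferCons, transfer_eq, h1, h2, map_smul, smul_smul]
  norm_num

/-- The sum of the insertions of a family of vectors, with Koszul signs. -/
def insertions (u : Fin n → ℤ) (x : Fin n → V) (η : Finset (Fin n) → V) (I : Finset (Fin n)) : W :=
  ∑ S ∈ I.powerset, eps u S (I \ S) • transferCons C u x (∑ i ∈ S, u i + 1) (η S) (I \ S)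

/-- Sum the equation for a single inserted entry over the blocks `S` that feed it. After that both
sides are sums over ordered partitions into the inserted block and the two blocks of the bracket,
with matching signs. -/
theorem insertions_eq [CharZero K] {u : Fin n → ℤ} {x : Fin n → V}
    (hx : ∀ i, x i ∈ A.deg (u i + 1)) {η : Finset (Fin n) → V} (hη : IsHomog A u 2 η)
    (I : Finset (Fin n)) :
    insertions C u x η I = C.incl (η I) -
      C.htpy (conv B u 2 (insertions C u x η) (transfer C u x) I) := by
  have h1 : ∀ S ∈ I.powerset, eps u S (I \ S) • transferCons C u x (∑ i ∈ S, u i + 1) (η S) (I \ S)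
      = (if S = I then C.incl (η I) else 0) - C.htpy (∑ J ∈ (I \ S).powerset,
        (eps u S (I \ S) * (eps u J ((I \ S) \ J) *
          (∑ i ∈ J, u i + (∑ i ∈ S, u i + 1 + 1)).negOnePow)) •
        B.br (transferCons C u x (∑ i ∈ S, u i + 1) (η S) J) (transfer C u x ((I \ S) \ J))) := by
    intro S hS
    have hS := Finset.mem_powerset.1 hS
    rw [transferCons_eq C hx (by have := hη S; rwa [← one_add_one_eq_two, ← add_assoc] at this),
      smul_sub, ← map_units_int_smul, conv, Finset.smul_sum]
    congr 1
    · by_cases h : S = I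
      · subst h; simp
      · have : I \ S ≠ ∅ := fun h' => h (hS.antisymm (Finset.sdiff_eq_empty_iff_subset.1 h'))
        simp [h, this]
    · congr 1
      exact Finset.sum_congr rfl fun J _ => smul_smul _ _ _
  rw [insertions, Finset.sum_congr rfl h1, Finset.sum_sub_distrib, ← map_sum]
  congr 1
  · simp
  · congr 1
    have e1 := sum_powerset_powerset I fun S J L => (eps u (S ∪ J) L * (∑ i ∈ S ∪ J, u i + 2).negOnePow *
        eps u S J) • B.br (transferCons C u x (∑ i ∈ S, u i + 1) (η S) J) (transfer C u x L)
    have e2 := sum_powerset_compl I fun S J L => (eps u S (J ∪ L) * (eps u J L *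
          (∑ i ∈ J, u i + (∑ i ∈ S, u i + 1 + 1)).negOnePow)) •
        B.br (transferCons C u x (∑ i ∈ S, u i + 1) (η S) J) (transfer C u x L)
    have e3 : conv B u 2 (insertions C u x η) (transfer C u x) I =
        ∑ J ∈ I.powerset, ∑ S ∈ J.powerset, (eps u (S ∪ J \ S) (I \ J) *
          (∑ i ∈ S ∪ J \ S, u i + 2).negOnePow * eps u S (J \ S)) •
          B.br (transferCons C u x (∑ i ∈ S, u i + 1) (η S) (J \ S)) (transfer C u x (I \ J)) := by
      refine Finset.sum_congr rfl fun J _ => ?_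
      rw [insertions, map_sum, LinearMap.sum_apply, Finset.smul_sum]
      refine Finset.sum_congr rfl fun S hS => ?_
      rw [B.br_units_smul_left, smul_smul, Finset.union_sdiff_of_subset (Finset.mem_powerset.1 hS)]
    rw [e3, e1, ← sum_powerset_compl I fun S J L => (eps u (S ∪ J) L *
        (∑ i ∈ S ∪ J, u i + 2).negOnePow *
        eps u S J) • B.br (transferCons C u x (∑ i ∈ S, u i + 1) (η S) J) (transfer C u x L)]
    refine Finset.sum_congr rfl fun S _ => Finset.sum_congr rfl fun J hJ => ?_
    have hJ := Finset.mem_powerset.1 hJ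
    have hSJ : Disjoint S J := (Finset.disjoint_of_subset_left hJ Finset.sdiff_disjoint).symm
    congr 1
    have := eps_union_right u S (Finset.disjoint_sdiff (s := J) (t := I \ S))
    rw [Finset.union_sdiff_of_subset hJ] at this
    rw [this, eps_union_left u hSJ, Finset.sum_union hSJ]
    have e : ∑ i ∈ J, u i + (∑ i ∈ S, u i + 1 + 1) = ∑ x ∈ S, u x + ∑ x ∈ J, u x + 2 := by ring
    rw [e]
    ac_rfl

/-- The equation of an `L_∞`-morphism for the family `transfer`. -/
theorem curvature_eq_insertions [CharZero K] {u : Fin n → ℤ} {x : Fin n → V}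
    (hx : ∀ i, x i ∈ A.deg (u i + 1)) (I : Finset (Fin n)) :
    B.d (transfer C u x I) + (2 : K)⁻¹ • conv B u 1 (transfer C u x) (transfer C u x) I =
      insertions C u x (fun S => A.d (singles x S) +
        (2 : K)⁻¹ • conv A u 1 (singles x) (singles x) S) I := by
  have hs : IsHomog A u 1 (singles x) := by
    intro S
    by_cases h : S.card = 1
    · obtain ⟨i, rfl⟩ := Finset.card_eq_one.1 h
      simpa [singles] using hx i
    · rw [singles_of_card_ne _ h]; exact Submodule.zero_mem _
  have hη : IsHomog A u 2 (fun S => A.d (singles x S) +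
        (2 : K)⁻¹ • conv A u 1 (singles x) (singles x) S) := fun S =>
    Submodule.add_mem _ (hs.d S) (Submodule.smul_mem _ _ (conv_mem hs hs S))
  induction hn : I.card using Nat.strong_induction_on generalizing I with
  | _ n ih =>
    subst hn
    rw [curvature_transfer C hx, insertions_eq C hx hη]
    congr 2
    -- Both sides solve the linear equation `X = incl η - h [X, F]`, and the value of the
    -- convolution on `I` involves `X` on proper subsets only.
    refine conv_congr_left (transfer_empty C u x) fun J hJ => ?_
    exact ih _ (Finset.card_lt_card hJ) J rfl

end Insertion

end

section

/-! ### The `L_∞`-morphism of a strict contraction -/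

section Morphism

variable {K V W : Type*} [Field K] [AddCommGroup V] [Module K V]
    [AddCommGroup W] [Module K W] {A : DGLA K V} {B : DGLA K W} (C : StrictContraction A B)

/-- The shifted degree `0` or `1` of a given parity. -/
def parityDeg (b : Bool) : ℤ := if b then 1 else 0

open Classical in
/-- The projection onto the elements whose shifted degree has the given parity. -/
def DGLA.parityProj (A : DGLA K V) (b : Bool) : V →ₗ[K] V :=
  DirectSum.toModule K ℤ V (fun n => if Even (n - 1 - parityDeg b) then (A.deg n).subtype else 0) ∘ₗ
    (LinearEquiv.ofBijective (DirectSum.coeLinearMap A.deg) A.isInternal).symm.toLinearMap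

open Classical in
theorem DGLA.parityProj_apply {n : ℤ} {x : V} (hx : x ∈ A.deg n) (b : Bool) :
    A.parityProj b x = if Even (n - 1 - parityDeg b) then x else 0 := by
  have h : (LinearEquiv.ofBijective (DirectSum.coeLinearMap A.deg) A.isInternal).symm x =
      DirectSum.lof K ℤ (fun i => A.deg i) n ⟨x, hx⟩ := by
    rw [LinearEquiv.symm_apply_eq]
    exact (DirectSum.coeLinearMap_lof A.deg n ⟨x, hx⟩).symm
  rw [DGLA.parityProj, LinearMap.comp_apply, LinearEquiv.coe_coe, h, DirectSum.toModule_lof]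
  split_ifs <;> rfl

/-- `transfer` as a multilinear map, for fixed parities. -/
def transferMulti {n : ℕ} (u : Fin n → ℤ) : MultilinearMap K (fun _ : Fin n => V) W where
  toFun x := transfer C u x Finset.univ
  map_update_add' := by
    intro inst x i a b
    have := transfer_update_combination C (u := u) (x := x) (Finset.mem_univ i) a b (1 : K)
    rw [one_smul, one_smul] at this
    convert this
  map_update_smul' := by
    intro inst x i r a
    have h := transfer_update_combination C (u := u) (x := x) (Finset.mem_univ i) 0 0 (1 : K)
    have h' := transfer_update_combination C (u := u) (x := x) (Finset.mem_univ i) 0 a r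
    rw [one_smul, one_smul, add_zero, left_eq_add] at h
    rw [zero_add, h, zero_add] at h'
    convert h'

/-- The structure maps of the transferred morphism. -/
def transferMap (n : ℕ) : MultilinearMap K (fun _ : Fin n => V) W :=
  ∑ s : Fin n → Bool, (transferMulti C fun i => parityDeg (s i)).compLinearMap
    fun i => A.parityProj (s i)

/-- Summing over all vectors of parities produces a multilinear map defined on inhomogeneous entries
from a formula whose signs depend on degrees. On homogeneous entries the parity projections kill all
summands but one. -/
theorem transferMap_apply {n : ℕ} {e : Fin n → ℤ} {x : Fin n → V} (hx : ∀ i, x i ∈ A.deg (e i)) :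
    transferMap C n x = transfer C (fun i => e i - 1) x Finset.univ := by
  classical
  have hp : ∀ i, Even (e i - 1 - parityDeg (decide (Odd (e i - 1)))) := by
    intro i
    by_cases h : Odd (e i - 1)
    · simp only [parityDeg, h, decide_true, if_true]
      exact h.sub_odd odd_one
    · simp only [parityDeg, h, decide_false, Bool.false_eq_true, if_false, sub_zero]
      exact Int.not_odd_iff_even.1 h
  rw [transferMap, _root_.sum_apply,
    Finset.sum_eq_single (fun i => decide (Odd (e i - 1)))]
  · rw [MultilinearMap.compLinearMap_apply]
    have : (fun i => A.parityProj (decide (Odd (e i - 1))) (x i)) = x := by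
      funext i
      rw [A.parityProj_apply (hx i), if_pos (hp i)]
    rw [this]
    refine (transfer_congr_parity C (fun i => ?_) x _).symm
    exact hp i
  · intro s _ hs
    obtain ⟨i, hi⟩ := Function.ne_iff.1 hs
    rw [MultilinearMap.compLinearMap_apply]
    refine MultilinearMap.map_coord_zero _ i ?_
    rw [A.parityProj_apply (hx i), if_neg]
    intro h
    apply hi
    have h2 := h.sub (hp i)
    by_cases ho : Odd (e i - 1) <;> cases hsi : s i <;> simp_all [parityDeg]
  · intro h; exact absurd (Finset.mem_univ _) h

theorem transferMap_sub {n : ℕ} {e : Fin n → ℤ} {x : Fin n → V} (hx : ∀ i, x i ∈ A.deg (e i))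
    (I : Finset (Fin n)) :
    transferMap C I.card (sub x I) = transfer C (fun i => e i - 1) x I := by
  rw [transferMap_apply C (x := sub x I) (e := e ∘ I.orderEmbOfFin rfl) (fun i => hx _)]
  have := transfer_orderEmb C (I.orderEmbOfFin rfl) (fun i => e i - 1) x Finset.univ
  rw [Finset.map_orderEmbOfFin_univ] at this
  exact this

/-- The extension of an order embedding by a new least element. -/
def consOrderEmb {m n : ℕ} (f : Fin m ↪o Fin n) : Fin (m + 1) ↪o Fin (n + 1) :=
  OrderEmbedding.ofStrictMono (Fin.cons 0 fun i => (f i).succ) <| by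
    intro i j
    refine Fin.cases ?_ (fun i => ?_) i <;> refine Fin.cases ?_ (fun j => ?_) j
    · simp
    · simp
    · simp
    · simp

theorem transferMap_cons {n : ℕ} {e : Fin n → ℤ} {x : Fin n → V} (hx : ∀ i, x i ∈ A.deg (e i))
    {c : ℤ} {η : V} (hη : η ∈ A.deg (c + 1)) (I : Finset (Fin n)) :
    transferMap C (I.card + 1) (Fin.cons (α := fun _ => V) η (sub x I)) =
      transferCons C (fun i => e i - 1) x c η I := by
  rw [transferMap_apply C (e := Fin.cons (c + 1) (e ∘ I.orderEmbOfFin rfl))]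
  · have := transfer_orderEmb C (consOrderEmb (I.orderEmbOfFin rfl))
      (Fin.cons c fun i => e i - 1 : Fin (n + 1) → ℤ) (Fin.cons η x : Fin (n + 1) → V) Finset.univ
    rw [transferCons]
    have h1 : insert 0 (I.map (Fin.succOrderEmb n).toEmbedding) =
        Finset.univ.map (consOrderEmb (I.orderEmbOfFin rfl)).toEmbedding := by
      rw [Fin.univ_succ, Finset.map_cons, Finset.cons_eq_insert]
      congr 1
      nth_rw 1 [← Finset.map_orderEmbOfFin_univ I rfl]
      rw [Finset.map_map, Finset.map_map]
      rfl
    rw [h1, ← this]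
    congr 1
    · funext i
      refine Fin.cases ?_ (fun j => ?_) i
      · show c + 1 - 1 = c; ring
      · rfl
    · funext i
      refine Fin.cases ?_ (fun j => ?_) i <;> rfl
  · intro i
    refine Fin.cases ?_ (fun j => ?_) i
    · exact hη
    · exact hx _

theorem eps_eq_shuffleSign {n : ℕ} (e : Fin n → ℤ) (I : Finset (Fin n)) :
    eps (fun i => e i - 1) I (Finset.univ \ I) = shuffleSign e I := by
  refine Finset.prod_congr rfl fun i _ => ?_
  rw [Finset.prod_filter, ← Finset.compl_eq_univ_sdiff]

/-- The curvature of the family `singles` lives on one-element sets, where it is the differential,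
and on two-element sets, where it is the bracket. These give the two sums on the right-hand side of
`LInftyHom.comm`. -/
theorem sum_card_one_two {n : ℕ} {X : Type*} [AddCommMonoid X] (f : Finset (Fin n) → X)
    (h : ∀ S : Finset (Fin n), S.card ≠ 1 → S.card ≠ 2 → f S = 0) :
    ∑ S, f S = ∑ i, f {i} + ∑ i, ∑ j ∈ Finset.univ.filter (fun j => i < j), f {i, j} := by
  have h1 : ∑ S, f S = ∑ S ∈ Finset.univ.filter (fun S : Finset (Fin n) => S.card = 1), f S +
      ∑ S ∈ Finset.univ.filter (fun S : Finset (Fin n) => S.card = 2), f S := by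
    rw [← Finset.sum_union]
    · symm
      refine Finset.sum_subset (Finset.subset_univ _) fun S _ hS => ?_
      simp only [Finset.mem_union, Finset.mem_filter, Finset.mem_univ, true_and, not_or] at hS
      exact h S hS.1 hS.2
    · rw [Finset.disjoint_filter]
      intro S _ h1 h2
      omega
  rw [h1, Finset.sum_sigma']
  congr 1
  · symm
    refine Finset.sum_bij (fun i _ => {i}) ?_ ?_ ?_ ?_
    · intro i _; simp
    · intro i _ j _ hij; simpa using hij
    · intro S hS
      simp only [Finset.mem_filter, Finset.mem_univ, true_and] at hS
      obtain ⟨i, rfl⟩ := Finset.card_eq_one.1 hS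
      exact ⟨i, Finset.mem_univ _, rfl⟩
    · intro i _; rfl
  · symm
    refine Finset.sum_bij (fun p _ => {p.1, p.2}) ?_ ?_ ?_ ?_
    · rintro ⟨i, j⟩ hij
      simp only [Finset.mem_sigma, Finset.mem_univ, Finset.mem_filter, true_and] at hij
      simp [Finset.card_pair hij.ne]
    · rintro ⟨i, j⟩ hij ⟨k, l⟩ hkl he
      simp only [Finset.mem_sigma, Finset.mem_univ, Finset.mem_filter, true_and] at hij hkl he
      have h1 : i ∈ ({k, l} : Finset (Fin n)) := he ▸ by simp
      have h2 : j ∈ ({k, l} : Finset (Fin n)) := he ▸ by simp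
      have h3 : k ∈ ({i, j} : Finset (Fin n)) := he ▸ by simp
      have h4 : l ∈ ({i, j} : Finset (Fin n)) := he ▸ by simp
      simp only [Finset.mem_insert, Finset.mem_singleton] at h1 h2 h3 h4
      have hik : i = k := by omega
      have hjl : j = l := by omega
      subst hik hjl
      rfl
    · intro S hS
      simp only [Finset.mem_filter, Finset.mem_univ, true_and] at hS
      obtain ⟨i, j, hij, rfl⟩ := Finset.card_eq_two.1 hS
      rcases lt_or_gt_of_ne hij with h | h
      · exact ⟨⟨i, j⟩, by simp [h], rfl⟩
      · exact ⟨⟨j, i⟩, by simp [h], Finset.pair_comm _ _⟩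
    · rintro ⟨i, j⟩ _; rfl

theorem conv_singles_of_card_ne {ι : Type*} [LinearOrder ι] (u : ι → ℤ) (x : ι → V) {S : Finset ι}
    (h : S.card ≠ 2) : conv A u 1 (singles x) (singles x) S = 0 := by
  refine Finset.sum_eq_zero fun J hJ => ?_
  have hJ := Finset.mem_powerset.1 hJ
  by_cases h1 : J.card = 1
  · have : (S \ J).card ≠ 1 := by
      rw [Finset.card_sdiff_of_subset hJ]
      omega
    rw [singles_of_card_ne x this, map_zero, smul_zero]
  · rw [singles_of_card_ne x h1, map_zero, LinearMap.zero_apply, smul_zero]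

/-- Only the two splittings into singletons contribute. They agree by graded symmetry, and the
resulting `2` cancels the `1/2` in the curvature. -/
theorem conv_singles_pair {ι : Type*} [LinearOrder ι] {u : ι → ℤ} {x : ι → V}
    (hx : ∀ i, x i ∈ A.deg (u i + 1)) {i j : ι} (h : i < j) :
    conv A u 1 (singles x) (singles x) {i, j} =
      (2 : K) • (u i + 1).negOnePow • A.br (x i) (x j) := by
  have hs : IsHomog A u 1 (singles x) := by
    intro S
    by_cases h : S.card = 1
    · obtain ⟨i, rfl⟩ := Finset.card_eq_one.1 h
      simpa [singles] using hx i
    · rw [singles_of_card_ne _ h]; exact Submodule.zero_mem _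
  have hij : i ∉ ({j} : Finset ι) := by simp [h.ne]
  have e1 : ({i, j} : Finset ι) \ {j} = {i} := by
    ext a; simp; constructor
    · rintro ⟨rfl | rfl, h⟩ <;> simp_all
    · rintro rfl; simp [h.ne]
  have e2 : ({i, j} : Finset ι) \ {i} = {j} := by
    ext a; simp; constructor
    · rintro ⟨rfl | rfl, h⟩ <;> simp_all
    · rintro rfl; simp [h.ne']
  have hp : ({j} : Finset ι).powerset = {∅, {j}} := by
    ext S; simp [Finset.subset_singleton_iff]
  rw [conv, show ({i, j} : Finset ι) = insert i {j} from rfl, Finset.sum_powerset_insert hij, hp,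
    Finset.sum_pair (Finset.singleton_ne_empty j).symm,
    Finset.sum_pair (Finset.singleton_ne_empty j).symm]
  have z : singles x (∅ : Finset ι) = 0 := singles_of_card_ne x (by simp)
  have hi0 : insert i (∅ : Finset ι) = {i} := rfl
  have e3 : (insert i {j} : Finset ι) \ {j} = {i} := e1
  have e4 : (insert i {j} : Finset ι) \ {i} = {j} := e2
  rw [hi0, e3, e4, Finset.sdiff_self, z, map_zero, LinearMap.zero_apply, smul_zero, zero_add,
    map_zero, smul_zero, add_zero, conv_term_swap hs hs (by simp [h.ne']), two_smul,
    singles_singleton, singles_singleton]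
  simp [eps, h.not_gt]

/-- The `L_∞`-morphism obtained by transfer along a contraction. -/
def StrictContraction.lInftyHom [CharZero K] : LInftyHom A B where
  map := transferMap C
  map_zero := by
    ext x
    rw [transferMap_apply C (e := fun _ => 0) (fun i => i.elim0)]
    simpa using transfer_empty C _ x
  map_mem := by
    intro n e x hx
    rw [transferMap_apply C hx]
    have := transfer_homog C (u := fun i => e i - 1) (x := x) (by simpa using hx) Finset.univ
    convert this using 2
    simp [Finset.sum_sub_distrib]
    ring
  symm := by
    intro n e x hx σ
    rw [transferMap_apply C hx, transferMap_apply C (x := x ∘ σ) (e := e ∘ σ) (fun i => hx _)]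
    have := transfer_map C σ.toEmbedding (fun i => e i - 1) x Finset.univ
    rw [Finset.map_univ_equiv] at this
    refine this.trans ?_
    congr 1
    refine Finset.prod_congr rfl fun i _ => ?_
    rw [Finset.prod_filter]
    rfl
  comm := by
    intro n e x hx
    have hx' : ∀ i, x i ∈ A.deg ((fun i => e i - 1) i + 1) := by simpa using hx
    -- The equation of an `L_∞`-morphism is this identity on the full index set, read term by term.
    have h := curvature_eq_insertions C hx' Finset.univ
    rw [conv, insertions, Finset.powerset_univ] at h
    rw [transferMap_apply C hx]
    have h1 : ∀ I : Finset (Fin n), (shuffleSign e I * (∑ i ∈ I, (e i - 1) + 1).negOnePow) •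
          B.br (transferMap C I.card (sub x I)) (transferMap C Iᶜ.card (sub x Iᶜ)) =
        (eps (fun i => e i - 1) I (Finset.univ \ I) * (∑ i ∈ I, (e i - 1) + 1).negOnePow) •
          B.br (transfer C (fun i => e i - 1) x I)
            (transfer C (fun i => e i - 1) x (Finset.univ \ I)) := by
      intro I
      rw [transferMap_sub C hx, transferMap_sub C hx, eps_eq_shuffleSign,
        Finset.compl_eq_univ_sdiff]
    rw [Finset.sum_congr rfl fun I _ => h1 I, h, sum_card_one_two]
    · congr 1
      · refine Finset.sum_congr rfl fun i _ => ?_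
        rw [eps_eq_shuffleSign, conv_singles_of_card_ne _ _ (by simp), smul_zero, add_zero,
          singles_singleton, transferMap_cons C (c := e i) hx (A.d_mem _ _ (hx i)),
          Finset.compl_eq_univ_sdiff]
        congr 2
        simp
      · refine Finset.sum_congr rfl fun i _ => Finset.sum_congr rfl fun j hj => ?_
        have hij : i < j := by simpa using hj
        rw [eps_eq_shuffleSign, conv_singles_pair hx' hij, singles_of_card_ne _
          (by simp [Finset.card_pair hij.ne]), map_zero, zero_add]
        have hb : (e i).negOnePow • A.br (x i) (x j) ∈ A.deg (e i + e j - 1 + 1) := by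
          rw [Units.smul_def, sub_add_cancel]
          exact zsmul_mem (A.br_mem _ _ _ (hx i) _ (hx j)) _
        have hm := transferMap_cons C hx hb (Finset.univ \ {i, j})
        rw [Finset.compl_eq_univ_sdiff, ← smul_smul (shuffleSign e {i, j})]
        have hl : (e i).negOnePow • transferMap C ((Finset.univ \ {i, j}).card + 1)
            (Fin.cons (α := fun _ => V) (A.br (x i) (x j)) (sub x (Finset.univ \ {i, j}))) =
            transferMap C ((Finset.univ \ {i, j}).card + 1)
            (Fin.cons (α := fun _ => V) ((e i).negOnePow • A.br (x i) (x j))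
              (sub x (Finset.univ \ {i, j}))) := by
          have h0 := (transferMap C ((Finset.univ \ {i, j}).card + 1)).map_update_smul
            (Fin.cons (α := fun _ => V) (A.br (x i) (x j)) (sub x (Finset.univ \ {i, j}))) 0
            (((e i).negOnePow : ℤ) : K) (A.br (x i) (x j))
          rw [Fin.update_cons_zero, Fin.update_cons_zero] at h0
          rw [Units.smul_def, Units.smul_def, ← Int.cast_smul_eq_zsmul K,
            ← Int.cast_smul_eq_zsmul K, h0]
        rw [hl, hm]
        congr 2
        · rw [Finset.sum_pair hij.ne]; ring
        · rw [smul_smul (2 : K)⁻¹, sub_add_cancel]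
          norm_num
    · intro S h1 h2
      rw [conv_singles_of_card_ne _ _ h2, singles_of_card_ne _ h1, map_zero, smul_zero, add_zero]
      have := transferMap_cons C hx (c := ∑ i ∈ S, (e i - 1) + 1) (Submodule.zero_mem _)
        (Finset.univ \ S)
      rw [← this, MultilinearMap.map_coord_zero _ 0 rfl, smul_zero]

/-- For one index there is no bracket. Inhomogeneous entries are covered as well, because the two
parity projections add up to the identity. -/
theorem transferMap_one [CharZero K] (x : V) : C.lInftyHom.map 1 ![x] = C.incl x := by
  have key : ∀ u : Fin 1 → ℤ, ∀ x : Fin 1 → V, transfer C u x Finset.univ = C.incl (x 0) := by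
    intro u x
    have h : conv B u 1 (transfer C u x) (transfer C u x) Finset.univ = 0 := by
      refine conv_rec C u x _ (p := (· = 0)) rfl (fun a b ha hb => by rw [ha, hb, add_zero])
          fun J hJ hne hJ' => ?_
      have := card_lt_of_ne hJ hne
      have := hJ'.card_pos
      simp only [Finset.card_univ, Fintype.card_fin] at *
      omega
    rw [transfer_eq, h, map_zero, smul_zero, sub_zero]
    simp [singles]
  have hall : ∀ v : V, ∑ s : Fin 1 → Bool, A.parityProj (s 0) v = v := by
    intro v
    have hv : v ∈ ⨆ n, A.deg n := by rw [A.isInternal.submodule_iSup_eq_top]; trivial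
    induction hv using Submodule.iSup_induction' with
    | mem n v hv =>
      rw [show ∑ s : Fin 1 → Bool, A.parityProj (s 0) v = ∑ b, A.parityProj b v from
        (Equiv.funUnique (Fin 1) Bool).sum_comp (fun b => A.parityProj b v)]
      simp only [Fintype.univ_bool, Finset.mem_singleton, Bool.true_eq_false, not_false_eq_true,
        Finset.sum_insert, Finset.sum_singleton]
      rw [A.parityProj_apply hv, A.parityProj_apply hv]
      by_cases h : Even (n - 1)
      · rw [if_neg, if_pos, zero_add]
        · simpa [parityDeg] using h
        · intro h'
          have := h.sub h'
          simp [parityDeg] at this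
      · rw [if_pos, if_neg, add_zero]
        · simpa [parityDeg] using h
        · exact (Int.not_even_iff_odd.1 h).sub_odd odd_one
    | zero => simp
    | add v w _ _ hv hw => simp only [map_add, Finset.sum_add_distrib, hv, hw]
  change transferMap C 1 ![x] = _
  rw [transferMap, _root_.sum_apply]
  nth_rw 2 [← hall x]
  rw [map_sum]
  refine Finset.sum_congr rfl fun s _ => ?_
  exact key _ _

/-- This need not be an axiom: `d` applied to the homotopy identity, compared with that identity at
`d w`, gives the claim after the inclusion, which has the left inverse `pr`. -/
theorem StrictContraction.pr_d (w : W) : C.pr (B.d w) = A.d (C.pr w) := by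
  have h1 := congrArg B.d (C.d_htpy w)
  have h2 := C.d_htpy (B.d w)
  rw [map_add, B.d_d, zero_add, map_sub, ← C.incl_d] at h1
  rw [B.d_d, map_zero, add_zero, h1, sub_right_inj] at h2
  have := congrArg C.pr h2
  rw [C.pr_incl, C.pr_incl] at this
  exact this.symm

/-- The projection is a chain map, a strict left inverse of the inclusion, and a right inverse up to
the homotopy. -/
theorem StrictContraction.lInftyHom_isQuasiIso [CharZero K] : C.lInftyHom.IsQuasiIso := by
  refine ⟨fun x _ ⟨w, hw⟩ => ⟨C.pr w, ?_⟩, fun w hw => ⟨C.pr w, ?_, C.htpy w, ?_⟩⟩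
  · rw [← C.pr_d, hw, transferMap_one, C.pr_incl]
  · rw [← C.pr_d, hw, map_zero]
  · have := C.d_htpy w
    rw [hw, map_zero, add_zero] at this
    rw [transferMap_one, this]

theorem StrictContraction.lInftyHom_mem_filtration [CharZero K] {F : ℕ → Submodule K W}
    (hF0 : ∀ x, C.incl x ∈ F 0)
    (hF : ∀ m n x y, x ∈ F m → y ∈ F n → B.br x y ∈ F (m + n))
    (hF1 : ∀ n x, x ∈ F n → C.htpy x ∈ F (n + 1)) (n : ℕ) (x : Fin n → V) :
    C.lInftyHom.map n x ∈ F (n - 1) := by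
  change transferMap C n x ∈ _
  rw [transferMap, _root_.sum_apply]
  refine Submodule.sum_mem _ fun s _ => ?_
  have := transfer_mem_filtration C hF0 hF hF1 (fun i => parityDeg (s i))
    (fun i => A.parityProj (s i) (x i)) Finset.univ
  rw [Finset.card_univ, Fintype.card_fin] at this
  exact this

end Morphism

end

section

/-! ## `ADT` as an enveloping algebra, and the superscript notation as algebra morphisms -/

section Enveloping

variable {K : Type*} [Field K] {L : Type*} [LieRing L] [LieAlgebra K L]

theorem uea_induction {p : UniversalEnvelopingAlgebra K L → Prop}
    (algebraMap : ∀ r, p (algebraMap K _ r)) (ι : ∀ x, p (UniversalEnvelopingAlgebra.ι K x))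
    (mul : ∀ a b, p a → p b → p (a * b)) (add : ∀ a b, p a → p b → p (a + b))
    (a : UniversalEnvelopingAlgebra K L) : p a := by
  obtain ⟨a, rfl⟩ : ∃ b, UniversalEnvelopingAlgebra.mkAlgHom K L b = a :=
    Quotient.exists_rep a
  induction a using TensorAlgebra.induction with
  | algebraMap r => rw [AlgHom.commutes]; exact algebraMap r
  | ι x => exact ι x
  | mul x y hx hy => rw [map_mul]; exact mul _ _ hx hy
  | add x y hx hy => rw [map_add]; exact add _ _ hx hy

theorem uea_commute {A : Type*} [Ring A] [Algebra K A] (f : UniversalEnvelopingAlgebra K L →ₐ[K] A)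
    {z : A} (h : ∀ x, Commute (f (UniversalEnvelopingAlgebra.ι K x)) z)
    (u : UniversalEnvelopingAlgebra K L) : Commute (f u) z := by
  induction u using uea_induction with
  | algebraMap r => rw [AlgHom.commutes]; exact Algebra.commute_algebraMap_left _ _
  | ι x => exact h x
  | mul a b ha hb => rw [map_mul]; exact ha.mul_left hb
  | add a b ha hb => rw [map_add]; exact ha.add_left hb

theorem uea_commute_commute {L' A : Type*} [LieRing L'] [LieAlgebra K L'] [Ring A] [Algebra K A]
    (f : UniversalEnvelopingAlgebra K L →ₐ[K] A) (g : UniversalEnvelopingAlgebra K L' →ₐ[K] A)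
    (h : ∀ x y, Commute (f (UniversalEnvelopingAlgebra.ι K x))
      (g (UniversalEnvelopingAlgebra.ι K y))) (u v) : Commute (f u) (g v) :=
  uea_commute f (fun x => (uea_commute g (fun y => (h x y).symm) v).symm) u

/-- The functoriality of the enveloping algebra. -/
def ueaMap {L' : Type*} [LieRing L'] [LieAlgebra K L'] (f : L →ₗ⁅K⁆ L') :
    UniversalEnvelopingAlgebra K L →ₐ[K] UniversalEnvelopingAlgebra K L' :=
  UniversalEnvelopingAlgebra.lift K ((UniversalEnvelopingAlgebra.ι K).comp f)

@[simp] theorem ueaMap_ι {L' : Type*} [LieRing L'] [LieAlgebra K L'] (f : L →ₗ⁅K⁆ L') (x : L) :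
    ueaMap f (UniversalEnvelopingAlgebra.ι K x) = UniversalEnvelopingAlgebra.ι K (f x) := by
  rw [ueaMap, UniversalEnvelopingAlgebra.lift_ι_apply]; rfl

end Enveloping

theorem ofFn_prod_mul {A : Type*} [Monoid A] {k : ℕ} (x y : Fin k → A)
    (h : ∀ i j, i ≠ j → Commute (x i) (y j)) :
    (List.ofFn fun i => x i * y i).prod = (List.ofFn x).prod * (List.ofFn y).prod := by
  induction k with
  | zero => simp
  | succ k ih =>
    simp only [List.ofFn_succ, List.prod_cons]
    rw [ih _ _ fun i j hij => h _ _ (by simpa using hij)]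
    have : Commute (List.ofFn fun i : Fin k => x i.succ).prod (y 0) := by
      refine Commute.list_prod_left _ _ fun a ha => ?_
      obtain ⟨i, rfl⟩ := (List.mem_ofFn' _ _).1 ha
      exact h _ _ (Fin.succ_ne_zero i)
    simp only [mul_assoc]
    rw [← mul_assoc (List.ofFn fun i : Fin k => x i.succ).prod (y 0), this.eq]
    simp only [mul_assoc]

theorem ofFn_mulSingle_prod {A : Type*} [Monoid A] {k : ℕ} (i : Fin k) (a : A) :
    (List.ofFn (Pi.mulSingle (M := fun _ : Fin k => A) i a)).prod = a := by
  induction k with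
  | zero => exact i.elim0
  | succ k ih =>
    rw [List.ofFn_succ, List.prod_cons]
    refine Fin.cases ?_ (fun j => ?_) i
    · rw [List.prod_eq_one]
      · simp
      · intro b hb
        obtain ⟨j, rfl⟩ := (List.mem_ofFn' _ _).1 hb
        simp [Fin.succ_ne_zero]
    · have : (fun i : Fin k => (Pi.mulSingle (M := fun _ : Fin (k + 1) => A) j.succ a) i.succ) =
          Pi.mulSingle (M := fun _ : Fin k => A) j a := by
        funext l
        by_cases hl : l = j
        · subst hl; simp
        · simp [hl]
      rw [this, ih]
      simp [(Fin.succ_ne_zero j).symm]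

variable {K : Type*} [Field K] {𝔤 : Type*} [LieRing 𝔤] [LieAlgebra K 𝔤] (𝔥 : LieSubalgebra K 𝔤)

theorem adt_hom_ext {A : Type*} [Ring A] [Algebra K A] {k : ℕ} {F G : ADT K 𝔥 k →ₐ[K] A}
    (h1 : ∀ i x, F (leg K 𝔥 i (UniversalEnvelopingAlgebra.ι K x)) =
      G (leg K 𝔥 i (UniversalEnvelopingAlgebra.ι K x)))
    (h2 : ∀ y, F (tail K 𝔥 k (UniversalEnvelopingAlgebra.ι K y)) =
      G (tail K 𝔥 k (UniversalEnvelopingAlgebra.ι K y))) : F = G := by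
  have : F.comp (toADT K 𝔥 k).toAlgHom = G.comp (toADT K 𝔥 k).toAlgHom := by
    apply Algebra.TensorProduct.ext
    · apply PiTensorProduct.algHom_ext
      intro i
      apply UniversalEnvelopingAlgebra.hom_ext
      ext x
      exact h1 i x
    · apply UniversalEnvelopingAlgebra.hom_ext
      ext x
      exact h2 x
  ext x
  exact congrArg (fun H => H ((toADT K 𝔥 k).symm x)) this

/-- The algebra morphism on `ADT` determined by commuting morphisms on the tensor factors. -/
def adtLift {A : Type*} [Ring A] [Algebra K A] {k : ℕ}
    (f : Fin k → UniversalEnvelopingAlgebra K 𝔤 →ₐ[K] A) (g : UniversalEnvelopingAlgebra K 𝔥 →ₐ[K] A)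
    (hf : ∀ i j, i ≠ j → ∀ u v, Commute (f i u) (f j v)) (hg : ∀ i u v, Commute (f i u) (g v)) :
    ADT K 𝔥 k →ₐ[K] A :=
  (Algebra.TensorProduct.lift (PiTensorProduct.liftAlgHom
    ((MultilinearMap.mkPiAlgebraFin K k A).compLinearMap fun j => (f j).toLinearMap)
    (by
      simp only [MultilinearMap.compLinearMap_apply, MultilinearMap.mkPiAlgebraFin_apply]
      refine List.prod_eq_one fun a ha => ?_
      obtain ⟨i, rfl⟩ := (List.mem_ofFn' _ _).1 ha
      simp)
    (by
      intro x y
      simp only [MultilinearMap.compLinearMap_apply, MultilinearMap.mkPiAlgebraFin_apply]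
      simp only [AlgHom.toLinearMap_apply, Pi.mul_apply, map_mul]
      exact ofFn_prod_mul _ _ fun i j hij => hf i j hij _ _)) g (by
      intro x v
      induction x using PiTensorProduct.induction_on with
      | smul_tprod r x =>
        rw [map_smul]
        refine Commute.smul_left ?_ r
        rw [PiTensorProduct.liftAlgHom_apply, PiTensorProduct.lift.tprod,
          MultilinearMap.compLinearMap_apply, MultilinearMap.mkPiAlgebraFin_apply]
        refine Commute.list_prod_left _ _ fun a ha => ?_
        obtain ⟨i, rfl⟩ := (List.mem_ofFn' _ _).1 ha
        exact hg _ _ _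
      | add x y hx hy => rw [map_add]; exact hx.add_left hy)).comp (toADT K 𝔥 k).symm.toAlgHom

section lift

variable {A : Type*} [Ring A] [Algebra K A] {k : ℕ}
    (f : Fin k → UniversalEnvelopingAlgebra K 𝔤 →ₐ[K] A) (g : UniversalEnvelopingAlgebra K 𝔥 →ₐ[K] A)
    (hf : ∀ i j, i ≠ j → ∀ u v, Commute (f i u) (f j v)) (hg : ∀ i u v, Commute (f i u) (g v))

theorem adtLift_tmul (u : Fin k → UniversalEnvelopingAlgebra K 𝔤)
    (v : UniversalEnvelopingAlgebra K 𝔥) :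
    adtLift 𝔥 f g hf hg (toADT K 𝔥 k (PiTensorProduct.tprod K u ⊗ₜ[K] v)) =
      (List.ofFn fun i => f i (u i)).prod * g v := by
  rw [adtLift, AlgHom.comp_apply]
  refine (Algebra.TensorProduct.lift_tmul _ _ _ _ _).trans ?_
  rw [PiTensorProduct.liftAlgHom_apply,
    PiTensorProduct.lift.tprod, MultilinearMap.compLinearMap_apply,
    MultilinearMap.mkPiAlgebraFin_apply]
  rfl

theorem adtLift_leg (i : Fin k) (u : UniversalEnvelopingAlgebra K 𝔤) :
    adtLift 𝔥 f g hf hg (leg K 𝔥 i u) = f i u := by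
  have := adtLift_tmul 𝔥 f g hf hg (Pi.mulSingle i u) 1
  rw [map_one, mul_one] at this
  refine this.trans ?_
  have h : (List.ofFn fun j => f j (Pi.mulSingle (M := fun _ : Fin k => UniversalEnvelopingAlgebra K 𝔤) i u j)) =
      List.ofFn (Pi.mulSingle (M := fun _ : Fin k => A) i (f i u)) := by
    congr 1
    funext j
    by_cases hj : j = i
    · subst hj; simp
    · simp [hj]
  rw [h, ofFn_mulSingle_prod]

theorem adtLift_tail (v : UniversalEnvelopingAlgebra K 𝔥) :
    adtLift 𝔥 f g hf hg (tail K 𝔥 k v) = g v := by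
  have := adtLift_tmul 𝔥 f g hf hg 1 v
  refine this.trans ?_
  rw [List.prod_eq_one, one_mul]
  intro b hb
  obtain ⟨j, rfl⟩ := (List.mem_ofFn' _ _).1 hb
  simp

end lift

theorem tmul_eq_prod {k : ℕ} (u : Fin k → UniversalEnvelopingAlgebra K 𝔤)
    (v : UniversalEnvelopingAlgebra K 𝔥) :
    toADT K 𝔥 k (PiTensorProduct.tprod K u ⊗ₜ[K] v) =
      (List.ofFn fun i => leg K 𝔥 i (u i)).prod * tail K 𝔥 k v := by
  rw [← adtLift_tmul 𝔥 (fun i => leg K 𝔥 i) (tail K 𝔥 k)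
    (fun i j hij u v => leg_commute K 𝔥 hij u v) (fun i u v => leg_tail_commute K 𝔥 i u v)]
  have : adtLift 𝔥 (fun i => leg K 𝔥 i) (tail K 𝔥 k)
    (fun i j hij u v => leg_commute K 𝔥 hij u v) (fun i u v => leg_tail_commute K 𝔥 i u v) =
      AlgHom.id K _ := adt_hom_ext 𝔥 (fun i x => adtLift_leg ..) (fun y => adtLift_tail ..)
  rw [this]; rfl

theorem adt_linear_ext {X : Type*} [AddCommGroup X] [Module K X] {k : ℕ}
    {F G : ADT K 𝔥 k →ₗ[K] X}
    (h : ∀ u v, F (toADT K 𝔥 k (PiTensorProduct.tprod K u ⊗ₜ[K] v)) =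
      G (toADT K 𝔥 k (PiTensorProduct.tprod K u ⊗ₜ[K] v))) : F = G := by
  have : F ∘ₗ (toADT K 𝔥 k).toLinearMap = G ∘ₗ (toADT K 𝔥 k).toLinearMap := by
    apply TensorProduct.ext
    apply PiTensorProduct.ext
    ext u v
    exact h u v
  ext x
  exact congrArg (fun H => H ((toADT K 𝔥 k).symm x)) this

/-- Once the spread factors commute, as they do for disjoint index sets, the superscript notation is
multiplicative. Identities between such operations can then be checked on the letters from `𝔤` and
`𝔥`. -/
theorem sup_eq_adtLift {k n : ℕ} (I : Fin k → Finset (Fin n)) (J : Finset (Fin n))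
    (hf : ∀ i j, i ≠ j → ∀ u v, Commute (spread K 𝔥 (I i) u) (spread K 𝔥 (I j) v))
    (hg : ∀ i u v, Commute (spread K 𝔥 (I i) u) (spreadTail K 𝔥 J v)) :
    sup K 𝔥 I J = (adtLift 𝔥 (fun i => spread K 𝔥 (I i)) (spreadTail K 𝔥 J) hf hg).toLinearMap := by
  apply adt_linear_ext
  intro u v
  refine Eq.trans ?_ (adtLift_tmul 𝔥 _ _ hf hg u v).symm
  rw [sup, LinearMap.comp_apply]
  change TensorProduct.lift _ (PiTensorProduct.tprod K u ⊗ₜ[K] v) = _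
  rw [TensorProduct.lift.tmul, LinearMap.compl₁₂_apply, PiTensorProduct.lift.tprod,
    MultilinearMap.compLinearMap_apply, MultilinearMap.mkPiAlgebraFin_apply]
  rfl

theorem spread_ι {k : ℕ} (I : Finset (Fin k)) (x : 𝔤) :
    spread K 𝔥 I (UniversalEnvelopingAlgebra.ι K x) =
      ∑ i ∈ I, leg K 𝔥 i (UniversalEnvelopingAlgebra.ι K x) := by
  rw [spread, UniversalEnvelopingAlgebra.lift_ι_apply]
  change (∑ i ∈ I, (leg K 𝔥 i).toLinearMap ∘ₗ
    (UniversalEnvelopingAlgebra.ι K : 𝔤 →ₗ⁅K⁆ _).toLinearMap) x = _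
  rw [LinearMap.sum_apply]
  rfl

theorem spreadTail_ι {k : ℕ} (I : Finset (Fin k)) (y : 𝔥) :
    spreadTail K 𝔥 I (UniversalEnvelopingAlgebra.ι K y) =
      ∑ i ∈ I, leg K 𝔥 i (UniversalEnvelopingAlgebra.ι K (y : 𝔤)) +
        tail K 𝔥 k (UniversalEnvelopingAlgebra.ι K y) := by
  rw [spreadTail, UniversalEnvelopingAlgebra.lift_ι_apply]
  change (∑ i ∈ I, (leg K 𝔥 i).toLinearMap ∘ₗ
    (UniversalEnvelopingAlgebra.ι K : 𝔤 →ₗ⁅K⁆ _).toLinearMap ∘ₗ 𝔥.toSubmodule.subtype +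
        (tail K 𝔥 k).toLinearMap ∘ₗ (UniversalEnvelopingAlgebra.ι K : 𝔥 →ₗ⁅K⁆ _).toLinearMap) y = _
  rw [LinearMap.add_apply, LinearMap.sum_apply]
  rfl

theorem sum_leg_commute {k : ℕ} {I J : Finset (Fin k)} (h : Disjoint I J) (x y : 𝔤) :
    Commute (∑ i ∈ I, leg K 𝔥 i (UniversalEnvelopingAlgebra.ι K x))
      (∑ i ∈ J, leg K 𝔥 i (UniversalEnvelopingAlgebra.ι K y)) :=
  Commute.sum_left _ _ _ fun i hi => Commute.sum_right _ _ _ fun j hj =>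
    leg_commute K 𝔥 (by rintro rfl; exact Finset.disjoint_left.1 h hi hj) _ _

end

/-! ### Position maps, invariance and partial compositions -/

section

variable {K : Type*} [Field K] {𝔤 : Type*} [LieRing 𝔤] [LieAlgebra K 𝔤] (𝔥 : LieSubalgebra K 𝔤)

theorem adt_induction {k : ℕ} {p : ADT K 𝔥 k → Prop}
    (algebraMap : ∀ r, p (algebraMap K _ r))
    (leg : ∀ i x, p (leg K 𝔥 i (UniversalEnvelopingAlgebra.ι K x)))
    (tail : ∀ y, p (tail K 𝔥 k (UniversalEnvelopingAlgebra.ι K y)))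
    (mul : ∀ a b, p a → p b → p (a * b)) (add : ∀ a b, p a → p b → p (a + b))
    (P : ADT K 𝔥 k) : p P := by
  have hl : ∀ i u, p (DynTwist.leg K 𝔥 i u) := fun i u => by
    induction u using uea_induction with
    | algebraMap r => rw [AlgHom.commutes]; exact algebraMap r
    | ι x => exact leg i x
    | mul a b ha hb => rw [map_mul]; exact mul _ _ ha hb
    | add a b ha hb => rw [map_add]; exact add _ _ ha hb
  have ht : ∀ u, p (DynTwist.tail K 𝔥 k u) := fun u => by
    induction u using uea_induction with
    | algebraMap r => rw [AlgHom.commutes]; exact algebraMap r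
    | ι x => exact tail x
    | mul a b ha hb => rw [map_mul]; exact mul _ _ ha hb
    | add a b ha hb => rw [map_add]; exact add _ _ ha hb
  have h1 : p 1 := by simpa using algebraMap 1
  have hprod : ∀ l : List (ADT K 𝔥 k), (∀ a ∈ l, p a) → p l.prod := fun l => by
    induction l with
    | nil => intro _; simpa using h1
    | cons a l ih =>
      intro h
      rw [List.prod_cons]
      exact mul _ _ (h a (by simp)) (ih fun b hb => h b (by simp [hb]))
  obtain ⟨z, rfl⟩ := (toADT K 𝔥 k).surjective P
  induction z using TensorProduct.induction_on with
  | zero => simpa using algebraMap 0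
  | add x y hx hy => rw [map_add]; exact add _ _ hx hy
  | tmul x v =>
    induction x using PiTensorProduct.induction_on with
    | smul_tprod r x =>
      rw [← TensorProduct.smul_tmul', map_smul, Algebra.smul_def]
      refine mul _ _ (algebraMap r) ?_
      rw [tmul_eq_prod]
      refine mul _ _ (hprod _ fun a ha => ?_) (ht v)
      obtain ⟨i, rfl⟩ := (List.mem_ofFn' _ _).1 ha
      exact hl _ _
    | add x y hx hy => rw [TensorProduct.add_tmul, map_add]; exact add _ _ hx hy

theorem adt_commute {A : Type*} [Ring A] [Algebra K A] {k : ℕ} (F : ADT K 𝔥 k →ₐ[K] A) {z : A}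
    (h1 : ∀ i x, Commute (F (leg K 𝔥 i (UniversalEnvelopingAlgebra.ι K x))) z)
    (h2 : ∀ y, Commute (F (tail K 𝔥 k (UniversalEnvelopingAlgebra.ι K y))) z) (P : ADT K 𝔥 k) :
    Commute (F P) z := by
  induction P using adt_induction with
  | algebraMap r => rw [AlgHom.commutes]; exact Algebra.commute_algebraMap_left _ _
  | leg i x => exact h1 i x
  | tail y => exact h2 y
  | mul a b ha hb => rw [map_mul]; exact ha.mul_left hb
  | add a b ha hb => rw [map_add]; exact ha.add_left hb

/-! ### The superscript notation -/

/-- The tensor factors of an element of degree `n` that are fed from the slot `j` under `f`. -/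
def fiber (n : ℕ) (f : ℕ → ℕ) (j : ℕ) : Finset (Fin n) := Finset.univ.filter fun l => f l = j

@[simp] theorem mem_fiber {n : ℕ} {f : ℕ → ℕ} {j : ℕ} {l : Fin n} : l ∈ fiber n f j ↔ f l = j := by
  simp [fiber]

theorem disjoint_fiber {n : ℕ} (f : ℕ → ℕ) {i j : ℕ} (h : i ≠ j) :
    Disjoint (fiber n f i) (fiber n f j) :=
  Finset.disjoint_left.2 fun _ hi hj => h ((mem_fiber.1 hi).symm.trans (mem_fiber.1 hj))

/-- The superscript notation, with the index sets described by a map `f` of positions: the position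
`l` belongs to the `f l`-th index set, the last one being the `k`-th; the positions `l` with
`k < f l` do not occur. -/
def pull (k n : ℕ) (f : ℕ → ℕ) : ADT K 𝔥 k →ₐ[K] ADT K 𝔥 n :=
  adtLift 𝔥 (fun j => spread K 𝔥 (fiber n f j)) (spreadTail K 𝔥 (fiber n f k))
    (fun i j hij => uea_commute_commute _ _ fun x y => by
      rw [spread_ι, spread_ι]
      exact sum_leg_commute 𝔥 (disjoint_fiber f (by simpa [Fin.ext_iff] using hij)) x y)
    (fun i => uea_commute_commute _ _ fun x y => by
      rw [spread_ι, spreadTail_ι]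
      exact (sum_leg_commute 𝔥 (disjoint_fiber f i.2.ne) x y).add_right
        (Commute.sum_left _ _ _ fun l _ => leg_tail_commute K 𝔥 l _ _))

theorem sup_eq_pull {k n : ℕ} (f : ℕ → ℕ) {I : Fin k → Finset (Fin n)} {J : Finset (Fin n)}
    (hI : ∀ j l, l ∈ I j ↔ f l = j) (hJ : ∀ l, l ∈ J ↔ f l = k) :
    sup K 𝔥 I J = (pull 𝔥 k n f).toLinearMap := by
  obtain rfl : I = fun j : Fin k => fiber n f j := by ext j l; simp [hI]
  obtain rfl : J = fiber n f k := by ext l; simp [hJ]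
  exact sup_eq_adtLift ..

theorem pull_leg {k n : ℕ} (f : ℕ → ℕ) (j : Fin k) (u : UniversalEnvelopingAlgebra K 𝔤) :
    pull 𝔥 k n f (leg K 𝔥 j u) = spread K 𝔥 (fiber n f j) u := adtLift_leg ..

theorem pull_tail {k n : ℕ} (f : ℕ → ℕ) (u : UniversalEnvelopingAlgebra K 𝔥) :
    pull 𝔥 k n f (tail K 𝔥 k u) = spreadTail K 𝔥 (fiber n f k) u := adtLift_tail ..

theorem pull_leg_ι {k n : ℕ} (f : ℕ → ℕ) (j : Fin k) (x : 𝔤) :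
    pull 𝔥 k n f (leg K 𝔥 j (UniversalEnvelopingAlgebra.ι K x)) =
      ∑ l ∈ fiber n f j, leg K 𝔥 l (UniversalEnvelopingAlgebra.ι K x) := by
  rw [pull_leg, spread_ι]

theorem pull_tail_ι {k n : ℕ} (f : ℕ → ℕ) (y : 𝔥) :
    pull 𝔥 k n f (tail K 𝔥 k (UniversalEnvelopingAlgebra.ι K y)) =
      ∑ l ∈ fiber n f k, leg K 𝔥 l (UniversalEnvelopingAlgebra.ι K (y : 𝔤)) +
        tail K 𝔥 n (UniversalEnvelopingAlgebra.ι K y) := by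
  rw [pull_tail, spreadTail_ι]

theorem sum_fiber_fiber {n m k : ℕ} {A : Type*} [AddCommMonoid A] (f g : ℕ → ℕ) (X : Fin m → A) :
    ∑ l ∈ fiber n f k, ∑ l' ∈ fiber m g l, X l' =
      ∑ l' ∈ Finset.univ.filter (fun l' : Fin m => g l' < n ∧ f (g l') = k), X l' := by
  rw [← Finset.sum_biUnion]
  · refine Finset.sum_congr ?_ fun _ _ => rfl
    ext l'
    simp only [Finset.mem_biUnion, mem_fiber, Finset.mem_filter, Finset.mem_univ, true_and]
    constructor
    · rintro ⟨l, h1, h2⟩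
      rw [h2]
      exact ⟨l.2, h1⟩
    · rintro ⟨h1, h2⟩
      exact ⟨⟨g l', h1⟩, h2, rfl⟩
  · intro i _ j _ hij
    exact disjoint_fiber g (by simpa [Fin.ext_iff] using hij)

/-- All maps are algebra morphisms, so letters suffice. The second alternative in the hypothesis
reflects that the last factor of the intermediate algebra is itself spread over the positions `l`
with `g l = n`. -/
theorem pull_comp {k n m : ℕ} {f g h : ℕ → ℕ}
    (H : ∀ l < m, ∀ j ≤ k, h l = j ↔ (g l < n ∧ f (g l) = j) ∨ (g l = n ∧ j = k)) :
    (pull 𝔥 n m g).comp (pull 𝔥 k n f) = pull 𝔥 k m h := by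
  apply adt_hom_ext
  · intro i x
    rw [AlgHom.comp_apply, pull_leg_ι, pull_leg_ι, map_sum]
    simp only [pull_leg_ι]
    rw [sum_fiber_fiber]
    refine Finset.sum_congr ?_ fun _ _ => rfl
    ext l
    simp only [Finset.mem_filter, Finset.mem_univ, true_and, mem_fiber]
    rw [H l l.2 i i.2.le]
    have := i.2
    constructor
    · exact Or.inl
    · rintro (h | h)
      · exact h
      · omega
  · intro y
    rw [AlgHom.comp_apply, pull_tail_ι, pull_tail_ι, map_add, map_sum]
    simp only [pull_leg_ι, pull_tail_ι]
    rw [sum_fiber_fiber, ← add_assoc, ← Finset.sum_union]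
    · congr 1
      refine Finset.sum_congr ?_ fun _ _ => rfl
      ext l
      simp only [Finset.mem_union, Finset.mem_filter, Finset.mem_univ, true_and, mem_fiber]
      rw [H l l.2 k le_rfl]
      simp
    · refine Finset.disjoint_left.2 fun l h1 h2 => ?_
      simp only [Finset.mem_filter, Finset.mem_univ, true_and, mem_fiber] at h1 h2
      omega

theorem pull_pull {k n m : ℕ} {f g h : ℕ → ℕ} (P : ADT K 𝔥 k)
    (H : ∀ l < m, ∀ j ≤ k, h l = j ↔ (g l < n ∧ f (g l) = j) ∨ (g l = n ∧ j = k)) :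
    pull 𝔥 n m g (pull 𝔥 k n f P) = pull 𝔥 k m h P :=
  congrArg (fun F => F P) (pull_comp 𝔥 H)

theorem pull_congr {k n : ℕ} {f g : ℕ → ℕ} (H : ∀ l < n, ∀ j ≤ k, f l = j ↔ g l = j) :
    pull 𝔥 k n f = pull 𝔥 k n g := by
  apply adt_hom_ext
  · intro i x
    rw [pull_leg_ι, pull_leg_ι]
    congr 1
    ext l
    simpa using H l l.2 i i.2.le
  · intro y
    rw [pull_tail_ι, pull_tail_ι]
    congr 2
    ext l
    simpa using H l l.2 k le_rfl

/-- The sum over all tensor factors of the copies of `y`. -/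
def total (k : ℕ) (y : 𝔥) : ADT K 𝔥 k :=
  spreadTail K 𝔥 Finset.univ (UniversalEnvelopingAlgebra.ι K y)

theorem total_eq (k : ℕ) (y : 𝔥) :
    total 𝔥 k y = ∑ i, leg K 𝔥 i (UniversalEnvelopingAlgebra.ι K (y : 𝔤)) +
      tail K 𝔥 k (UniversalEnvelopingAlgebra.ι K y) := spreadTail_ι ..

/-- Invariance under the adjoint action of `𝔥`. -/
def Inv (k : ℕ) (P : ADT K 𝔥 k) : Prop := ∀ y, Commute (total 𝔥 k y) P

/-- A letter is primitive, so the coproducts turn the diagonal sum into the diagonal sum over all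
positions that occur; only the unused positions are missing. Every application of invariance goes
through this formula. -/
theorem pull_total {k n : ℕ} (f : ℕ → ℕ) (y : 𝔥) :
    pull 𝔥 k n f (total 𝔥 k y) + ∑ l ∈ Finset.univ.filter (fun l : Fin n => k < f l),
      leg K 𝔥 l (UniversalEnvelopingAlgebra.ι K (y : 𝔤)) = total 𝔥 n y := by
  rw [total_eq, total_eq, map_add, map_sum]
  simp only [pull_leg_ι, pull_tail_ι]
  have h1 : ∑ i : Fin k, ∑ l ∈ fiber n f i, leg K 𝔥 l (UniversalEnvelopingAlgebra.ι K (y : 𝔤)) =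
      ∑ l ∈ Finset.univ.filter (fun l : Fin n => f l < k),
        leg K 𝔥 l (UniversalEnvelopingAlgebra.ι K (y : 𝔤)) := by
    rw [← Finset.sum_biUnion]
    · refine Finset.sum_congr ?_ fun _ _ => rfl
      ext l
      simp only [Finset.mem_biUnion, Finset.mem_univ, true_and, mem_fiber, Finset.mem_filter]
      constructor
      · rintro ⟨i, h⟩; rw [h]; exact i.2
      · intro h; exact ⟨⟨f l, h⟩, rfl⟩
    · intro i _ j _ hij
      exact disjoint_fiber f (by simpa [Fin.ext_iff] using hij)
  have h2 : (∑ i, leg K 𝔥 i (UniversalEnvelopingAlgebra.ι K (y : 𝔤)) : ADT K 𝔥 n) =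
      ∑ l ∈ Finset.univ.filter (fun l : Fin n => f l < k),
        leg K 𝔥 l (UniversalEnvelopingAlgebra.ι K (y : 𝔤)) +
      ∑ l ∈ fiber n f k, leg K 𝔥 l (UniversalEnvelopingAlgebra.ι K (y : 𝔤)) +
      ∑ l ∈ Finset.univ.filter (fun l : Fin n => k < f l),
        leg K 𝔥 l (UniversalEnvelopingAlgebra.ι K (y : 𝔤)) := by
    rw [← Finset.sum_union, ← Finset.sum_union]
    · refine Finset.sum_congr ?_ fun _ _ => rfl
      ext l
      simp only [Finset.mem_union, Finset.mem_filter, Finset.mem_univ, true_and, mem_fiber,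
        true_iff]
      omega
    · refine Finset.disjoint_left.2 fun l h1 h2 => ?_
      simp only [Finset.mem_union, Finset.mem_filter, Finset.mem_univ, true_and, mem_fiber] at h1 h2
      omega
    · refine Finset.disjoint_left.2 fun l h1 h2 => ?_
      simp only [Finset.mem_filter, Finset.mem_univ, true_and, mem_fiber] at h1 h2
      omega
  rw [h1, h2]
  abel

theorem leg_commute_pull {k n : ℕ} {f : ℕ → ℕ} {l : Fin n} (hl : k < f l)
    (u : UniversalEnvelopingAlgebra K 𝔤) (P : ADT K 𝔥 k) :
    Commute (leg K 𝔥 l u) (pull 𝔥 k n f P) := by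
  refine (adt_commute 𝔥 (pull 𝔥 k n f) (fun i x => ?_) (fun y => ?_) P).symm
  · rw [pull_leg_ι]
    refine Commute.sum_left _ _ _ fun l' hl' => leg_commute K 𝔥 ?_ _ _
    rintro rfl
    have := i.2
    rw [mem_fiber] at hl'
    omega
  · rw [pull_tail_ι]
    refine Commute.add_left (Commute.sum_left _ _ _ fun l' hl' => leg_commute K 𝔥 ?_ _ _)
      (leg_tail_commute ..).symm
    rintro rfl
    rw [mem_fiber] at hl'
    omega

theorem Inv.pull {k n : ℕ} (f : ℕ → ℕ) {P : ADT K 𝔥 k} (hP : Inv 𝔥 k P) :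
    Inv 𝔥 n (pull 𝔥 k n f P) := fun y => by
  rw [← pull_total 𝔥 (k := k) f y]
  refine Commute.add_left ((hP y).map (DynTwist.pull 𝔥 k n f)) (Commute.sum_left _ _ _ fun l hl => ?_)
  exact leg_commute_pull 𝔥 (by simpa using hl) _ _

theorem Inv.mul {k : ℕ} {P Q : ADT K 𝔥 k} (hP : Inv 𝔥 k P) (hQ : Inv 𝔥 k Q) : Inv 𝔥 k (P * Q) :=
  fun y => (hP y).mul_right (hQ y)

/-- If all tensor factors that `R` is spread over are in the last index set of `Q`, then the
invariance of `R` makes the two commute. -/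
theorem pull_commute_pull {k r n : ℕ} {f f' : ℕ → ℕ} (Q : ADT K 𝔥 k) {R : ADT K 𝔥 r}
    (hR : Inv 𝔥 r R) (H : ∀ l < n, f' l ≤ r → f l = k) :
    Commute (pull 𝔥 k n f Q) (pull 𝔥 r n f' R) := by
  refine adt_commute 𝔥 (pull 𝔥 k n f) (fun i x => ?_) (fun y => ?_) Q
  · rw [pull_leg_ι]
    refine Commute.sum_left _ _ _ fun l hl => leg_commute_pull 𝔥 ?_ _ _
    by_contra h
    have h1 := H l l.2 (not_lt.1 h)
    rw [mem_fiber] at hl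
    have := i.2
    omega
  · have h1 : pull 𝔥 k n f (tail K 𝔥 k (UniversalEnvelopingAlgebra.ι K y)) =
        pull 𝔥 r n f' (total 𝔥 r y) +
          ∑ l ∈ Finset.univ.filter (fun l : Fin n => f l = k ∧ r < f' l),
            leg K 𝔥 l (UniversalEnvelopingAlgebra.ι K (y : 𝔤)) := by
      have h2 := pull_total 𝔥 (k := r) (n := n) f' y
      rw [← eq_sub_iff_add_eq] at h2
      rw [h2, pull_tail_ι, total_eq]
      have h3 : (∑ i, leg K 𝔥 i (UniversalEnvelopingAlgebra.ι K (y : 𝔤)) : ADT K 𝔥 n) =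
          ∑ l ∈ Finset.univ.filter (fun l : Fin n => r < f' l),
            leg K 𝔥 l (UniversalEnvelopingAlgebra.ι K (y : 𝔤)) +
          ∑ l ∈ Finset.univ.filter (fun l : Fin n => ¬ r < f' l),
            leg K 𝔥 l (UniversalEnvelopingAlgebra.ι K (y : 𝔤)) :=
        (Finset.sum_filter_add_sum_filter_not ..).symm
      have h4 : (∑ l ∈ fiber n f k, leg K 𝔥 l (UniversalEnvelopingAlgebra.ι K (y : 𝔤)) :
            ADT K 𝔥 n) =
          ∑ l ∈ Finset.univ.filter (fun l : Fin n => f l = k ∧ r < f' l),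
            leg K 𝔥 l (UniversalEnvelopingAlgebra.ι K (y : 𝔤)) +
          ∑ l ∈ Finset.univ.filter (fun l : Fin n => ¬ r < f' l),
            leg K 𝔥 l (UniversalEnvelopingAlgebra.ι K (y : 𝔤)) := by
        rw [← Finset.sum_union]
        · refine Finset.sum_congr ?_ fun _ _ => rfl
          ext l
          simp only [Finset.mem_union, Finset.mem_filter, Finset.mem_univ, true_and, mem_fiber]
          have := H l l.2
          constructor
          · intro h; by_cases hh : r < f' l
            · exact Or.inl ⟨h, hh⟩
            · exact Or.inr hh
          · rintro (h | h)
            · exact h.1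
            · exact this (not_lt.1 h)
        · refine Finset.disjoint_left.2 fun l h1 h2 => ?_
          simp only [Finset.mem_filter, Finset.mem_univ, true_and] at h1 h2
          exact h2 h1.2
      rw [h3, h4]
      abel
    rw [h1]
    refine Commute.add_left ((hR y).map (pull 𝔥 r n f')) (Commute.sum_left _ _ _ fun l hl => ?_)
    exact leg_commute_pull 𝔥 (Finset.mem_filter.1 hl).2.2 _ _

/-! ### Partial compositions -/

/-- The position map of the first factor of a partial composition at `i`. -/
def outer (i q l : ℕ) : ℕ := if l < i then l else if l < i + q then i else l + 1 - q

/-- The position map of the second factor of a partial composition at `i`. -/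
def inner (i q l : ℕ) : ℕ := if l < i then q + 1 else if l < i + q then l - i else q

/-- The partial composition `P^{1, …, i+1⋯i+q, …} Q^{i+1, …, i+q, i+q+1⋯}`. -/
def circ (p q n i : ℕ) (P : ADT K 𝔥 p) (Q : ADT K 𝔥 q) : ADT K 𝔥 n :=
  pull 𝔥 p n (outer i q) P * pull 𝔥 q n (inner i q) Q

theorem Inv.circ {p q n i : ℕ} {P : ADT K 𝔥 p} {Q : ADT K 𝔥 q} (hP : Inv 𝔥 p P)
    (hQ : Inv 𝔥 q Q) : Inv 𝔥 n (circ 𝔥 p q n i P Q) :=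
  Inv.mul 𝔥 (Inv.pull 𝔥 _ hP) (Inv.pull 𝔥 _ hQ)

theorem brace_apply {p q n : ℕ} (hn : n + 1 = p + q) (P : ADT K 𝔥 p) (Q : ADT K 𝔥 q) :
    brace K 𝔥 p q n P Q =
      ∑ i ∈ Finset.range p, (-1 : ℤ) ^ ((q + 1) * i) • circ 𝔥 p q n i P Q := by
  rw [brace, LinearMap.sum_apply, LinearMap.sum_apply]
  refine Finset.sum_congr rfl fun i hi => ?_
  rw [Finset.mem_range] at hi
  rw [LinearMap.smul_apply, LinearMap.smul_apply, LinearMap.compl₁₂_apply, LinearMap.mul_apply',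
    sup_eq_pull 𝔥 (outer i q), sup_eq_pull 𝔥 (inner i q)]
  · rfl
  · intro j l
    simp only [Finset.mem_filter, Finset.mem_univ, true_and, inner]
    split_ifs <;> omega
  · intro l
    simp only [Finset.mem_filter, Finset.mem_univ, true_and, inner]
    split_ifs <;> omega
  · intro j l
    simp only [Finset.mem_filter, Finset.mem_univ, true_and, outer]
    split_ifs <;> omega
  · intro l
    simp only [Finset.notMem_empty, false_iff, outer]
    split_ifs <;> omega

/-- Nested insertion is associative for arbitrary elements: only position maps have to be composed.
-/
theorem circ_circ {p q r n n' s i j : ℕ} (hn : n + 1 = p + q) (hn' : n' + 1 = n + r)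
    (hs : s + 1 = q + r) (hi : i < p) (hj : j < q) (P : ADT K 𝔥 p) (Q : ADT K 𝔥 q)
    (R : ADT K 𝔥 r) :
    circ 𝔥 n r n' (i + j) (circ 𝔥 p q n i P Q) R =
      circ 𝔥 p s n' i P (circ 𝔥 q r s j Q R) := by
  simp only [circ, map_mul]
  rw [← mul_assoc]
  congr 1
  · congr 1
    · refine pull_pull 𝔥 P fun l hl m hm => ?_
      grind [outer]
    -- The value `q + 1` stands for positions at which `Q` does not occur.
    · rw [pull_pull 𝔥 (h := fun l => if inner i s l < s then outer j r (inner i s l) else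
        if inner i s l = s then q else q + 1) (g := inner i s) (f := outer j r)]
      · refine pull_pull 𝔥 Q fun l hl m hm => ?_
        grind [outer, inner]
      · intro l hl m hm
        grind [outer, inner]
  · refine (pull_pull 𝔥 R fun l hl m hm => ?_).symm
    grind [inner]

/-- Insertions at different places interchange, but not for formal reasons: the last index set of
`Q` contains every position of `R`, and the two factors commute only because `R` is invariant. -/
theorem circ_circ_comm {p q r n n₁ n' i k : ℕ} (hn : n + 1 = p + q) (hn' : n' + 1 = n + r)
    (hn₁ : n₁ + 1 = p + r) (hik : i < k) (hk : k < p) (P : ADT K 𝔥 p) (Q : ADT K 𝔥 q)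
    {R : ADT K 𝔥 r} (hR : Inv 𝔥 r R) :
    circ 𝔥 n r n' (k + q - 1) (circ 𝔥 p q n i P Q) R =
      circ 𝔥 n₁ q n' i (circ 𝔥 p r n₁ k P R) Q := by
  simp only [circ, map_mul]
  rw [pull_pull 𝔥 (h := inner i q) Q, pull_pull 𝔥 (h := inner (k + q - 1) r) R, mul_assoc, mul_assoc,
    (pull_commute_pull 𝔥 (f := inner i q) (f' := inner (k + q - 1) r) Q hR ?_).eq]
  · congr 1
    rw [pull_pull 𝔥 (h := fun l => if outer i q l < n₁ then outer k r (outer i q l) else p)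
      (g := outer i q) (f := outer k r) P]
    · refine pull_pull 𝔥 P fun l hl m hm => ?_
      simp only [outer]
      split_ifs <;> omega
    · intro l hl m hm
      grind [outer]
  · intro l hl
    grind [inner]
  · intro l hl m hm
    grind [outer, inner]
  · intro l hl m hm
    grind [outer, inner]

end

/-! ### The pre-Lie identity and the bracket of invariants -/

section

variable {K : Type*} [Field K] {𝔤 : Type*} [LieRing 𝔤] [LieAlgebra K 𝔤] (𝔥 : LieSubalgebra K 𝔤)

/-- The element of `ADT` given by an element of degree `k`. -/
abbrev lf (k : ℕ) : ADT K 𝔥 k →ₗ[K] ADTTot K 𝔥 := DirectSum.lof K ℕ (ADT K 𝔥) k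

/-- Degrees such as `p + q - 1` agree propositionally only; expressions that make sense for every
target degree avoid transport between the summands. -/
theorem lf_congr {n n' : ℕ} (h : n = n') (F : ∀ n, ADT K 𝔥 n) : lf 𝔥 n (F n) = lf 𝔥 n' (F n') := by
  subst h; rfl

theorem lf_apply_self (k : ℕ) (P : ADT K 𝔥 k) : lf 𝔥 k P k = P := DirectSum.lof_apply ..

theorem lf_apply_of_ne {k l : ℕ} (h : k ≠ l) (P : ADT K 𝔥 k) : lf 𝔥 k P l = 0 :=
  DFinsupp.single_eq_of_ne h.symm

theorem tot_induction {p : ADTTot K 𝔥 → Prop} (zero : p 0) (add : ∀ x y, p x → p y → p (x + y))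
    (lf : ∀ k P, p (lf 𝔥 k P)) (x : ADTTot K 𝔥) : p x := by
  induction x using DirectSum.induction_on with
  | zero => exact zero
  | of k P => exact lf k P
  | add x y hx hy => exact add x y hx hy

theorem bracketTot_lf (p q : ℕ) (P : ADT K 𝔥 p) (Q : ADT K 𝔥 q) :
    bracketTot K 𝔥 (lf 𝔥 p P) (lf 𝔥 q Q) = lf 𝔥 (p + q - 1) (bracket K 𝔥 p q P Q) := by
  rw [bracketTot, DirectSum.toModule_lof, LinearMap.flip_apply, DirectSum.toModule_lof]
  rfl

theorem dTot_lf (k : ℕ) (P : ADT K 𝔥 k) :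
    dTot K 𝔥 (lf 𝔥 k P) = (-1 : ℤ) ^ (k + 1) • lf 𝔥 (k + 1) (b K 𝔥 k P) := by
  rw [dTot, DirectSum.toModule_lof]
  rfl

/-- The brace on `ADT`. -/
def braceTot : ADTTot K 𝔥 →ₗ[K] ADTTot K 𝔥 →ₗ[K] ADTTot K 𝔥 :=
  DirectSum.toModule K ℕ _ fun p => LinearMap.flip <|
    DirectSum.toModule K ℕ _ fun q => LinearMap.flip <|
      (brace K 𝔥 p q (p + q - 1)).compr₂ (DirectSum.lof K ℕ (ADT K 𝔥) (p + q - 1))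

theorem braceTot_lf' (p q : ℕ) (P : ADT K 𝔥 p) (Q : ADT K 𝔥 q) :
    braceTot 𝔥 (lf 𝔥 p P) (lf 𝔥 q Q) = lf 𝔥 (p + q - 1) (brace K 𝔥 p q (p + q - 1) P Q) := by
  rw [braceTot, DirectSum.toModule_lof, LinearMap.flip_apply, DirectSum.toModule_lof]
  rfl

theorem braceTot_lf (p q : ℕ) (P : ADT K 𝔥 p) (Q : ADT K 𝔥 q) :
    braceTot 𝔥 (lf 𝔥 p P) (lf 𝔥 q Q) = ∑ i ∈ Finset.range p, (-1 : ℤ) ^ ((q + 1) * i) •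
      lf 𝔥 (p + q - 1) (circ 𝔥 p q (p + q - 1) i P Q) := by
  rw [braceTot_lf']
  rcases Nat.eq_zero_or_pos p with rfl | hp
  · simp [brace]
  · rw [brace_apply 𝔥 (by omega), map_sum]
    simp only [map_zsmul]

theorem bracketTot_eq (p q : ℕ) (P : ADT K 𝔥 p) (Q : ADT K 𝔥 q) :
    bracketTot K 𝔥 (lf 𝔥 p P) (lf 𝔥 q Q) = braceTot 𝔥 (lf 𝔥 p P) (lf 𝔥 q Q) -
      (-1 : ℤ) ^ ((p + 1) * (q + 1)) • braceTot 𝔥 (lf 𝔥 q Q) (lf 𝔥 p P) := by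
  rw [bracketTot_lf, braceTot_lf', braceTot_lf', bracket, LinearMap.sub_apply, LinearMap.sub_apply,
    LinearMap.smul_apply, LinearMap.smul_apply, LinearMap.flip_apply, map_sub, map_zsmul,
    lf_congr 𝔥 (by omega : q + p - 1 = p + q - 1) (fun n => brace K 𝔥 q p n Q P)]

theorem negOne_pow_congr {m n : ℕ} (h : Even (m + n)) : (-1 : ℤ) ^ m = (-1) ^ n := by
  rcases Nat.even_or_odd m with hm | hm
  · rw [hm.neg_one_pow, ((Nat.even_add.1 h).1 hm).neg_one_pow]
  · rw [hm.neg_one_pow, Odd.neg_one_pow]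
    rw [← Nat.not_even_iff_odd] at hm ⊢
    exact fun h' => hm ((Nat.even_add.1 h).2 h')

/-- The terms of `{{P|Q}|R}` in which `R` is inserted before `Q`. -/
def crossing (p q r : ℕ) (P : ADT K 𝔥 p) (Q : ADT K 𝔥 q) (R : ADT K 𝔥 r) : ADTTot K 𝔥 :=
  ∑ k ∈ Finset.range p, ∑ m ∈ Finset.range k, (-1 : ℤ) ^ ((q + 1) * k + (r + 1) * m) •
    lf 𝔥 (p + q - 1 + r - 1)
      (circ 𝔥 (p + q - 1) r (p + q - 1 + r - 1) m (circ 𝔥 p q (p + q - 1) k P Q) R)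

theorem sum_range_triangle {A : Type*} [AddCommMonoid A] (p : ℕ) (F : ℕ → ℕ → A) :
    ∑ i ∈ Finset.range p, ∑ e ∈ Finset.range (p - 1 - i), F i (i + 1 + e) =
      ∑ k ∈ Finset.range p, ∑ i ∈ Finset.range k, F i k := by
  rw [Finset.sum_sigma', Finset.sum_sigma']
  refine Finset.sum_bij' (fun x _ => ⟨x.1 + 1 + x.2, x.1⟩) (fun x _ => ⟨x.2, x.1 - 1 - x.2⟩)
    ?_ ?_ ?_ ?_ ?_
  · rintro ⟨i, e⟩ h
    simp only [Finset.mem_sigma, Finset.mem_range] at h ⊢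
    omega
  · rintro ⟨i, e⟩ h
    simp only [Finset.mem_sigma, Finset.mem_range] at h ⊢
    omega
  · rintro ⟨i, e⟩ h
    simp only [Sigma.mk.injEq, heq_eq_eq, true_and]
    omega
  · rintro ⟨i, e⟩ h
    simp only [Finset.mem_sigma, Finset.mem_range] at h
    simp only [Sigma.mk.injEq, heq_eq_eq, and_true]
    omega
  · rintro ⟨i, e⟩ h
    rfl

/-- The place at which `R` enters `{P | Q}` lies before, inside or after the block of `Q`, the three
ranges having lengths `i`, `q` and `p - 1 - i`. The middle range is nested insertion by `circ_circ`;
the last is the first with `Q` and `R` exchanged, by `circ_circ_comm`. -/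
theorem brace_brace {p q r : ℕ} (P : ADT K 𝔥 p) (Q : ADT K 𝔥 q) {R : ADT K 𝔥 r}
    (hR : Inv 𝔥 r R) :
    braceTot 𝔥 (braceTot 𝔥 (lf 𝔥 p P) (lf 𝔥 q Q)) (lf 𝔥 r R) =
      crossing 𝔥 p q r P Q R + braceTot 𝔥 (lf 𝔥 p P) (braceTot 𝔥 (lf 𝔥 q Q) (lf 𝔥 r R)) +
        (-1 : ℤ) ^ ((q + 1) * (r + 1)) • crossing 𝔥 p r q P R Q := by
  have hL : braceTot 𝔥 (braceTot 𝔥 (lf 𝔥 p P) (lf 𝔥 q Q)) (lf 𝔥 r R) =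
      ∑ i ∈ Finset.range p, ∑ m ∈ Finset.range (p + q - 1),
        (-1 : ℤ) ^ ((q + 1) * i + (r + 1) * m) • lf 𝔥 (p + q - 1 + r - 1)
          (circ 𝔥 (p + q - 1) r (p + q - 1 + r - 1) m (circ 𝔥 p q (p + q - 1) i P Q) R) := by
    rw [braceTot_lf, map_sum, LinearMap.sum_apply]
    refine Finset.sum_congr rfl fun i _ => ?_
    rw [map_zsmul, LinearMap.smul_apply, braceTot_lf, Finset.smul_sum]
    refine Finset.sum_congr rfl fun m _ => ?_
    rw [smul_smul, ← pow_add]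
  have hR' : braceTot 𝔥 (lf 𝔥 p P) (braceTot 𝔥 (lf 𝔥 q Q) (lf 𝔥 r R)) =
      ∑ i ∈ Finset.range p, ∑ j ∈ Finset.range q,
        (-1 : ℤ) ^ ((q + 1) * i + (r + 1) * (i + j)) • lf 𝔥 (p + q - 1 + r - 1)
          (circ 𝔥 (p + q - 1) r (p + q - 1 + r - 1) (i + j) (circ 𝔥 p q (p + q - 1) i P Q) R) := by
    rw [braceTot_lf, map_sum, Finset.sum_comm]
    refine Finset.sum_congr rfl fun j hj => ?_
    rw [map_zsmul, braceTot_lf, Finset.smul_sum]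
    refine Finset.sum_congr rfl fun i hi => ?_
    rw [Finset.mem_range] at hi hj
    rw [smul_smul, ← pow_add, circ_circ 𝔥 (s := q + r - 1) (by omega) (by omega) (by omega) hi hj,
      lf_congr 𝔥 (by omega : p + (q + r - 1) - 1 = p + q - 1 + r - 1)
        (fun n => circ 𝔥 p (q + r - 1) n i P (circ 𝔥 q r (q + r - 1) j Q R))]
    congr 1
    apply negOne_pow_congr
    rw [show q + r - 1 + 1 = q + r by omega]
    refine ⟨(r + 1) * j + q * i + r * i + i, ?_⟩
    ring
  have hC : (-1 : ℤ) ^ ((q + 1) * (r + 1)) • crossing 𝔥 p r q P R Q =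
      ∑ i ∈ Finset.range p, ∑ e ∈ Finset.range (p - 1 - i),
        (-1 : ℤ) ^ ((q + 1) * i + (r + 1) * (i + q + e)) • lf 𝔥 (p + q - 1 + r - 1)
          (circ 𝔥 (p + q - 1) r (p + q - 1 + r - 1) (i + q + e) (circ 𝔥 p q (p + q - 1) i P Q) R) := by
    have h := sum_range_triangle p fun i k =>
      (-1 : ℤ) ^ ((q + 1) * i + (r + 1) * (k + q - 1)) • lf 𝔥 (p + q - 1 + r - 1)
          (circ 𝔥 (p + q - 1) r (p + q - 1 + r - 1) (k + q - 1) (circ 𝔥 p q (p + q - 1) i P Q) R)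
    have h' : ∀ i e, i + 1 + e + q - 1 = i + q + e := fun i e => by omega
    simp only [h'] at h
    rw [h, crossing, Finset.smul_sum]
    refine Finset.sum_congr rfl fun k hk => ?_
    rw [Finset.smul_sum]
    refine Finset.sum_congr rfl fun i hi => ?_
    rw [Finset.mem_range] at hi hk
    rw [smul_smul, ← pow_add, circ_circ_comm 𝔥 (n₁ := p + r - 1) (by omega) (by omega) (by omega)
      hi hk P Q hR,
      lf_congr 𝔥 (by omega : p + r - 1 + q - 1 = p + q - 1 + r - 1)
        (fun n => circ 𝔥 (p + r - 1) q n i (circ 𝔥 p r (p + r - 1) k P R) Q)]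
    congr 1
    apply negOne_pow_congr
    obtain ⟨k, rfl⟩ : ∃ k', k = k' + 1 := ⟨k - 1, by omega⟩
    rw [show k + 1 + q - 1 = k + q by omega]
    refine ⟨(q + 1) * (r + 1) + (r + 1) * k + (q + 1) * i, ?_⟩
    ring
  rw [hL, hR', hC, crossing, ← Finset.sum_add_distrib, ← Finset.sum_add_distrib]
  refine Finset.sum_congr rfl fun i hi => ?_
  rw [Finset.mem_range] at hi
  rw [show p + q - 1 = i + q + (p - 1 - i) by omega, Finset.sum_range_add, Finset.sum_range_add]

/-- In the associator the nested insertions cancel; the two crossing sums that remain are exchanged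
by swapping `Q` and `R`. -/
theorem preLie {p q r : ℕ} (P : ADT K 𝔥 p) {Q : ADT K 𝔥 q} (hQ : Inv 𝔥 q Q) {R : ADT K 𝔥 r}
    (hR : Inv 𝔥 r R) :
    braceTot 𝔥 (braceTot 𝔥 (lf 𝔥 p P) (lf 𝔥 q Q)) (lf 𝔥 r R) -
        braceTot 𝔥 (lf 𝔥 p P) (braceTot 𝔥 (lf 𝔥 q Q) (lf 𝔥 r R)) =
      (-1 : ℤ) ^ ((q + 1) * (r + 1)) •
        (braceTot 𝔥 (braceTot 𝔥 (lf 𝔥 p P) (lf 𝔥 r R)) (lf 𝔥 q Q) -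
          braceTot 𝔥 (lf 𝔥 p P) (braceTot 𝔥 (lf 𝔥 r R) (lf 𝔥 q Q))) := by
  rw [brace_brace 𝔥 P Q hR, brace_brace 𝔥 P R hQ]
  have h : (-1 : ℤ) ^ ((q + 1) * (r + 1)) * (-1) ^ ((r + 1) * (q + 1)) = 1 := by
    rw [mul_comm (r + 1), ← pow_add, ← two_mul, pow_mul]; simp
  rw [add_right_comm, add_sub_cancel_right, add_right_comm, add_sub_cancel_right, smul_add,
    smul_smul, h, one_smul, add_comm]

/-- The alternative `Z = 0` takes care of `p = 0`, where the brace is an empty sum and the truncated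
degree `p + q - 1` may be wrong. -/
theorem braceTot_mem (p q : ℕ) (P : ADT K 𝔥 p) (Q : ADT K 𝔥 q) :
    ∃ n Z, braceTot 𝔥 (lf 𝔥 p P) (lf 𝔥 q Q) = lf 𝔥 n Z ∧ (n + 1 = p + q ∨ Z = 0) := by
  refine ⟨_, _, braceTot_lf' .., ?_⟩
  rcases Nat.eq_zero_or_pos p with rfl | hp
  · exact Or.inr (by simp [brace])
  · left; omega

theorem negOne_pow_mul_self (n : ℕ) : (-1 : ℤ) ^ n * (-1) ^ n = 1 := by
  rw [← pow_add, ← two_mul, pow_mul]; simp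

theorem bracketTot_brace_left (p q r : ℕ) (P : ADT K 𝔥 p) (Q : ADT K 𝔥 q) (R : ADT K 𝔥 r) :
    bracketTot K 𝔥 (braceTot 𝔥 (lf 𝔥 p P) (lf 𝔥 q Q)) (lf 𝔥 r R) =
      braceTot 𝔥 (braceTot 𝔥 (lf 𝔥 p P) (lf 𝔥 q Q)) (lf 𝔥 r R) -
        ((-1 : ℤ) ^ ((p + 1) * (r + 1)) * (-1) ^ ((q + 1) * (r + 1))) •
          braceTot 𝔥 (lf 𝔥 r R) (braceTot 𝔥 (lf 𝔥 p P) (lf 𝔥 q Q)) := by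
  obtain ⟨n, Z, h, hn | rfl⟩ := braceTot_mem 𝔥 p q P Q
  · rw [h, bracketTot_eq, hn, ← pow_add,
      negOne_pow_congr (n := (p + 1) * (r + 1) + (q + 1) * (r + 1))]
    exact ⟨(p + q + 1) * (r + 1), by ring⟩
  · simp [h]

theorem bracketTot_brace_right (p q r : ℕ) (P : ADT K 𝔥 p) (Q : ADT K 𝔥 q) (R : ADT K 𝔥 r) :
    bracketTot K 𝔥 (lf 𝔥 p P) (braceTot 𝔥 (lf 𝔥 q Q) (lf 𝔥 r R)) =
      braceTot 𝔥 (lf 𝔥 p P) (braceTot 𝔥 (lf 𝔥 q Q) (lf 𝔥 r R)) -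
        ((-1 : ℤ) ^ ((p + 1) * (q + 1)) * (-1) ^ ((p + 1) * (r + 1))) •
          braceTot 𝔥 (braceTot 𝔥 (lf 𝔥 q Q) (lf 𝔥 r R)) (lf 𝔥 p P) := by
  obtain ⟨n, Z, h, hn | rfl⟩ := braceTot_mem 𝔥 q r Q R
  · rw [h, bracketTot_eq, hn, ← pow_add,
      negOne_pow_congr (n := (p + 1) * (q + 1) + (p + 1) * (r + 1))]
    exact ⟨(p + 1) * (q + r + 1), by ring⟩
  · simp [h]

/-- The bracket is the graded commutator of a pre-Lie product, so the Jacobi identity is a signed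
combination of the three instances of `preLie`. -/
theorem bracket_jacobi {p q r : ℕ} {P : ADT K 𝔥 p} {Q : ADT K 𝔥 q} {R : ADT K 𝔥 r}
    (hP : Inv 𝔥 p P) (hQ : Inv 𝔥 q Q) (hR : Inv 𝔥 r R) :
    bracketTot K 𝔥 (lf 𝔥 p P) (bracketTot K 𝔥 (lf 𝔥 q Q) (lf 𝔥 r R)) =
      bracketTot K 𝔥 (bracketTot K 𝔥 (lf 𝔥 p P) (lf 𝔥 q Q)) (lf 𝔥 r R) +
        (-1 : ℤ) ^ ((p + 1) * (q + 1)) •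
          bracketTot K 𝔥 (lf 𝔥 q Q) (bracketTot K 𝔥 (lf 𝔥 p P) (lf 𝔥 r R)) := by
  have h1 := preLie 𝔥 P hQ hR
  have h2 := preLie 𝔥 Q hP hR
  have h3 := preLie 𝔥 R hP hQ
  rw [bracketTot_eq 𝔥 q r, bracketTot_eq 𝔥 p q, bracketTot_eq 𝔥 p r]
  simp only [map_sub, map_zsmul, LinearMap.sub_apply, LinearMap.smul_apply,
    bracketTot_brace_left, bracketTot_brace_right]
  simp only [mul_comm (q + 1) (p + 1)] at h1 h2 h3 ⊢
  have hu := negOne_pow_mul_self ((p + 1) * (q + 1))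
  have hv := negOne_pow_mul_self ((p + 1) * (r + 1))
  have hw := negOne_pow_mul_self ((q + 1) * (r + 1))
  generalize (-1 : ℤ) ^ ((p + 1) * (q + 1)) = u at *
  generalize (-1 : ℤ) ^ ((p + 1) * (r + 1)) = v at *
  generalize (-1 : ℤ) ^ ((q + 1) * (r + 1)) = w at *
  -- Only the three pairwise signs matter; for each of their eight values the claim is linear in the
  -- pre-Lie identities.
  rcases Int.isUnit_iff.1 (IsUnit.of_mul_eq_one _ hu) with rfl | rfl <;>
  rcases Int.isUnit_iff.1 (IsUnit.of_mul_eq_one _ hv) with rfl | rfl <;>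
  rcases Int.isUnit_iff.1 (IsUnit.of_mul_eq_one _ hw) with rfl | rfl
  · linear_combination (norm := module) (-1 : ℤ) • h1 + h2 - h3
  · linear_combination (norm := module) (-1 : ℤ) • h1 + h2 + h3
  · linear_combination (norm := module) (-1 : ℤ) • h1 + h2 + h3
  · linear_combination (norm := module) (-1 : ℤ) • h1 + h2 - h3
  · linear_combination (norm := module) (-1 : ℤ) • h1 - h2 - h3
  · linear_combination (norm := module) (-1 : ℤ) • h1 - h2 + h3
  · linear_combination (norm := module) (-1 : ℤ) • h1 - h2 + h3
  · linear_combination (norm := module) (-1 : ℤ) • h1 - h2 - h3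

theorem bracket_skew {p q : ℕ} (P : ADT K 𝔥 p) (Q : ADT K 𝔥 q) :
    bracketTot K 𝔥 (lf 𝔥 p P) (lf 𝔥 q Q) =
      -((-1 : ℤ) ^ ((p + 1) * (q + 1)) • bracketTot K 𝔥 (lf 𝔥 q Q) (lf 𝔥 p P)) := by
  rw [bracketTot_eq, bracketTot_eq, smul_sub, smul_smul, mul_comm (q + 1), negOne_pow_mul_self,
    one_smul, neg_sub]

/-! ### The differential -/

theorem b_apply (k : ℕ) (P : ADT K 𝔥 k) :
    b K 𝔥 k P = pull 𝔥 k (k + 1) (fun l => if l = 0 then k + 1 else l - 1) P +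
      ∑ i ∈ Finset.range (k + 1), (-1 : ℤ) ^ (i + 1) •
        pull 𝔥 k (k + 1) (fun l => if l ≤ i then l else l - 1) P := by
  rw [b, LinearMap.add_apply, LinearMap.sum_apply,
    sup_eq_pull 𝔥 (fun l => if l = 0 then k + 1 else l - 1)]
  · congr 1
    refine Finset.sum_congr rfl fun i hi => ?_
    rw [Finset.mem_range] at hi
    rw [LinearMap.smul_apply, sup_eq_pull 𝔥 (fun l => if l ≤ i then l else l - 1)]
    · rfl
    · intro j l
      simp only [Finset.mem_filter, Finset.mem_univ, true_and]
      split_ifs <;> omega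
    · intro l
      have := l.2
      simp only [Finset.mem_filter, Finset.mem_univ, true_and]
      split_ifs <;> omega
  · intro j l
    simp only [Finset.mem_singleton, Fin.ext_iff, Fin.val_succ]
    split_ifs <;> omega
  · intro l
    have := l.2
    simp only [Finset.notMem_empty, false_iff]
    split_ifs <;> omega

/-- The element `1` of degree `2`. -/
def mult : ADTTot K 𝔥 := lf 𝔥 2 1

theorem inv_one (k : ℕ) : Inv 𝔥 k (1 : ADT K 𝔥 k) := fun _ => Commute.one_right _

/-- The differential is inner. The two insertions into the multiplication are the outermost terms of
`b`, and inserting the multiplication into `P` doubles one position. Hence the Leibniz rule and `d²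
= 0` are cases of the Jacobi identity. -/
theorem dTot_eq (x : ADTTot K 𝔥) : dTot K 𝔥 x = bracketTot K 𝔥 (mult 𝔥) x := by
  induction x using tot_induction with
  | zero => simp
  | add x y hx hy => rw [map_add, map_add, hx, hy]
  | lf k P =>
    have h1 : ∀ i, lf 𝔥 (2 + k - 1) (circ 𝔥 2 k (2 + k - 1) i 1 P) =
        lf 𝔥 (k + 1) (circ 𝔥 2 k (k + 1) i 1 P) := fun i =>
      lf_congr 𝔥 (by omega) fun n => circ 𝔥 2 k n i 1 P
    have h6 : ∀ i, lf 𝔥 (k + 2 - 1) (circ 𝔥 k 2 (k + 2 - 1) i P 1) =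
        lf 𝔥 (k + 1) (circ 𝔥 k 2 (k + 1) i P 1) := fun i =>
      lf_congr 𝔥 (by omega) fun n => circ 𝔥 k 2 n i P 1
    have h2 : pull 𝔥 k (k + 1) (inner 0 k) =
        pull 𝔥 k (k + 1) (fun l => if l ≤ k then l else l - 1) := pull_congr 𝔥 fun l hl m hm => by
      simp only [inner]; split_ifs <;> omega
    have h3 : pull 𝔥 k (k + 1) (inner 1 k) =
        pull 𝔥 k (k + 1) (fun l => if l = 0 then k + 1 else l - 1) :=
      pull_congr 𝔥 fun l hl m hm => by
        simp only [inner]; split_ifs <;> omega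
    have h4 : ∀ i, pull 𝔥 k (k + 1) (outer i 2) =
        pull 𝔥 k (k + 1) (fun l => if l ≤ i then l else l - 1) := fun i =>
      pull_congr 𝔥 fun l hl m hm => by
        simp only [outer]; split_ifs <;> omega
    rw [mult, bracketTot_eq, braceTot_lf, braceTot_lf, dTot_lf, b_apply, Finset.sum_range_succ _ k]
    simp only [h1, h6]
    simp only [Finset.sum_range_succ, Finset.sum_range_zero, circ, map_one, one_mul, mul_one,
      zero_add, mul_zero, h2, h3, h4,
      map_add, map_sum, map_zsmul]
    rw [smul_add, smul_add, smul_smul, negOne_pow_mul_self, pow_zero, one_smul,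
      negOne_pow_congr (m := (2 + 1) * (k + 1)) (n := k + 1) ⟨2 * (k + 1), by ring⟩]
    have h5 : ∀ i, (-1 : ℤ) ^ ((2 + 1) * i) = -(-1) ^ (i + 1) := fun i => by
      rw [pow_succ, negOne_pow_congr (m := (2 + 1) * i) (n := i) ⟨2 * i, by ring⟩]; simp
    simp only [h5, neg_smul, Finset.sum_neg_distrib, zsmul_neg, sub_neg_eq_add]
    abel

/-- The two insertions of the multiplication into itself are both `1` and carry opposite signs, so
the brace already vanishes. -/
theorem bracket_mult_mult : bracketTot K 𝔥 (mult 𝔥) (mult 𝔥) = 0 := by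
  rw [mult, bracketTot_eq, braceTot_lf]
  simp [circ, Finset.sum_range_succ]

/-! ### The differential graded Lie algebra of invariants -/

theorem mem_invariants {x : ADTTot K 𝔥} : x ∈ invariants K 𝔥 ↔ ∀ k, Inv 𝔥 k (x k) :=
  ⟨fun h k y => h y k, fun h y k => h k y⟩

theorem lf_mem_invariants {k : ℕ} {P : ADT K 𝔥 k} (hP : Inv 𝔥 k P) :
    lf 𝔥 k P ∈ invariants K 𝔥 := by
  rw [mem_invariants]
  intro l
  by_cases h : k = l
  · subst h; rwa [lf_apply_self]
  · rw [lf_apply_of_ne 𝔥 h]; exact fun y => Commute.zero_right _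

theorem sum_lf (x : ADTTot K 𝔥) : ∃ s : Finset ℕ, x = ∑ k ∈ s, lf 𝔥 k (x k) := by
  classical
  exact ⟨DFinsupp.support x, (DirectSum.sum_support_of x).symm⟩

theorem inv_induction {p : ADTTot K 𝔥 → Prop} (zero : p 0) (add : ∀ x y, p x → p y → p (x + y))
    (lf : ∀ k P, Inv 𝔥 k P → p (lf 𝔥 k P)) {x : ADTTot K 𝔥} (hx : x ∈ invariants K 𝔥) : p x := by
  obtain ⟨s, hs⟩ := sum_lf 𝔥 x
  rw [hs]
  exact Finset.sum_induction _ _ add zero fun k _ => lf k _ ((mem_invariants 𝔥).1 hx k)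

theorem braceTot_mem_invariants {x y : ADTTot K 𝔥} (hx : x ∈ invariants K 𝔥)
    (hy : y ∈ invariants K 𝔥) : braceTot 𝔥 x y ∈ invariants K 𝔥 := by
  refine inv_induction 𝔥 (p := fun x => braceTot 𝔥 x y ∈ invariants K 𝔥)
    (by rw [map_zero]; exact Submodule.zero_mem _)
    (fun a b ha hb => by rw [map_add]; exact Submodule.add_mem _ ha hb) (fun p P hP => ?_) hx
  refine inv_induction 𝔥 (p := fun y => braceTot 𝔥 (lf 𝔥 p P) y ∈ invariants K 𝔥)
    (by rw [map_zero]; exact Submodule.zero_mem _)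
    (fun a b ha hb => by rw [map_add]; exact Submodule.add_mem _ ha hb) (fun q Q hQ => ?_) hy
  rw [braceTot_lf]
  exact Submodule.sum_mem _ fun i _ => zsmul_mem (lf_mem_invariants 𝔥 (hP.circ 𝔥 hQ)) _

theorem bracketTot_mem_invariants {x y : ADTTot K 𝔥} (hx : x ∈ invariants K 𝔥)
    (hy : y ∈ invariants K 𝔥) : bracketTot K 𝔥 x y ∈ invariants K 𝔥 := by
  refine inv_induction 𝔥 (p := fun x => bracketTot K 𝔥 x y ∈ invariants K 𝔥)
    (by rw [map_zero]; exact Submodule.zero_mem _)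
    (fun a b ha hb => by rw [map_add]; exact Submodule.add_mem _ ha hb) (fun p P hP => ?_) hx
  refine inv_induction 𝔥 (p := fun y => bracketTot K 𝔥 (lf 𝔥 p P) y ∈ invariants K 𝔥)
    (by rw [map_zero]; exact Submodule.zero_mem _)
    (fun a b ha hb => by rw [map_add]; exact Submodule.add_mem _ ha hb) (fun q Q hQ => ?_) hy
  have hP := lf_mem_invariants 𝔥 hP
  have hQ := lf_mem_invariants 𝔥 hQ
  rw [bracketTot_eq]
  exact Submodule.sub_mem _ (braceTot_mem_invariants 𝔥 hP hQ)
    (zsmul_mem (braceTot_mem_invariants 𝔥 hQ hP) _)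

theorem mult_mem_invariants : mult 𝔥 ∈ invariants K 𝔥 := lf_mem_invariants 𝔥 (inv_one 𝔥 2)

theorem dTot_mem_invariants {x : ADTTot K 𝔥} (hx : x ∈ invariants K 𝔥) :
    dTot K 𝔥 x ∈ invariants K 𝔥 := by
  rw [dTot_eq]
  exact bracketTot_mem_invariants 𝔥 (mult_mem_invariants 𝔥) hx

/-- Elements of `ADT` of shifted degree `n`. -/
def HomDeg (n : ℤ) (x : ADTTot K 𝔥) : Prop := ∀ k : ℕ, (k : ℤ) ≠ n + 1 → x k = 0

theorem HomDeg.cases {n : ℤ} {x : ADTTot K 𝔥} (hx : HomDeg 𝔥 n x) :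
    x = 0 ∨ ∃ p : ℕ, n = p - 1 ∧ x = lf 𝔥 p (x p) := by
  by_cases h : n + 1 < 0
  · left
    ext k
    exact hx k (by omega)
  · right
    refine ⟨(n + 1).toNat, by omega, ?_⟩
    ext k
    by_cases hk : (n + 1).toNat = k
    · subst hk; rw [lf_apply_self]
    · rw [lf_apply_of_ne 𝔥 hk, hx k (by omega)]

theorem homDeg_lf {p : ℕ} {n : ℤ} (h : n = p - 1) (P : ADT K 𝔥 p) : HomDeg 𝔥 n (lf 𝔥 p P) :=
  fun k hk => lf_apply_of_ne 𝔥 (by rintro rfl; omega) _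

theorem HomDeg.zsmul {n : ℤ} {x : ADTTot K 𝔥} (hx : HomDeg 𝔥 n x) (c : ℤ) :
    HomDeg 𝔥 n (c • x) := fun k hk => by
  rw [DirectSum.smul_apply, hx k hk, smul_zero]

theorem HomDeg.dTot {n : ℤ} {x : ADTTot K 𝔥} (hx : HomDeg 𝔥 n x) :
    HomDeg 𝔥 (n + 1) (dTot K 𝔥 x) := by
  rcases hx.cases with rfl | ⟨p, rfl, h⟩
  · rw [map_zero]; exact fun _ _ => rfl
  · rw [h, dTot_lf]
    exact (homDeg_lf 𝔥 (by push_cast; ring) _).zsmul 𝔥 _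

theorem HomDeg.bracketTot {m n : ℤ} {x y : ADTTot K 𝔥} (hx : HomDeg 𝔥 m x) (hy : HomDeg 𝔥 n y) :
    HomDeg 𝔥 (m + n) (bracketTot K 𝔥 x y) := by
  rcases hx.cases with rfl | ⟨p, rfl, h⟩
  · rw [map_zero]; exact fun _ _ => rfl
  rcases hy.cases with rfl | ⟨q, rfl, h'⟩
  · rw [map_zero]; exact fun _ _ => rfl
  rw [h, h', bracketTot_lf]
  rcases Nat.eq_zero_or_pos (p + q) with h0 | h0
  -- Here `p + q - 1` truncates to `0` although the correct degree is `-1`; the bracket vanishes, so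
  -- no harm is done.
  · obtain ⟨rfl, rfl⟩ : p = 0 ∧ q = 0 := by omega
    simp only [bracket, brace, Finset.range_zero, Finset.sum_empty]
    simp only [LinearMap.sub_apply, LinearMap.smul_apply, LinearMap.flip_apply, LinearMap.zero_apply,
      smul_zero, sub_zero, map_zero]
    exact fun _ _ => rfl
  · exact homDeg_lf 𝔥 (by omega) _

theorem negOnePow_sub_one_mul (p q : ℕ) :
    ((((p : ℤ) - 1) * (q - 1)).negOnePow : ℤ) = (-1) ^ ((p + 1) * (q + 1)) := by
  have : (((p : ℤ) - 1) * (q - 1)).negOnePow = (((p + 1) * (q + 1) : ℕ) : ℤ).negOnePow := by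
    rw [Int.negOnePow_eq_iff]
    push_cast
    exact ⟨-(p + q), by ring⟩
  rw [this, Int.negOnePow_def, zpow_natCast, Units.val_pow_eq_pow_val, Units.val_neg, Units.val_one]

theorem bracketTot_skew {m n : ℤ} {x y : ADTTot K 𝔥} (hx : HomDeg 𝔥 m x) (hy : HomDeg 𝔥 n y) :
    bracketTot K 𝔥 x y = -((m * n).negOnePow • bracketTot K 𝔥 y x) := by
  rcases hx.cases with rfl | ⟨p, rfl, h⟩
  · simp
  rcases hy.cases with rfl | ⟨q, rfl, h'⟩
  · simp
  rw [h, h', bracket_skew, Units.smul_def, negOnePow_sub_one_mul]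

theorem bracketTot_jacobi {l m n : ℤ} {x y z : ADTTot K 𝔥} (hx : HomDeg 𝔥 l x) (hy : HomDeg 𝔥 m y)
    (hz : HomDeg 𝔥 n z) (hx' : x ∈ invariants K 𝔥) (hy' : y ∈ invariants K 𝔥)
    (hz' : z ∈ invariants K 𝔥) :
    bracketTot K 𝔥 x (bracketTot K 𝔥 y z) = bracketTot K 𝔥 (bracketTot K 𝔥 x y) z +
      (l * m).negOnePow • bracketTot K 𝔥 y (bracketTot K 𝔥 x z) := by
  rw [mem_invariants] at hx' hy' hz'
  rcases hx.cases with rfl | ⟨p, rfl, h⟩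
  · simp
  rcases hy.cases with rfl | ⟨q, rfl, h'⟩
  · simp
  rcases hz.cases with rfl | ⟨r, rfl, h''⟩
  · simp
  rw [h, h', h'', bracket_jacobi 𝔥 (hx' p) (hy' q) (hz' r), Units.smul_def, negOnePow_sub_one_mul]

theorem homDeg_mult : HomDeg 𝔥 1 (mult 𝔥) := homDeg_lf 𝔥 (by norm_num) _

theorem dTot_bracketTot {m n : ℤ} {x y : ADTTot K 𝔥} (hx : HomDeg 𝔥 m x) (hy : HomDeg 𝔥 n y)
    (hx' : x ∈ invariants K 𝔥) (hy' : y ∈ invariants K 𝔥) :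
    dTot K 𝔥 (bracketTot K 𝔥 x y) = bracketTot K 𝔥 (dTot K 𝔥 x) y +
      m.negOnePow • bracketTot K 𝔥 x (dTot K 𝔥 y) := by
  simp only [dTot_eq]
  rw [bracketTot_jacobi 𝔥 (homDeg_mult 𝔥) hx hy (mult_mem_invariants 𝔥) hx' hy', one_mul]

/-- The Jacobi identity for the odd element `mult`, whose bracket with itself is zero, gives `2 d² =
0`. -/
theorem dTot_dTot [CharZero K] {x : ADTTot K 𝔥} (hx : x ∈ invariants K 𝔥) :
    dTot K 𝔥 (dTot K 𝔥 x) = 0 := by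
  simp only [dTot_eq]
  refine inv_induction 𝔥
    (p := fun x => bracketTot K 𝔥 (mult 𝔥) (bracketTot K 𝔥 (mult 𝔥) x) = 0) (by simp)
    (fun a b ha hb => by simp only [map_add, ha, hb, add_zero]) (fun p P hP => ?_) hx
  · have := bracketTot_jacobi 𝔥 (homDeg_mult 𝔥) (homDeg_mult 𝔥) (homDeg_lf 𝔥 rfl P)
      (mult_mem_invariants 𝔥) (mult_mem_invariants 𝔥) (lf_mem_invariants 𝔥 hP)
    rw [bracket_mult_mult, map_zero, LinearMap.zero_apply, zero_add, one_mul, Int.negOnePow_one,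
      Units.neg_smul, one_smul, ← sub_eq_zero, sub_neg_eq_add, ← two_smul K] at this
    exact (smul_eq_zero.1 this).resolve_left two_ne_zero

/-- The grading of a graded subspace of `ADT`. -/
theorem shiftedDeg_isInternal {L : Submodule K (ADTTot K 𝔥)} (hL : ∀ x ∈ L, ∀ k, lf 𝔥 k (x k) ∈ L) :
    DirectSum.IsInternal (shiftedDeg K 𝔥 L) := by
  have key : ∀ (f : ⨁ n, shiftedDeg K 𝔥 L n) (k : ℕ),
      ((DirectSum.coeAddMonoidHom (shiftedDeg K 𝔥 L) f : L) : ADTTot K 𝔥) k =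
        ((f (k - 1) : L) : ADTTot K 𝔥) k := by
    intro f k
    induction f using DirectSum.induction_on with
    | zero => rw [map_zero]; rfl
    | of n x =>
      rw [DirectSum.coeAddMonoidHom_of]
      by_cases h : n = k - 1
      · subst h; rw [DirectSum.of_eq_same]
      · rw [DirectSum.of_eq_of_ne _ _ _ (Ne.symm h)]
        exact x.2 k (by omega)
    | add f g hf hg =>
      rw [map_add, DirectSum.add_apply, Submodule.coe_add, Submodule.coe_add, Submodule.coe_add,
        DirectSum.add_apply, DirectSum.add_apply, hf, hg]
  constructor
  · intro f g hfg
    refine DFinsupp.ext fun n => Subtype.ext (Subtype.ext (DFinsupp.ext fun k => ?_))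
    by_cases h : (k : ℤ) = n + 1
    · obtain rfl : n = k - 1 := by omega
      exact (key f k).symm.trans ((congrArg (fun z : L => (z : ADTTot K 𝔥) k) hfg).trans (key g k))
    · exact ((f n).2 k h).trans ((g n).2 k h).symm
  · intro x
    obtain ⟨s, hs⟩ := sum_lf 𝔥 (x : ADTTot K 𝔥)
    have hx : x = ∑ k ∈ s, ⟨lf 𝔥 k ((x : ADTTot K 𝔥) k), hL x x.2 k⟩ := by
      apply Subtype.ext
      rw [AddSubmonoidClass.coe_finsetSum]
      exact hs
    rw [hx]
    refine sum_mem (S := AddMonoidHom.mrange (DirectSum.coeAddMonoidHom (shiftedDeg K 𝔥 L)))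
      fun k _ => ?_
    refine ⟨DirectSum.of (fun n => shiftedDeg K 𝔥 L n) ((k : ℤ) - 1)
      ⟨⟨lf 𝔥 k ((x : ADTTot K 𝔥) k), hL x x.2 k⟩, homDeg_lf 𝔥 rfl _⟩, ?_⟩
    rw [DirectSum.coeAddMonoidHom_of]

/-- The differential graded Lie algebra `𝔤₂[1]`. -/
def dglaInvariants [CharZero K] : DGLA K (g₂ K 𝔥) where
  deg := shiftedDeg K 𝔥 (g₂ K 𝔥)
  isInternal := shiftedDeg_isInternal 𝔥 fun x hx k =>
    lf_mem_invariants 𝔥 ((mem_invariants 𝔥).1 hx k)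
  d := (dTot K 𝔥).restrict fun _ hx => dTot_mem_invariants 𝔥 hx
  br := LinearMap.mk₂ K (fun x y => ⟨bracketTot K 𝔥 x y, bracketTot_mem_invariants 𝔥 x.2 y.2⟩)
    (fun x y z => Subtype.ext (by simp)) (fun c x y => Subtype.ext (by simp))
    (fun x y z => Subtype.ext (by simp)) (fun c x y => Subtype.ext (by simp))
  d_mem _ x hx := HomDeg.dTot 𝔥 hx
  br_mem _ _ x hx y hy := HomDeg.bracketTot 𝔥 hx hy
  d_d x := Subtype.ext (dTot_dTot 𝔥 x.2)
  skew _ _ x hx y hy := Subtype.ext (bracketTot_skew 𝔥 hx hy)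
  leibniz _ _ x hx y hy := Subtype.ext (dTot_bracketTot 𝔥 hx hy x.2 y.2)
  jacobi _ _ _ x hx y hy z hz := Subtype.ext (bracketTot_jacobi 𝔥 hx hy hz x.2 y.2 z.2)

end

section

/-! ## The Poincaré–Birkhoff–Witt representation on the symmetric algebra -/

section PBW

open SymmetricAlgebra (ι)

variable {K : Type*} [Field K] {L : Type*} [AddCommGroup L] [Module K L]
  {κ : Type*} (e : Module.Basis κ K L)

/-- The monomial with the given multiset of factors. -/
def mon (M : Multiset κ) : SymmetricAlgebra K L := (M.map fun i => ι K L (e i)).prod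

theorem mon_cons (i : κ) (M : Multiset κ) : mon e (i ::ₘ M) = ι K L (e i) * mon e M := by
  simp [mon]

open Classical in
/-- The basis of monomials. -/
def monBasis : Module.Basis (Multiset κ) K (SymmetricAlgebra K L) :=
  e.symmetricAlgebra.reindex (Multiset.toFinsupp (α := κ)).symm.toEquiv

theorem monBasis_apply (M : Multiset κ) : monBasis e M = mon e M := by
  classical
  rw [monBasis, Module.Basis.reindex_apply]
  change (SymmetricAlgebra.equivMvPolynomial e).symm
    (MvPolynomial.basisMonomials κ K (Multiset.toFinsupp M)) = mon e M
  rw [MvPolynomial.coe_basisMonomials]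
  beta_reduce
  induction M using Multiset.induction_on with
  | empty => simp [mon]
  | cons i M ih =>
    rw [mon_cons, ← ih, ← Multiset.singleton_add, map_add, Multiset.toFinsupp_singleton]
    rw [← mul_one (1 : K), ← MvPolynomial.monomial_mul, map_mul, mul_one]
    congr 1
    exact SymmetricAlgebra.equivMvPolynomial_symm_X e i

/-- The elements of degree at most `n`. -/
def degLE (n : ℕ) : Submodule K (SymmetricAlgebra K L) :=
  Submodule.span K {w | ∃ M : Multiset κ, M.card ≤ n ∧ w = mon e M}

theorem mon_mem_degLE {M : Multiset κ} {n : ℕ} (h : M.card ≤ n) : mon e M ∈ degLE e n :=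
  Submodule.subset_span ⟨M, h, rfl⟩

theorem degLE_mono {m n : ℕ} (h : m ≤ n) : degLE e m ≤ degLE e n :=
  Submodule.span_mono fun _ ⟨M, hM, hw⟩ => ⟨M, hM.trans h, hw⟩

theorem exists_mem_degLE (w : SymmetricAlgebra K L) : ∃ n, w ∈ degLE e n := by
  refine Submodule.span_induction (p := fun w _ => ∃ n, w ∈ degLE e n) ?_
    ⟨0, Submodule.zero_mem _⟩ ?_ (fun c x _ ⟨n, hn⟩ => ⟨n, Submodule.smul_mem _ c hn⟩)
    ((monBasis e).mem_span w)
  · rintro _ ⟨M, rfl⟩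
    rw [monBasis_apply]
    exact ⟨_, mon_mem_degLE e le_rfl⟩
  · rintro x y _ _ ⟨m, hm⟩ ⟨n, hn⟩
    exact ⟨max m n, Submodule.add_mem _ (degLE_mono e (le_max_left _ _) hm)
      (degLE_mono e (le_max_right _ _) hn)⟩

theorem degLE_induction {n : ℕ} {p : SymmetricAlgebra K L → Prop}
    (zero : p 0) (add : ∀ x y, p x → p y → p (x + y)) (smul : ∀ (c : K) x, p x → p (c • x))
    (mon : ∀ M : Multiset κ, M.card ≤ n → p (mon e M)) {w : SymmetricAlgebra K L}
    (hw : w ∈ degLE e n) : p w := by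
  refine Submodule.span_induction ?_ zero (fun x y _ _ => add x y) (fun c x _ => smul c x) hw
  rintro _ ⟨M, hM, rfl⟩
  exact mon M hM

theorem basis_induction {p : L → Prop} (zero : p 0) (add : ∀ x y, p x → p y → p (x + y))
    (smul : ∀ (c : K) x, p x → p (c • x)) (basis : ∀ i, p (e i)) (x : L) : p x := by
  refine Submodule.span_induction (p := fun x _ => p x) ?_ zero (fun x y _ _ => add x y)
    (fun c x _ => smul c x) (e.mem_span x)
  rintro _ ⟨i, rfl⟩
  exact basis i

theorem ι_mul_mem_degLE {n : ℕ} (x : L) {w : SymmetricAlgebra K L} (hw : w ∈ degLE e n) :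
    ι K L x * w ∈ degLE e (n + 1) := by
  refine degLE_induction e (p := fun w => ι K L x * w ∈ degLE e (n + 1)) (by simp)
    (fun a b ha hb => by rw [mul_add]; exact Submodule.add_mem _ ha hb)
    (fun c a ha => by rw [mul_smul_comm]; exact Submodule.smul_mem _ c ha) (fun M hM => ?_) hw
  induction x using basis_induction e with
  | zero => simp
  | add x y hx hy => rw [map_add, add_mul]; exact Submodule.add_mem _ hx hy
  | smul c x hx => rw [map_smul, smul_mul_assoc]; exact Submodule.smul_mem _ c hx
  | basis i => rw [← mon_cons]; exact mon_mem_degLE e (by simpa using hM)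

end PBW

section PBWRep

open SymmetricAlgebra (ι)

variable {K : Type*} [Field K] {L : Type*} [LieRing L] [LieAlgebra K L]
  {κ : Type*} [LinearOrder κ] (e : Module.Basis κ K L)

/-- If `e i` is not in normal order in front of a monomial, the straightening recursion moves it
past the smallest factor, provided by this lemma. -/
theorem exists_min_cons {i : κ} {M : Multiset κ} (h : ¬ ∀ j ∈ M, i ≤ j) :
    ∃ x : κ × Multiset κ, M = x.1 ::ₘ x.2 ∧ (∀ k ∈ x.2, x.1 ≤ k) ∧ x.1 < i := by
  push Not at h
  obtain ⟨j, hj, hji⟩ := h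
  have hne : M.toFinset.Nonempty := ⟨j, by simpa using hj⟩
  have hmem := M.toFinset.min'_mem hne
  rw [Multiset.mem_toFinset] at hmem
  refine ⟨(M.toFinset.min' hne, M.erase (M.toFinset.min' hne)), (Multiset.cons_erase hmem).symm,
    fun k hk => ?_, ?_⟩
  · exact Finset.min'_le _ _ (by simpa using Multiset.mem_of_mem_erase hk)
  · exact (Finset.min'_le _ _ (by simpa using hj)).trans_lt hji

open Classical in
/-- Approximations of the Poincaré–Birkhoff–Witt representation: the `n`-th one is right on
elements of degree at most `n`. -/
def approx : ℕ → L →ₗ[K] SymmetricAlgebra K L →ₗ[K] SymmetricAlgebra K L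
  | 0 => LinearMap.mul K (SymmetricAlgebra K L) ∘ₗ ι K L
  | n + 1 => e.constr K fun i => (monBasis e).constr K fun M =>
      mon e (i ::ₘ M) +
        if h : ∀ j ∈ M, i ≤ j then 0 else
          let x := (exists_min_cons h).choose
          approx n (e x.1) (approx n (e i) (mon e x.2) - mon e (i ::ₘ x.2)) +
            approx n ⁅e i, e x.1⁆ (mon e x.2)

theorem approx_zero (x : L) (w : SymmetricAlgebra K L) : approx e 0 x w = ι K L x * w := rfl

theorem approx_of_le (n : ℕ) {i : κ} {M : Multiset κ} (h : ∀ j ∈ M, i ≤ j) :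
    approx e n (e i) (mon e M) = mon e (i ::ₘ M) := by
  cases n with
  | zero => rw [approx_zero, mon_cons]
  | succ n =>
    rw [approx, Module.Basis.constr_basis, ← monBasis_apply, Module.Basis.constr_basis, dif_pos h,
      add_zero]

/-- The choice made in `approx` is forced, since a smallest factor and the rest are determined by
the multiset. -/
theorem approx_of_lt (n : ℕ) {i j : κ} {T : Multiset κ} (h : ∀ k ∈ T, j ≤ k) (hj : j < i) :
    approx e (n + 1) (e i) (mon e (j ::ₘ T)) = mon e (i ::ₘ j ::ₘ T) +
      (approx e n (e j) (approx e n (e i) (mon e T) - mon e (i ::ₘ T)) +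
        approx e n ⁅e i, e j⁆ (mon e T)) := by
  have hM : ¬ ∀ k ∈ j ::ₘ T, i ≤ k := fun hh => (hh j (by simp)).not_gt hj
  rw [approx, Module.Basis.constr_basis, ← monBasis_apply, Module.Basis.constr_basis, dif_neg hM]
  obtain ⟨h1, h2, h3⟩ := (exists_min_cons hM).choose_spec
  generalize (exists_min_cons hM).choose = x at h1 h2 h3
  obtain ⟨j', T'⟩ := x
  dsimp only at h1 h2 h3 ⊢
  have hjj : j = j' := by
    apply le_antisymm
    · have : j' ∈ j ::ₘ T := by rw [h1]; simp
      rcases Multiset.mem_cons.1 this with h | h'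
      · exact h.ge
      · exact h _ h'
    · have : j ∈ j' ::ₘ T' := by rw [← h1]; simp
      rcases Multiset.mem_cons.1 this with h | h'
      · exact h.ge
      · exact h2 _ h'
  subst hjj
  obtain rfl : T = T' := (Multiset.cons_inj_right _).1 h1
  rfl

/-- Straightening changes a product only by terms of lower degree. This is why subtracting the
leading monomial lets the recursion proceed by degree. -/
theorem approx_sub_mem (n : ℕ) : ∀ {m : ℕ} (x : L) {w : SymmetricAlgebra K L}, w ∈ degLE e m →
    approx e n x w - ι K L x * w ∈ degLE e m := by
  induction n with
  | zero => intro m x w _; rw [approx_zero, sub_self]; exact Submodule.zero_mem _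
  | succ n ih =>
    intro m x w hw
    have ih' : ∀ {m : ℕ} (x : L) {w : SymmetricAlgebra K L}, w ∈ degLE e m →
        approx e n x w ∈ degLE e (m + 1) := fun x w hw => by
      have := Submodule.add_mem _ (degLE_mono e (Nat.le_succ _) (ih x hw)) (ι_mul_mem_degLE e x hw)
      rwa [sub_add_cancel] at this
    refine degLE_induction e (p := fun w => approx e (n + 1) x w - ι K L x * w ∈ degLE e m) (by simp)
      (fun a b ha hb => ?_) (fun c a ha => ?_) (fun M hM => ?_) hw
    · rw [map_add, mul_add, add_sub_add_comm]; exact Submodule.add_mem _ ha hb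
    · rw [map_smul, mul_smul_comm, ← smul_sub]; exact Submodule.smul_mem _ c ha
    induction x using basis_induction e with
    | zero => simp
    | add x y hx hy =>
      rw [map_add, map_add, LinearMap.add_apply, add_mul, add_sub_add_comm]
      exact Submodule.add_mem _ hx hy
    | smul c x hx =>
      rw [map_smul, map_smul, LinearMap.smul_apply, smul_mul_assoc, ← smul_sub]
      exact Submodule.smul_mem _ c hx
    | basis i =>
      rw [← mon_cons]
      by_cases h : ∀ j ∈ M, i ≤ j
      · rw [approx_of_le e _ h, sub_self]; exact Submodule.zero_mem _
      · obtain ⟨⟨j, T⟩, rfl, h2, h3⟩ := exists_min_cons h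
        rw [approx_of_lt e n h2 h3, add_sub_cancel_left]
        have hT := mon_mem_degLE e (le_refl T.card)
        have h4 : T.card + 1 ≤ m := by simpa using hM
        refine degLE_mono e h4 (Submodule.add_mem _ (ih' _ ?_) (ih' _ hT))
        have := ih (e i) hT
        rwa [← mon_cons] at this

/-- On a monomial with `n + 1` factors the recursion applies the previous approximation to elements
of degree at most `n` only, so the approximations stabilize and `pbwOp` is their limit. -/
theorem approx_succ (n : ℕ) : ∀ (x : L) {w : SymmetricAlgebra K L}, w ∈ degLE e n →
    approx e (n + 1) x w = approx e n x w := by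
  induction n with
  | zero =>
    intro x w hw
    refine degLE_induction e (p := fun w => approx e (0 + 1) x w = approx e 0 x w) (by simp)
      (fun a b ha hb => by rw [map_add, map_add, ha, hb])
      (fun c a ha => by rw [map_smul, map_smul, ha]) (fun M hM => ?_) hw
    obtain rfl : M = 0 := by simpa using hM
    induction x using basis_induction e with
    | zero => simp
    | add x y hx hy => rw [map_add, map_add, LinearMap.add_apply, LinearMap.add_apply, hx, hy]
    | smul c x hx => rw [map_smul, map_smul, LinearMap.smul_apply, LinearMap.smul_apply, hx]
    | basis i => rw [approx_of_le e _ (by simp), approx_of_le e _ (by simp)]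
  | succ n ih =>
    intro x w hw
    refine degLE_induction e (p := fun w => approx e (n + 1 + 1) x w = approx e (n + 1) x w)
      (by simp) (fun a b ha hb => by rw [map_add, map_add, ha, hb])
      (fun c a ha => by rw [map_smul, map_smul, ha]) (fun M hM => ?_) hw
    induction x using basis_induction e with
    | zero => simp
    | add x y hx hy => rw [map_add, map_add, LinearMap.add_apply, LinearMap.add_apply, hx, hy]
    | smul c x hx => rw [map_smul, map_smul, LinearMap.smul_apply, LinearMap.smul_apply, hx]
    | basis i =>
      by_cases h : ∀ j ∈ M, i ≤ j
      · rw [approx_of_le e _ h, approx_of_le e _ h]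
      · obtain ⟨⟨j, T⟩, rfl, h2, h3⟩ := exists_min_cons h
        have h4 : T.card ≤ n := by simpa using hM
        have hT := mon_mem_degLE e h4
        rw [approx_of_lt e _ h2 h3, approx_of_lt e _ h2 h3, ih _ hT, ih _ hT, ih]
        have := approx_sub_mem e n (e i) hT
        rwa [← mon_cons] at this

theorem approx_eq_of_le {m n : ℕ} (h : m ≤ n) (x : L) {w : SymmetricAlgebra K L}
    (hw : w ∈ degLE e m) : approx e n x w = approx e m x w := by
  induction n, h using Nat.le_induction with
  | base => rfl
  | succ n hn ih => rw [approx_succ e n x (degLE_mono e hn hw), ih]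

/-- The operators of the Poincaré–Birkhoff–Witt representation. -/
def pbwOp : L →ₗ[K] SymmetricAlgebra K L →ₗ[K] SymmetricAlgebra K L :=
  LinearMap.flip <| (monBasis e).constr K fun M => (approx e M.card).flip (mon e M)

theorem pbwOp_eq {n : ℕ} (x : L) {w : SymmetricAlgebra K L} (hw : w ∈ degLE e n) :
    pbwOp e x w = approx e n x w := by
  refine degLE_induction e (p := fun w => pbwOp e x w = approx e n x w) (by simp)
      (fun a b ha hb => by rw [map_add, map_add, ha, hb])
      (fun c a ha => by rw [map_smul, map_smul, ha]) (fun M hM => ?_) hw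
  rw [approx_eq_of_le e hM x (mon_mem_degLE e le_rfl), pbwOp, LinearMap.flip_apply]
  nth_rw 1 [← monBasis_apply]
  rw [Module.Basis.constr_basis, LinearMap.flip_apply]

theorem pbwOp_sub_mem {m : ℕ} (x : L) {w : SymmetricAlgebra K L} (hw : w ∈ degLE e m) :
    pbwOp e x w - ι K L x * w ∈ degLE e m := by
  rw [pbwOp_eq e x hw]; exact approx_sub_mem e m x hw

theorem pbwOp_of_le {i : κ} {M : Multiset κ} (h : ∀ j ∈ M, i ≤ j) :
    pbwOp e (e i) (mon e M) = mon e (i ::ₘ M) := by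
  rw [pbwOp_eq e _ (mon_mem_degLE e le_rfl), approx_of_le e _ h]

/-- The defining relation in its final form. The monomial subtracted in `approx` returns because `e
j`, being smallest, acts on it by plain multiplication. -/
theorem pbwOp_of_lt {i j : κ} {T : Multiset κ} (h : ∀ k ∈ T, j ≤ k) (hj : j < i) :
    pbwOp e (e i) (mon e (j ::ₘ T)) =
      pbwOp e (e j) (pbwOp e (e i) (mon e T)) + pbwOp e ⁅e i, e j⁆ (mon e T) := by
  have hT := mon_mem_degLE e (le_refl T.card)
  have h1 : mon e (j ::ₘ T) ∈ degLE e (T.card + 1) := mon_mem_degLE e (by simp)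
  have h2 := approx_sub_mem e T.card (e i) hT
  rw [← mon_cons] at h2
  rw [pbwOp_eq e _ h1, approx_of_lt e _ h hj, ← pbwOp_eq e _ h2, ← pbwOp_eq e _ hT,
    ← pbwOp_eq e _ hT, map_sub, pbwOp_of_le e (M := i ::ₘ T), Multiset.cons_swap]
  · abel
  · intro k hk
    rcases Multiset.mem_cons.1 hk with rfl | hk
    · exact hj.le
    · exact h k hk

/-- If `j` comes first in `T`, the relation is built into the definition. Otherwise a smaller factor
`k` is pulled out, both operators are moved past `e k` with the defining relation and induction on
the degree, and the remainder cancels by the Jacobi identity of `L`. -/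
theorem pbwOp_lie_aux {n : ℕ} (ih : ∀ m < n, ∀ (x y : L), ∀ w ∈ degLE e m,
      pbwOp e x (pbwOp e y w) - pbwOp e y (pbwOp e x w) = pbwOp e ⁅x, y⁆ w)
    {T : Multiset κ} (hT : T.card = n) {i j : κ} (hji : j < i) :
    pbwOp e (e i) (pbwOp e (e j) (mon e T)) - pbwOp e (e j) (pbwOp e (e i) (mon e T)) =
      pbwOp e ⁅e i, e j⁆ (mon e T) := by
  by_cases h : ∀ k ∈ T, j ≤ k
  · rw [pbwOp_of_le e h, pbwOp_of_lt e h hji]; abel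
  · obtain ⟨⟨k, T⟩, rfl, h2, h3⟩ := exists_min_cons h
    dsimp only at h2 h3
    have hT' : mon e T ∈ degLE e T.card := mon_mem_degLE e le_rfl
    have hlt : T.card < n := by rw [← hT]; simp
    have key : ∀ i j, k < i → k < j → pbwOp e (e i) (pbwOp e (e j) (mon e (k ::ₘ T))) =
        pbwOp e (e k) (pbwOp e (e i) (pbwOp e (e j) (mon e T))) +
          pbwOp e ⁅e i, e k⁆ (pbwOp e (e j) (mon e T)) +
          (pbwOp e ⁅e j, e k⁆ (pbwOp e (e i) (mon e T)) + pbwOp e ⁅e i, ⁅e j, e k⁆⁆ (mon e T)) := by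
      intro i j hi hj
      rw [pbwOp_of_lt e h2 hj, map_add]
      have h4 : pbwOp e (e i) (pbwOp e (e k) (pbwOp e (e j) (mon e T))) =
          pbwOp e (e k) (pbwOp e (e i) (pbwOp e (e j) (mon e T))) +
            pbwOp e ⁅e i, e k⁆ (pbwOp e (e j) (mon e T)) := by
        -- The induction hypothesis covers only the part of `e j · mon T` that differs from the
        -- monomial by lower degree; the monomial itself is handled by the defining relation, `k`
        -- being minimal.
        have h5 := ih _ hlt (e i) (e k) _ (pbwOp_sub_mem e (e j) hT')
        rw [← mon_cons] at h5
        have hk : ∀ l ∈ j ::ₘ T, k ≤ l := by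
          intro l hl
          rcases Multiset.mem_cons.1 hl with rfl | hl
          · exact hj.le
          · exact h2 l hl
        have h6 := pbwOp_of_lt e hk hi
        rw [← pbwOp_of_le e hk] at h6
        simp only [map_sub] at h5
        linear_combination (norm := module) h5 + h6
      have h7 := ih _ hlt (e i) ⁅e j, e k⁆ _ hT'
      rw [h4]
      linear_combination (norm := module) h7
    rw [key i j (h3.trans hji) h3, key j i h3 (h3.trans hji), ← pbwOp_of_le e h2]
    have h8 := ih _ hlt ⁅e i, e j⁆ (e k) _ hT'
    have h9 := ih _ hlt (e i) (e j) _ hT'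
    have h10 : ⁅⁅e i, e j⁆, e k⁆ = ⁅e i, ⁅e j, e k⁆⁆ - ⁅e j, ⁅e i, e k⁆⁆ := by
      rw [lie_lie]
    rw [h10, map_sub, LinearMap.sub_apply] at h8
    have h11 := congrArg (pbwOp e (e k)) h9
    rw [map_sub] at h11
    linear_combination (norm := module) h11 - h8

theorem pbwOp_lie (n : ℕ) : ∀ (x y : L), ∀ w ∈ degLE e n,
      pbwOp e x (pbwOp e y w) - pbwOp e y (pbwOp e x w) = pbwOp e ⁅x, y⁆ w := by
  induction n using Nat.strong_induction_on with
  | _ n ih =>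
    intro x y w hw
    refine degLE_induction e
      (p := fun w => pbwOp e x (pbwOp e y w) - pbwOp e y (pbwOp e x w) = pbwOp e ⁅x, y⁆ w) (by simp)
      (fun a b ha hb => by simp only [map_add, ← ha, ← hb]; abel)
      (fun c a ha => by simp only [map_smul, ← ha, smul_sub]) (fun M hM => ?_) hw
    rcases hM.lt_or_eq with hM | hM
    · exact ih _ hM x y _ (mon_mem_degLE e le_rfl)
    induction x using basis_induction e with
    | zero => simp
    | add x x' hx hx' =>
      simp only [map_add, LinearMap.add_apply, add_lie, ← hx, ← hx']; abel
    | smul c x hx => simp only [map_smul, LinearMap.smul_apply, smul_lie, ← hx, smul_sub]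
    | basis i =>
      induction y using basis_induction e with
      | zero => simp
      | add y y' hy hy' =>
        simp only [map_add, LinearMap.add_apply, lie_add, ← hy, ← hy']; abel
      | smul c y hy => simp only [map_smul, LinearMap.smul_apply, lie_smul, ← hy, smul_sub]
      | basis j =>
        rcases lt_trichotomy j i with h | rfl | h
        · exact pbwOp_lie_aux e ih hM h
        · simp
        · rw [← neg_sub, pbwOp_lie_aux e ih hM h, ← lie_skew, map_neg, LinearMap.neg_apply, neg_neg]

/-- The Poincaré–Birkhoff–Witt representation of the enveloping algebra on the symmetric algebra. -/
def pbwRep : UniversalEnvelopingAlgebra K L →ₐ[K] Module.End K (SymmetricAlgebra K L) :=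
  UniversalEnvelopingAlgebra.lift K
    { toLinearMap := pbwOp e
      map_lie' := by
        intro x y
        ext w
        obtain ⟨n, hn⟩ := exists_mem_degLE e w
        exact (pbwOp_lie e n x y w hn).symm }

theorem pbwRep_ι (x : L) (w : SymmetricAlgebra K L) :
    pbwRep e (UniversalEnvelopingAlgebra.ι K x) w = pbwOp e x w := by
  rw [pbwRep, UniversalEnvelopingAlgebra.lift_ι_apply]; rfl

end PBWRep

end

section

set_option linter.unusedSectionVars false

/-! ## Polynomial arguments -/

section LinPow

variable {A : Type*} [Ring A]

/-- The polynomial `(a + b X)^n`. -/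
def linPow (a b : A) (n : ℕ) : Polynomial A :=
  (Polynomial.C a + Polynomial.C b * Polynomial.X) ^ n

theorem linPow_coeff_zero (a b : A) (n : ℕ) : (linPow a b n).coeff 0 = a ^ n := by
  induction n with
  | zero => simp [linPow]
  | succ n ih => rw [linPow, pow_succ, ← linPow, Polynomial.mul_coeff_zero, ih]; simp [pow_succ]

theorem linPow_coeff_one (a b : A) (n : ℕ) :
    (linPow a b (n + 1)).coeff 1 = (linPow a b n).coeff 1 * a + a ^ n * b := by
  rw [linPow, pow_succ, ← linPow, Polynomial.mul_coeff_one, linPow_coeff_zero]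
  simp [add_comm]

theorem linPow_coeff_one_of_commute {a b : A} (h : Commute a b) (n : ℕ) :
    (linPow a b (n + 1)).coeff 1 = (n + 1) * (a ^ n * b) := by
  induction n with
  | zero => rw [linPow_coeff_one]; simp [linPow, Polynomial.coeff_one]
  | succ n ih =>
    rw [linPow_coeff_one, ih, pow_succ]
    push_cast
    rw [mul_assoc, mul_assoc (a ^ n) b, ← h.eq, ← mul_assoc (a ^ n)]
    noncomm_ring

theorem linPow_coeff_one_commutator (a y : A) (n : ℕ) :
    (linPow a (y * a - a * y) n).coeff 1 = y * a ^ n - a ^ n * y := by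
  induction n with
  | zero => simp [linPow, Polynomial.coeff_one]
  | succ n ih => rw [linPow_coeff_one, ih, pow_succ]; noncomm_ring

end LinPow

section Poly

variable {K : Type*} [Field K] {A : Type*} [Ring A] [Algebra K A]

/-- Evaluation of a polynomial at a scalar. -/
def evalAt (t : K) : Polynomial A →+* A :=
  Polynomial.eval₂RingHom' (RingHom.id A) (algebraMap K A t) fun a => (Algebra.commutes t a).symm

theorem evalAt_C (t : K) (a : A) : evalAt t (Polynomial.C a) = a := by
  simp [evalAt, Polynomial.eval₂RingHom']

theorem evalAt_X (t : K) : evalAt t (Polynomial.X : Polynomial A) = algebraMap K A t := by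
  simp [evalAt, Polynomial.eval₂RingHom']

theorem evalAt_eq_sum (t : K) (p : Polynomial A) :
    evalAt t p = ∑ i ∈ Finset.range (p.natDegree + 1), t ^ i • p.coeff i := by
  have : evalAt t p = p.eval₂ (RingHom.id A) (algebraMap K A t) := rfl
  rw [this, Polynomial.eval₂_eq_sum_range]
  refine Finset.sum_congr rfl fun i _ => ?_
  rw [RingHom.id_apply, ← map_pow, ← Algebra.commutes, ← Algebra.smul_def]

theorem evalAt_eq_sum_of_le (t : K) (p : Polynomial A) {n : ℕ} (hn : p.natDegree + 1 ≤ n) :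
    evalAt t p = ∑ i ∈ Finset.range n, t ^ i • p.coeff i := by
  rw [evalAt_eq_sum]
  refine Finset.sum_subset (Finset.range_mono hn) fun j _ hj => ?_
  rw [Polynomial.coeff_eq_zero_of_natDegree_lt, smul_zero]
  simp at hj; omega

theorem evalAt_smul (t c : K) (p : Polynomial A) : evalAt t (c • p) = c • evalAt t p := by
  rw [evalAt_eq_sum_of_le t (c • p) (Nat.add_le_add_right (Polynomial.natDegree_smul_le c p) 1),
    evalAt_eq_sum, Finset.smul_sum]
  exact Finset.sum_congr rfl fun i _ => by rw [Polynomial.coeff_smul, smul_comm]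

/-- If some `c i` were outside `N`, a linear functional vanishing on `N` but not at `c i` would
yield a nonzero polynomial over `K` with all values zero, which is impossible over an infinite
field. -/
theorem coeff_mem_of_sum_mem [CharZero K] {X : Type*} [AddCommGroup X] [Module K X] (N : Submodule K X) {n : ℕ}
    {c : ℕ → X} (h : ∀ t : K, ∑ i ∈ Finset.range n, t ^ i • c i ∈ N) {i : ℕ} (hi : i < n) :
    c i ∈ N := by
  by_contra hc
  obtain ⟨f, hf, hN⟩ := Submodule.exists_le_ker_of_notMem hc
  have h1 : ∑ j ∈ Finset.range n, Polynomial.C (f (c j)) * Polynomial.X ^ j = 0 := by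
    apply Polynomial.funext
    intro t
    have := hN (h t)
    rw [LinearMap.mem_ker, map_sum] at this
    simp only [map_smul, smul_eq_mul] at this
    rw [Polynomial.eval_finsetSum, Polynomial.eval_zero, ← this]
    refine Finset.sum_congr rfl fun j _ => ?_
    rw [Polynomial.eval_mul, Polynomial.eval_C, Polynomial.eval_pow, Polynomial.eval_X, mul_comm]
  have h2 := congrArg (fun p => Polynomial.coeff p i) h1
  simp only [Polynomial.finsetSum_coeff, Polynomial.coeff_C_mul, Polynomial.coeff_X_pow,
    Polynomial.coeff_zero] at h2
  rw [Finset.sum_eq_single i] at h2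
  · simp at h2; exact hf h2
  · intro j _ hj; simp [hj.symm]
  · intro h; exact absurd (Finset.mem_range.2 hi) h

theorem coeff_mem_of_evalAt_mem [CharZero K] (N : Submodule K A) {p : Polynomial A}
    (h : ∀ t : K, evalAt t p ∈ N) (i : ℕ) : p.coeff i ∈ N := by
  by_cases hi : i < p.natDegree + 1
  · refine coeff_mem_of_sum_mem N (fun t => ?_) hi
    rw [← evalAt_eq_sum]
    exact h t
  · rw [Polynomial.coeff_eq_zero_of_natDegree_lt (by omega)]
    exact Submodule.zero_mem _

/-- The polarization device of the whole file: an identity proved for the powers of `v + t w`, for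
all scalars `t`, holds for each coefficient of `t`. -/
theorem map_coeff_eq [CharZero K] {B X : Type*} [Ring B] [Algebra K B] [AddCommGroup X] [Module K X]
    (F : A →ₗ[K] X) (G : B →ₗ[K] X) {p : Polynomial A} {q : Polynomial B}
    (h : ∀ t : K, F (evalAt t p) = G (evalAt t q)) (i : ℕ) : F (p.coeff i) = G (q.coeff i) := by
  set n := max (p.natDegree + 1) (max (q.natDegree + 1) (i + 1)) with hn
  have key : F (p.coeff i) - G (q.coeff i) ∈ (⊥ : Submodule K X) := by
    refine coeff_mem_of_sum_mem (n := n) (c := fun j => F (p.coeff j) - G (q.coeff j)) ⊥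
      (fun t => ?_) (by omega)
    rw [Submodule.mem_bot, ← sub_eq_zero.2 (h t), evalAt_eq_sum_of_le t p (n := n) (by omega), evalAt_eq_sum_of_le t q (n := n) (by omega), map_sum,
      map_sum, ← Finset.sum_sub_distrib]
    refine Finset.sum_congr rfl fun j _ => ?_
    rw [map_smul, map_smul, smul_sub]
  exact sub_eq_zero.1 ((Submodule.mem_bot K).1 key)

theorem evalAt_linPow (a b : A) (n : ℕ) (t : K) : evalAt t (linPow a b n) = (a + t • b) ^ n := by
  rw [linPow, map_pow, map_add, map_mul, evalAt_C, evalAt_C, evalAt_X, ← Algebra.commutes,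
    ← Algebra.smul_def]

end Poly

/-! ## The symmetrization map -/

section Sym

open SymmetricAlgebra (ι)

variable {K : Type*} [Field K] [CharZero K] {V : Type*} [AddCommGroup V] [Module K V]

/-- The linear coefficient of `(v + t x)^(n + 1)` is `(n + 1) v^n x`, so in characteristic `0` the
span of powers is stable under multiplication by letters. -/
theorem span_pow : Submodule.span K {w | ∃ (v : V) (n : ℕ), w = ι K V v ^ n} = ⊤ := by
  set W := Submodule.span K {w | ∃ (v : V) (n : ℕ), w = ι K V v ^ n} with hW
  have h1 : ∀ x, ∀ w ∈ W, w * ι K V x ∈ W := by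
    intro x w hw
    refine Submodule.span_induction (p := fun w _ => w * ι K V x ∈ W) ?_ (by simp)
      (fun a b _ _ ha hb => by rw [add_mul]; exact Submodule.add_mem _ ha hb)
      (fun c a _ ha => by rw [smul_mul_assoc]; exact Submodule.smul_mem _ c ha) hw
    rintro _ ⟨v, n, rfl⟩
    have := coeff_mem_of_evalAt_mem W (p := linPow (ι K V v) (ι K V x) (n + 1)) (fun t => by
      rw [evalAt_linPow, ← map_smul, ← map_add]
      exact Submodule.subset_span ⟨_, _, rfl⟩) 1
    rw [linPow_coeff_one_of_commute (Commute.all _ _)] at this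
    have h2 : ((n : SymmetricAlgebra K V) + 1) * (ι K V v ^ n * ι K V x) =
        ((n : K) + 1) • (ι K V v ^ n * ι K V x) := by
      rw [Algebra.smul_def]; simp
    rw [h2] at this
    exact (Submodule.smul_mem_iff _ (by exact_mod_cast Nat.succ_ne_zero n)).1 this
  have h2 : ∀ u w, w ∈ W → w * u ∈ W := by
    intro u
    induction u using SymmetricAlgebra.induction with
    | algebraMap r =>
      intro w hw
      rw [← Algebra.commutes, ← Algebra.smul_def]; exact Submodule.smul_mem _ r hw
    | ι x => exact fun w hw => h1 x w hw
    | mul a b ha hb => intro w hw; rw [← mul_assoc]; exact hb _ (ha _ hw)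
    | add a b ha hb => intro w hw; rw [mul_add]; exact Submodule.add_mem _ (ha _ hw) (hb _ hw)
  rw [eq_top_iff]
  intro u _
  have := h2 u 1 (Submodule.subset_span ⟨0, 0, by simp⟩)
  rwa [one_mul] at this

theorem pow_induction {p : SymmetricAlgebra K V → Prop} (zero : p 0)
    (add : ∀ x y, p x → p y → p (x + y)) (smul : ∀ (c : K) x, p x → p (c • x))
    (pow : ∀ v n, p (ι K V v ^ n)) (w : SymmetricAlgebra K V) : p w := by
  have hw : w ∈ Submodule.span K {w | ∃ (v : V) (n : ℕ), w = ι K V v ^ n} := by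
    rw [span_pow]; trivial
  refine Submodule.span_induction ?_ zero (fun x y _ _ => add x y) (fun c x _ => smul c x) hw
  rintro _ ⟨v, n, rfl⟩
  exact pow v n

theorem pow_ext {X : Type*} [AddCommGroup X] [Module K X] {F G : SymmetricAlgebra K V →ₗ[K] X}
    (h : ∀ v n, F (ι K V v ^ n) = G (ι K V v ^ n)) : F = G := by
  ext w
  induction w using pow_induction with
  | zero => simp
  | add x y hx hy => rw [map_add, map_add, hx, hy]
  | smul c x hx => rw [map_smul, map_smul, hx]
  | pow v n => exact h v n

/-! ### Derivations with values in `S V ⊗ W` -/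

section Der

variable {W : Type*} [AddCommGroup W] [Module K W] (c : V →ₗ[K] W)

/-- The algebra morphism behind `der`. -/
def derHom : SymmetricAlgebra K V →ₐ[K]
    TrivSqZeroExt (SymmetricAlgebra K V) (SymmetricAlgebra K V ⊗[K] W) :=
  SymmetricAlgebra.lift
    ((TrivSqZeroExt.inlAlgHom K (SymmetricAlgebra K V) (SymmetricAlgebra K V ⊗[K] W)).toLinearMap ∘ₗ
        ι K V +
      (TrivSqZeroExt.inrHom (SymmetricAlgebra K V) (SymmetricAlgebra K V ⊗[K] W)).restrictScalars K ∘ₗ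
        TensorProduct.mk K (SymmetricAlgebra K V) W 1 ∘ₗ c)

theorem derHom_ι (v : V) :
    derHom c (ι K V v) = TrivSqZeroExt.inl (ι K V v) + TrivSqZeroExt.inr (1 ⊗ₜ[K] c v) := by
  rw [derHom, SymmetricAlgebra.lift_ι_apply]; rfl

theorem fst_derHom (w : SymmetricAlgebra K V) : (derHom c w).fst = w := by
  have : (TrivSqZeroExt.fstHom K (SymmetricAlgebra K V) (SymmetricAlgebra K V ⊗[K] W)).comp
      (derHom c) = AlgHom.id K _ := by
    apply SymmetricAlgebra.algHom_ext
    ext v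
    change (derHom c (ι K V v)).fst = ι K V v
    rw [derHom_ι]; simp
  exact congrArg (fun F => F w) this

/-- The derivation of the symmetric algebra with values in `S V ⊗ W` that extends `c`. -/
def der : SymmetricAlgebra K V →ₗ[K] SymmetricAlgebra K V ⊗[K] W where
  toFun w := (derHom c w).snd
  map_add' x y := by simp
  map_smul' r x := by simp

theorem der_apply (w : SymmetricAlgebra K V) : der c w = (derHom c w).snd := rfl

theorem der_ι (v : V) : der c (ι K V v) = 1 ⊗ₜ[K] c v := by
  rw [der_apply, derHom_ι]; simp

theorem der_mul (w w' : SymmetricAlgebra K V) :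
    der c (w * w') = w • der c w' + w' • der c w := by
  rw [der_apply, map_mul, TrivSqZeroExt.snd_mul, fst_derHom, fst_derHom, op_smul_eq_smul]
  rfl

theorem der_one : der c 1 = 0 := by
  rw [der_apply, map_one]; simp

theorem der_prod {n : ℕ} (y : Fin n → V) : der c (∏ i, ι K V (y i)) =
    ∑ i, (∏ j ∈ Finset.univ.erase i, ι K V (y j)) ⊗ₜ[K] c (y i) := by
  have : ∀ s : Finset (Fin n), der c (∏ i ∈ s, ι K V (y i)) =
      ∑ i ∈ s, (∏ j ∈ s.erase i, ι K V (y j)) ⊗ₜ[K] c (y i) := by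
    intro s
    induction s using Finset.induction_on with
    | empty => simp [der_one]
    | insert i s hi ih =>
      rw [Finset.prod_insert hi, Finset.sum_insert hi, der_mul, der_ι, ih, Finset.erase_insert hi,
        TensorProduct.smul_tmul', smul_eq_mul, mul_one, add_comm, Finset.smul_sum]
      congr 1
      refine Finset.sum_congr rfl fun j hj => ?_
      have hij : i ≠ j := by rintro rfl; exact hi hj
      rw [Finset.erase_insert_of_ne hij, Finset.prod_insert (by simp [hi]),
        TensorProduct.smul_tmul', smul_eq_mul]
  exact this Finset.univ

theorem der_pow (v : V) (n : ℕ) :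
    der c (ι K V v ^ (n + 1)) = ((n : K) + 1) • ((ι K V v ^ n) ⊗ₜ[K] c v) := by
  induction n with
  | zero => simp [der_ι]
  | succ n ih =>
    rw [pow_succ, der_mul, der_ι, ih, TensorProduct.smul_tmul', smul_eq_mul, mul_one, smul_comm,
      TensorProduct.smul_tmul', smul_eq_mul, ← pow_succ']
    push_cast
    module

end Der

/-! ### Substitutions and one-parameter families of them -/

section Family

variable {V' : Type*} [AddCommGroup V'] [Module K V'] (f g : V →ₗ[K] V')

/-- The functoriality of the symmetric algebra. -/
def smap : SymmetricAlgebra K V →ₐ[K] SymmetricAlgebra K V' := SymmetricAlgebra.lift (ι K V' ∘ₗ f)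

@[simp] theorem smap_ι (v : V) : smap f (ι K V v) = ι K V' (f v) := SymmetricAlgebra.lift_ι_apply ..

theorem smap_comp {V'' : Type*} [AddCommGroup V''] [Module K V''] (f' : V' →ₗ[K] V'') :
    (smap f').comp (smap f) = smap (f' ∘ₗ f) := by
  apply SymmetricAlgebra.algHom_ext; ext v; simp

theorem smap_smap {V'' : Type*} [AddCommGroup V''] [Module K V''] (f' : V' →ₗ[K] V'')
    (w : SymmetricAlgebra K V) : smap f' (smap f w) = smap (f' ∘ₗ f) w :=
  congrArg (fun F => F w) (smap_comp f f')

theorem smap_id (w : SymmetricAlgebra K V) : smap (LinearMap.id : V →ₗ[K] V) w = w := by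
  have : smap (LinearMap.id : V →ₗ[K] V) = AlgHom.id K _ := by
    apply SymmetricAlgebra.algHom_ext; ext v; simp
  rw [this]; rfl

/-- The polynomial family of the maps induced by `f + t g`. -/
def family : SymmetricAlgebra K V →ₐ[K] Polynomial (SymmetricAlgebra K V') :=
  SymmetricAlgebra.lift
    ((Polynomial.CAlgHom (R := K)).toLinearMap ∘ₗ ι K V' ∘ₗ f +
      (LinearMap.mulRight K Polynomial.X) ∘ₗ (Polynomial.CAlgHom (R := K)).toLinearMap ∘ₗ ι K V' ∘ₗ g)

theorem family_ι (v : V) : family f g (ι K V v) =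
    Polynomial.C (ι K V' (f v)) + Polynomial.C (ι K V' (g v)) * Polynomial.X := by
  rw [family, SymmetricAlgebra.lift_ι_apply]; rfl

theorem family_pow (v : V) (n : ℕ) :
    family f g (ι K V v ^ n) = linPow (ι K V' (f v)) (ι K V' (g v)) n := by
  rw [map_pow, family_ι]; rfl

theorem evalAt_family (t : K) (w : SymmetricAlgebra K V) :
    evalAt t (family f g w) = smap (f + t • g) w := by
  induction w using pow_induction with
  | zero => simp
  | add x y hx hy => rw [map_add, map_add, map_add, hx, hy]
  | smul c x hx =>
    rw [map_smul, evalAt_smul, hx, map_smul]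
  | pow v n => rw [family_pow, evalAt_linPow, map_pow, smap_ι]; simp

end Family

variable {A : Type*} [Ring A] [Algebra K A] (a : V →ₗ[K] A)

/-- The part of degree `n` of the symmetrization map. -/
def symD : (n : ℕ) → SymmetricAlgebra K V →ₗ[K] A
  | 0 => Algebra.linearMap K A ∘ₗ SymmetricAlgebra.algebraMapInv.toLinearMap
  | n + 1 => ((n : K) + 1)⁻¹ • (TensorProduct.lift
      (((LinearMap.mul K A).compl₁₂ a (symD n)).flip) ∘ₗ der (LinearMap.id : V →ₗ[K] V))

theorem symD_pow (v : V) (n : ℕ) : symD a n (ι K V v ^ n) = a v ^ n := by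
  induction n with
  | zero => simp [symD]
  | succ n ih =>
    rw [symD, LinearMap.smul_apply, LinearMap.comp_apply, der_pow, map_smul, smul_smul,
      inv_mul_cancel₀ (by exact_mod_cast Nat.succ_ne_zero n), one_smul, TensorProduct.lift.tmul,
      LinearMap.flip_apply, LinearMap.compl₁₂_apply, ih, pow_succ']
    rfl

/-- The symmetrization map, with `v ^ n ↦ (a v) ^ n`. -/
def sym : SymmetricAlgebra K V →ₗ[K] A :=
  Polynomial.lsum (symD a) ∘ₗ (family (0 : V →ₗ[K] V) LinearMap.id).toLinearMap

theorem sym_pow (v : V) (n : ℕ) : sym a (ι K V v ^ n) = a v ^ n := by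
  rw [sym, LinearMap.comp_apply, AlgHom.toLinearMap_apply, family_pow, linPow, LinearMap.zero_apply,
    map_zero, map_zero, zero_add, mul_pow, ← map_pow, Polynomial.C_mul_X_pow_eq_monomial,
    Polynomial.lsum_apply, Polynomial.sum_monomial_index _ _ (map_zero (symD a n))]
  exact symD_pow a v n

theorem sym_one : sym a 1 = 1 := by simpa using sym_pow a 0 0

theorem map_sym {B : Type*} [Ring B] [Algebra K B] (F : A →ₐ[K] B) (w : SymmetricAlgebra K V) :
    F (sym a w) = sym (F.toLinearMap ∘ₗ a) w := by
  have : F.toLinearMap ∘ₗ sym a = sym (F.toLinearMap ∘ₗ a) := pow_ext fun v n => by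
    simp [sym_pow]
  exact congrArg (fun G => G w) this

theorem sym_smap {V' : Type*} [AddCommGroup V'] [Module K V'] (f : V' →ₗ[K] V)
    (w : SymmetricAlgebra K V') : sym a (smap f w) = sym (a ∘ₗ f) w := by
  have : sym a ∘ₗ (smap f).toLinearMap = sym (a ∘ₗ f) := pow_ext fun v n => by
    simp [sym_pow]
  exact congrArg (fun G => G w) this

/-- The derivation of the symmetric algebra induced by an endomorphism. -/
def deriv (D : V →ₗ[K] V) : SymmetricAlgebra K V →ₗ[K] SymmetricAlgebra K V :=
  (Polynomial.lcoeff (SymmetricAlgebra K V) 1).restrictScalars K ∘ₗ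
    (family LinearMap.id D).toLinearMap

theorem deriv_pow (D : V →ₗ[K] V) (v : V) (n : ℕ) :
    deriv D (ι K V v ^ n) = (linPow (ι K V v) (ι K V (D v)) n).coeff 1 := by
  rw [deriv, LinearMap.comp_apply, AlgHom.toLinearMap_apply, family_pow]; rfl

/-- On a power of `v`, both sides are the linear coefficient in `t` of `(a v + t a (D v))^n`; for `a
(D v)` a commutator with `y` this coefficient telescopes. -/
theorem commutator_sym {D : V →ₗ[K] V} {y : A} (h : ∀ v, a (D v) = y * a v - a v * y)
    (w : SymmetricAlgebra K V) : sym a (deriv D w) = y * sym a w - sym a w * y := by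
  have : sym a ∘ₗ deriv D = LinearMap.mulLeft K y ∘ₗ sym a - LinearMap.mulRight K y ∘ₗ sym a := by
    refine pow_ext fun v n => ?_
    rw [LinearMap.comp_apply, deriv_pow, LinearMap.sub_apply, LinearMap.comp_apply,
      LinearMap.comp_apply, sym_pow, LinearMap.mulLeft_apply, LinearMap.mulRight_apply,
      ← linPow_coeff_one_commutator, ← h]
    refine map_coeff_eq (K := K) (sym a) (LinearMap.id : A →ₗ[K] A)
      (q := linPow (a v) (a (D v)) n) (fun t => ?_) 1
    rw [evalAt_linPow, evalAt_linPow, ← map_smul, ← map_add, sym_pow, map_add, map_smul]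
    rfl
  exact congrArg (fun G => G w) this

/-- The symmetrization of a product. -/
theorem sym_prod (n : ℕ) (x : Fin n → V) : sym a (∏ i, ι K V (x i)) =
    (n.factorial : K)⁻¹ • ∑ σ : Equiv.Perm (Fin n), (List.ofFn fun i => a (x (σ i))).prod := by
  have h1 : ∀ (n : ℕ) (x : Fin n → V), sym a (∏ i, ι K V (x i)) = symD a n (∏ i, ι K V (x i)) := by
    intro n x
    rw [sym, LinearMap.comp_apply, AlgHom.toLinearMap_apply, map_prod]
    simp only [family_ι, LinearMap.zero_apply, map_zero, zero_add, LinearMap.id_apply]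
    rw [Finset.prod_mul_distrib, ← map_prod, Finset.prod_const, Finset.card_univ, Fintype.card_fin,
      Polynomial.C_mul_X_pow_eq_monomial,
      Polynomial.lsum_apply, Polynomial.sum_monomial_index _ _ (map_zero (symD a n))]
  rw [h1]
  induction n with
  | zero => simp [symD]
  | succ n ih =>
    rw [symD, LinearMap.smul_apply, LinearMap.comp_apply, der_prod, map_sum]
    have h3 : ∀ i : Fin (n + 1), ∏ j ∈ Finset.univ.erase i, ι K V (x j) =
        ∏ j : Fin n, ι K V (x (Equiv.swap 0 i j.succ)) := by
      intro i
      refine Eq.trans ?_ (Finset.prod_map Finset.univ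
        ((Fin.succEmb n).trans (Equiv.swap 0 i).toEmbedding) fun j => ι K V (x j))
      refine Finset.prod_congr ?_ fun _ _ => rfl
      ext l
      simp only [Finset.mem_erase, Finset.mem_univ, and_true, Finset.mem_map, true_and,
        Function.Embedding.trans_apply, Fin.coe_succEmb, Equiv.coe_toEmbedding]
      constructor
      · intro h
        obtain ⟨j, hj⟩ := Fin.exists_succ_eq.2 (fun h' => h (by
          rw [← Equiv.swap_apply_self 0 i l, h', Equiv.swap_apply_left]) : Equiv.swap 0 i l ≠ 0)
        exact ⟨j, by rw [hj, Equiv.swap_apply_self]⟩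
      · rintro ⟨j, rfl⟩ h
        have := congrArg (Equiv.swap 0 i) h
        rw [Equiv.swap_apply_self, Equiv.swap_apply_right] at this
        exact Fin.succ_ne_zero j this
    -- A permutation of `n + 1` letters is the choice of the letter in front together with a
    -- permutation of the rest; the recursion in `symD` averages over this choice.
    have h4 : ∀ i : Fin (n + 1), (TensorProduct.lift
        (((LinearMap.mul K A).compl₁₂ a (symD a n)).flip))
          ((∏ j ∈ Finset.univ.erase i, ι K V (x j)) ⊗ₜ[K] x i) =
        (n.factorial : K)⁻¹ • ∑ τ : Equiv.Perm (Fin n), (List.ofFn fun j =>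
          a (x (Equiv.Perm.decomposeFin.symm (i, τ) j))).prod := by
      intro i
      rw [TensorProduct.lift.tmul, LinearMap.flip_apply, LinearMap.compl₁₂_apply, h3, ih,
        LinearMap.mul_apply', mul_smul_comm, Finset.mul_sum]
      congr 1
      refine Finset.sum_congr rfl fun τ _ => ?_
      rw [List.ofFn_succ, List.prod_cons, Equiv.Perm.decomposeFin_symm_apply_zero]
      simp only [Equiv.Perm.decomposeFin_symm_apply_succ]
    refine (congrArg _ (Finset.sum_congr rfl fun i _ => h4 i)).trans ?_
    rw [← Finset.smul_sum, smul_smul, ← Finset.sum_product', Nat.factorial_succ]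
    congr 1
    · push_cast
      rw [mul_inv]
    · rw [Finset.univ_product_univ]
      exact Fintype.sum_equiv Equiv.Perm.decomposeFin.symm _ _ fun _ => rfl

end Sym

end

section

set_option linter.unusedSectionVars false

/-! ## The mixed symmetrization map -/

section Mixed

open SymmetricAlgebra (ι)

variable {K : Type*} [Field K] [CharZero K] {V : Type*} [AddCommGroup V] [Module K V]

theorem coeff_zero_family {V' : Type*} [AddCommGroup V'] [Module K V'] (f g : V →ₗ[K] V')
    (w : SymmetricAlgebra K V) : (family f g w).coeff 0 = smap f w := by
  have := evalAt_family f g 0 w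
  rw [zero_smul, add_zero] at this
  rw [← this, evalAt_eq_sum, Finset.sum_range_succ']
  simp

theorem deriv_ι (D : V →ₗ[K] V) (v : V) : deriv D (ι K V v) = ι K V (D v) := by
  rw [deriv, LinearMap.comp_apply, AlgHom.toLinearMap_apply, family_ι]
  simp [Polynomial.lcoeff_apply]

theorem deriv_mul (D : V →ₗ[K] V) (w w' : SymmetricAlgebra K V) :
    deriv D (w * w') = deriv D w * w' + w * deriv D w' := by
  simp only [deriv, LinearMap.comp_apply, AlgHom.toLinearMap_apply, map_mul,
    LinearMap.restrictScalars_apply, Polynomial.lcoeff_apply, Polynomial.mul_coeff_one,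
    coeff_zero_family, smap_id]
  exact add_comm _ _

theorem deriv_algebraMap (D : V →ₗ[K] V) (r : K) : deriv D (algebraMap K _ r) = 0 := by
  rw [deriv, LinearMap.comp_apply, AlgHom.toLinearMap_apply, AlgHom.commutes]
  simp [Polynomial.lcoeff_apply, Polynomial.algebraMap_apply]

theorem deriv_smap {V' : Type*} [AddCommGroup V'] [Module K V'] {f : V →ₗ[K] V'} {D : V →ₗ[K] V}
    {D' : V' →ₗ[K] V'} (h : ∀ v, D' (f v) = f (D v)) (w : SymmetricAlgebra K V) :
    deriv D' (smap f w) = smap f (deriv D w) := by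
  induction w using SymmetricAlgebra.induction with
  | algebraMap r => rw [AlgHom.commutes, deriv_algebraMap, deriv_algebraMap, map_zero]
  | ι x => rw [smap_ι, deriv_ι, deriv_ι, smap_ι, h]
  | mul a b ha hb => rw [map_mul, deriv_mul, deriv_mul, ha, hb, map_add, map_mul, map_mul]
  | add a b ha hb => simp only [map_add, ha, hb]

variable (π : V →ₗ[K] V)

/-- The complementary projection. -/
abbrev compl : V →ₗ[K] V := LinearMap.id - π

/-- The isomorphism `S (M ⊕ H) → S M ⊗ S H`. -/
def split : SymmetricAlgebra K V →ₐ[K] SymmetricAlgebra K V ⊗[K] SymmetricAlgebra K V :=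
  SymmetricAlgebra.lift
    (Algebra.TensorProduct.includeLeft.toLinearMap ∘ₗ ι K V ∘ₗ π +
      Algebra.TensorProduct.includeRight.toLinearMap ∘ₗ ι K V ∘ₗ compl π)

theorem split_ι (v : V) : split π (ι K V v) = ι K V (π v) ⊗ₜ 1 + 1 ⊗ₜ ι K V (compl π v) := by
  rw [split, SymmetricAlgebra.lift_ι_apply]; rfl

theorem mul_split (w : SymmetricAlgebra K V) : LinearMap.mul' K _ (split π w) = w := by
  have : (Algebra.TensorProduct.lmul' K).comp (split π) = AlgHom.id K _ := by
    apply SymmetricAlgebra.algHom_ext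
    ext v
    simp [split_ι]
  exact congrArg (fun F => F w) this

variable {π} (hπ : ∀ v, π (π v) = π v)

include hπ

theorem map_split (w : SymmetricAlgebra K V) :
    Algebra.TensorProduct.map (smap π) (smap (compl π)) (split π w) = split π w := by
  have : (Algebra.TensorProduct.map (smap π) (smap (compl π))).comp (split π) = split π := by
    apply SymmetricAlgebra.algHom_ext
    ext v
    simp [split_ι, hπ]
  exact congrArg (fun F => F w) this

theorem split_mul (w w' : SymmetricAlgebra K V) :
    split π (smap π w * smap (compl π) w') = smap π w ⊗ₜ smap (compl π) w' := by
  have h1 : (split π).comp (smap π) = Algebra.TensorProduct.includeLeft.comp (smap π) := by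
    apply SymmetricAlgebra.algHom_ext
    ext v
    simp [split_ι, hπ]
  have h2 : (split π).comp (smap (compl π)) =
      Algebra.TensorProduct.includeRight.comp (smap (compl π)) := by
    apply SymmetricAlgebra.algHom_ext
    ext v
    simp [split_ι, hπ]
  have h1 := congrArg (fun F => F w) h1
  have h2 := congrArg (fun F => F w') h2
  simp only [AlgHom.comp_apply] at h1 h2
  rw [map_mul, h1, h2]
  simp

theorem split_induction {p : SymmetricAlgebra K V → Prop} (zero : p 0)
    (add : ∀ x y, p x → p y → p (x + y))
    (mul : ∀ w w', p (smap π w * smap (compl π) w')) (w : SymmetricAlgebra K V) : p w := by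
  rw [← mul_split π w, ← map_split hπ]
  generalize split π w = z
  induction z using TensorProduct.induction_on with
  | zero => rw [map_zero, map_zero]; exact zero
  | tmul a b => exact mul a b
  | add a b ha hb => rw [map_add, map_add]; exact add _ _ ha hb

/-- Splitting followed by polarization in each factor: products `x^i y^j`, with `x` in the image and
`y` in the kernel of `π`, span the symmetric algebra. -/
theorem split_pow_induction {p : SymmetricAlgebra K V → Prop} (zero : p 0)
    (add : ∀ x y, p x → p y → p (x + y)) (smul : ∀ (c : K) x, p x → p (c • x))
    (pow : ∀ x y i j, π x = x → π y = 0 → p (ι K V x ^ i * ι K V y ^ j))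
    (w : SymmetricAlgebra K V) : p w := by
  refine split_induction hπ zero add (fun w w' => ?_) w
  induction w using pow_induction with
  | zero => simpa using zero
  | add x y hx hy => rw [map_add, add_mul]; exact add _ _ hx hy
  | smul c x hx => rw [map_smul, smul_mul_assoc]; exact smul _ _ hx
  | pow v n =>
    induction w' using pow_induction with
    | zero => simpa using zero
    | add x y hx hy => rw [map_add, mul_add]; exact add _ _ hx hy
    | smul c x hx => rw [map_smul, mul_smul_comm]; exact smul _ _ hx
    | pow v' n' =>
      rw [map_pow, map_pow, smap_ι, smap_ι]
      exact pow _ _ _ _ (hπ v) (by simp [hπ])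

omit hπ

variable {A : Type*} [Ring A] [Algebra K A] (a : V →ₗ[K] A)

variable (π) in
/-- The symmetrization map on both factors of `S (M ⊕ H) = S M ⊗ S H`, followed by the product. -/
def psi : SymmetricAlgebra K V →ₗ[K] A :=
  TensorProduct.lift ((LinearMap.mul K A).compl₁₂ (sym a) (sym a)) ∘ₗ (split π).toLinearMap

include hπ in
theorem psi_mul (w w' : SymmetricAlgebra K V) : psi π a (smap π w * smap (compl π) w') =
    sym a (smap π w) * sym a (smap (compl π) w') := by
  rw [psi, LinearMap.comp_apply, AlgHom.toLinearMap_apply, split_mul hπ, TensorProduct.lift.tmul]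
  rfl

include hπ in
theorem psi_mul_of {w w' : SymmetricAlgebra K V} (h : smap π w = w) (h' : smap (compl π) w' = w') :
    psi π a (w * w') = sym a w * sym a w' := by
  rw [← h, ← h', psi_mul hπ]

include hπ in
theorem psi_pow {x y : V} (hx : π x = x) (hy : π y = 0) (i j : ℕ) :
    psi π a (ι K V x ^ i * ι K V y ^ j) = a x ^ i * a y ^ j := by
  rw [psi_mul_of hπ, sym_pow, sym_pow]
  · rw [map_pow, smap_ι, hx]
  · rw [map_pow, smap_ι]; simp [hy]

theorem map_psi {B : Type*} [Ring B] [Algebra K B] (F : A →ₐ[K] B) (w : SymmetricAlgebra K V) :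
    F (psi π a w) = psi π (F.toLinearMap ∘ₗ a) w := by
  have : F.toLinearMap ∘ₗ TensorProduct.lift ((LinearMap.mul K A).compl₁₂ (sym a) (sym a)) =
      TensorProduct.lift ((LinearMap.mul K B).compl₁₂ (sym (F.toLinearMap ∘ₗ a))
        (sym (F.toLinearMap ∘ₗ a))) := TensorProduct.ext' fun x y => by
    rw [LinearMap.comp_apply, AlgHom.toLinearMap_apply, TensorProduct.lift.tmul,
      TensorProduct.lift.tmul, LinearMap.compl₁₂_apply,
      LinearMap.compl₁₂_apply, LinearMap.mul_apply', LinearMap.mul_apply', map_mul, map_sym, map_sym]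
  exact congrArg (fun G => G (split π w)) this

theorem psi_smap {V' : Type*} [AddCommGroup V'] [Module K V'] {π' : V' →ₗ[K] V'} {f : V' →ₗ[K] V}
    (hf : ∀ v, π (f v) = f (π' v)) (w : SymmetricAlgebra K V') :
    psi π a (smap f w) = psi π' (a ∘ₗ f) w := by
  have h : (split π).comp (smap f) =
      (Algebra.TensorProduct.map (smap f) (smap f)).comp (split π') := by
    apply SymmetricAlgebra.algHom_ext
    ext v
    simp [split_ι, hf]
  have h := congrArg (fun F => F w) h
  simp only [AlgHom.comp_apply] at h
  rw [psi, psi, LinearMap.comp_apply, LinearMap.comp_apply, AlgHom.toLinearMap_apply,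
    AlgHom.toLinearMap_apply, h]
  have : TensorProduct.lift ((LinearMap.mul K A).compl₁₂ (sym a) (sym a)) ∘ₗ
        (Algebra.TensorProduct.map (smap f) (smap f)).toLinearMap =
      TensorProduct.lift ((LinearMap.mul K A).compl₁₂ (sym (a ∘ₗ f)) (sym (a ∘ₗ f))) :=
    TensorProduct.ext' fun x y => by
      rw [LinearMap.comp_apply, AlgHom.toLinearMap_apply, Algebra.TensorProduct.map_tmul,
        TensorProduct.lift.tmul, TensorProduct.lift.tmul,
        LinearMap.compl₁₂_apply, LinearMap.compl₁₂_apply, sym_smap, sym_smap]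
  exact congrArg (fun G => G (split π' w)) this

include hπ in
theorem psi_deriv {D : V →ₗ[K] V} (hD : ∀ v, π (D v) = D (π v)) {y : A}
    (h : ∀ v, a (D v) = y * a v - a v * y) (w : SymmetricAlgebra K V) :
    psi π a (deriv D w) = y * psi π a w - psi π a w * y := by
  refine split_induction hπ (p := fun w => psi π a (deriv D w) = y * psi π a w - psi π a w * y)
    (by simp) (fun x y hx hy => ?_) (fun w w' => ?_) w
  · simp only [map_add, hx, hy]; noncomm_ring
  · rw [deriv_mul, deriv_smap (D := D) (fun v => (hD v).symm), deriv_smap (D := D), map_add,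
      psi_mul hπ, psi_mul hπ, psi_mul hπ, ← deriv_smap (D := D) (D' := D) (fun v => (hD v).symm),
      ← deriv_smap (D := D) (D' := D), commutator_sym a h, commutator_sym a h]
    · noncomm_ring
    · intro v; simp [hD]
    · intro v; simp [hD]

-- The factor from the kernel of `π` stands on the right in `psi`, so on `x^i y^(j + 1)` the value
-- lies in the left ideal, whereas the projected term vanishes. This dictates the order of the
-- factors in `psi`.
include hπ in
theorem psi_sub_mem {I : Ideal A} (hI : ∀ y, π y = 0 → a y ∈ I) (w : SymmetricAlgebra K V) :
    psi π a w - psi π a (smap π w) ∈ I := by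
  refine split_pow_induction hπ (p := fun w => psi π a w - psi π a (smap π w) ∈ I) (by simp)
    (fun x y hx hy => ?_) (fun c x hx => ?_)
    (fun x y i j hx hy => ?_) w
  · rw [map_add, map_add, map_add, add_sub_add_comm]; exact I.add_mem hx hy
  · rw [map_smul, map_smul, map_smul, ← smul_sub]
    exact Submodule.smul_of_tower_mem I c hx
  · rw [map_mul (smap π), map_pow (smap π), map_pow (smap π), smap_ι, smap_ι, hx, hy]
    cases j with
    | zero => simp
    | succ j =>
      rw [map_zero, zero_pow (Nat.succ_ne_zero j), mul_zero, map_zero, sub_zero, psi_pow hπ a hx hy,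
        pow_succ, ← mul_assoc]
      exact I.mul_mem_left _ (hI y hy)

end Mixed

end

section

set_option linter.unusedSectionVars false

/-! ## The Poincaré–Birkhoff–Witt theorem -/

section Filtration

variable {K : Type*} [Field K] {L : Type*} [LieRing L] [LieAlgebra K L]

variable (K L) in
/-- The filtration of the enveloping algebra by the number of factors. -/
def ueaLE (n : ℕ) : Submodule K (UniversalEnvelopingAlgebra K L) :=
  (1 ⊔ LinearMap.range (UniversalEnvelopingAlgebra.ι K : L →ₗ⁅K⁆ _).toLinearMap) ^ n

theorem ι_mem_ueaLE (x : L) : UniversalEnvelopingAlgebra.ι K x ∈ ueaLE K L 1 := by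
  rw [ueaLE, pow_one]
  exact Submodule.mem_sup_right ⟨x, rfl⟩

theorem mul_mem_ueaLE {m n : ℕ} {u v : UniversalEnvelopingAlgebra K L} (hu : u ∈ ueaLE K L m)
    (hv : v ∈ ueaLE K L n) : u * v ∈ ueaLE K L (m + n) := by
  rw [ueaLE, pow_add]
  exact Submodule.mul_mem_mul hu hv

theorem one_mem_ueaLE (n : ℕ) : (1 : UniversalEnvelopingAlgebra K L) ∈ ueaLE K L n := by
  induction n with
  | zero => rw [ueaLE, pow_zero]; exact Submodule.one_le.1 le_rfl
  | succ n ih =>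
    rw [← one_mul (1 : UniversalEnvelopingAlgebra K L)]
    refine mul_mem_ueaLE ih ?_
    rw [ueaLE, pow_one]
    exact Submodule.mem_sup_left (Submodule.one_le.1 le_rfl)

theorem ueaLE_mono {m n : ℕ} (h : m ≤ n) : ueaLE K L m ≤ ueaLE K L n := by
  intro u hu
  obtain ⟨d, rfl⟩ := Nat.exists_eq_add_of_le h
  have := mul_mem_ueaLE hu (one_mem_ueaLE d)
  rwa [mul_one] at this

theorem pow_mem_ueaLE (x : L) (n : ℕ) : UniversalEnvelopingAlgebra.ι K x ^ n ∈ ueaLE K L n := by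
  induction n with
  | zero => rw [pow_zero]; exact one_mem_ueaLE 0
  | succ n ih => rw [pow_succ]; exact mul_mem_ueaLE ih (ι_mem_ueaLE x)

theorem exists_mem_ueaLE (u : UniversalEnvelopingAlgebra K L) : ∃ n, u ∈ ueaLE K L n := by
  induction u using uea_induction with
  | algebraMap r =>
    refine ⟨0, ?_⟩
    rw [Algebra.algebraMap_eq_smul_one]
    exact Submodule.smul_mem _ r (one_mem_ueaLE 0)
  | ι x => exact ⟨1, ι_mem_ueaLE x⟩
  | mul a b ha hb =>
    obtain ⟨m, hm⟩ := ha
    obtain ⟨n, hn⟩ := hb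
    exact ⟨m + n, mul_mem_ueaLE hm hn⟩
  | add a b ha hb =>
    obtain ⟨m, hm⟩ := ha
    obtain ⟨n, hn⟩ := hb
    exact ⟨max m n, Submodule.add_mem _ (ueaLE_mono (le_max_left _ _) hm)
      (ueaLE_mono (le_max_right _ _) hn)⟩

theorem ueaLE_succ_induction {n : ℕ} {p : UniversalEnvelopingAlgebra K L → Prop}
    (add : ∀ x y, p x → p y → p (x + y)) (base : ∀ u ∈ ueaLE K L n, p u)
    (mul : ∀ x, ∀ u ∈ ueaLE K L n, p (UniversalEnvelopingAlgebra.ι K x * u))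
    {u : UniversalEnvelopingAlgebra K L} (hu : u ∈ ueaLE K L (n + 1)) : p u := by
  rw [ueaLE, pow_succ'] at hu
  refine Submodule.mul_induction_on hu (fun a ha b hb => ?_) add
  obtain ⟨c, hc, _, ⟨x, rfl⟩, rfl⟩ := Submodule.mem_sup.1 ha
  obtain ⟨r, rfl⟩ := Submodule.mem_one.1 hc
  rw [add_mul]
  refine add _ _ (base _ ?_) (mul x b hb)
  rw [← Algebra.smul_def]
  exact Submodule.smul_mem _ r hb

theorem ueaLE_zero_induction {p : UniversalEnvelopingAlgebra K L → Prop}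
    (h : ∀ r : K, p (algebraMap K _ r)) {u : UniversalEnvelopingAlgebra K L}
    (hu : u ∈ ueaLE K L 0) : p u := by
  rw [ueaLE, pow_zero] at hu
  obtain ⟨r, rfl⟩ := Submodule.mem_one.1 hu
  exact h r

theorem pow_mul_sub_mem_ueaLE (x y : L) (n : ℕ) :
    UniversalEnvelopingAlgebra.ι K x ^ n * UniversalEnvelopingAlgebra.ι K y -
      UniversalEnvelopingAlgebra.ι K y * UniversalEnvelopingAlgebra.ι K x ^ n ∈ ueaLE K L n := by
  induction n with
  | zero => simp
  | succ n ih =>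
    have h1 := mul_mem_ueaLE ih (ι_mem_ueaLE x)
    have h2 := mul_mem_ueaLE (pow_mem_ueaLE (K := K) x n) (ι_mem_ueaLE (K := K) ⁅x, y⁆)
    rw [LieHom.map_lie, LieRing.of_associative_ring_bracket] at h2
    convert Submodule.add_mem _ h1 h2 using 1
    rw [pow_succ]
    noncomm_ring

theorem linPow_coeff_one_sub_mem (x y : L) (n : ℕ) :
    (linPow (UniversalEnvelopingAlgebra.ι K x) (UniversalEnvelopingAlgebra.ι K y) (n + 1)).coeff 1 -
      ((n : K) + 1) • (UniversalEnvelopingAlgebra.ι K y * UniversalEnvelopingAlgebra.ι K x ^ n) ∈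
      ueaLE K L n := by
  induction n with
  | zero => simp [linPow]
  | succ n ih =>
    have h1 := mul_mem_ueaLE ih (ι_mem_ueaLE x)
    have h2 := pow_mul_sub_mem_ueaLE (K := K) x y (n + 1)
    convert Submodule.add_mem _ h1 h2 using 1
    rw [linPow_coeff_one _ _ (n + 1), sub_mul, smul_mul_assoc, mul_assoc, ← pow_succ]
    push_cast
    module

end Filtration

/-! ### Comparison of symbols and bijectivity of the split symmetrization -/

section PBW

open SymmetricAlgebra (ι)

variable {K : Type*} [Field K] [CharZero K] {L : Type*} [LieRing L] [LieAlgebra K L]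

/-- The canonical map to the enveloping algebra, as a linear map. -/
abbrev ιU : L →ₗ[K] UniversalEnvelopingAlgebra K L :=
  (UniversalEnvelopingAlgebra.ι K : L →ₗ⁅K⁆ _).toLinearMap

/-- The elements of degree at most `n` of the symmetric algebra are spanned by powers. -/
theorem degLE_pow_induction {κ : Type*} (e : Module.Basis κ K L) {n : ℕ}
    {p : SymmetricAlgebra K L → Prop} (zero : p 0)
    (add : ∀ x y, p x → p y → p (x + y)) (smul : ∀ (c : K) x, p x → p (c • x))
    (pow : ∀ v, ∀ m ≤ n, p (ι K L v ^ m)) {w : SymmetricAlgebra K L} (hw : w ∈ degLE e n) : p w := by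
  have key : ∀ m, ∀ M : Multiset κ, M.card = m →
      mon e M ∈ Submodule.span K {w | ∃ v : L, w = ι K L v ^ m} := by
    intro m
    induction m with
    | zero =>
      intro M hM
      rw [Multiset.card_eq_zero] at hM
      subst hM
      exact Submodule.subset_span ⟨0, by simp [mon]⟩
    | succ m ih =>
      intro M hM
      obtain ⟨i, hi⟩ := Multiset.card_pos_iff_exists_mem.1 (hM.symm ▸ Nat.succ_pos m : 0 < M.card)
      obtain ⟨M, rfl⟩ := Multiset.exists_cons_of_mem hi
      rw [mon_cons]
      refine Submodule.span_induction (p := fun w _ => ι K L (e i) * w ∈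
          Submodule.span K {w | ∃ v : L, w = ι K L v ^ (m + 1)}) ?_ (by simp)
        (fun a b _ _ ha hb => by rw [mul_add]; exact Submodule.add_mem _ ha hb)
        (fun c a _ ha => by rw [mul_smul_comm]; exact Submodule.smul_mem _ c ha)
        (ih M (by simpa using hM))
      rintro _ ⟨v, rfl⟩
      have := coeff_mem_of_evalAt_mem (Submodule.span K {w | ∃ v : L, w = ι K L v ^ (m + 1)})
        (p := linPow (ι K L v) (ι K L (e i)) (m + 1)) (fun t => by
          rw [evalAt_linPow, ← map_smul, ← map_add]
          exact Submodule.subset_span ⟨_, rfl⟩) 1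
      rw [linPow_coeff_one_of_commute (Commute.all _ _), mul_comm (ι K L v ^ m)] at this
      have h2 : ((m : SymmetricAlgebra K L) + 1) * (ι K L (e i) * ι K L v ^ m) =
          ((m : K) + 1) • (ι K L (e i) * ι K L v ^ m) := by
        rw [Algebra.smul_def]; simp
      rw [h2] at this
      exact (Submodule.smul_mem_iff _ (by exact_mod_cast Nat.succ_ne_zero m)).1 this
  refine degLE_induction e zero add smul (fun M hM => ?_) hw
  refine Submodule.span_induction ?_ zero (fun x y _ _ => add x y) (fun c x _ => smul c x)
    (key _ M rfl)
  rintro _ ⟨v, rfl⟩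
  exact pow v _ hM

/-- Compare the linear coefficients of `(x + t y)^(n + 1)` on both sides: in the enveloping algebra
the different orders of the factors agree up to shorter products. -/
theorem sym_mul_pow_sub_mem (x y : L) (n : ℕ) :
    sym ιU (ι K L y * ι K L x ^ n) - UniversalEnvelopingAlgebra.ι K y *
      UniversalEnvelopingAlgebra.ι K x ^ n ∈ ueaLE K L n := by
  have h := map_coeff_eq (K := K) (sym (ιU (K := K) (L := L)))
    (LinearMap.id : UniversalEnvelopingAlgebra K L →ₗ[K] _)
    (p := linPow (ι K L x) (ι K L y) (n + 1))
    (q := linPow (UniversalEnvelopingAlgebra.ι K x) (UniversalEnvelopingAlgebra.ι K y) (n + 1))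
    (fun t => by
      rw [evalAt_linPow, evalAt_linPow, ← map_smul, ← map_add, sym_pow, map_add, map_smul]; rfl) 1
  rw [linPow_coeff_one_of_commute (Commute.all _ _), mul_comm (ι K L x ^ n)] at h
  have h2 : ((n : SymmetricAlgebra K L) + 1) * (ι K L y * ι K L x ^ n) =
      ((n : K) + 1) • (ι K L y * ι K L x ^ n) := by
    rw [Algebra.smul_def]; simp
  have h3 := linPow_coeff_one_sub_mem (K := K) x y n
  rw [h2, map_smul, LinearMap.id_apply] at h
  rw [← h, ← smul_sub] at h3
  exact (Submodule.smul_mem_iff _ (by exact_mod_cast Nat.succ_ne_zero n)).1 h3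

variable {π : L →ₗ[K] L} (hπ : ∀ v, π (π v) = π v)

include hπ

/-- Up to shorter products `psi` turns multiplication by a letter into left multiplication. After
the binomial expansion this is the statement for `sym` in each of the two factors, plus the
commutator needed to move the second component of `z` past the first factor. -/
theorem psi_mul_sub_mem {κ : Type*} (e : Module.Basis κ K L) {n : ℕ} (z : L)
    {w : SymmetricAlgebra K L} (hw : w ∈ degLE e n) :
    psi π ιU (ι K L z * w) - UniversalEnvelopingAlgebra.ι K z * psi π ιU w ∈ ueaLE K L n := by
  refine degLE_pow_induction e (p := fun w => psi π ιU (ι K L z * w) -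
    UniversalEnvelopingAlgebra.ι K z * psi π ιU w ∈ ueaLE K L n) (by simp)
    (fun a b ha hb => ?_) (fun c a ha => ?_) (fun v m hm => ?_) hw
  · rw [mul_add, map_add, map_add, mul_add, add_sub_add_comm]; exact Submodule.add_mem _ ha hb
  · rw [mul_smul_comm, map_smul, map_smul, mul_smul_comm, ← smul_sub]
    exact Submodule.smul_mem _ c ha
  have hv : ι K L v = ι K L (π v) + ι K L (compl π v) := by rw [← map_add]; simp
  have hz : ι K L z = ι K L (π z) + ι K L (compl π z) := by rw [← map_add]; simp
  have hz' : UniversalEnvelopingAlgebra.ι K z = UniversalEnvelopingAlgebra.ι K (π z) +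
      UniversalEnvelopingAlgebra.ι K (compl π z) := by
    rw [← map_add]; simp
  have hc : ∀ u, π (compl π u) = 0 := fun u => by simp [hπ]
  rw [hv, add_pow, Finset.mul_sum, map_sum, map_sum, Finset.mul_sum, ← Finset.sum_sub_distrib]
  refine Submodule.sum_mem _ fun i hi => ?_
  generalize hj : m - i = j
  have hij : i + j ≤ n := by rw [Finset.mem_range] at hi; omega
  have hcast : ∀ w : SymmetricAlgebra K L, w * (m.choose i : SymmetricAlgebra K L) =
      (m.choose i : K) • w := fun w => by rw [mul_comm, Algebra.smul_def]; simp
  rw [hcast, mul_smul_comm, map_smul, map_smul, mul_smul_comm, ← smul_sub]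
  refine Submodule.smul_mem _ _ ?_
  refine ueaLE_mono hij ?_
  have hs : ∀ k u, smap π (ι K L (π u) ^ k) = ι K L (π u) ^ k := fun k u => by
    rw [map_pow, smap_ι, hπ]
  have hs' : ∀ k u, smap (compl π) (ι K L (compl π u) ^ k) = ι K L (compl π u) ^ k := fun k u => by
    rw [map_pow, smap_ι]; simp [hπ]
  rw [psi_pow hπ _ (hπ v) (hc v), hz, add_mul, map_add, ← mul_assoc,
    psi_mul_of hπ _ (by rw [map_mul, hs, smap_ι, hπ]) (hs' _ _), sym_pow,
    ← mul_assoc, mul_comm (ι K L (compl π z)), mul_assoc, psi_mul_of hπ _ (hs _ _), sym_pow, hz']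
  · have h1 := mul_mem_ueaLE (sym_mul_pow_sub_mem (K := K) (π v) (π z) i)
      (pow_mem_ueaLE (K := K) (compl π v) j)
    have h2 := mul_mem_ueaLE (pow_mem_ueaLE (K := K) (π v) i)
      (sym_mul_pow_sub_mem (K := K) (compl π v) (compl π z) j)
    have h3 := mul_mem_ueaLE (pow_mul_sub_mem_ueaLE (K := K) (π v) (compl π z) i)
      (pow_mem_ueaLE (K := K) (compl π v) j)
    convert Submodule.add_mem _ h1 (Submodule.add_mem _ h2 h3) using 1
    simp only [LieHom.coe_toLinearMap]
    noncomm_ring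
  · rw [map_mul, hs', smap_ι]; simp [hπ]

/-- Filtered surjectivity, by induction on the number of factors: a product with one more letter
equals the value of `psi` on a product, up to an error already in the image. -/
theorem ueaLE_le_map_psi {κ : Type*} (e : Module.Basis κ K L) (n : ℕ) :
    ueaLE K L n ≤ (degLE e n).map (psi π ιU) := by
  induction n with
  | zero =>
    intro u hu
    refine ueaLE_zero_induction (p := fun u => u ∈ (degLE e 0).map (psi π ιU)) (fun r => ?_) hu
    refine ⟨algebraMap K _ r, ?_, ?_⟩
    · rw [Algebra.algebraMap_eq_smul_one]
      exact Submodule.smul_mem _ _ (mon_mem_degLE e (M := 0) le_rfl)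
    · rw [Algebra.algebraMap_eq_smul_one, Algebra.algebraMap_eq_smul_one, map_smul]
      congr 1
      simpa using psi_pow hπ (ιU (K := K) (L := L)) (x := 0) (y := 0) (by simp) (by simp) 0 0
  | succ n ih =>
    have hle := Submodule.map_mono (f := psi π (ιU (K := K))) (degLE_mono e (Nat.le_succ n))
    intro u hu
    refine ueaLE_succ_induction (p := fun u => u ∈ (degLE e (n + 1)).map (psi π ιU))
      (fun x y hx hy => Submodule.add_mem _ hx hy) (fun u hu => ?_) (fun x u hu => ?_) hu
    · exact hle (ih hu)
    · obtain ⟨w, hw, rfl⟩ := ih hu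
      have h1 := hle (ih (psi_mul_sub_mem hπ e x hw))
      have h2 := Submodule.mem_map_of_mem (f := psi π (ιU (K := K))) (ι_mul_mem_degLE e x hw)
      have := Submodule.sub_mem _ h2 h1
      rwa [sub_sub_cancel] at this

theorem psi_surjective : Function.Surjective (psi π (ιU (K := K) (L := L))) := by
  intro u
  obtain ⟨κ, e⟩ : Σ κ, Module.Basis κ K L := ⟨_, Module.Free.chooseBasis K L⟩
  obtain ⟨n, hn⟩ := exists_mem_ueaLE u
  obtain ⟨w, _, hw⟩ := ueaLE_le_map_psi hπ e n hn
  exact ⟨w, hw⟩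

omit [CharZero K] hπ in
theorem pbwRep_mem {κ : Type*} [LinearOrder κ] (e : Module.Basis κ K L) {n : ℕ}
    {u : UniversalEnvelopingAlgebra K L} (hu : u ∈ ueaLE K L n) :
    pbwRep e u 1 ∈ degLE e n := by
  induction n generalizing u with
  | zero =>
    refine ueaLE_zero_induction (p := fun u => pbwRep e u 1 ∈ degLE e 0) (fun r => ?_) hu
    rw [AlgHom.commutes, Module.algebraMap_end_apply]
    exact Submodule.smul_mem _ _ (mon_mem_degLE e (M := 0) le_rfl)
  | succ n ih =>
    refine ueaLE_succ_induction (p := fun u => pbwRep e u 1 ∈ degLE e (n + 1))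
      (fun x y hx hy => by rw [map_add]; exact Submodule.add_mem _ hx hy)
      (fun u hu => degLE_mono e (Nat.le_succ n) (ih hu)) (fun x u hu => ?_) hu
    rw [map_mul, Module.End.mul_apply, pbwRep_ι]
    have := Submodule.add_mem _ (degLE_mono e (Nat.le_succ n) (pbwOp_sub_mem e x (ih hu)))
      (ι_mul_mem_degLE e x (ih hu))
    rwa [sub_add_cancel] at this

/-- The symbol of `psi w` is the one of `w`. -/
theorem pbwRep_psi_sub_mem {κ : Type*} [LinearOrder κ] (e : Module.Basis κ K L) (n : ℕ) :
    (∀ w ∈ degLE e 0, pbwRep e (psi π ιU w) 1 = w) ∧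
      ∀ w ∈ degLE e (n + 1), pbwRep e (psi π ιU w) 1 - w ∈ degLE e n := by
  have h0 : ∀ w ∈ degLE e 0, pbwRep e (psi π ιU w) 1 = w := by
    intro w hw
    refine degLE_induction e (p := fun w => pbwRep e (psi π ιU w) 1 = w) (by simp)
      (fun a b ha hb => by rw [map_add, map_add, LinearMap.add_apply, ha, hb])
      (fun c a ha => by rw [map_smul, map_smul, LinearMap.smul_apply, ha]) (fun M hM => ?_) hw
    obtain rfl : M = 0 := by simpa using hM
    have : psi π (ιU (K := K)) 1 = 1 := by
      simpa using psi_pow hπ (ιU (K := K) (L := L)) (x := 0) (y := 0) (by simp) (by simp) 0 0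
    simp [mon, this]
  have hstep : ∀ m, ∀ i, ∀ M : Multiset κ, M.card ≤ m →
      pbwRep e (psi π ιU (mon e M)) 1 - mon e M ∈ degLE e (m - 1) →
      pbwRep e (psi π ιU (mon e (i ::ₘ M))) 1 - mon e (i ::ₘ M) ∈ degLE e m := by
    intro m i M hM h
    have h1 := pbwRep_mem e (psi_mul_sub_mem hπ e (e i) (mon_mem_degLE e hM))
    have hle : degLE e (m - 1) ≤ degLE e m := degLE_mono e (Nat.sub_le m 1)
    have hm : pbwRep e (psi π ιU (mon e M)) 1 ∈ degLE e m := by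
      have := Submodule.add_mem _ (hle h) (mon_mem_degLE e hM)
      rwa [sub_add_cancel] at this
    have h2 := pbwOp_sub_mem e (e i) hm
    have h3 : ι K L (e i) * (pbwRep e (psi π ιU (mon e M)) 1 - mon e M) ∈ degLE e m := by
      rcases Nat.eq_zero_or_pos m with rfl | hpos
      · rw [h0 _ (mon_mem_degLE e hM), sub_self, mul_zero]; exact Submodule.zero_mem _
      · have := ι_mul_mem_degLE e (e i) h
        rwa [Nat.sub_add_cancel hpos] at this
    rw [map_sub, map_mul (pbwRep e), LinearMap.sub_apply, Module.End.mul_apply, pbwRep_ι] at h1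
    rw [mon_cons]
    convert Submodule.add_mem _ h1 (Submodule.add_mem _ h2 h3) using 1
    rw [mul_sub]
    abel
  have main : ∀ m, ∀ M : Multiset κ, M.card ≤ m + 1 →
      pbwRep e (psi π ιU (mon e M)) 1 - mon e M ∈ degLE e m := by
    intro m
    induction m with
    | zero =>
      intro M hM
      induction M using Multiset.induction_on with
      | empty => rw [h0 _ (mon_mem_degLE e (by simp)), sub_self]; exact Submodule.zero_mem _
      | cons i M _ =>
        obtain rfl : M = 0 := by simpa using hM
        refine hstep 0 i 0 (by simp) ?_
        rw [h0 _ (mon_mem_degLE e (by simp)), sub_self]; exact Submodule.zero_mem _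
    | succ m ih =>
      intro M hM
      induction M using Multiset.induction_on with
      | empty => rw [h0 _ (mon_mem_degLE e (by simp)), sub_self]; exact Submodule.zero_mem _
      | cons i M _ =>
        have hM' : M.card ≤ m + 1 := by simpa using hM
        exact hstep (m + 1) i M hM' (ih M hM')
  refine ⟨h0, fun w hw => ?_⟩
  refine degLE_induction e (p := fun w => pbwRep e (psi π ιU w) 1 - w ∈ degLE e n) (by simp)
    (fun a b ha hb => ?_) (fun c a ha => ?_) (fun M hM => main n M hM) hw
  · rw [map_add, map_add, LinearMap.add_apply, add_sub_add_comm]; exact Submodule.add_mem _ ha hb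
  · rw [map_smul, map_smul, LinearMap.smul_apply, ← smul_sub]; exact Submodule.smul_mem _ c ha

/-- Acting on `1` through the Poincaré–Birkhoff–Witt representation recovers the leading part of
`w`, so a `w` in the kernel has arbitrarily small degree and finally is zero. -/
theorem psi_injective : Function.Injective (psi π (ιU (K := K) (L := L))) := by
  rw [injective_iff_map_eq_zero]
  intro w hw
  obtain ⟨κ, e⟩ : Σ κ, Module.Basis κ K L := ⟨_, Module.Free.chooseBasis K L⟩
  classical
  let _ : LinearOrder κ := linearOrderOfSTO WellOrderingRel
  obtain ⟨n, hn⟩ := exists_mem_degLE e w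
  have h0 : w ∈ degLE e 0 := by
    induction n with
    | zero => exact hn
    | succ n ih =>
      have := (pbwRep_psi_sub_mem hπ e n).2 w hn
      rw [hw, map_zero, LinearMap.zero_apply, zero_sub] at this
      exact ih (neg_mem_iff.1 this)
  have := (pbwRep_psi_sub_mem hπ e 0).1 w h0
  rw [← this, hw, map_zero, LinearMap.zero_apply]

theorem psi_bijective : Function.Bijective (psi π (ιU (K := K) (L := L))) :=
  ⟨psi_injective hπ, psi_surjective hπ⟩

end PBW

end

section

set_option linter.unusedSectionVars false

/-! ## The decomposition `U𝔤 = U𝔪 ⊕ U𝔤 · 𝔥` -/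

section Decomposition

open SymmetricAlgebra (ι)

variable {K : Type*} [Field K] {𝔤 : Type*} [LieRing 𝔤] [LieAlgebra K 𝔤]
  (𝔥 : LieSubalgebra K 𝔤) (𝔪 : Submodule K 𝔤) (hc : IsCompl 𝔥.toSubmodule 𝔪)

/-- The projection onto `𝔪` along `𝔥`. -/
def prM : 𝔤 →ₗ[K] 𝔤 := 𝔪.projection 𝔥.toSubmodule hc.symm

theorem prM_mem (x : 𝔤) : prM 𝔥 𝔪 hc x ∈ 𝔪 := by
  rw [prM]; exact Submodule.projection_apply_mem _ _

theorem prM_of_mem {x : 𝔤} (hx : x ∈ 𝔪) : prM 𝔥 𝔪 hc x = x := by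
  rw [prM]; exact Submodule.projection_apply_of_mem_left _ hx

theorem prM_prM (x : 𝔤) : prM 𝔥 𝔪 hc (prM 𝔥 𝔪 hc x) = prM 𝔥 𝔪 hc x :=
  prM_of_mem 𝔥 𝔪 hc (prM_mem 𝔥 𝔪 hc x)

theorem prM_eq_zero_iff {x : 𝔤} : prM 𝔥 𝔪 hc x = 0 ↔ x ∈ 𝔥 := by
  rw [prM, Submodule.projection_apply_eq_zero_iff]; rfl

theorem compl_prM_mem (x : 𝔤) : compl (prM 𝔥 𝔪 hc) x ∈ 𝔥 := by
  rw [← prM_eq_zero_iff 𝔥 𝔪 hc]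
  simp [prM_prM]

theorem pow_mem_Um [CharZero K] {x : 𝔤} (hx : x ∈ 𝔪) (n : ℕ) :
    UniversalEnvelopingAlgebra.ι K x ^ n ∈ Um K 𝔪 := by
  refine Submodule.subset_span ⟨n, fun _ => ⟨x, hx⟩, ?_⟩
  have h : (n.factorial : K) ≠ 0 := by exact_mod_cast n.factorial_ne_zero
  rw [Finset.sum_const, Finset.card_univ, Fintype.card_perm, Fintype.card_fin, List.ofFn_const,
    List.prod_replicate, ← Nat.cast_smul_eq_nsmul K, smul_smul, inv_mul_cancel₀ h, one_smul]

variable [CharZero K]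

theorem sym_zero {V : Type*} [AddCommGroup V] [Module K V] : sym (0 : V →ₗ[K] K) =
    (SymmetricAlgebra.algebraMapInv (R := K) (M := V)).toLinearMap := by
  refine pow_ext fun v n => ?_
  rw [sym_pow, AlgHom.toLinearMap_apply, map_pow, SymmetricAlgebra.algebraMapInv_ι]
  rfl

theorem psi_smap_mem_Um (w : SymmetricAlgebra K 𝔤) :
    psi (prM 𝔥 𝔪 hc) ιU (smap (prM 𝔥 𝔪 hc) w) ∈ Um K 𝔪 := by
  induction w using pow_induction with
  | zero => simp
  | add x y hx hy => rw [map_add, map_add]; exact Submodule.add_mem _ hx hy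
  | smul c x hx => rw [map_smul, map_smul]; exact Submodule.smul_mem _ c hx
  | pow v n =>
    have := psi_pow (prM_prM 𝔥 𝔪 hc) (ιU (K := K)) (prM_prM 𝔥 𝔪 hc v) (map_zero _) n 0
    rw [pow_zero, mul_one, pow_zero, mul_one] at this
    rw [map_pow (smap _), smap_ι, this]
    exact pow_mem_Um 𝔪 (prM_mem 𝔥 𝔪 hc v) n

theorem exists_psi_smap_of_mem_Um {u : UniversalEnvelopingAlgebra K 𝔤} (hu : u ∈ Um K 𝔪) :
    ∃ w, u = psi (prM 𝔥 𝔪 hc) ιU (smap (prM 𝔥 𝔪 hc) w) := by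
  have : Um K 𝔪 ≤ LinearMap.range
      (psi (prM 𝔥 𝔪 hc) (ιU (K := K)) ∘ₗ (smap (prM 𝔥 𝔪 hc)).toLinearMap) := by
    refine Submodule.span_le.2 ?_
    rintro _ ⟨n, x, rfl⟩
    refine ⟨∏ i, ι K 𝔤 (x i), ?_⟩
    have h := sym_prod (K := K) (ιU (K := K) (L := 𝔤)) n fun i => (x i : 𝔤)
    refine Eq.trans ?_ h
    have h2 : smap (prM 𝔥 𝔪 hc) (∏ i, ι K 𝔤 (x i)) = ∏ i, ι K 𝔤 (x i) := by
      rw [map_prod]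
      exact Finset.prod_congr rfl fun i _ => by rw [smap_ι, prM_of_mem 𝔥 𝔪 hc (x i).2]
    have := psi_mul_of (prM_prM 𝔥 𝔪 hc) (ιU (K := K)) h2 (map_one (smap (compl (prM 𝔥 𝔪 hc))))
    rw [mul_one, sym_one, mul_one] at this
    rw [← this, LinearMap.comp_apply, AlgHom.toLinearMap_apply, h2]
  obtain ⟨w, hw⟩ := this hu
  exact ⟨w, hw.symm⟩

/-- It suffices to treat `x^i z^j y` with `x ∈ 𝔪` and `z, y ∈ 𝔥`. Here `z^j y` is the symmetrization
of an element `w'` of `S𝔥` without constant term, so the preimage `x^i w'` is killed by the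
projection onto `S𝔪`. -/
theorem exists_psi_of_mem_Ugh {u : UniversalEnvelopingAlgebra K 𝔤} (hu : u ∈ Ugh K 𝔥) :
    ∃ w, smap (prM 𝔥 𝔪 hc) w = 0 ∧ u = psi (prM 𝔥 𝔪 hc) ιU w := by
  have hprod : ∀ (u : UniversalEnvelopingAlgebra K 𝔤) (y : 𝔥),
      ∃ w, smap (prM 𝔥 𝔪 hc) w = 0 ∧
        u * UniversalEnvelopingAlgebra.ι K (y : 𝔤) = psi (prM 𝔥 𝔪 hc) ιU w := by
    intro u y
    obtain ⟨w, rfl⟩ := psi_surjective (prM_prM 𝔥 𝔪 hc) u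
    refine split_pow_induction (prM_prM 𝔥 𝔪 hc) (p := fun w => ∃ w', smap (prM 𝔥 𝔪 hc) w' = 0 ∧
      psi (prM 𝔥 𝔪 hc) ιU w * UniversalEnvelopingAlgebra.ι K (y : 𝔤) = psi (prM 𝔥 𝔪 hc) ιU w')
      ⟨0, by simp⟩ ?_ ?_ (fun x z i j hx hz => ?_) w
    · rintro a b ⟨a', ha, ha'⟩ ⟨b', hb, hb'⟩
      exact ⟨a' + b', by rw [map_add, ha, hb, add_zero], by rw [map_add, map_add, add_mul, ha', hb']⟩
    · rintro c a ⟨a', ha, ha'⟩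
      exact ⟨c • a', by rw [map_smul, ha, smul_zero], by rw [map_smul, map_smul, smul_mul_assoc, ha']⟩
    · lift z to 𝔥 using (prM_eq_zero_iff 𝔥 𝔪 hc).1 hz
      rw [psi_pow (prM_prM 𝔥 𝔪 hc) _ hx hz, mul_assoc]
      -- For the projection `0` the map `psi` is the ordinary symmetrization of `𝔥`.
      obtain ⟨w', hw'⟩ := psi_surjective (K := K) (L := 𝔥) (π := 0) (by simp)
        (UniversalEnvelopingAlgebra.ι K z ^ j * UniversalEnvelopingAlgebra.ι K y)
      have hincl : ueaMap 𝔥.incl (UniversalEnvelopingAlgebra.ι K z ^ j *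
          UniversalEnvelopingAlgebra.ι K y) = UniversalEnvelopingAlgebra.ι K (z : 𝔤) ^ j *
          UniversalEnvelopingAlgebra.ι K (y : 𝔤) := by
        rw [map_mul, map_pow, ueaMap_ι, ueaMap_ι]; rfl
      have h1 : (ueaMap 𝔥.incl).toLinearMap ∘ₗ (ιU (K := K) (L := 𝔥)) =
          (ιU (K := K) (L := 𝔤)) ∘ₗ 𝔥.toSubmodule.subtype := by
        ext x
        exact ueaMap_ι _ _
      have h2 : UniversalEnvelopingAlgebra.ι K (z : 𝔤) ^ j * UniversalEnvelopingAlgebra.ι K (y : 𝔤) =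
          sym ιU (smap 𝔥.toSubmodule.subtype w') := by
        rw [← hincl, ← hw', map_psi, h1]
        have := psi_mul_of (π := (0 : 𝔥 →ₗ[K] 𝔥)) (by simp)
          ((ιU (K := K) (L := 𝔤)) ∘ₗ 𝔥.toSubmodule.subtype) (w := 1) (w' := w') (map_one _)
          (by rw [compl, sub_zero, smap_id])
        rw [one_mul, sym_one, one_mul] at this
        rw [this, sym_smap]
      -- Symmetrization intertwines the augmentations, and the counit vanishes on a product ending
      -- in a letter.
      have h3 : SymmetricAlgebra.algebraMapInv w' = 0 := by
        have h4 : ∀ w : SymmetricAlgebra K 𝔥,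
            UniversalEnvelopingAlgebra.lift K (0 : 𝔥 →ₗ⁅K⁆ K) (psi 0 ιU w) =
            SymmetricAlgebra.algebraMapInv w := by
          intro w
          rw [map_psi]
          have h5 : (UniversalEnvelopingAlgebra.lift K (0 : 𝔥 →ₗ⁅K⁆ K)).toLinearMap ∘ₗ
              (ιU (K := K) (L := 𝔥)) = 0 := by
            ext x
            exact UniversalEnvelopingAlgebra.lift_ι_apply ..
          rw [h5]
          have h6 := psi_mul_of (π := (0 : 𝔥 →ₗ[K] 𝔥)) (by simp)
            (0 : 𝔥 →ₗ[K] K) (w := 1) (w' := w) (map_one _)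
            (by rw [compl, sub_zero, smap_id])
          rw [one_mul, sym_one, one_mul] at h6
          rw [h6, sym_zero]
          rfl
        rw [← h4, hw', map_mul, UniversalEnvelopingAlgebra.lift_ι_apply]
        simp
      have h7 : smap (compl (prM 𝔥 𝔪 hc)) (smap 𝔥.toSubmodule.subtype w') =
          smap 𝔥.toSubmodule.subtype w' := by
        rw [smap_smap]
        congr 2
        ext x
        have := (prM_eq_zero_iff 𝔥 𝔪 hc).2 x.2
        simp [this]
      have h8 : smap (prM 𝔥 𝔪 hc) (ι K 𝔤 x ^ i) = ι K 𝔤 x ^ i := by rw [map_pow, smap_ι, hx]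
      refine ⟨ι K 𝔤 x ^ i * smap 𝔥.toSubmodule.subtype w', ?_, ?_⟩
      · have h9 : prM 𝔥 𝔪 hc ∘ₗ 𝔥.toSubmodule.subtype = 0 := by
          ext x
          exact (prM_eq_zero_iff 𝔥 𝔪 hc).2 x.2
        have h10 : (smap (0 : 𝔥 →ₗ[K] 𝔤)) = (Algebra.ofId K _).comp
            SymmetricAlgebra.algebraMapInv := by
          apply SymmetricAlgebra.algHom_ext
          ext x
          change smap 0 (ι K 𝔥 x) = algebraMap K _ (SymmetricAlgebra.algebraMapInv (ι K 𝔥 x))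
          rw [SymmetricAlgebra.algebraMapInv_ι, smap_ι]
          simp
        rw [map_mul, smap_smap, h9, h10, AlgHom.comp_apply, h3, map_zero, mul_zero]
      · rw [psi_mul_of (prM_prM 𝔥 𝔪 hc) _ h8 h7, sym_pow, ← h2]
        rfl
  have hmul : ∀ r : UniversalEnvelopingAlgebra K 𝔤, ∃ w, smap (prM 𝔥 𝔪 hc) w = 0 ∧
      r * u = psi (prM 𝔥 𝔪 hc) ιU w := by
    refine Submodule.span_induction (p := fun u _ => ∀ r : UniversalEnvelopingAlgebra K 𝔤, ∃ w,
      smap (prM 𝔥 𝔪 hc) w = 0 ∧ r * u = psi (prM 𝔥 𝔪 hc) ιU w) ?_ (fun r => ⟨0, by simp⟩) ?_ ?_ hu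
    · rintro _ ⟨y, hy, rfl⟩ r
      exact hprod r ⟨y, hy⟩
    · intro a b _ _ h h' r
      obtain ⟨a', ha, ha'⟩ := h r
      obtain ⟨b', hb, hb'⟩ := h' r
      exact ⟨a' + b', by rw [map_add, ha, hb, add_zero], by rw [mul_add, map_add, ha', hb']⟩
    · intro s a _ h r
      rw [smul_eq_mul, ← mul_assoc]
      exact h (r * s)
  obtain ⟨w, hw⟩ := hmul 1
  exact ⟨w, by rwa [one_mul] at hw⟩

-- Under the bijection `psi` the two subspaces correspond to the image and the kernel of the
-- substitution induced by the projection onto `𝔪`.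
include hc in
theorem isCompl_Um_Ugh : IsCompl (Um K 𝔪) (Ugh K 𝔥) := by
  constructor
  · rw [Submodule.disjoint_def]
    intro u h1 h2
    obtain ⟨w, rfl⟩ := exists_psi_smap_of_mem_Um 𝔥 𝔪 hc h1
    obtain ⟨w', hw', h⟩ := exists_psi_of_mem_Ugh 𝔥 𝔪 hc h2
    have h3 := congrArg (smap (prM 𝔥 𝔪 hc)) (psi_injective (prM_prM 𝔥 𝔪 hc) h)
    have h4 : prM 𝔥 𝔪 hc ∘ₗ prM 𝔥 𝔪 hc = prM 𝔥 𝔪 hc := by ext x; exact prM_prM 𝔥 𝔪 hc x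
    rw [hw', smap_smap, h4] at h3
    rw [h3, map_zero]
  · rw [codisjoint_iff, eq_top_iff]
    intro u _
    obtain ⟨w, rfl⟩ := psi_surjective (prM_prM 𝔥 𝔪 hc) u
    refine Submodule.mem_sup.2 ⟨_, psi_smap_mem_Um 𝔥 𝔪 hc w, _,
      psi_sub_mem (prM_prM 𝔥 𝔪 hc) (ιU (K := K)) (I := Ideal.span
        ((UniversalEnvelopingAlgebra.ι K : 𝔤 → _) '' (𝔥 : Set 𝔤))) (fun y hy => ?_) w, ?_⟩
    · exact Ideal.subset_span ⟨y, (prM_eq_zero_iff 𝔥 𝔪 hc).1 hy, rfl⟩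
    · rw [add_sub_cancel]

end Decomposition

end

section

set_option linter.unusedSectionVars false

/-! ## `ADT` as the enveloping algebra of `𝔤ᵏ × 𝔥`, and its symmetrization map -/

section PiLie

variable {ι L : Type*} [LieRing L]

instance piLieRing : LieRing (ι → L) where
  bracket x y := fun i => ⁅x i, y i⁆
  add_lie x y z := funext fun i => add_lie (x i) (y i) (z i)
  lie_add x y z := funext fun i => lie_add (x i) (y i) (z i)
  lie_self x := funext fun i => lie_self (x i)
  leibniz_lie x y z := funext fun i => leibniz_lie (x i) (y i) (z i)

instance piLieAlgebra {R : Type*} [CommRing R] [LieAlgebra R L] : LieAlgebra R (ι → L) where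
  lie_smul c x y := funext fun i => lie_smul c (x i) (y i)

theorem pi_lie_apply (x y : ι → L) (i : ι) : ⁅x, y⁆ i = ⁅x i, y i⁆ := rfl

end PiLie

open SymmetricAlgebra (ι)

variable {K : Type*} [Field K] {𝔤 : Type*} [LieRing 𝔤] [LieAlgebra K 𝔤] (𝔥 : LieSubalgebra K 𝔤)

/-- The Lie algebra with enveloping algebra `⊗ᵏ U𝔤 ⊗ U𝔥`. -/
abbrev Slots (k : ℕ) : Type _ := (Fin k → 𝔤) × 𝔥

/-- The inclusion of `𝔤ᵏ × 𝔥` into `⊗ᵏ U𝔤 ⊗ U𝔥`. -/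
def letter (k : ℕ) : Slots 𝔥 k →ₗ[K] ADT K 𝔥 k :=
  ∑ i, (leg K 𝔥 i).toLinearMap ∘ₗ (UniversalEnvelopingAlgebra.ι K : 𝔤 →ₗ⁅K⁆ _).toLinearMap ∘ₗ
      LinearMap.proj i ∘ₗ LinearMap.fst K _ _ +
    (tail K 𝔥 k).toLinearMap ∘ₗ (UniversalEnvelopingAlgebra.ι K : 𝔥 →ₗ⁅K⁆ _).toLinearMap ∘ₗ
      LinearMap.snd K _ _

theorem letter_apply (k : ℕ) (v : Slots 𝔥 k) : letter 𝔥 k v =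
    ∑ i, leg K 𝔥 i (UniversalEnvelopingAlgebra.ι K (v.1 i)) +
      tail K 𝔥 k (UniversalEnvelopingAlgebra.ι K v.2) := by
  rw [letter, LinearMap.add_apply, LinearMap.sum_apply]
  rfl

theorem letter_lie (k : ℕ) (v w : Slots 𝔥 k) :
    letter 𝔥 k ⁅v, w⁆ = letter 𝔥 k v * letter 𝔥 k w - letter 𝔥 k w * letter 𝔥 k v := by
  have hc : ∀ v w : Slots 𝔥 k, Commute (∑ i, leg K 𝔥 i (UniversalEnvelopingAlgebra.ι K (v.1 i)))
      (tail K 𝔥 k (UniversalEnvelopingAlgebra.ι K w.2)) := fun v w =>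
    Commute.sum_left _ _ _ fun i _ => leg_tail_commute K 𝔥 i _ _
  have h : ∑ i, leg K 𝔥 i (UniversalEnvelopingAlgebra.ι K (⁅v, w⁆.1 i)) =
      (∑ i, leg K 𝔥 i (UniversalEnvelopingAlgebra.ι K (v.1 i))) *
        (∑ i, leg K 𝔥 i (UniversalEnvelopingAlgebra.ι K (w.1 i))) -
      (∑ i, leg K 𝔥 i (UniversalEnvelopingAlgebra.ι K (w.1 i))) *
        (∑ i, leg K 𝔥 i (UniversalEnvelopingAlgebra.ι K (v.1 i))) := by
    rw [Finset.sum_mul_sum, Finset.sum_mul_sum,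
      Finset.sum_comm (f := fun i j => leg K 𝔥 i (UniversalEnvelopingAlgebra.ι K (w.1 i)) *
        leg K 𝔥 j (UniversalEnvelopingAlgebra.ι K (v.1 j))), ← Finset.sum_sub_distrib]
    refine Finset.sum_congr rfl fun i hi => ?_
    rw [← Finset.sum_sub_distrib, Finset.sum_eq_single_of_mem i hi]
    · change leg K 𝔥 i (UniversalEnvelopingAlgebra.ι K ⁅v.1 i, w.1 i⁆) = _
      rw [LieHom.map_lie, LieRing.of_associative_ring_bracket, map_sub, map_mul, map_mul]
    · intro j _ hj
      rw [(leg_commute K 𝔥 hj.symm _ _).eq, sub_self]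
  have h1 := (hc v w).eq
  have h2 := (hc w v).eq
  rw [letter_apply, h, letter_apply, letter_apply, LieAlgebra.Prod.bracket_apply,
    LieHom.map_lie (UniversalEnvelopingAlgebra.ι K : 𝔥 →ₗ⁅K⁆ _),
    LieRing.of_associative_ring_bracket, map_sub, map_mul, map_mul]
  simp only [add_mul, mul_add, h1, h2]
  abel

/-- The morphism from the enveloping algebra of `𝔤ᵏ × 𝔥` to `⊗ᵏ U𝔤 ⊗ U𝔥`. -/
def ofSlots (k : ℕ) : UniversalEnvelopingAlgebra K (Slots 𝔥 k) →ₐ[K] ADT K 𝔥 k :=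
  UniversalEnvelopingAlgebra.lift K
    { toLinearMap := letter 𝔥 k
      map_lie' := fun {v w} => letter_lie 𝔥 k v w }

theorem ofSlots_ι (k : ℕ) (v : Slots 𝔥 k) :
    ofSlots 𝔥 k (UniversalEnvelopingAlgebra.ι K v) = letter 𝔥 k v := by
  rw [ofSlots, UniversalEnvelopingAlgebra.lift_ι_apply]
  rfl

/-- The vector with the entry `x` in the slot `i`. -/
def legVec {k : ℕ} (i : Fin k) : 𝔤 →ₗ[K] Slots 𝔥 k :=
  LinearMap.inl K _ _ ∘ₗ LinearMap.single K (fun _ : Fin k => 𝔤) i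

theorem legVec_apply {k : ℕ} (i : Fin k) (x : 𝔤) : legVec 𝔥 i x = (Pi.single i x, 0) := rfl

/-- The vector with the last entry `y`. -/
def tailVec (k : ℕ) : 𝔥 →ₗ[K] Slots 𝔥 k := LinearMap.inr K _ _

theorem tailVec_apply (k : ℕ) (y : 𝔥) : tailVec 𝔥 k y = (0, y) := rfl

theorem letter_legVec {k : ℕ} (i : Fin k) (x : 𝔤) :
    letter 𝔥 k (legVec 𝔥 i x) = leg K 𝔥 i (UniversalEnvelopingAlgebra.ι K x) := by
  rw [letter_apply, legVec_apply, map_zero, map_zero, add_zero,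
    Finset.sum_eq_single_of_mem i (Finset.mem_univ i)]
  · simp
  · intro j _ hj
    simp [hj]

theorem letter_tailVec (k : ℕ) (y : 𝔥) :
    letter 𝔥 k (tailVec 𝔥 k y) = tail K 𝔥 k (UniversalEnvelopingAlgebra.ι K y) := by
  rw [letter_apply, tailVec_apply]
  simp

theorem slots_eq_sum {k : ℕ} (v : Slots 𝔥 k) :
    v = ∑ i, legVec 𝔥 i (v.1 i) + tailVec 𝔥 k v.2 := by
  refine Prod.ext (funext fun j => ?_) ?_
  · simp [legVec_apply, tailVec_apply, Prod.fst_sum, Finset.sum_apply, Finset.sum_pi_single]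
  · simp [legVec_apply, tailVec_apply, Prod.snd_sum]

/-- `legVec` as a morphism of Lie algebras. -/
def legLie {k : ℕ} (i : Fin k) : 𝔤 →ₗ⁅K⁆ Slots 𝔥 k :=
  { legVec 𝔥 i with
    map_lie' := by
      intro x y
      change ((Pi.single i ⁅x, y⁆ : Fin k → 𝔤), (0 : 𝔥)) = (_, ⁅(0 : 𝔥), (0 : 𝔥)⁆)
      rw [lie_self]
      congr 1
      funext j
      by_cases h : j = i
      · subst h; simp [pi_lie_apply, legVec_apply]
      · simp [pi_lie_apply, legVec_apply, h] }

/-- The inverse comes from the universal property of the tensor product, applicable because elements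
in different slots have bracket zero. -/
theorem ofSlots_bijective (k : ℕ) : Function.Bijective (ofSlots 𝔥 k) := by
  have hleg : ∀ i j : Fin k, i ≠ j → ∀ x y, ⁅legLie 𝔥 i x, legLie 𝔥 j y⁆ = 0 := by
    intro i j hij x y
    refine Prod.ext (funext fun l => ?_) (lie_self _)
    change ⁅(Pi.single i x : Fin k → 𝔤) l, (Pi.single j y : Fin k → 𝔤) l⁆ = 0
    by_cases h : l = i
    · subst h; simp [hij]
    · simp [h]
  have htail : ∀ (i : Fin k) x y, ⁅legLie 𝔥 i x, LieHom.inr K (Fin k → 𝔤) 𝔥 y⁆ = 0 := by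
    intro i x y
    refine Prod.ext (funext fun l => ?_) ?_
    · change ⁅(Pi.single i x : Fin k → 𝔤) l, (0 : 𝔤)⁆ = 0
      rw [lie_zero]
    · change ⁅(0 : 𝔥), y⁆ = 0
      rw [zero_lie]
  have hcomm : ∀ x y : Slots 𝔥 k, ⁅x, y⁆ = 0 → Commute (UniversalEnvelopingAlgebra.ι K x)
      (UniversalEnvelopingAlgebra.ι K y) := by
    intro x y h
    rw [commute_iff_lie_eq, ← LieHom.map_lie, h, map_zero]
  let G : ADT K 𝔥 k →ₐ[K] UniversalEnvelopingAlgebra K (Slots 𝔥 k) :=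
    adtLift 𝔥 (fun i => ueaMap (legLie 𝔥 i)) (ueaMap (LieHom.inr K (Fin k → 𝔤) 𝔥))
      (fun i j hij => uea_commute_commute _ _ fun x y => by
        rw [ueaMap_ι, ueaMap_ι]; exact hcomm _ _ (hleg i j hij x y))
      (fun i => uea_commute_commute _ _ fun x y => by
        rw [ueaMap_ι, ueaMap_ι]; exact hcomm _ _ (htail i x y))
  have h1 : (ofSlots 𝔥 k).comp G = AlgHom.id K _ := by
    apply adt_hom_ext
    · intro i x
      rw [AlgHom.comp_apply, adtLift_leg, ueaMap_ι, ofSlots_ι]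
      exact letter_legVec 𝔥 i x
    · intro y
      rw [AlgHom.comp_apply, adtLift_tail, ueaMap_ι, ofSlots_ι]
      exact letter_tailVec 𝔥 k y
  have h2 : G.comp (ofSlots 𝔥 k) = AlgHom.id K _ := by
    apply UniversalEnvelopingAlgebra.hom_ext
    refine LieHom.ext fun v => ?_
    change G (ofSlots 𝔥 k (UniversalEnvelopingAlgebra.ι K v)) = UniversalEnvelopingAlgebra.ι K v
    rw [ofSlots_ι, letter_apply, map_add, map_sum]
    simp only [G, adtLift_leg, adtLift_tail, ueaMap_ι]
    conv_rhs => rw [slots_eq_sum 𝔥 v, map_add, map_sum]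
    rfl
  exact ⟨Function.LeftInverse.injective (g := G) fun x => congrArg (fun F => F x) h2,
    Function.RightInverse.surjective (g := G) fun x => congrArg (fun F => F x) h1⟩

/-! ### Maps between the slots -/

/-- The map `𝔤ᵏ × 𝔥 → 𝔤ⁿ × 𝔥` underlying the superscript notation. -/
def slotMap (k n : ℕ) (f : ℕ → ℕ) : Slots 𝔥 k →ₗ[K] Slots 𝔥 n :=
  LinearMap.prod (LinearMap.pi fun l : Fin n =>
    if h : f l < k then LinearMap.proj (⟨f l, h⟩ : Fin k) ∘ₗ LinearMap.fst K _ _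
    else if f l = k then 𝔥.toSubmodule.subtype ∘ₗ LinearMap.snd K _ _ else 0) (LinearMap.snd K _ _)

theorem slotMap_snd (k n : ℕ) (f : ℕ → ℕ) (v : Slots 𝔥 k) : (slotMap 𝔥 k n f v).2 = v.2 := rfl

theorem slotMap_fst (k n : ℕ) (f : ℕ → ℕ) (v : Slots 𝔥 k) (l : Fin n) :
    (slotMap 𝔥 k n f v).1 l =
      if h : f l < k then v.1 ⟨f l, h⟩ else if f l = k then (v.2 : 𝔤) else 0 := by
  change (if h : f l < k then LinearMap.proj (⟨f l, h⟩ : Fin k) ∘ₗ LinearMap.fst K _ _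
    else if f l = k then 𝔥.toSubmodule.subtype ∘ₗ LinearMap.snd K _ _ else 0 :
      Slots 𝔥 k →ₗ[K] 𝔤) v = _
  split_ifs <;> rfl

theorem pull_letter (k n : ℕ) (f : ℕ → ℕ) (v : Slots 𝔥 k) :
    pull 𝔥 k n f (letter 𝔥 k v) = letter 𝔥 n (slotMap 𝔥 k n f v) := by
  rw [letter_apply, letter_apply, map_add, map_sum]
  simp only [pull_leg_ι, pull_tail_ι, slotMap_snd]
  rw [← add_assoc]
  congr 1
  have h1 : ∀ l : Fin n, leg K 𝔥 l (UniversalEnvelopingAlgebra.ι K ((slotMap 𝔥 k n f v).1 l)) =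
      ∑ i : Fin k, (if f l = i then leg K 𝔥 l (UniversalEnvelopingAlgebra.ι K (v.1 i)) else 0) +
        if f l = k then leg K 𝔥 l (UniversalEnvelopingAlgebra.ι K (v.2 : 𝔤)) else 0 := by
    intro l
    rw [slotMap_fst]
    by_cases h : f l < k
    · rw [dif_pos h, if_neg h.ne, add_zero, Finset.sum_eq_single_of_mem ⟨f l, h⟩ (Finset.mem_univ _)]
      · simp
      · intro i _ hi
        rw [if_neg]
        rintro h'
        exact hi (Fin.ext h'.symm)
    · rw [dif_neg h, Finset.sum_eq_zero, zero_add]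
      · split_ifs <;> simp
      · intro i _
        rw [if_neg]
        have := i.2
        omega
  simp only [h1, Finset.sum_add_distrib]
  rw [Finset.sum_comm]
  simp only [fiber, Finset.sum_filter]

variable (𝔪 : Submodule K 𝔤) (hc : IsCompl 𝔥.toSubmodule 𝔪)

/-- The projection of `𝔤ᵏ × 𝔥` onto `𝔪ᵏ`. -/
def slotPr (k : ℕ) : Slots 𝔥 k →ₗ[K] Slots 𝔥 k :=
  LinearMap.prodMap (LinearMap.pi fun i => prM 𝔥 𝔪 hc ∘ₗ LinearMap.proj i) 0

theorem slotPr_apply (k : ℕ) (v : Slots 𝔥 k) :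
    slotPr 𝔥 𝔪 hc k v = (fun i => prM 𝔥 𝔪 hc (v.1 i), 0) := rfl

theorem slotPr_slotPr (k : ℕ) (v : Slots 𝔥 k) :
    slotPr 𝔥 𝔪 hc k (slotPr 𝔥 𝔪 hc k v) = slotPr 𝔥 𝔪 hc k v := by
  simp [slotPr_apply, prM_prM]

/-- Position maps copy entries, and the entries copied from the last slot lie in `𝔥`, which the
projection kills. -/
theorem slotPr_slotMap (k n : ℕ) (f : ℕ → ℕ) (v : Slots 𝔥 k) :
    slotPr 𝔥 𝔪 hc n (slotMap 𝔥 k n f v) = slotMap 𝔥 k n f (slotPr 𝔥 𝔪 hc k v) := by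
  refine Prod.ext (funext fun l => ?_) rfl
  rw [slotMap_fst]
  change prM 𝔥 𝔪 hc ((slotMap 𝔥 k n f v).1 l) = _
  rw [slotMap_fst]
  split_ifs
  · rfl
  · exact (prM_eq_zero_iff 𝔥 𝔪 hc).2 v.2.2
  · exact map_zero _

/-- The adjoint action of `𝔥` on the slots. -/
def slotAd (k : ℕ) (y : 𝔥) : Slots 𝔥 k →ₗ[K] Slots 𝔥 k :=
  LieAlgebra.ad K (Slots 𝔥 k) (fun _ => (y : 𝔤), y)

theorem slotAd_apply (k : ℕ) (y : 𝔥) (v : Slots 𝔥 k) :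
    slotAd 𝔥 k y v = (fun i => ⁅(y : 𝔤), v.1 i⁆, ⁅y, v.2⁆) := rfl

theorem slotAd_slotMap (k n : ℕ) (f : ℕ → ℕ) (y : 𝔥) (v : Slots 𝔥 k) :
    slotAd 𝔥 n y (slotMap 𝔥 k n f v) = slotMap 𝔥 k n f (slotAd 𝔥 k y v) := by
  refine Prod.ext (funext fun l => ?_) rfl
  rw [slotMap_fst]
  change ⁅(y : 𝔤), (slotMap 𝔥 k n f v).1 l⁆ = _
  rw [slotMap_fst]
  split_ifs
  · rfl
  · rfl
  · exact lie_zero _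

theorem letter_slotAd (k : ℕ) (y : 𝔥) (v : Slots 𝔥 k) : letter 𝔥 k (slotAd 𝔥 k y v) =
    total 𝔥 k y * letter 𝔥 k v - letter 𝔥 k v * total 𝔥 k y := by
  have : total 𝔥 k y = letter 𝔥 k (fun _ => (y : 𝔤), y) := by rw [total_eq, letter_apply]
  rw [this, ← letter_lie]
  rfl

-- The one place where `[𝔥, 𝔪] ⊂ 𝔪` enters directly. The equivariance of `Psi`, of the projection
-- and of the homotopy all derive from it.
include hc in
theorem prM_lie (hm : ∀ x ∈ 𝔥, ∀ y ∈ 𝔪, ⁅x, y⁆ ∈ 𝔪) (y : 𝔥) (x : 𝔤) :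
    prM 𝔥 𝔪 hc ⁅(y : 𝔤), x⁆ = ⁅(y : 𝔤), prM 𝔥 𝔪 hc x⁆ := by
  have h : x = prM 𝔥 𝔪 hc x + compl (prM 𝔥 𝔪 hc) x := by simp
  have h1 : ⁅(y : 𝔤), compl (prM 𝔥 𝔪 hc) x⁆ ∈ 𝔥 := 𝔥.lie_mem y.2 (compl_prM_mem 𝔥 𝔪 hc x)
  conv_lhs => rw [h, lie_add, map_add, prM_of_mem 𝔥 𝔪 hc (hm _ y.2 _ (prM_mem 𝔥 𝔪 hc x)),
    (prM_eq_zero_iff 𝔥 𝔪 hc).2 h1, add_zero]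

include hc in
theorem slotPr_slotAd (hm : ∀ x ∈ 𝔥, ∀ y ∈ 𝔪, ⁅x, y⁆ ∈ 𝔪) (k : ℕ) (y : 𝔥) (v : Slots 𝔥 k) :
    slotPr 𝔥 𝔪 hc k (slotAd 𝔥 k y v) = slotAd 𝔥 k y (slotPr 𝔥 𝔪 hc k v) := by
  simp only [slotPr_apply, slotAd_apply, prM_lie 𝔥 𝔪 hc hm, lie_zero]

/-! ### The symmetrization map -/

variable [CharZero K]

/-- The symmetrization map `S (𝔤ᵏ × 𝔥) → ⊗ᵏ U𝔤 ⊗ U𝔥` adapted to `𝔤 = 𝔪 ⊕ 𝔥`. -/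
def Psi (k : ℕ) : SymmetricAlgebra K (Slots 𝔥 k) →ₗ[K] ADT K 𝔥 k :=
  psi (slotPr 𝔥 𝔪 hc k) (letter 𝔥 k)

theorem Psi_bijective (k : ℕ) : Function.Bijective (Psi 𝔥 𝔪 hc k) := by
  have h : ⇑(Psi 𝔥 𝔪 hc k) = ofSlots 𝔥 k ∘ psi (slotPr 𝔥 𝔪 hc k) ιU := by
    funext w
    have : (ofSlots 𝔥 k).toLinearMap ∘ₗ ιU = letter 𝔥 k := by
      refine LinearMap.ext fun v => ofSlots_ι 𝔥 k v
    rw [Function.comp_apply, map_psi, this]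
    rfl
  rw [h]
  exact (ofSlots_bijective 𝔥 k).comp (psi_bijective (slotPr_slotPr 𝔥 𝔪 hc k))

/-- Letters are mapped linearly to letters, and the splitting is preserved; so the naturality of
symmetrization turns coproducts into substitutions in symmetric algebras. -/
theorem pull_Psi (k n : ℕ) (f : ℕ → ℕ) (w : SymmetricAlgebra K (Slots 𝔥 k)) :
    pull 𝔥 k n f (Psi 𝔥 𝔪 hc k w) = Psi 𝔥 𝔪 hc n (smap (slotMap 𝔥 k n f) w) := by
  rw [Psi, Psi, map_psi, psi_smap _ (slotPr_slotMap 𝔥 𝔪 hc k n f)]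
  congr 2
  exact LinearMap.ext fun v => pull_letter 𝔥 k n f v

theorem Psi_deriv (hm : ∀ x ∈ 𝔥, ∀ y ∈ 𝔪, ⁅x, y⁆ ∈ 𝔪) (k : ℕ) (y : 𝔥)
    (w : SymmetricAlgebra K (Slots 𝔥 k)) : Psi 𝔥 𝔪 hc k (deriv (slotAd 𝔥 k y) w) =
      total 𝔥 k y * Psi 𝔥 𝔪 hc k w - Psi 𝔥 𝔪 hc k w * total 𝔥 k y :=
  psi_deriv (slotPr_slotPr 𝔥 𝔪 hc k) _ (slotPr_slotAd 𝔥 𝔪 hc hm k y) (letter_slotAd 𝔥 k y) w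

theorem inv_Psi_iff (hm : ∀ x ∈ 𝔥, ∀ y ∈ 𝔪, ⁅x, y⁆ ∈ 𝔪) (k : ℕ)
    (w : SymmetricAlgebra K (Slots 𝔥 k)) :
    Inv 𝔥 k (Psi 𝔥 𝔪 hc k w) ↔ ∀ y, deriv (slotAd 𝔥 k y) w = 0 := by
  refine forall_congr' fun y => ?_
  rw [← (Psi_bijective 𝔥 𝔪 hc k).1.eq_iff, map_zero, Psi_deriv 𝔥 𝔪 hc hm, sub_eq_zero]
  rfl

end

section

set_option linter.unusedSectionVars false

/-! ## The projection onto `T^*U𝔪` -/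

open SymmetricAlgebra (ι)

variable {K : Type*} [Field K] {𝔤 : Type*} [LieRing 𝔤] [LieAlgebra K 𝔤] (𝔥 : LieSubalgebra K 𝔤)

/-- The left ideal of `⊗ᵏ U𝔤 ⊗ U𝔥` generated by the copies of `𝔥` in all tensor factors. -/
def hIdeal (k : ℕ) : Ideal (ADT K 𝔥 k) :=
  Ideal.span (Set.range (fun z : Fin k × 𝔥 =>
      leg K 𝔥 z.1 (UniversalEnvelopingAlgebra.ι K (z.2 : 𝔤))) ∪
    Set.range fun y : 𝔥 => tail K 𝔥 k (UniversalEnvelopingAlgebra.ι K y))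

theorem leg_mem_hIdeal {k : ℕ} (i : Fin k) (y : 𝔥) :
    leg K 𝔥 i (UniversalEnvelopingAlgebra.ι K (y : 𝔤)) ∈ hIdeal 𝔥 k :=
  Ideal.subset_span (Or.inl ⟨(i, y), rfl⟩)

theorem tail_mem_hIdeal {k : ℕ} (y : 𝔥) :
    tail K 𝔥 k (UniversalEnvelopingAlgebra.ι K y) ∈ hIdeal 𝔥 k :=
  Ideal.subset_span (Or.inr ⟨y, rfl⟩)

theorem total_mem_hIdeal {k : ℕ} (y : 𝔥) : total 𝔥 k y ∈ hIdeal 𝔥 k := by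
  rw [total_eq]
  exact Ideal.add_mem _ (sum_mem fun i _ => leg_mem_hIdeal 𝔥 i y) (tail_mem_hIdeal 𝔥 y)

theorem hIdeal_induction {k : ℕ} {p : ADT K 𝔥 k → Prop} (zero : p 0)
    (add : ∀ a b, p a → p b → p (a + b)) (mul : ∀ a b, p b → p (a * b))
    (leg : ∀ i (y : 𝔥), p (leg K 𝔥 i (UniversalEnvelopingAlgebra.ι K (y : 𝔤))))
    (tail : ∀ y, p (tail K 𝔥 k (UniversalEnvelopingAlgebra.ι K y)))
    {P : ADT K 𝔥 k} (hP : P ∈ hIdeal 𝔥 k) : p P := by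
  refine Submodule.span_induction (p := fun P _ => p P) ?_ zero (fun a b _ _ => add a b)
    (fun a b _ => mul a b) hP
  rintro _ (⟨⟨i, y⟩, rfl⟩ | ⟨y, rfl⟩)
  · exact leg i y
  · exact tail y

theorem pull_mem_hIdeal {k n : ℕ} (f : ℕ → ℕ) {P : ADT K 𝔥 k} (hP : P ∈ hIdeal 𝔥 k) :
    pull 𝔥 k n f P ∈ hIdeal 𝔥 n := by
  refine hIdeal_induction 𝔥 (p := fun P => pull 𝔥 k n f P ∈ hIdeal 𝔥 n) ?_ ?_ ?_ ?_ ?_ hP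
  · rw [map_zero]; exact zero_mem _
  · intro a b ha hb; rw [map_add]; exact add_mem ha hb
  · intro a b hb; rw [map_mul]; exact Ideal.mul_mem_left _ _ hb
  · intro i y; rw [pull_leg_ι]; exact sum_mem fun l _ => leg_mem_hIdeal 𝔥 l y
  · intro y
    rw [pull_tail_ι]
    exact add_mem (sum_mem fun l _ => leg_mem_hIdeal 𝔥 l y) (tail_mem_hIdeal 𝔥 y)

/-- The last tensor factor and the ones with positions in `I`, taken as a set of letters that is
stable under commutators with the diagonal copy of `𝔥`, can be moved past `P^{…}`. -/
theorem letter_mul_pull_mem {k n : ℕ} {f : ℕ → ℕ} (ℓ : 𝔥 → ADT K 𝔥 n)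
    (h1 : ∀ y i x, Commute (ℓ y) (pull 𝔥 k n f (leg K 𝔥 i (UniversalEnvelopingAlgebra.ι K x))))
    (h2 : ∀ y y', ℓ y * pull 𝔥 k n f (tail K 𝔥 k (UniversalEnvelopingAlgebra.ι K y')) =
      pull 𝔥 k n f (tail K 𝔥 k (UniversalEnvelopingAlgebra.ι K y')) * ℓ y + ℓ ⁅y, y'⁆)
    (h3 : ∀ y, ℓ y ∈ hIdeal 𝔥 n) (Q : ADT K 𝔥 k) (y : 𝔥) :
    ℓ y * pull 𝔥 k n f Q ∈ hIdeal 𝔥 n := by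
  -- The extra right factor `X` lets the induction pass through products in `Q`.
  have key : ∀ X, (∀ y, ℓ y * X ∈ hIdeal 𝔥 n) → ∀ y, ℓ y * (pull 𝔥 k n f Q * X) ∈ hIdeal 𝔥 n := by
    induction Q using adt_induction with
    | algebraMap r =>
      intro X hX y
      rw [AlgHom.commutes, ← mul_assoc, ← Algebra.commutes, mul_assoc]
      exact Ideal.mul_mem_left _ _ (hX y)
    | leg i x =>
      intro X hX y
      rw [← mul_assoc, (h1 y i x).eq, mul_assoc]
      exact Ideal.mul_mem_left _ _ (hX y)
    | tail y' =>
      intro X hX y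
      rw [← mul_assoc, h2, add_mul, mul_assoc]
      exact add_mem (Ideal.mul_mem_left _ _ (hX y)) (hX _)
    | mul a b ha hb =>
      intro X hX y
      rw [map_mul, mul_assoc]
      exact ha _ (hb X hX) y
    | add a b ha hb =>
      intro X hX y
      rw [map_add, add_mul, mul_add]
      exact add_mem (ha X hX y) (hb X hX y)
  have := key 1 (fun y => by rw [mul_one]; exact h3 y) y
  rwa [mul_one] at this

theorem ι_mul_ι_eq {L : Type*} [LieRing L] [LieAlgebra K L] (x y : L) :
    UniversalEnvelopingAlgebra.ι K x * UniversalEnvelopingAlgebra.ι K y =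
      UniversalEnvelopingAlgebra.ι K y * UniversalEnvelopingAlgebra.ι K x +
        UniversalEnvelopingAlgebra.ι K ⁅x, y⁆ := by
  rw [LieHom.map_lie, LieRing.of_associative_ring_bracket]; abel

theorem tail_mul_pull_mem {k n : ℕ} (f : ℕ → ℕ) (Q : ADT K 𝔥 k) (y : 𝔥) :
    tail K 𝔥 n (UniversalEnvelopingAlgebra.ι K y) * pull 𝔥 k n f Q ∈ hIdeal 𝔥 n := by
  refine letter_mul_pull_mem 𝔥 (fun y => tail K 𝔥 n (UniversalEnvelopingAlgebra.ι K y)) ?_ ?_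
    (tail_mem_hIdeal 𝔥) Q y
  · intro y i x
    rw [pull_leg_ι]
    exact Commute.sum_right _ _ _ fun l _ => (leg_tail_commute K 𝔥 l _ _).symm
  · intro y y'
    rw [pull_tail_ι, mul_add, add_mul,
      (Commute.sum_right _ _ _ fun l _ => (leg_tail_commute K 𝔥 l _ _).symm : Commute
        (tail K 𝔥 n (UniversalEnvelopingAlgebra.ι K y)) (∑ l ∈ fiber n f k, _)).eq,
      ← map_mul, ι_mul_ι_eq, map_add, map_mul, add_assoc]

theorem leg_mul_pull_mem {k n : ℕ} {f : ℕ → ℕ} (Q : ADT K 𝔥 k) {l : Fin n} (hl : f l = k) (y : 𝔥) :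
    leg K 𝔥 l (UniversalEnvelopingAlgebra.ι K (y : 𝔤)) * pull 𝔥 k n f Q ∈ hIdeal 𝔥 n := by
  refine letter_mul_pull_mem 𝔥
    (fun y => leg K 𝔥 l (UniversalEnvelopingAlgebra.ι K (y : 𝔤))) ?_ ?_ (leg_mem_hIdeal 𝔥 l) Q y
  · intro y i x
    rw [pull_leg_ι]
    refine Commute.sum_right _ _ _ fun l' hl' => leg_commute K 𝔥 ?_ _ _
    rintro rfl
    rw [mem_fiber] at hl'
    have := i.2
    omega
  · intro y y'
    have hc : Commute (leg K 𝔥 l (UniversalEnvelopingAlgebra.ι K (y : 𝔤)))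
        (∑ l' ∈ (fiber n f k).erase l, leg K 𝔥 l' (UniversalEnvelopingAlgebra.ι K (y' : 𝔤)) +
          tail K 𝔥 n (UniversalEnvelopingAlgebra.ι K y')) :=
      Commute.add_right (Commute.sum_right _ _ _ fun l' hl' =>
        leg_commute K 𝔥 (Finset.mem_erase.1 hl').1.symm _ _) (leg_tail_commute K 𝔥 l _ _)
    rw [pull_tail_ι, ← Finset.add_sum_erase _ _ (mem_fiber.2 hl), add_assoc, mul_add, add_mul, hc.eq,
      ← map_mul, ι_mul_ι_eq, map_add, map_mul, LieSubalgebra.coe_bracket]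
    abel

/-- The left ideals `hIdeal` are stable under partial composition with an invariant element. -/
theorem circ_mem_hIdeal_left {p q n i : ℕ} {P : ADT K 𝔥 p} {Q : ADT K 𝔥 q}
    (hi : i < p) (hP : P ∈ hIdeal 𝔥 p) (hQ : Inv 𝔥 q Q) :
    circ 𝔥 p q n i P Q ∈ hIdeal 𝔥 n := by
  have hlast : ∀ y : 𝔥, ∑ l ∈ Finset.univ.filter (fun l : Fin n => i + q ≤ (l : ℕ)),
      leg K 𝔥 l (UniversalEnvelopingAlgebra.ι K (y : 𝔤)) * pull 𝔥 q n (inner i q) Q ∈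
        hIdeal 𝔥 n := fun y => sum_mem fun l hl => leg_mul_pull_mem 𝔥 Q (by
    have := (Finset.mem_filter.1 hl).2
    simp only [inner]
    split_ifs <;> omega) y
  refine hIdeal_induction 𝔥 (p := fun P => circ 𝔥 p q n i P Q ∈ hIdeal 𝔥 n) ?_ ?_ ?_ ?_ ?_ hP
  · rw [circ, map_zero, zero_mul]; exact zero_mem _
  · intro a b ha hb; rw [circ, map_add, add_mul]; exact add_mem ha hb
  · intro a b hb; rw [circ, map_mul, mul_assoc]; exact Ideal.mul_mem_left _ _ hb
  · intro j y
    rw [circ, pull_leg_ι]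
    rcases lt_trichotomy (j : ℕ) i with hj | hj | hj
    · rw [Finset.sum_mul]
      refine sum_mem fun l hl => ?_
      have hl' : q < inner i q l := by
        rw [mem_fiber] at hl
        simp only [inner, outer] at hl ⊢
        split_ifs at hl ⊢ <;> omega
      rw [(leg_commute_pull 𝔥 hl' _ Q).eq]
      exact Ideal.mul_mem_left _ _ (leg_mem_hIdeal 𝔥 l y)
    -- A letter spread over the block of `Q` equals the total of `y` on `Q` minus the copies to the
    -- right of the block and in the last factor. The total commutes with `Q` by invariance; the
    -- other copies belong to the last index set of `Q` and can be moved past it modulo the ideal.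
    · have h := pull_total 𝔥 (k := q) (n := n) (inner i q) y
      have h' : total 𝔥 n y = ∑ l ∈ Finset.univ.filter (fun l : Fin n => q < inner i q l),
            leg K 𝔥 l (UniversalEnvelopingAlgebra.ι K (y : 𝔤)) +
          (∑ l ∈ fiber n (outer i q) j, leg K 𝔥 l (UniversalEnvelopingAlgebra.ι K (y : 𝔤)) +
          ∑ l ∈ Finset.univ.filter (fun l : Fin n => i + q ≤ (l : ℕ)),
            leg K 𝔥 l (UniversalEnvelopingAlgebra.ι K (y : 𝔤)) +
          tail K 𝔥 n (UniversalEnvelopingAlgebra.ι K y)) := by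
        rw [total_eq, ← add_assoc, ← add_assoc]
        congr 1
        rw [← Finset.sum_union, ← Finset.sum_union]
        · refine Finset.sum_congr ?_ fun _ _ => rfl
          ext l
          simp only [Finset.mem_union, Finset.mem_filter, Finset.mem_univ, true_and, mem_fiber,
            true_iff]
          simp only [inner, outer]
          split_ifs <;> omega
        · refine Finset.disjoint_left.2 fun l h1 h2 => ?_
          simp only [Finset.mem_union, Finset.mem_filter, Finset.mem_univ, true_and, mem_fiber]
            at h1 h2
          simp only [inner, outer] at h1 h2
          split_ifs at h1 h2 <;> omega
        · refine Finset.disjoint_left.2 fun l h1 h2 => ?_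
          simp only [Finset.mem_filter, Finset.mem_univ, true_and, mem_fiber]
            at h1 h2
          simp only [inner, outer] at h1 h2
          split_ifs at h1 h2 <;> omega
      have h'' : ∑ l ∈ fiber n (outer i q) j, leg K 𝔥 l (UniversalEnvelopingAlgebra.ι K (y : 𝔤)) =
          pull 𝔥 q n (inner i q) (total 𝔥 q y) -
          (∑ l ∈ Finset.univ.filter (fun l : Fin n => i + q ≤ (l : ℕ)),
            leg K 𝔥 l (UniversalEnvelopingAlgebra.ι K (y : 𝔤)) +
          tail K 𝔥 n (UniversalEnvelopingAlgebra.ι K y)) := by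
        rw [h'] at h
        rw [eq_sub_iff_add_eq, ← add_assoc]
        exact (add_right_cancel (h.trans (add_comm _ _))).symm
      rw [h'', sub_mul, ← map_mul, (hQ y).eq, map_mul, add_mul, Finset.sum_mul]
      exact sub_mem (Ideal.mul_mem_left _ _ (pull_mem_hIdeal 𝔥 _ (total_mem_hIdeal 𝔥 y)))
        (add_mem (hlast y) (tail_mul_pull_mem 𝔥 _ Q y))
    · rw [Finset.sum_mul]
      refine sum_mem fun l hl => leg_mul_pull_mem 𝔥 Q ?_ y
      rw [mem_fiber] at hl
      simp only [inner, outer] at hl ⊢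
      split_ifs at hl ⊢ <;> omega
  · intro y
    rw [circ, pull_tail_ι, add_mul, Finset.sum_mul]
    refine add_mem (sum_mem fun l hl => leg_mul_pull_mem 𝔥 Q ?_ y) (tail_mul_pull_mem 𝔥 _ Q y)
    rw [mem_fiber] at hl
    simp only [inner, outer] at hl ⊢
    split_ifs at hl ⊢ <;> omega

theorem circ_mem_hIdeal_right {p q n i : ℕ} (P : ADT K 𝔥 p) {Q : ADT K 𝔥 q} (hQ : Q ∈ hIdeal 𝔥 q) :
    circ 𝔥 p q n i P Q ∈ hIdeal 𝔥 n :=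
  Ideal.mul_mem_left _ _ (pull_mem_hIdeal 𝔥 _ hQ)

/-! ### The projection in each degree -/

variable (𝔪 : Submodule K 𝔤)

/-- The map `(⊗ᵏ p) ⊗ ε`. -/
def degPr (k : ℕ) : ADT K 𝔥 k →ₗ[K] ADT K 𝔥 k :=
  (toADT K 𝔥 k).toLinearMap ∘ₗ
    TensorProduct.map (PiTensorProduct.map fun _ : Fin k => proj K 𝔥 𝔪)
      (unitCounit K 𝔥).toLinearMap ∘ₗ
    (toADT K 𝔥 k).symm.toLinearMap

theorem projTot_lf (k : ℕ) (P : ADT K 𝔥 k) :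
    projTot K 𝔥 𝔪 (lf 𝔥 k P) = lf 𝔥 k (degPr 𝔥 𝔪 k P) := by
  rw [projTot, DirectSum.toModule_lof]
  rfl

theorem projTot_apply (x : ADTTot K 𝔥) (k : ℕ) : projTot K 𝔥 𝔪 x k = degPr 𝔥 𝔪 k (x k) := by
  induction x using tot_induction with
  | zero => simp
  | add x y hx hy => rw [map_add, DirectSum.add_apply, DirectSum.add_apply, map_add, hx, hy]
  | lf l P =>
    rw [projTot_lf]
    by_cases h : l = k
    · subst h; rw [lf_apply_self, lf_apply_self]
    · rw [lf_apply_of_ne 𝔥 h, lf_apply_of_ne 𝔥 h, map_zero]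

theorem degPr_tmul (k : ℕ) (u : Fin k → UniversalEnvelopingAlgebra K 𝔤)
    (v : UniversalEnvelopingAlgebra K 𝔥) :
    degPr 𝔥 𝔪 k (toADT K 𝔥 k (PiTensorProduct.tprod K u ⊗ₜ[K] v)) =
      toADT K 𝔥 k (PiTensorProduct.tprod K (fun i => proj K 𝔥 𝔪 (u i)) ⊗ₜ[K] unitCounit K 𝔥 v) := by
  change toADT K 𝔥 k (TensorProduct.map _ _ (PiTensorProduct.tprod K u ⊗ₜ[K] v)) = _
  rw [TensorProduct.map_tmul, PiTensorProduct.map_tprod]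
  rfl

theorem leg_eq_tmul {k : ℕ} (i : Fin k) (u : UniversalEnvelopingAlgebra K 𝔤) : leg K 𝔥 i u =
    toADT K 𝔥 k (PiTensorProduct.tprod K (Pi.mulSingle i u) ⊗ₜ[K] 1) := rfl

theorem tail_eq_tmul (k : ℕ) (v : UniversalEnvelopingAlgebra K 𝔥) : tail K 𝔥 k v =
    toADT K 𝔥 k (PiTensorProduct.tprod K (fun _ => 1) ⊗ₜ[K] v) := rfl

theorem tmul_mul_tmul (k : ℕ) (u u' : Fin k → UniversalEnvelopingAlgebra K 𝔤)
    (v v' : UniversalEnvelopingAlgebra K 𝔥) :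
    toADT K 𝔥 k (PiTensorProduct.tprod K u ⊗ₜ[K] v) *
      toADT K 𝔥 k (PiTensorProduct.tprod K u' ⊗ₜ[K] v') =
    toADT K 𝔥 k (PiTensorProduct.tprod K (u * u') ⊗ₜ[K] (v * v')) := by
  rw [← map_mul, Algebra.TensorProduct.tmul_mul_tmul, PiTensorProduct.tprod_mul_tprod]

variable (hc : IsCompl (Um K 𝔪) (Ugh K 𝔥))

include hc

theorem proj_eq : proj K 𝔥 𝔪 = (Um K 𝔪).projection (Ugh K 𝔥) hc := dif_pos hc

/-- Right multiplication by a letter of `𝔥` puts a tensor factor into `U𝔤 · 𝔥`, or the last one into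
the kernel of the counit. The left factor `X` is carried along because the ideal is a left one. -/
theorem degPr_eq_zero {k : ℕ} {P : ADT K 𝔥 k} (hP : P ∈ hIdeal 𝔥 k) : degPr 𝔥 𝔪 k P = 0 := by
  have key : ∀ X, degPr 𝔥 𝔪 k (X * P) = 0 := by
    refine hIdeal_induction 𝔥 (p := fun P => ∀ X, degPr 𝔥 𝔪 k (X * P) = 0) ?_ ?_ ?_ ?_ ?_ hP
    · intro X; rw [mul_zero, map_zero]
    · intro a b ha hb X; rw [mul_add, map_add, ha, hb, add_zero]
    · intro a b hb X; rw [← mul_assoc]; exact hb _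
    · intro i y X
      have : degPr 𝔥 𝔪 k ∘ₗ LinearMap.mulRight K
          (leg K 𝔥 i (UniversalEnvelopingAlgebra.ι K (y : 𝔤))) = 0 := by
        apply adt_linear_ext
        intro u v
        rw [LinearMap.comp_apply, LinearMap.mulRight_apply, leg_eq_tmul, tmul_mul_tmul, degPr_tmul,
          (PiTensorProduct.tprod K).map_coord_zero i, TensorProduct.zero_tmul, map_zero]
        · rfl
        · rw [Pi.mul_apply, Pi.mulSingle_eq_same, proj_eq 𝔥 𝔪 hc,
            Submodule.projection_apply_eq_zero_iff]
          exact Ideal.mul_mem_left _ _ (Ideal.subset_span ⟨y, y.2, rfl⟩)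
      exact congrArg (fun F => F X) this
    · intro y X
      have : degPr 𝔥 𝔪 k ∘ₗ LinearMap.mulRight K
          (tail K 𝔥 k (UniversalEnvelopingAlgebra.ι K y)) = 0 := by
        apply adt_linear_ext
        intro u v
        have h : unitCounit K 𝔥 (UniversalEnvelopingAlgebra.ι K y) = 0 := by
          rw [unitCounit, AlgHom.comp_apply, UniversalEnvelopingAlgebra.lift_ι_apply]
          exact map_zero _
        rw [LinearMap.comp_apply, LinearMap.mulRight_apply, tail_eq_tmul, tmul_mul_tmul, degPr_tmul,
          map_mul (unitCounit K 𝔥), h, mul_zero, TensorProduct.tmul_zero, map_zero]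
        rfl
      exact congrArg (fun F => F X) this
  simpa using key 1

omit hc

/-- The degree `k` part of `T^*U𝔪`. -/
def degTUm (k : ℕ) : Submodule K (ADT K 𝔥 k) := LinearMap.range
    ((toADT K 𝔥 k).toLinearMap ∘ₗ (TensorProduct.mk K (⨂[K] _ : Fin k, UniversalEnvelopingAlgebra K 𝔤)
        (UniversalEnvelopingAlgebra K 𝔥)).flip 1 ∘ₗ
      PiTensorProduct.map fun _ : Fin k => (Um K 𝔪).subtype)

theorem mem_TUm {x : ADTTot K 𝔥} : x ∈ TUm K 𝔥 𝔪 ↔ ∀ k, x k ∈ degTUm 𝔥 𝔪 k := Iff.rfl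

theorem tmul_mem_degTUm {k : ℕ} {u : Fin k → UniversalEnvelopingAlgebra K 𝔤}
    (hu : ∀ i, u i ∈ Um K 𝔪) :
    toADT K 𝔥 k (PiTensorProduct.tprod K u ⊗ₜ[K] 1) ∈ degTUm 𝔥 𝔪 k := by
  refine ⟨PiTensorProduct.tprod K fun i => ⟨u i, hu i⟩, ?_⟩
  rw [LinearMap.comp_apply, LinearMap.comp_apply, PiTensorProduct.map_tprod]
  rfl

include hc in
theorem degPr_of_mem {k : ℕ} {P : ADT K 𝔥 k} (hP : P ∈ degTUm 𝔥 𝔪 k) : degPr 𝔥 𝔪 k P = P := by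
  obtain ⟨z, rfl⟩ := hP
  induction z using PiTensorProduct.induction_on with
  | smul_tprod r u =>
    rw [map_smul, map_smul]
    congr 1
    rw [LinearMap.comp_apply, LinearMap.comp_apply, PiTensorProduct.map_tprod]
    refine (degPr_tmul 𝔥 𝔪 k _ 1).trans ?_
    rw [map_one]
    simp only [proj_eq 𝔥 𝔪 hc, Submodule.subtype_apply, Submodule.projection_apply_left]
    rfl
  | add x y hx hy => rw [map_add, map_add, hx, hy]

variable [CharZero K]

/-- The legs commute, so the binomial theorem produces tensors of powers of elements of `𝔪`. The
condition outside `s` ensures that a newly added leg meets the entry `1`, so no product of two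
powers arises there. -/
theorem sum_leg_pow_mem {k : ℕ} (x : Fin k → 𝔪) (s : Finset (Fin k)) (n : ℕ) :
    (∑ i ∈ s, leg K 𝔥 i (UniversalEnvelopingAlgebra.ι K (x i : 𝔤))) ^ n ∈
      Submodule.span K {P | ∃ u : Fin k → UniversalEnvelopingAlgebra K 𝔤, (∀ i, u i ∈ Um K 𝔪) ∧
        (∀ i ∉ s, u i = 1) ∧ P = toADT K 𝔥 k (PiTensorProduct.tprod K u ⊗ₜ[K] 1)} := by
  have h1 : (1 : UniversalEnvelopingAlgebra K 𝔤) ∈ Um K 𝔪 := by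
    simpa using pow_mem_Um 𝔪 𝔪.zero_mem 0
  induction s using Finset.induction_on generalizing n with
  | empty =>
    rw [Finset.sum_empty]
    cases n with
    | zero => exact Submodule.subset_span ⟨fun _ => 1, fun _ => h1, fun _ _ => rfl, rfl⟩
    | succ n => rw [zero_pow n.succ_ne_zero]; exact zero_mem _
  | insert a s ha ih =>
    rw [Finset.sum_insert ha, (Commute.sum_right _ _ _ fun i hi => leg_commute K 𝔥
      (by rintro rfl; exact ha hi) _ _ : Commute (leg K 𝔥 a _) (∑ i ∈ s, _)).add_pow]
    refine sum_mem fun m _ => ?_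
    rw [← nsmul_eq_mul']
    refine nsmul_mem ?_ _
    rw [← map_pow]
    generalize (∑ i ∈ s, leg K 𝔥 i (UniversalEnvelopingAlgebra.ι K (x i : 𝔤))) ^ (n - m) = X,
      ih (n - m) = hX
    refine Submodule.span_induction (p := fun X _ => leg K 𝔥 a _ * X ∈ _) ?_ ?_ ?_ ?_ hX
    · rintro _ ⟨u, hu, hu', rfl⟩
      refine Submodule.subset_span ⟨Pi.mulSingle a (UniversalEnvelopingAlgebra.ι K (x a : 𝔤) ^ m) * u,
        fun i => ?_, fun i hi => ?_, ?_⟩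
      · by_cases h : i = a
        · subst h
          rw [Pi.mul_apply, Pi.mulSingle_eq_same, hu' i ha, mul_one]
          exact pow_mem_Um 𝔪 (x i).2 m
        · rw [Pi.mul_apply, Pi.mulSingle_eq_of_ne h, one_mul]
          exact hu i
      · rw [Finset.mem_insert, not_or] at hi
        rw [Pi.mul_apply, Pi.mulSingle_eq_of_ne hi.1, one_mul, hu' i hi.2]
      · rw [leg_eq_tmul, tmul_mul_tmul, one_mul]
    · rw [mul_zero]; exact zero_mem _
    · intro X Y _ _ hX hY; rw [mul_add]; exact add_mem hX hY
    · intro c X _ hX; rw [mul_smul_comm]; exact Submodule.smul_mem _ c hX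

variable (h𝔪 : IsCompl 𝔥.toSubmodule 𝔪)

theorem Psi_smap_mem_degTUm (k : ℕ) (w : SymmetricAlgebra K (Slots 𝔥 k)) :
    Psi 𝔥 𝔪 h𝔪 k (smap (slotPr 𝔥 𝔪 h𝔪 k) w) ∈ degTUm 𝔥 𝔪 k := by
  induction w using pow_induction with
  | zero => simp
  | add x y hx hy => rw [map_add, map_add]; exact Submodule.add_mem _ hx hy
  | smul c x hx => rw [map_smul, map_smul]; exact Submodule.smul_mem _ c hx
  | pow v n =>
    have := psi_pow (slotPr_slotPr 𝔥 𝔪 h𝔪 k) (letter 𝔥 k) (slotPr_slotPr 𝔥 𝔪 h𝔪 k v) (map_zero _) n 0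
    rw [pow_zero, mul_one, pow_zero, mul_one] at this
    rw [map_pow (smap _), smap_ι, Psi, this, letter_apply]
    have h : tail K 𝔥 k (UniversalEnvelopingAlgebra.ι K (slotPr 𝔥 𝔪 h𝔪 k v).2) = 0 := by
      rw [slotPr_apply, map_zero, map_zero]
    rw [h, add_zero]
    refine Submodule.span_le.2 ?_ (sum_leg_pow_mem 𝔥 𝔪 (fun i => ⟨prM 𝔥 𝔪 h𝔪 (v.1 i),
      prM_mem 𝔥 𝔪 h𝔪 _⟩) Finset.univ n)
    rintro _ ⟨u, hu, -, rfl⟩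
    exact tmul_mem_degTUm 𝔥 𝔪 hu

theorem Psi_sub_mem_hIdeal (k : ℕ) (w : SymmetricAlgebra K (Slots 𝔥 k)) :
    Psi 𝔥 𝔪 h𝔪 k w - Psi 𝔥 𝔪 h𝔪 k (smap (slotPr 𝔥 𝔪 h𝔪 k) w) ∈ hIdeal 𝔥 k := by
  refine psi_sub_mem (slotPr_slotPr 𝔥 𝔪 h𝔪 k) _ (fun v hv => ?_) w
  rw [letter_apply]
  refine add_mem (sum_mem fun i _ => ?_) (tail_mem_hIdeal 𝔥 _)
  have := congrFun (congrArg Prod.fst hv) i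
  exact leg_mem_hIdeal 𝔥 i ⟨_, (prM_eq_zero_iff 𝔥 𝔪 h𝔪).1 this⟩

/-- The two elements differ by an element of the left ideal, which the projection kills, and the
projected one already lies in `⊗ᵏ U𝔪`. Thus `(⊗ p) ⊗ ε` is a substitution in the symmetric picture.
-/
theorem degPr_Psi (k : ℕ) (w : SymmetricAlgebra K (Slots 𝔥 k)) :
    degPr 𝔥 𝔪 k (Psi 𝔥 𝔪 h𝔪 k w) = Psi 𝔥 𝔪 h𝔪 k (smap (slotPr 𝔥 𝔪 h𝔪 k) w) := by
  have hc := isCompl_Um_Ugh 𝔥 𝔪 h𝔪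
  have := degPr_eq_zero 𝔥 𝔪 hc (Psi_sub_mem_hIdeal 𝔥 𝔪 h𝔪 k w)
  rw [map_sub, sub_eq_zero] at this
  rw [this, degPr_of_mem 𝔥 𝔪 hc (Psi_smap_mem_degTUm 𝔥 𝔪 h𝔪 k w)]

end

section

set_option linter.unusedSectionVars false

/-! ## The differential graded Lie algebra `(T^*U𝔪)^𝔥[1]` -/

variable {K : Type*} [Field K] {𝔤 : Type*} [LieRing 𝔤] [LieAlgebra K 𝔤] (𝔥 : LieSubalgebra K 𝔤)

/-- The position maps of the terms of the coboundary operator. -/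
def face (k i l : ℕ) : ℕ := if l < i then l else if l = 0 then k + 1 else l - 1

/-- The coboundary operator on symmetric algebras. -/
def cob (k : ℕ) : SymmetricAlgebra K (Slots 𝔥 k) →ₗ[K] SymmetricAlgebra K (Slots 𝔥 (k + 1)) :=
  ∑ i ∈ Finset.range (k + 2), (-1 : ℤ) ^ i • (smap (slotMap 𝔥 k (k + 1) (face k i))).toLinearMap

/-- The elements of `ADT` with components in the left ideals generated by `𝔥`. -/
def hIdealTot : Submodule K (ADTTot K 𝔥) where
  carrier := {x | ∀ k, x k ∈ hIdeal 𝔥 k}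
  zero_mem' := fun _ => zero_mem _
  add_mem' := fun hx hy k => by rw [DirectSum.add_apply]; exact add_mem (hx k) (hy k)
  smul_mem' := fun c x hx k => by
    rw [DirectSum.smul_apply]; exact Submodule.smul_of_tower_mem _ c (hx k)

theorem lf_mem_hIdealTot {k : ℕ} {P : ADT K 𝔥 k} (hP : P ∈ hIdeal 𝔥 k) :
    lf 𝔥 k P ∈ hIdealTot 𝔥 := by
  intro l
  by_cases h : k = l
  · subst h; rwa [lf_apply_self]
  · rw [lf_apply_of_ne 𝔥 h]; exact zero_mem _

theorem braceTot_mem_hIdealTot_left {x y : ADTTot K 𝔥} (hx : x ∈ hIdealTot 𝔥)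
    (hy : y ∈ invariants K 𝔥) : braceTot 𝔥 x y ∈ hIdealTot 𝔥 := by
  refine inv_induction 𝔥 (p := fun y => braceTot 𝔥 x y ∈ hIdealTot 𝔥)
    (by rw [map_zero]; exact Submodule.zero_mem _)
    (fun a b ha hb => by rw [map_add]; exact Submodule.add_mem _ ha hb) (fun q Q hQ => ?_) hy
  obtain ⟨s, hs⟩ := sum_lf 𝔥 x
  rw [hs, map_sum, LinearMap.sum_apply]
  refine sum_mem fun p _ => ?_
  rw [braceTot_lf]
  refine sum_mem fun i hi => zsmul_mem (lf_mem_hIdealTot 𝔥 ?_) _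
  exact circ_mem_hIdeal_left 𝔥 (Finset.mem_range.1 hi) (hx p) hQ

theorem braceTot_mem_hIdealTot_right (x : ADTTot K 𝔥) {y : ADTTot K 𝔥} (hy : y ∈ hIdealTot 𝔥) :
    braceTot 𝔥 x y ∈ hIdealTot 𝔥 := by
  induction x using tot_induction with
  | zero => rw [map_zero]; exact zero_mem _
  | add a b ha hb => rw [map_add]; exact add_mem ha hb
  | lf p P =>
    obtain ⟨s, hs⟩ := sum_lf 𝔥 y
    rw [hs, map_sum]
    refine sum_mem fun q _ => ?_
    rw [braceTot_lf]
    exact sum_mem fun i _ => zsmul_mem (lf_mem_hIdealTot 𝔥 (circ_mem_hIdeal_right 𝔥 P (hy q))) _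

theorem lf_component_mem_hIdealTot {x : ADTTot K 𝔥} (hx : x ∈ hIdealTot 𝔥) (k : ℕ) :
    lf 𝔥 k (x k) ∈ hIdealTot 𝔥 := lf_mem_hIdealTot 𝔥 (hx k)

theorem lf_component_mem_invariants {x : ADTTot K 𝔥} (hx : x ∈ invariants K 𝔥) (k : ℕ) :
    lf 𝔥 k (x k) ∈ invariants K 𝔥 := lf_mem_invariants 𝔥 ((mem_invariants 𝔥).1 hx k)

/-- Both braces stay in the ideals: one because the other argument is invariant, the other because
the ideals are left ideals stable under coproducts. -/
theorem bracketTot_mem_hIdealTot_left {x y : ADTTot K 𝔥} (hx : x ∈ hIdealTot 𝔥)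
    (hy : y ∈ invariants K 𝔥) : bracketTot K 𝔥 x y ∈ hIdealTot 𝔥 := by
  obtain ⟨s, hs⟩ := sum_lf 𝔥 x
  obtain ⟨t, ht⟩ := sum_lf 𝔥 y
  rw [hs, ht, map_sum]
  refine sum_mem fun q _ => ?_
  rw [map_sum, LinearMap.sum_apply]
  refine sum_mem fun p _ => ?_
  rw [bracketTot_eq]
  exact sub_mem (braceTot_mem_hIdealTot_left 𝔥 (lf_component_mem_hIdealTot 𝔥 hx p)
    (lf_component_mem_invariants 𝔥 hy q))
    (zsmul_mem (braceTot_mem_hIdealTot_right 𝔥 _ (lf_component_mem_hIdealTot 𝔥 hx p)) _)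

theorem bracketTot_mem_hIdealTot_right {x y : ADTTot K 𝔥} (hx : x ∈ invariants K 𝔥)
    (hy : y ∈ hIdealTot 𝔥) : bracketTot K 𝔥 x y ∈ hIdealTot 𝔥 := by
  obtain ⟨s, hs⟩ := sum_lf 𝔥 x
  obtain ⟨t, ht⟩ := sum_lf 𝔥 y
  rw [hs, ht, map_sum]
  refine sum_mem fun q _ => ?_
  rw [map_sum, LinearMap.sum_apply]
  refine sum_mem fun p _ => ?_
  rw [bracketTot_eq]
  exact sub_mem (braceTot_mem_hIdealTot_right 𝔥 _ (lf_component_mem_hIdealTot 𝔥 hy q))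
    (zsmul_mem (braceTot_mem_hIdealTot_left 𝔥 (lf_component_mem_hIdealTot 𝔥 hy q)
    (lf_component_mem_invariants 𝔥 hx p)) _)

variable [CharZero K] (𝔪 : Submodule K 𝔤) (hc : IsCompl 𝔥.toSubmodule 𝔪)

theorem b_Psi (k : ℕ) (w : SymmetricAlgebra K (Slots 𝔥 k)) :
    b K 𝔥 k (Psi 𝔥 𝔪 hc k w) = Psi 𝔥 𝔪 hc (k + 1) (cob 𝔥 k w) := by
  rw [b_apply, cob, LinearMap.sum_apply, Finset.sum_range_succ' _ (k + 1), map_add, map_sum]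
  refine (add_comm _ _).trans ?_
  congr 1
  · refine Finset.sum_congr rfl fun i hi => ?_
    rw [LinearMap.smul_apply, map_zsmul, AlgHom.toLinearMap_apply, ← pull_Psi]
    congr 2
    refine pull_congr 𝔥 fun l hl j hj => ?_
    simp only [face]
    split_ifs <;> omega
  · rw [LinearMap.smul_apply, map_zsmul, AlgHom.toLinearMap_apply, ← pull_Psi, pow_zero, one_smul]
    congr 1

theorem smap_slotPr_cob (k : ℕ) (w : SymmetricAlgebra K (Slots 𝔥 k)) :
    smap (slotPr 𝔥 𝔪 hc (k + 1)) (cob 𝔥 k w) = cob 𝔥 k (smap (slotPr 𝔥 𝔪 hc k) w) := by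
  rw [cob, LinearMap.sum_apply, LinearMap.sum_apply, map_sum]
  refine Finset.sum_congr rfl fun i _ => ?_
  rw [LinearMap.smul_apply, LinearMap.smul_apply, map_zsmul, AlgHom.toLinearMap_apply,
    AlgHom.toLinearMap_apply, smap_smap, smap_smap]
  congr 3
  exact LinearMap.ext fun v => slotPr_slotMap 𝔥 𝔪 hc k (k + 1) _ v

include hc

theorem degPr_b (k : ℕ) (P : ADT K 𝔥 k) :
    degPr 𝔥 𝔪 (k + 1) (b K 𝔥 k P) = b K 𝔥 k (degPr 𝔥 𝔪 k P) := by
  obtain ⟨w, rfl⟩ := (Psi_bijective 𝔥 𝔪 hc k).2 P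
  rw [b_Psi, degPr_Psi, smap_slotPr_cob, degPr_Psi, b_Psi]

theorem projTot_dTot (x : ADTTot K 𝔥) :
    projTot K 𝔥 𝔪 (dTot K 𝔥 x) = dTot K 𝔥 (projTot K 𝔥 𝔪 x) := by
  induction x using tot_induction with
  | zero => simp
  | add a b ha hb => simp only [map_add, ha, hb]
  | lf k P => rw [dTot_lf, projTot_lf, map_zsmul, projTot_lf, dTot_lf, degPr_b 𝔥 𝔪 hc]

theorem degPr_mem (k : ℕ) (P : ADT K 𝔥 k) : degPr 𝔥 𝔪 k P ∈ degTUm 𝔥 𝔪 k := by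
  obtain ⟨w, rfl⟩ := (Psi_bijective 𝔥 𝔪 hc k).2 P
  rw [degPr_Psi]
  exact Psi_smap_mem_degTUm 𝔥 𝔪 hc k w

theorem projTot_mem (x : ADTTot K 𝔥) : projTot K 𝔥 𝔪 x ∈ TUm K 𝔥 𝔪 := by
  rw [mem_TUm]
  intro k
  rw [projTot_apply]
  exact degPr_mem 𝔥 𝔪 hc k _

theorem projTot_of_mem {x : ADTTot K 𝔥} (hx : x ∈ TUm K 𝔥 𝔪) : projTot K 𝔥 𝔪 x = x := by
  refine DFinsupp.ext fun k => ?_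
  exact (projTot_apply 𝔥 𝔪 x k).trans
    (degPr_of_mem 𝔥 𝔪 (isCompl_Um_Ugh 𝔥 𝔪 hc) ((mem_TUm 𝔥 𝔪).1 hx k))

theorem sub_projTot_mem (x : ADTTot K 𝔥) : x - projTot K 𝔥 𝔪 x ∈ hIdealTot 𝔥 := by
  intro k
  rw [DirectSum.sub_apply, projTot_apply]
  obtain ⟨w, h⟩ := (Psi_bijective 𝔥 𝔪 hc k).2 (x k)
  rw [← h, degPr_Psi]
  exact Psi_sub_mem_hIdeal 𝔥 𝔪 hc k w

theorem projTot_eq_zero {x : ADTTot K 𝔥} (hx : x ∈ hIdealTot 𝔥) : projTot K 𝔥 𝔪 x = 0 := by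
  refine DFinsupp.ext fun k => ?_
  exact (projTot_apply 𝔥 𝔪 x k).trans (degPr_eq_zero 𝔥 𝔪 (isCompl_Um_Ugh 𝔥 𝔪 hc) (hx k))

/-- Under the outer projection an argument may be replaced by its own projection, so the projected
bracket is a quotient bracket and inherits the Jacobi identity. -/
theorem projTot_bracketTot_left {x y : ADTTot K 𝔥} (hy : y ∈ invariants K 𝔥) :
    projTot K 𝔥 𝔪 (bracketTot K 𝔥 (projTot K 𝔥 𝔪 x) y) = projTot K 𝔥 𝔪 (bracketTot K 𝔥 x y) := by
  have := projTot_eq_zero 𝔥 𝔪 hc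
    (bracketTot_mem_hIdealTot_left 𝔥 (sub_projTot_mem 𝔥 𝔪 hc x) hy)
  rw [map_sub, LinearMap.sub_apply, map_sub, sub_eq_zero] at this
  exact this.symm

theorem projTot_bracketTot_right {x y : ADTTot K 𝔥} (hx : x ∈ invariants K 𝔥) :
    projTot K 𝔥 𝔪 (bracketTot K 𝔥 x (projTot K 𝔥 𝔪 y)) = projTot K 𝔥 𝔪 (bracketTot K 𝔥 x y) := by
  have := projTot_eq_zero 𝔥 𝔪 hc
    (bracketTot_mem_hIdealTot_right 𝔥 hx (sub_projTot_mem 𝔥 𝔪 hc y))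
  rw [map_sub, map_sub, sub_eq_zero] at this
  exact this.symm

variable (hm : ∀ x ∈ 𝔥, ∀ y ∈ 𝔪, ⁅x, y⁆ ∈ 𝔪)
include hm

theorem projTot_mem_invariants {x : ADTTot K 𝔥} (hx : x ∈ invariants K 𝔥) :
    projTot K 𝔥 𝔪 x ∈ invariants K 𝔥 := by
  rw [mem_invariants] at hx ⊢
  intro k
  have h := hx k
  rw [projTot_apply]
  obtain ⟨w, hw⟩ := (Psi_bijective 𝔥 𝔪 hc k).2 (x k)
  rw [← hw, inv_Psi_iff 𝔥 𝔪 hc hm] at h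
  rw [← hw, degPr_Psi, inv_Psi_iff 𝔥 𝔪 hc hm]
  intro y
  rw [deriv_smap (D := slotAd 𝔥 k y) (fun v => (slotPr_slotAd 𝔥 𝔪 hc hm k y v).symm), h y, map_zero]

theorem projTot_mem_TUmInv {x : ADTTot K 𝔥} (hx : x ∈ invariants K 𝔥) :
    projTot K 𝔥 𝔪 x ∈ TUmInv K 𝔥 𝔪 :=
  ⟨projTot_mem 𝔥 𝔪 hc x, projTot_mem_invariants 𝔥 𝔪 hc hm hx⟩

omit hm in
theorem dTot_mem_TUmInv {x : ADTTot K 𝔥} (hx : x ∈ TUmInv K 𝔥 𝔪) :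
    dTot K 𝔥 x ∈ TUmInv K 𝔥 𝔪 := by
  refine ⟨?_, dTot_mem_invariants 𝔥 hx.2⟩
  rw [← projTot_of_mem 𝔥 𝔪 hc hx.1, ← projTot_dTot 𝔥 𝔪 hc]
  exact projTot_mem 𝔥 𝔪 hc _

omit hc hm in
theorem HomDeg.projTot {n : ℤ} {x : ADTTot K 𝔥} (hx : HomDeg 𝔥 n x) :
    HomDeg 𝔥 n (projTot K 𝔥 𝔪 x) := fun k hk => by
  rw [projTot_apply, hx k hk, map_zero]

omit [CharZero K] hc hm in
theorem lf_component_mem_TUmInv {x : ADTTot K 𝔥} (hx : x ∈ TUmInv K 𝔥 𝔪) (k : ℕ) :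
    lf 𝔥 k (x k) ∈ TUmInv K 𝔥 𝔪 := by
  refine ⟨?_, lf_component_mem_invariants 𝔥 hx.2 k⟩
  refine (mem_TUm 𝔥 𝔪).2 fun l => ?_
  by_cases h : k = l
  · subst h; rw [lf_apply_self]; exact (mem_TUm 𝔥 𝔪).1 hx.1 k
  · rw [lf_apply_of_ne 𝔥 h]; exact zero_mem _

/-- The differential graded Lie algebra `(T^*U𝔪)^𝔥[1]`. -/
def dglaTUmInv : DGLA K (TUmInv K 𝔥 𝔪) where
  deg := shiftedDeg K 𝔥 (TUmInv K 𝔥 𝔪)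
  isInternal := shiftedDeg_isInternal 𝔥 fun x hx k => lf_component_mem_TUmInv 𝔥 𝔪 hx k
  d := (dTot K 𝔥).restrict fun _ hx => dTot_mem_TUmInv 𝔥 𝔪 hc hx
  br := LinearMap.mk₂ K (fun x y => ⟨projTot K 𝔥 𝔪 (bracketTot K 𝔥 x y),
      projTot_mem_TUmInv 𝔥 𝔪 hc hm (bracketTot_mem_invariants 𝔥 x.2.2 y.2.2)⟩)
    (fun x y z => Subtype.ext (by simp)) (fun c x y => Subtype.ext (by simp))
    (fun x y z => Subtype.ext (by simp)) (fun c x y => Subtype.ext (by simp))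
  d_mem _ x hx := HomDeg.dTot 𝔥 hx
  br_mem _ _ x hx y hy := HomDeg.projTot 𝔥 𝔪 (HomDeg.bracketTot 𝔥 hx hy)
  d_d x := Subtype.ext (dTot_dTot 𝔥 x.2.2)
  skew m n x hx y hy := Subtype.ext <| by
    have := congrArg (projTot K 𝔥 𝔪) (bracketTot_skew 𝔥 hx hy)
    rw [map_neg, Units.smul_def, map_zsmul] at this
    exact this
  leibniz m n x hx y hy := Subtype.ext <| by
    have := congrArg (projTot K 𝔥 𝔪) (dTot_bracketTot 𝔥 hx hy x.2.2 y.2.2)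
    rw [projTot_dTot 𝔥 𝔪 hc, map_add, Units.smul_def, map_zsmul] at this
    exact this
  jacobi l m n x hx y hy z hz := Subtype.ext <| by
    have := congrArg (projTot K 𝔥 𝔪) (bracketTot_jacobi 𝔥 hx hy hz x.2.2 y.2.2 z.2.2)
    rw [map_add, Units.smul_def, map_zsmul, ← projTot_bracketTot_right 𝔥 𝔪 hc
      (y := bracketTot K 𝔥 (y : ADTTot K 𝔥) z) x.2.2,
      ← projTot_bracketTot_left 𝔥 𝔪 hc (x := bracketTot K 𝔥 (x : ADTTot K 𝔥) y) z.2.2,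
      ← projTot_bracketTot_right 𝔥 𝔪 hc (x := (y : ADTTot K 𝔥))
        (y := bracketTot K 𝔥 (x : ADTTot K 𝔥) z) y.2.2] at this
    exact this

end

section

set_option linter.unusedSectionVars false

/-! ## A Koszul type decomposition of the identity of a symmetric algebra -/

section Koszul

open SymmetricAlgebra (ι)

variable {K : Type*} [Field K] [CharZero K] {V V' W : Type*} [AddCommGroup V] [Module K V]
  [AddCommGroup V'] [Module K V'] [AddCommGroup W] [Module K W]

theorem der_smap (c : V' →ₗ[K] W) (f : V →ₗ[K] V') (w : SymmetricAlgebra K V) :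
    der c (smap f w) = LinearMap.rTensor W (smap f).toLinearMap (der (c ∘ₗ f) w) := by
  have : der c ∘ₗ (smap f).toLinearMap =
      LinearMap.rTensor W (smap f).toLinearMap ∘ₗ der (c ∘ₗ f) := by
    refine pow_ext fun v n => ?_
    rw [LinearMap.comp_apply, LinearMap.comp_apply, AlgHom.toLinearMap_apply, map_pow, smap_ι]
    cases n with
    | zero => rw [pow_zero, pow_zero, der_one, der_one, map_zero]
    | succ n =>
      rw [der_pow, der_pow, map_smul, LinearMap.rTensor_tmul, AlgHom.toLinearMap_apply, map_pow,
        smap_ι]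
      rfl
  exact congrArg (fun F => F w) this

theorem deriv_pow_succ (D : V →ₗ[K] V) (v : V) (n : ℕ) :
    deriv D (ι K V v ^ (n + 1)) = ((n : K) + 1) • (ι K V v ^ n * ι K V (D v)) := by
  rw [deriv_pow, linPow_coeff_one_of_commute (Commute.all _ _), Algebra.smul_def, map_add,
    map_natCast, map_one]

theorem deriv_one (D : V →ₗ[K] V) : deriv D (1 : SymmetricAlgebra K V) = 0 := by
  simpa using deriv_algebraMap D (1 : K)

/-- The action of a pair of endomorphisms on `S V ⊗ W`. -/
def derivT (D : V →ₗ[K] V) (D' : W →ₗ[K] W) :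
    SymmetricAlgebra K V ⊗[K] W →ₗ[K] SymmetricAlgebra K V ⊗[K] W :=
  LinearMap.rTensor W (deriv D) + LinearMap.lTensor (SymmetricAlgebra K V) D'

theorem derivT_tmul (D : V →ₗ[K] V) (D' : W →ₗ[K] W) (w : SymmetricAlgebra K V) (y : W) :
    derivT D D' (w ⊗ₜ[K] y) = deriv D w ⊗ₜ[K] y + w ⊗ₜ[K] D' y := by
  rw [derivT, LinearMap.add_apply, LinearMap.rTensor_tmul, LinearMap.lTensor_tmul]

theorem derivT_rTensor_smap {D : V →ₗ[K] V} {D' : V' →ₗ[K] V'} (D'' : W →ₗ[K] W) {f : V →ₗ[K] V'}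
    (h : ∀ v, D' (f v) = f (D v)) (z : SymmetricAlgebra K V ⊗[K] W) :
    derivT D' D'' (LinearMap.rTensor W (smap f).toLinearMap z) =
      LinearMap.rTensor W (smap f).toLinearMap (derivT D D'' z) := by
  induction z using TensorProduct.induction_on with
  | zero => simp
  | add x y hx hy => simp only [map_add, hx, hy]
  | tmul w y =>
    rw [LinearMap.rTensor_tmul, derivT_tmul, derivT_tmul, map_add, LinearMap.rTensor_tmul,
      LinearMap.rTensor_tmul, AlgHom.toLinearMap_apply, AlgHom.toLinearMap_apply,
      deriv_smap h]

theorem der_deriv {c : V →ₗ[K] W} {D : V →ₗ[K] V} {D' : W →ₗ[K] W} (h : ∀ v, c (D v) = D' (c v))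
    (w : SymmetricAlgebra K V) : der c (deriv D w) = derivT D D' (der c w) := by
  have : der c ∘ₗ deriv D = derivT D D' ∘ₗ der c := by
    refine pow_ext fun v n => ?_
    rw [LinearMap.comp_apply, LinearMap.comp_apply]
    cases n with
    | zero => rw [pow_zero, der_one, deriv_one, map_zero, map_zero]
    | succ n =>
      rw [deriv_pow_succ, map_smul, der_pow, map_smul, der_mul, derivT_tmul, der_ι, h]
      congr 1
      rw [TensorProduct.smul_tmul', smul_eq_mul, mul_one, add_comm]
      congr 1
      cases n with
      | zero => rw [pow_zero, der_one, deriv_one, smul_zero, TensorProduct.zero_tmul]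
      | succ n =>
        rw [der_pow, deriv_pow_succ, smul_comm, TensorProduct.smul_tmul', smul_eq_mul,
          TensorProduct.smul_tmul', mul_comm]
  exact congrArg (fun F => F w) this

/-- The product `S V ⊗ W → S V` defined by a map `W → V`. -/
def mulBy (e : W →ₗ[K] V) : SymmetricAlgebra K V ⊗[K] W →ₗ[K] SymmetricAlgebra K V :=
  TensorProduct.lift ((LinearMap.mul K (SymmetricAlgebra K V)).compl₂ (ι K V ∘ₗ e))

theorem mulBy_tmul (e : W →ₗ[K] V) (w : SymmetricAlgebra K V) (y : W) :
    mulBy e (w ⊗ₜ[K] y) = w * ι K V (e y) := by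
  rw [mulBy, TensorProduct.lift.tmul]; rfl

theorem smap_mulBy (f : V →ₗ[K] V') (e : W →ₗ[K] V) (z : SymmetricAlgebra K V ⊗[K] W) :
    smap f (mulBy e z) = mulBy (f ∘ₗ e) (LinearMap.rTensor W (smap f).toLinearMap z) := by
  induction z using TensorProduct.induction_on with
  | zero => simp
  | add x y hx hy => simp only [map_add, hx, hy]
  | tmul w y => rw [mulBy_tmul, LinearMap.rTensor_tmul, mulBy_tmul, map_mul, smap_ι]; rfl

theorem mulBy_add (e e' : W →ₗ[K] V) (z : SymmetricAlgebra K V ⊗[K] W) :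
    mulBy (e + e') z = mulBy e z + mulBy e' z := by
  induction z using TensorProduct.induction_on with
  | zero => simp
  | add x y hx hy => rw [map_add, map_add, map_add, hx, hy]; abel
  | tmul w y => rw [mulBy_tmul, mulBy_tmul, mulBy_tmul, LinearMap.add_apply, map_add, mul_add]

theorem mulBy_zero (z : SymmetricAlgebra K V ⊗[K] W) : mulBy (0 : W →ₗ[K] V) z = 0 := by
  have := mulBy_add (0 : W →ₗ[K] V) 0 z
  rwa [add_zero, left_eq_add] at this

theorem mulBy_sum {σ : Type*} (s : Finset σ) (e : σ → W →ₗ[K] V)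
    (z : SymmetricAlgebra K V ⊗[K] W) : mulBy (∑ i ∈ s, e i) z = ∑ i ∈ s, mulBy (e i) z := by
  classical
  induction s using Finset.induction_on with
  | empty => rw [Finset.sum_empty, Finset.sum_empty, mulBy_zero]
  | insert a s ha ih => rw [Finset.sum_insert ha, Finset.sum_insert ha, mulBy_add, ih]

theorem mulBy_derivT {e : W →ₗ[K] V} {D : V →ₗ[K] V} {D' : W →ₗ[K] W} (h : ∀ y, e (D' y) = D (e y))
    (z : SymmetricAlgebra K V ⊗[K] W) : mulBy e (derivT D D' z) = deriv D (mulBy e z) := by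
  induction z using TensorProduct.induction_on with
  | zero => simp
  | add x y hx hy => simp only [map_add, hx, hy]
  | tmul w y => rw [derivT_tmul, map_add, mulBy_tmul, mulBy_tmul, mulBy_tmul, deriv_mul, deriv_ι, h]

/-- Division of the part of degree `j` in the kernel of `π` by `j` (and by `0⁻¹ = 0` if `j = 0`). -/
def ninv (π : V →ₗ[K] V) : SymmetricAlgebra K V →ₗ[K] SymmetricAlgebra K V :=
  Polynomial.lsum (fun j => (j : K)⁻¹ • LinearMap.id) ∘ₗ (family π (compl π)).toLinearMap

theorem ninv_eq_sum (π : V →ₗ[K] V) (w : SymmetricAlgebra K V) {n : ℕ}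
    (hn : (family π (compl π) w).natDegree < n) :
    ninv π w = ∑ j ∈ Finset.range n, (j : K)⁻¹ • (family π (compl π) w).coeff j := by
  rw [ninv, LinearMap.comp_apply, Polynomial.lsum_apply, AlgHom.toLinearMap_apply,
    Polynomial.sum_over_range' _ (fun n => map_zero _) n hn]
  rfl

/-- The degree in the kernel of `π` is encoded by the scaling that multiplies this kernel by `t`. A
map that commutes with all scalings preserves the homogeneous parts, hence commutes with dividing
each by its degree. -/
theorem ninv_natural {π : V →ₗ[K] V} {π' : V' →ₗ[K] V'}
    (F : SymmetricAlgebra K V →ₗ[K] SymmetricAlgebra K V')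
    (h : ∀ (t : K) w, smap (π' + t • compl π') (F w) = F (smap (π + t • compl π) w))
    (w : SymmetricAlgebra K V) : ninv π' (F w) = F (ninv π w) := by
  have hj := fun j => map_coeff_eq (K := K) LinearMap.id F (p := family π' (compl π') (F w))
    (q := family π (compl π) w) (fun t => by
      rw [evalAt_family, evalAt_family, LinearMap.id_apply, h]) j
  rw [ninv_eq_sum π' _ (Nat.lt_succ_of_le (le_max_left _ (family π (compl π) w).natDegree)),
    ninv_eq_sum π _ (Nat.lt_succ_of_le (le_max_right (family π' (compl π') (F w)).natDegree _)),
    map_sum]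
  refine Finset.sum_congr rfl fun j _ => ?_
  rw [map_smul, ← hj]
  rfl

theorem ninv_smap {π : V →ₗ[K] V} {π' : V' →ₗ[K] V'} {f : V →ₗ[K] V'}
    (h : ∀ v, π' (f v) = f (π v)) (w : SymmetricAlgebra K V) :
    ninv π' (smap f w) = smap f (ninv π w) := by
  refine ninv_natural (smap f).toLinearMap (fun t w => ?_) w
  rw [AlgHom.toLinearMap_apply, AlgHom.toLinearMap_apply, smap_smap, smap_smap]
  congr 2
  ext v
  simp [h]

theorem ninv_deriv {π : V →ₗ[K] V} {D : V →ₗ[K] V} (h : ∀ v, π (D v) = D (π v))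
    (w : SymmetricAlgebra K V) : ninv π (deriv D w) = deriv D (ninv π w) := by
  refine ninv_natural (deriv D) (fun t w => ?_) w
  refine (deriv_smap (fun v => ?_) w).symm
  simp [h]

theorem ninv_mem {π : V →ₗ[K] V} (N : Submodule K (SymmetricAlgebra K V))
    {w : SymmetricAlgebra K V} (h : ∀ t : K, smap (π + t • compl π) w ∈ N) : ninv π w ∈ N := by
  rw [ninv_eq_sum π w (Nat.lt_succ_self _)]
  refine sum_mem fun j _ => Submodule.smul_mem _ _ (coeff_mem_of_evalAt_mem N (fun t => ?_) j)
  rw [evalAt_family]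
  exact h t

theorem ninv_pow {π : V →ₗ[K] V} {x y : V} (hx : π x = x) (hy : π y = 0) (i j : ℕ) :
    ninv π (ι K V x ^ i * ι K V y ^ j) = (j : K)⁻¹ • (ι K V x ^ i * ι K V y ^ j) := by
  have h : family π (compl π) (ι K V x ^ i * ι K V y ^ j) =
      Polynomial.monomial j (ι K V x ^ i * ι K V y ^ j) := by
    rw [map_mul, map_pow, map_pow, family_ι, family_ι, ← Polynomial.C_mul_X_pow_eq_monomial]
    simp only [LinearMap.sub_apply, LinearMap.id_apply, hx, hy, sub_self, map_zero, zero_mul,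
      add_zero, zero_add, sub_zero, mul_pow, map_mul, map_pow, mul_assoc]
  rw [ninv, LinearMap.comp_apply, AlgHom.toLinearMap_apply, h, Polynomial.lsum_apply,
    Polynomial.sum_monomial_index]
  · rfl
  · exact map_zero _

/-- Euler's identity: on `x^i y^j` the derivations kill `x`, so the sum multiplies by the degree
`j`, which `ninv` has divided out. The part with `j = 0` is the projected element on the right. -/
theorem sum_mulBy_der_ninv {π : V →ₗ[K] V} (hπ : ∀ v, π (π v) = π v) {σ : Type*} (s : Finset σ)
    (c : σ → V →ₗ[K] W) (e : σ → W →ₗ[K] V) (hc : ∀ i, ∀ v, π v = v → c i v = 0)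
    (he : ∀ v, ∑ i ∈ s, e i (c i v) = compl π v) (w : SymmetricAlgebra K V) :
    ∑ i ∈ s, mulBy (e i) (der (c i) (ninv π w)) = w - smap π w := by
  refine split_pow_induction hπ (p := fun w => ∑ i ∈ s, mulBy (e i) (der (c i) (ninv π w)) =
    w - smap π w) (by simp) (fun a b ha hb => ?_) (fun r a ha => ?_)
    (fun x y i j hx hy => ?_) w
  · simp only [map_add, Finset.sum_add_distrib, ha, hb]; abel
  · simp only [map_smul, ← Finset.smul_sum, ha, smul_sub]
  · rw [ninv_pow hx hy, map_mul (smap π), map_pow, map_pow, smap_ι, smap_ι, hx, hy]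
    cases j with
    | zero => simp
    | succ j =>
      have hx' : ∀ l, der (c l) (ι K V x ^ i) = 0 := fun l => by
        cases i with
        | zero => rw [pow_zero, der_one]
        | succ i => rw [der_pow, hc l x hx, TensorProduct.tmul_zero, smul_zero]
      have hj : ((j : K) + 1) ≠ 0 := by exact_mod_cast j.succ_ne_zero
      have h1 : ∀ l, mulBy (e l) (der (c l) (((j + 1 : ℕ) : K)⁻¹ • (ι K V x ^ i * ι K V y ^ (j + 1)))) =
          ι K V x ^ i * ι K V y ^ j * ι K V (e l (c l y)) := fun l => by
        rw [map_smul, der_mul, hx', smul_zero, add_zero, der_pow,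
          smul_comm (ι K V x ^ i) ((j : K) + 1), smul_smul, Nat.cast_add, Nat.cast_one,
          inv_mul_cancel₀ hj, one_smul, TensorProduct.smul_tmul', smul_eq_mul, mulBy_tmul]
      simp only [h1]
      rw [← Finset.mul_sum, ← map_sum, he, map_zero, zero_pow j.succ_ne_zero, mul_zero, sub_zero,
        LinearMap.sub_apply, hy, sub_zero, LinearMap.id_apply, pow_succ, mul_assoc]

end Koszul

end

section

set_option linter.unusedSectionVars false

/-! ## The contracting homotopy on symmetric algebras -/

open SymmetricAlgebra (ι)

/-- At two adjacent indices the signs are opposite, so only the difference of the two terms has to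
match. -/
theorem alternating_sum_congr {A : Type*} [AddCommGroup A] {F G : ℕ → A} {l N : ℕ} (hl : l + 2 ≤ N)
    (h1 : ∀ i < N, i ≠ l → i ≠ l + 1 → F i = G i) (h2 : F l - F (l + 1) = G l - G (l + 1)) :
    ∑ i ∈ Finset.range N, (-1 : ℤ) ^ i • F i = ∑ i ∈ Finset.range N, (-1 : ℤ) ^ i • G i := by
  obtain ⟨r, rfl⟩ := Nat.exists_eq_add_of_le hl
  rw [Finset.sum_range_add _ (l + 2), Finset.sum_range_add _ (l + 2), Finset.sum_range_succ _ (l + 1),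
    Finset.sum_range_succ _ (l + 1), Finset.sum_range_succ, Finset.sum_range_succ]
  congr 1
  · rw [add_assoc, add_assoc]
    congr 1
    · refine Finset.sum_congr rfl fun i hi => ?_
      rw [Finset.mem_range] at hi
      rw [h1 i (by omega) (by omega) (by omega)]
    · rw [pow_succ, mul_neg_one, neg_smul, neg_smul, ← sub_eq_add_neg, ← sub_eq_add_neg, ← smul_sub,
        ← smul_sub, h2]
  · refine Finset.sum_congr rfl fun i hi => ?_
    rw [Finset.mem_range] at hi
    rw [h1 _ (by omega) (by omega) (by omega)]

/-- The bookkeeping of a simplicial homotopy: all terms cancel in pairs except the two at `l` and `l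
+ 1`, and `c` records the face at which the homotopy relation fails. -/
theorem alternating_sum_shift {A : Type*} [AddCommGroup A] {F G : ℕ → A} {c : A} {l N : ℕ}
    (hl : l < N) (h1 : ∀ i < l, G i = -((-1 : ℤ) ^ l • F i)) (h2 : G l = -((-1 : ℤ) ^ l • c))
    (h3 : ∀ i, l < i → i < N → G i = (-1 : ℤ) ^ l • F (i + 1)) :
    (-1 : ℤ) ^ l • ∑ i ∈ Finset.range (N + 1), (-1 : ℤ) ^ i • F i +
      ∑ i ∈ Finset.range N, (-1 : ℤ) ^ i • G i = F l - F (l + 1) - c := by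
  obtain ⟨r, rfl⟩ := Nat.exists_eq_add_of_lt hl
  rw [show l + r + 1 + 1 = l + 1 + 1 + r by omega, show l + r + 1 = l + 1 + r by omega,
    Finset.sum_range_add _ (l + 1 + 1) r, Finset.sum_range_add _ (l + 1) r,
    Finset.sum_range_succ _ (l + 1), Finset.sum_range_succ _ l, Finset.sum_range_succ _ l, h2]
  have e1 : ∑ i ∈ Finset.range l, (-1 : ℤ) ^ i • G i =
      -((-1 : ℤ) ^ l • ∑ i ∈ Finset.range l, (-1 : ℤ) ^ i • F i) := by
    rw [Finset.smul_sum, ← Finset.sum_neg_distrib]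
    refine Finset.sum_congr rfl fun i hi => ?_
    rw [h1 i (Finset.mem_range.1 hi), smul_neg, smul_comm]
  have e2 : ∑ i ∈ Finset.range r, (-1 : ℤ) ^ (l + 1 + i) • G (l + 1 + i) =
      -((-1 : ℤ) ^ l • ∑ i ∈ Finset.range r, (-1 : ℤ) ^ (l + 1 + 1 + i) • F (l + 1 + 1 + i)) := by
    rw [Finset.smul_sum, ← Finset.sum_neg_distrib]
    refine Finset.sum_congr rfl fun i hi => ?_
    have hi := Finset.mem_range.1 hi
    rw [h3 _ (by omega) (by omega), smul_comm, show l + 1 + 1 + i = l + 1 + i + 1 by omega,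
      pow_succ _ (l + 1 + i), mul_neg_one, neg_smul, smul_neg, neg_neg]
  rw [e1, e2, smul_add, smul_add, smul_add, smul_neg, smul_smul, smul_smul, smul_smul,
    pow_succ, mul_neg_one, mul_neg, negOne_pow_mul_self]
  module

variable {K : Type*} [Field K] {𝔤 : Type*} [LieRing 𝔤] [LieAlgebra K 𝔤] (𝔥 : LieSubalgebra K 𝔤)

/-! ### Position maps -/

theorem slotMap_comp {k n m : ℕ} {f g h : ℕ → ℕ}
    (H : ∀ l < m, (g l < n ∧ h l = f (g l)) ∨ (g l = n ∧ h l = k) ∨ (n < g l ∧ k < h l)) :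
    slotMap 𝔥 n m g ∘ₗ slotMap 𝔥 k n f = slotMap 𝔥 k m h := by
  refine LinearMap.ext fun v => Prod.ext (funext fun l => ?_) rfl
  rw [LinearMap.comp_apply, slotMap_fst, slotMap_fst]
  rcases H l l.2 with ⟨h1, h2⟩ | ⟨h1, h2⟩ | ⟨h1, h2⟩
  · rw [dif_pos h1, slotMap_fst]
    simp only [h2]
  · rw [dif_neg h1.not_lt, if_pos h1, slotMap_snd, dif_neg h2.not_lt, if_pos h2]
  · rw [dif_neg h1.not_gt, if_neg h1.ne', dif_neg h2.not_gt, if_neg h2.ne']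

theorem slotMap_id {k : ℕ} {f : ℕ → ℕ} (H : ∀ l < k, f l = l) :
    slotMap 𝔥 k k f = LinearMap.id := by
  refine LinearMap.ext fun v => Prod.ext (funext fun l => ?_) rfl
  rw [slotMap_fst, dif_pos (by rw [H l l.2]; exact l.2)]
  simp only [H l l.2]
  rfl

theorem slotMap_congr {k n : ℕ} {f g : ℕ → ℕ} (H : ∀ l < n, f l = g l) :
    slotMap 𝔥 k n f = slotMap 𝔥 k n g := by
  refine LinearMap.ext fun v => Prod.ext (funext fun l => ?_) rfl
  rw [slotMap_fst, slotMap_fst]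
  simp only [H l l.2]

variable [CharZero K]

/-- The map `S (𝔤ᵏ × 𝔥) ⊗ 𝔥 → S (𝔤ⁿ × 𝔥) ⊗ 𝔥` given by a map of positions. -/
def zmap (k n : ℕ) (f : ℕ → ℕ) : SymmetricAlgebra K (Slots 𝔥 k) ⊗[K] 𝔥 →ₗ[K]
    SymmetricAlgebra K (Slots 𝔥 n) ⊗[K] 𝔥 :=
  LinearMap.rTensor 𝔥 (smap (slotMap 𝔥 k n f)).toLinearMap

theorem zmap_zmap {k n m : ℕ} {f g : ℕ → ℕ} (h : ℕ → ℕ)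
    (H : ∀ l < m, (g l < n ∧ h l = f (g l)) ∨ (g l = n ∧ h l = k) ∨ (n < g l ∧ k < h l))
    (z : SymmetricAlgebra K (Slots 𝔥 k) ⊗[K] 𝔥) :
    zmap 𝔥 n m g (zmap 𝔥 k n f z) = zmap 𝔥 k m h z := by
  rw [zmap, zmap, zmap, ← LinearMap.comp_apply, ← LinearMap.rTensor_comp, ← slotMap_comp 𝔥 H,
    ← smap_comp]
  rfl

theorem zmap_id {k : ℕ} {f : ℕ → ℕ} (H : ∀ l < k, f l = l)
    (z : SymmetricAlgebra K (Slots 𝔥 k) ⊗[K] 𝔥) : zmap 𝔥 k k f z = z := by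
  have : (smap (slotMap 𝔥 k k f)).toLinearMap = LinearMap.id := by
    rw [slotMap_id 𝔥 H]
    exact LinearMap.ext fun w => smap_id w
  rw [zmap, this, LinearMap.rTensor_id, LinearMap.id_apply]

theorem zmap_congr {k n : ℕ} {f g : ℕ → ℕ} (H : ∀ l < n, f l = g l)
    (z : SymmetricAlgebra K (Slots 𝔥 k) ⊗[K] 𝔥) : zmap 𝔥 k n f z = zmap 𝔥 k n g z := by
  rw [zmap, zmap, slotMap_congr 𝔥 H]

/-- The position map that leaves out `l`. -/
def skip (l m : ℕ) : ℕ := if m < l then m else m + 1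

/-- The position map that replaces `l` by `l + 1`. -/
def dup (l m : ℕ) : ℕ := if m = l then l + 1 else m

/-- The families of elements of `S (𝔤ᵏ × 𝔥) ⊗ 𝔥` indexed by positions; only the positions
`0, …, k` matter. -/
abbrev Fam (k : ℕ) : Type _ := ℕ → SymmetricAlgebra K (Slots 𝔥 k) ⊗[K] 𝔥

/-- The terms of the coboundary operator on families. -/
def zface (k i : ℕ) (z : Fam 𝔥 k) (l : ℕ) : SymmetricAlgebra K (Slots 𝔥 (k + 1)) ⊗[K] 𝔥 :=
  if face k i l ≤ k then zmap 𝔥 k (k + 1) (face k i) (z (face k i l)) else 0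

/-- The coboundary operator on families. -/
def zd (k : ℕ) (z : Fam 𝔥 k) (l : ℕ) : SymmetricAlgebra K (Slots 𝔥 (k + 1)) ⊗[K] 𝔥 :=
  ∑ i ∈ Finset.range (k + 2), (-1 : ℤ) ^ i • zface 𝔥 k i z l

/-- A homotopy on families. -/
def zs (k : ℕ) (z : Fam 𝔥 (k + 1)) (l : ℕ) : SymmetricAlgebra K (Slots 𝔥 k) ⊗[K] 𝔥 :=
  (-1 : ℤ) ^ l • zmap 𝔥 (k + 1) k (skip l) (z l)

/-- The difference of `1` and the map homotopic to zero by `zs` is nilpotent, it shifts positions. -/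
def znu (k : ℕ) (z : Fam 𝔥 k) : ℕ → SymmetricAlgebra K (Slots 𝔥 k) ⊗[K] 𝔥
  | 0 => 0
  | l + 1 => z l - zmap 𝔥 k k (dup l) (z l)

theorem zface_of_le {k i l : ℕ} (h : face k i l ≤ k) (z : Fam 𝔥 k) :
    zface 𝔥 k i z l = zmap 𝔥 k (k + 1) (face k i) (z (face k i l)) := if_pos h

theorem zface_lt {k i l : ℕ} (h : l < i) (hl : l ≤ k) (z : Fam 𝔥 k) :
    zface 𝔥 k i z l = zmap 𝔥 k (k + 1) (face k i) (z l) := by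
  have : face k i l = l := if_pos h
  rw [zface_of_le 𝔥 (by omega), this]

theorem zface_ge {k i l : ℕ} (h : i ≤ l + 1) (hl : l ≤ k) (z : Fam 𝔥 k) :
    zface 𝔥 k i z (l + 1) = zmap 𝔥 k (k + 1) (face k i) (z l) := by
  have : face k i (l + 1) = l := by
    rw [face, if_neg h.not_gt, if_neg l.succ_ne_zero, Nat.add_sub_cancel]
  rw [zface_of_le 𝔥 (this.le.trans hl), this]

theorem zface_zero (k : ℕ) (z : Fam 𝔥 k) : zface 𝔥 k 0 z 0 = 0 := by
  rw [zface, if_neg]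
  simp [face]

theorem zmap_skip_zface_lt {k i l : ℕ} (hi : l < i) (hl : l ≤ k + 1) (z : Fam 𝔥 (k + 1)) :
    zmap 𝔥 (k + 2) (k + 1) (skip l) (zface 𝔥 (k + 1) i z l) =
      zmap 𝔥 (k + 1) (k + 1) (fun m => face (k + 1) i (skip l m)) (z l) := by
  rw [zface_lt 𝔥 hi hl]
  refine zmap_zmap 𝔥 _ (fun m hm => ?_) _
  exact Or.inl ⟨by simp only [skip]; split_ifs <;> omega, rfl⟩

theorem zmap_skip_zface_ge {k i l : ℕ} (hi : i ≤ l + 1) (hl : l ≤ k + 1) (z : Fam 𝔥 (k + 1)) :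
    zmap 𝔥 (k + 2) (k + 1) (skip (l + 1)) (zface 𝔥 (k + 1) i z (l + 1)) =
      zmap 𝔥 (k + 1) (k + 1) (fun m => face (k + 1) i (skip (l + 1) m)) (z l) := by
  rw [zface_ge 𝔥 hi hl]
  refine zmap_zmap 𝔥 _ (fun m hm => ?_) _
  exact Or.inl ⟨by simp only [skip]; split_ifs <;> omega, rfl⟩

theorem zface_zs_lt {k i l : ℕ} (hi : l < i) (hi' : i < k + 2) (z : Fam 𝔥 (k + 1)) :
    zface 𝔥 k i (zs 𝔥 k z) l =
      (-1 : ℤ) ^ l • zmap 𝔥 (k + 2) (k + 1) (skip l) (zface 𝔥 (k + 1) (i + 1) z l) := by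
  rw [zmap_skip_zface_lt 𝔥 (by omega) (by omega), zface_lt 𝔥 hi (by omega), zs, map_zsmul]
  congr 1
  refine zmap_zmap 𝔥 _ (fun m hm => ?_) _
  grind [face, skip]

theorem zface_zs_ge {k i l : ℕ} (hi : i ≤ l + 1) (hl : l ≤ k) (z : Fam 𝔥 (k + 1)) :
    zface 𝔥 k i (zs 𝔥 k z) (l + 1) =
      (-1 : ℤ) ^ l • zmap 𝔥 (k + 1) (k + 1) (fun m => skip l (face k i m)) (z l) := by
  rw [zface_ge 𝔥 hi hl, zs, map_zsmul]
  congr 1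
  refine zmap_zmap 𝔥 _ (fun m hm => ?_) _
  grind [face, skip]

theorem zmap_skip_zface_succ {k l : ℕ} (hl : l ≤ k + 1) (z : Fam 𝔥 (k + 1)) :
    zmap 𝔥 (k + 2) (k + 1) (skip l) (zface 𝔥 (k + 1) (l + 1) z l) = z l := by
  rw [zmap_skip_zface_lt 𝔥 (by omega) hl]
  refine zmap_id 𝔥 (fun m hm => ?_) _
  grind [face, skip]

theorem zmap_skip_zface_self {k l : ℕ} (hl : l ≤ k + 1) (z : Fam 𝔥 (k + 1)) :
    zmap 𝔥 (k + 2) (k + 1) (skip (l + 1)) (zface 𝔥 (k + 1) (l + 1) z (l + 1)) = z l := by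
  rw [zmap_skip_zface_ge 𝔥 le_rfl hl]
  refine zmap_id 𝔥 (fun m hm => ?_) _
  grind [face, skip]

theorem zface_zs_self {k l : ℕ} (hl : l ≤ k) (z : Fam 𝔥 (k + 1)) :
    zface 𝔥 k (l + 1) (zs 𝔥 k z) (l + 1) =
      (-1 : ℤ) ^ l • zmap 𝔥 (k + 1) (k + 1) (dup l) (z l) := by
  rw [zface_zs_ge 𝔥 le_rfl hl]
  congr 1
  refine zmap_congr 𝔥 (fun m hm => ?_) _
  grind [face, skip, dup]

theorem zface_zs_le {k i l : ℕ} (hi : i ≤ l) (hl : l ≤ k) (z : Fam 𝔥 (k + 1)) :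
    zface 𝔥 k i (zs 𝔥 k z) (l + 1) = (-1 : ℤ) ^ l •
      zmap 𝔥 (k + 2) (k + 1) (skip (l + 1)) (zface 𝔥 (k + 1) i z (l + 1)) := by
  rw [zface_zs_ge 𝔥 (by omega) hl, zmap_skip_zface_ge 𝔥 (by omega) (by omega)]
  congr 1
  refine zmap_congr 𝔥 (fun m hm => ?_) _
  grind [face, skip]

/-- The homotopy formula in positive degree. -/
theorem zs_zd (k : ℕ) (z : Fam 𝔥 (k + 1)) {l : ℕ} (hl : l ≤ k + 1) :
    zs 𝔥 (k + 1) (zd 𝔥 (k + 1) z) l + zd 𝔥 k (zs 𝔥 k z) l = znu 𝔥 (k + 1) z l - z l := by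
  rw [zs, zd, zd, map_sum]
  simp only [map_zsmul]
  cases l with
  | zero =>
    rw [alternating_sum_shift (c := 0) (by omega) (fun i hi => by omega)
      (by rw [zface_zero, smul_zero, neg_zero]) (fun i hi hi' => zface_zs_lt 𝔥 hi hi' z),
      zmap_skip_zface_succ 𝔥 (by omega), zface_zero, map_zero, znu, sub_zero]
  | succ l =>
    have hsign : ∀ x : SymmetricAlgebra K (Slots 𝔥 (k + 1)) ⊗[K] 𝔥,
        (-1 : ℤ) ^ l • x = -((-1 : ℤ) ^ (l + 1) • x) := fun x => by
      rw [pow_succ, mul_neg_one, neg_smul, neg_neg]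
    -- The surviving faces `l + 1` and `l + 2` give `z l` and `z (l + 1)`; the face `l + 1` applied
    -- after the homotopy yields the correction `c`. Together they form `znu` minus the identity.
    rw [alternating_sum_shift (l := l + 1) (c := zmap 𝔥 (k + 1) (k + 1) (dup l) (z l))
      (F := fun i => zmap 𝔥 (k + 2) (k + 1) (skip (l + 1)) (zface 𝔥 (k + 1) i z (l + 1)))
      (G := fun i => zface 𝔥 k i (zs 𝔥 k z) (l + 1)) (by omega)
      (fun i hi => (zface_zs_le 𝔥 (by omega) (by omega) z).trans (hsign _))
      ((zface_zs_self 𝔥 (by omega) z).trans (hsign _))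
      (fun i hi hi' => zface_zs_lt 𝔥 hi hi' z),
      zmap_skip_zface_succ 𝔥 hl, zmap_skip_zface_self 𝔥 (by omega), znu]
    abel

theorem zs_zd_zero (z : Fam 𝔥 0) : zs 𝔥 0 (zd 𝔥 0 z) 0 = -z 0 := by
  have h : zmap 𝔥 1 0 (skip 0) (zface 𝔥 0 1 z 0) = z 0 := by
    rw [zface_lt 𝔥 (by omega) (by omega), zmap_zmap 𝔥 id (fun l hl => by omega),
      zmap_id 𝔥 (fun l hl => by omega)]
  rw [zs, zd, Finset.sum_range_succ, Finset.sum_range_one, zface_zero, smul_zero, pow_one,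
    map_add, map_zero, map_zsmul, pow_zero, one_smul, h, neg_one_smul, zero_add]

theorem zd_congr {k : ℕ} {z z' : Fam 𝔥 k} (h : ∀ l ≤ k, z l = z' l) (l : ℕ) :
    zd 𝔥 k z l = zd 𝔥 k z' l := by
  refine Finset.sum_congr rfl fun i _ => ?_
  congr 1
  by_cases hl : face k i l ≤ k
  · rw [zface_of_le 𝔥 hl, zface_of_le 𝔥 hl, h _ hl]
  · rw [zface, zface, if_neg hl, if_neg hl]

theorem zmap_dup_zface_lt {k i l : ℕ} (hi : l < i) (hi' : i < k + 2) (z : Fam 𝔥 k) :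
    zmap 𝔥 (k + 1) (k + 1) (dup l) (zface 𝔥 k i z l) =
      zmap 𝔥 k (k + 1) (fun m => face k i (dup l m)) (z l) := by
  rw [zface_lt 𝔥 hi (by omega)]
  refine zmap_zmap 𝔥 _ (fun m hm => ?_) _
  grind [face, dup]

theorem zmap_dup_zface_succ {k l : ℕ} (hl : l ≤ k) (z : Fam 𝔥 k) :
    zmap 𝔥 (k + 1) (k + 1) (dup l) (zface 𝔥 k (l + 1) z l) = zface 𝔥 k (l + 1) z l := by
  rw [zmap_dup_zface_lt 𝔥 (by omega) (by omega), zface_lt 𝔥 (by omega) hl]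
  refine zmap_congr 𝔥 (fun m hm => ?_) _
  grind [face, dup]

theorem zface_znu_lt {k i l : ℕ} (hi : l + 1 < i) (hi' : i < k + 2) (z : Fam 𝔥 k) :
    zface 𝔥 k i (znu 𝔥 k z) (l + 1) =
      zface 𝔥 k i z l - zmap 𝔥 (k + 1) (k + 1) (dup l) (zface 𝔥 k i z l) := by
  rw [zmap_dup_zface_lt 𝔥 (by omega) (by omega), zface_lt 𝔥 hi (by omega),
    zface_lt 𝔥 (by omega) (by omega), znu, map_sub]
  congr 1
  refine zmap_zmap 𝔥 _ (fun m hm => ?_) _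
  grind [face, dup]

theorem zface_znu_ge {k i l : ℕ} (hi : i ≤ l) (hl : l + 1 ≤ k) (z : Fam 𝔥 k) :
    zface 𝔥 k i (znu 𝔥 k z) (l + 2) =
      zface 𝔥 k i z (l + 1) - zmap 𝔥 (k + 1) (k + 1) (dup (l + 1)) (zface 𝔥 k i z (l + 1)) := by
  rw [zface_ge 𝔥 (i := i) (l := l + 1) (by omega) hl (znu 𝔥 k z),
    zface_ge 𝔥 (i := i) (l := l) (by omega) (by omega) z, znu, map_sub]
  congr 1
  rw [zmap_zmap 𝔥 (f := dup l) (g := face k i) (fun m => face k i (dup (l + 1) m)),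
    zmap_zmap 𝔥 (f := face k i) (g := dup (l + 1)) (fun m => face k i (dup (l + 1) m))]
  · intro m hm
    grind [face, dup]
  · intro m hm
    grind [face, dup]

theorem zface_znu_sub {k l : ℕ} (hl : l + 1 ≤ k) (z : Fam 𝔥 k) :
    zface 𝔥 k (l + 1) (znu 𝔥 k z) (l + 2) - zface 𝔥 k (l + 2) (znu 𝔥 k z) (l + 2) =
      zface 𝔥 k (l + 1) z (l + 1) -
        zmap 𝔥 (k + 1) (k + 1) (dup (l + 1)) (zface 𝔥 k (l + 1) z (l + 1)) := by
  have e1 : zmap 𝔥 k (k + 1) (face k (l + 1)) (zmap 𝔥 k k (dup l) (z l)) =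
      zmap 𝔥 k (k + 1) (fun m => dup l (face k (l + 1) m)) (z l) :=
    zmap_zmap 𝔥 _ (fun m hm => by grind [face, dup]) _
  have e2 : zmap 𝔥 k (k + 1) (face k (l + 2)) (zmap 𝔥 k k (dup l) (z l)) =
      zmap 𝔥 k (k + 1) (fun m => dup l (face k (l + 1) m)) (z l) :=
    zmap_zmap 𝔥 _ (fun m hm => by grind [face, dup]) _
  have e3 : zmap 𝔥 (k + 1) (k + 1) (dup (l + 1)) (zmap 𝔥 k (k + 1) (face k (l + 1)) (z l)) =
      zmap 𝔥 k (k + 1) (face k (l + 2)) (z l) :=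
    zmap_zmap 𝔥 _ (fun m hm => by grind [face, dup]) _
  rw [zface_ge 𝔥 (i := l + 1) (l := l + 1) (by omega) hl (znu 𝔥 k z),
    zface_ge 𝔥 (i := l + 2) (l := l + 1) (by omega) hl (znu 𝔥 k z),
    zface_ge 𝔥 (i := l + 1) (l := l) le_rfl (by omega) z, znu, map_sub, map_sub, e1, e2, e3]
  abel

/-- At position `l + 1` the faces match one by one except those of index `l` and `l + 1`, for which
only the difference matches. Consequently `1 - znu` and its inverse are compatible with the
coboundary. -/
theorem znu_zd (k : ℕ) (z : Fam 𝔥 k) {l : ℕ} (hl : l ≤ k + 1) :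
    znu 𝔥 (k + 1) (zd 𝔥 k z) l = zd 𝔥 k (znu 𝔥 k z) l := by
  cases l with
  | zero =>
    rw [znu, zd, Finset.sum_eq_zero]
    intro i _
    cases i with
    | zero => rw [zface_zero, smul_zero]
    | succ i => rw [zface_lt 𝔥 (by omega) (by omega), znu, map_zero, smul_zero]
  | succ l =>
    rw [znu, zd, zd, map_sum, ← Finset.sum_sub_distrib]
    simp only [map_zsmul, ← smul_sub]
    refine alternating_sum_congr (l := l) (by omega) (fun i hi h1 h2 => ?_) ?_
    · rcases lt_or_gt_of_ne h1 with hi' | hi'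
      · obtain ⟨l, rfl⟩ : ∃ l', l = l' + 1 := ⟨l - 1, by omega⟩
        exact (zface_znu_ge 𝔥 (by omega) (by omega) z).symm
      · exact (zface_znu_lt 𝔥 (by omega) hi z).symm
    · rw [zmap_dup_zface_succ 𝔥 (by omega), sub_self, sub_zero]
      cases l with
      | zero =>
        rw [zface_zero, map_zero, sub_zero, zface_ge 𝔥 (i := 0) (l := 0) (by omega) (by omega),
          zface_ge 𝔥 (i := 0 + 1) (l := 0) (by omega) (by omega), znu, map_zero, map_zero, sub_zero]
      | succ l => exact (zface_znu_sub 𝔥 (by omega) z).symm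

/-- The inverse of `1 - znu`. -/
def zinv (k : ℕ) (z : Fam 𝔥 k) : ℕ → SymmetricAlgebra K (Slots 𝔥 k) ⊗[K] 𝔥
  | 0 => z 0
  | l + 1 => z (l + 1) + (zinv k z l - zmap 𝔥 k k (dup l) (zinv k z l))

theorem zinv_sub_znu (k : ℕ) (z : Fam 𝔥 k) (l : ℕ) :
    zinv 𝔥 k z l - znu 𝔥 k (zinv 𝔥 k z) l = z l := by
  cases l with
  | zero => rw [zinv, znu, sub_zero]
  | succ l => rw [zinv, znu, add_sub_cancel_right]

theorem eq_zinv {k : ℕ} {z u : Fam 𝔥 k} (h : ∀ l ≤ k, u l - znu 𝔥 k u l = z l) {l : ℕ}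
    (hl : l ≤ k) : u l = zinv 𝔥 k z l := by
  induction l with
  | zero => rw [zinv, ← h 0 hl, znu, sub_zero]
  | succ l ih => rw [zinv, ← ih (by omega), ← h _ hl, znu, sub_add_cancel]

theorem zd_sub (k : ℕ) (z z' : Fam 𝔥 k) (l : ℕ) :
    zd 𝔥 k (fun m => z m - z' m) l = zd 𝔥 k z l - zd 𝔥 k z' l := by
  rw [zd, zd, zd, ← Finset.sum_sub_distrib]
  refine Finset.sum_congr rfl fun i _ => ?_
  rw [← smul_sub]
  congr 1
  by_cases hl : face k i l ≤ k
  · rw [zface_of_le 𝔥 hl, zface_of_le 𝔥 hl, zface_of_le 𝔥 hl, map_sub]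
  · rw [zface, zface, zface, if_neg hl, if_neg hl, if_neg hl, sub_zero]

/-- The left side solves the equation that characterizes the right side, because `znu` commutes with
the coboundary. -/
theorem zd_zinv (k : ℕ) (z : Fam 𝔥 k) {l : ℕ} (hl : l ≤ k + 1) :
    zd 𝔥 k (zinv 𝔥 k z) l = zinv 𝔥 (k + 1) (zd 𝔥 k z) l := by
  refine eq_zinv 𝔥 (fun l hl => ?_) hl
  rw [znu_zd 𝔥 k _ hl, ← zd_sub]
  exact zd_congr 𝔥 (fun l _ => zinv_sub_znu 𝔥 k z l) l

end

section

set_option linter.unusedSectionVars false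

/-! ## The contraction of `ADT` onto `T^*U𝔪` -/

open SymmetricAlgebra (ι)

section DerZero

variable {K : Type*} [Field K] [CharZero K] {V W : Type*} [AddCommGroup V] [Module K V]
  [AddCommGroup W] [Module K W]

theorem der_zero (w : SymmetricAlgebra K V) : der (0 : V →ₗ[K] W) w = 0 := by
  have : der (0 : V →ₗ[K] W) = 0 := by
    refine pow_ext fun v n => ?_
    cases n with
    | zero => rw [pow_zero, der_one]; rfl
    | succ n => rw [der_pow, LinearMap.zero_apply, TensorProduct.tmul_zero, smul_zero]; rfl
  rw [this, LinearMap.zero_apply]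

end DerZero

variable {K : Type*} [Field K] {𝔤 : Type*} [LieRing 𝔤] [LieAlgebra K 𝔤] (𝔥 : LieSubalgebra K 𝔤)

/-- The vector with the entry `y ∈ 𝔥` in position `l`. -/
def hVec (k l : ℕ) : 𝔥 →ₗ[K] Slots 𝔥 k :=
  if h : l < k then legVec 𝔥 (⟨l, h⟩ : Fin k) ∘ₗ 𝔥.toSubmodule.subtype
  else if l = k then tailVec 𝔥 k else 0

theorem hVec_lt {k l : ℕ} (h : l < k) (y : 𝔥) : hVec 𝔥 k l y = legVec 𝔥 (⟨l, h⟩ : Fin k) (y : 𝔤) := by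
  rw [hVec, dif_pos h]; rfl

theorem hVec_self (k : ℕ) (y : 𝔥) : hVec 𝔥 k k y = tailVec 𝔥 k y := by
  rw [hVec, dif_neg (lt_irrefl _), if_pos rfl]

theorem hVec_fst {k l : ℕ} (hl : l ≤ k) (y : 𝔥) (j : Fin k) :
    (hVec 𝔥 k l y).1 j = if (j : ℕ) = l then (y : 𝔤) else 0 := by
  rcases hl.lt_or_eq with h | rfl
  · rw [hVec_lt 𝔥 h, legVec_apply]
    by_cases hj : (j : ℕ) = l
    · obtain rfl : j = ⟨l, h⟩ := Fin.ext hj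
      simp
    · rw [if_neg hj]
      exact Pi.single_eq_of_ne (fun h' => hj (congrArg Fin.val h')) _
  · rw [hVec_self, if_neg j.2.ne]; rfl

theorem hVec_snd {k l : ℕ} (hl : l ≤ k) (y : 𝔥) :
    (hVec 𝔥 k l y).2 = if l = k then y else 0 := by
  rcases hl.lt_or_eq with h | rfl
  · rw [hVec_lt 𝔥 h, if_neg h.ne]; rfl
  · rw [hVec_self, if_pos rfl]; rfl

theorem slotMap_hVec {k n m : ℕ} {f : ℕ → ℕ} (hm : m ≤ k) (hf : f n = k) (y : 𝔥) :
    slotMap 𝔥 k n f (hVec 𝔥 k m y) =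
      ∑ l ∈ Finset.range (n + 1), if f l = m then hVec 𝔥 n l y else 0 := by
  rw [slots_eq_sum 𝔥 (slotMap 𝔥 k n f (hVec 𝔥 k m y)), Finset.sum_range_succ, ← Fin.sum_univ_eq_sum_range
    (fun l => if f l = m then hVec 𝔥 n l y else 0)]
  congr 1
  · refine Finset.sum_congr rfl fun l _ => ?_
    have : (slotMap 𝔥 k n f (hVec 𝔥 k m y)).1 l = if f l = m then (y : 𝔤) else 0 := by
      rw [slotMap_fst]
      split_ifs with h1 h2 h3 h4 h5
      · rw [hVec_fst 𝔥 hm, if_pos h2]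
      · rw [hVec_fst 𝔥 hm, if_neg h2]
      · rw [hVec_snd 𝔥 hm, if_pos (h4.symm.trans h3)]
      · rw [hVec_snd 𝔥 hm, if_neg fun h => h4 (h3.trans h.symm)]; rfl
      · omega
      · rfl
    rw [this, hVec_lt 𝔥 l.2]
    split_ifs
    · rfl
    · exact map_zero _
  · rw [slotMap_snd, hVec_snd 𝔥 hm, hf, hVec_self]
    by_cases h : m = k
    · rw [if_pos h, if_pos h.symm]
    · rw [if_neg h, if_neg (Ne.symm h), map_zero]

theorem slotAd_hVec {k l : ℕ} (hl : l ≤ k) (y z : 𝔥) :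
    hVec 𝔥 k l (LieAlgebra.ad K 𝔥 y z) = slotAd 𝔥 k y (hVec 𝔥 k l z) := by
  rw [slotAd_apply]
  refine Prod.ext (funext fun j => ?_) ?_
  · change _ = ⁅(y : 𝔤), (hVec 𝔥 k l z).1 j⁆
    rw [hVec_fst 𝔥 hl, hVec_fst 𝔥 hl]
    split_ifs
    · rfl
    · exact (lie_zero _).symm
  · change _ = ⁅y, (hVec 𝔥 k l z).2⁆
    rw [hVec_snd 𝔥 hl, hVec_snd 𝔥 hl]
    split_ifs
    · rfl
    · exact (lie_zero _).symm

section Coord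

variable (𝔪 : Submodule K 𝔤) (hc : IsCompl 𝔥.toSubmodule 𝔪)

/-- The projection of `𝔤` onto `𝔥`. -/
def hPr : 𝔤 →ₗ[K] 𝔥 :=
  LinearMap.codRestrict 𝔥.toSubmodule (compl (prM 𝔥 𝔪 hc)) fun x => compl_prM_mem 𝔥 𝔪 hc x

theorem hPr_coe (x : 𝔤) : (hPr 𝔥 𝔪 hc x : 𝔤) = x - prM 𝔥 𝔪 hc x := rfl

theorem hPr_prM (x : 𝔤) : hPr 𝔥 𝔪 hc (prM 𝔥 𝔪 hc x) = 0 :=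
  Subtype.ext (by rw [hPr_coe, prM_prM, sub_self]; rfl)

theorem hPr_of_mem (y : 𝔥) : hPr 𝔥 𝔪 hc (y : 𝔤) = y :=
  Subtype.ext (by rw [hPr_coe, (prM_eq_zero_iff 𝔥 𝔪 hc).2 y.2, sub_zero])

theorem hPr_lie (hm : ∀ x ∈ 𝔥, ∀ y ∈ 𝔪, ⁅x, y⁆ ∈ 𝔪) (y : 𝔥) (x : 𝔤) :
    hPr 𝔥 𝔪 hc ⁅(y : 𝔤), x⁆ = ⁅y, hPr 𝔥 𝔪 hc x⁆ :=
  Subtype.ext (by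
    rw [hPr_coe, LieSubalgebra.coe_bracket, hPr_coe, lie_sub, prM_lie 𝔥 𝔪 hc hm])

/-- The `𝔥`-component in position `l`. -/
def hCoord (k l : ℕ) : Slots 𝔥 k →ₗ[K] 𝔥 :=
  if h : l < k then hPr 𝔥 𝔪 hc ∘ₗ LinearMap.proj (⟨l, h⟩ : Fin k) ∘ₗ LinearMap.fst K _ _
  else if l = k then LinearMap.snd K _ _ else 0

theorem hCoord_lt {k l : ℕ} (h : l < k) (v : Slots 𝔥 k) :
    hCoord 𝔥 𝔪 hc k l v = hPr 𝔥 𝔪 hc (v.1 ⟨l, h⟩) := by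
  rw [hCoord, dif_pos h]; rfl

theorem hCoord_self (k : ℕ) (v : Slots 𝔥 k) : hCoord 𝔥 𝔪 hc k k v = v.2 := by
  rw [hCoord, dif_neg (lt_irrefl _), if_pos rfl]; rfl

theorem hCoord_gt {k l : ℕ} (h : k < l) : hCoord 𝔥 𝔪 hc k l = 0 := by
  rw [hCoord, dif_neg h.not_gt, if_neg h.ne']

theorem hCoord_slotPr (k l : ℕ) (v : Slots 𝔥 k) :
    hCoord 𝔥 𝔪 hc k l (slotPr 𝔥 𝔪 hc k v) = 0 := by
  rcases lt_trichotomy l k with h | rfl | h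
  · rw [hCoord_lt 𝔥 𝔪 hc h]; exact hPr_prM 𝔥 𝔪 hc _
  · rw [hCoord_self]; rfl
  · rw [hCoord_gt 𝔥 𝔪 hc h]; rfl

theorem sum_hVec_hCoord (k : ℕ) (v : Slots 𝔥 k) :
    ∑ l ∈ Finset.range (k + 1), hVec 𝔥 k l (hCoord 𝔥 𝔪 hc k l v) = compl (slotPr 𝔥 𝔪 hc k) v := by
  rw [slots_eq_sum 𝔥 (compl (slotPr 𝔥 𝔪 hc k) v), Finset.sum_range_succ,
    ← Fin.sum_univ_eq_sum_range (fun l => hVec 𝔥 k l (hCoord 𝔥 𝔪 hc k l v))]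
  congr 1
  · refine Finset.sum_congr rfl fun l _ => ?_
    rw [hVec_lt 𝔥 l.2, hCoord_lt 𝔥 𝔪 hc l.2]
    rfl
  · rw [hVec_self, hCoord_self]
    congr 1
    exact (sub_zero v.2).symm

theorem hCoord_slotMap {k n l : ℕ} {f : ℕ → ℕ} (hl : l ≤ n) (hf : f n = k) :
    hCoord 𝔥 𝔪 hc n l ∘ₗ slotMap 𝔥 k n f = hCoord 𝔥 𝔪 hc k (f l) := by
  refine LinearMap.ext fun v => ?_
  rw [LinearMap.comp_apply]
  rcases hl.lt_or_eq with h | rfl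
  · rw [hCoord_lt 𝔥 𝔪 hc h, slotMap_fst]
    rcases lt_trichotomy (f l) k with h' | h' | h'
    · rw [dif_pos h', hCoord_lt 𝔥 𝔪 hc h']
    · rw [dif_neg h'.not_lt, if_pos h', h', hCoord_self, hPr_of_mem]
    · rw [dif_neg h'.not_gt, if_neg h'.ne', map_zero, hCoord_gt 𝔥 𝔪 hc h']; rfl
  · rw [hf, hCoord_self, hCoord_self, slotMap_snd]

theorem hCoord_slotAd (hm : ∀ x ∈ 𝔥, ∀ y ∈ 𝔪, ⁅x, y⁆ ∈ 𝔪) (k l : ℕ) (y : 𝔥) (v : Slots 𝔥 k) :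
    hCoord 𝔥 𝔪 hc k l (slotAd 𝔥 k y v) = LieAlgebra.ad K 𝔥 y (hCoord 𝔥 𝔪 hc k l v) := by
  rw [slotAd_apply, LieAlgebra.ad_apply]
  rcases lt_trichotomy l k with h | rfl | h
  · rw [hCoord_lt 𝔥 𝔪 hc h, hCoord_lt 𝔥 𝔪 hc h]; exact hPr_lie 𝔥 𝔪 hc hm _ _
  · rw [hCoord_self, hCoord_self]
  · rw [hCoord_gt 𝔥 𝔪 hc h, LinearMap.zero_apply, LinearMap.zero_apply, lie_zero]

theorem slotPr_hVec (k l : ℕ) : slotPr 𝔥 𝔪 hc k ∘ₗ hVec 𝔥 k l = 0 := by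
  refine LinearMap.ext fun y => ?_
  rw [LinearMap.comp_apply, slotPr_apply]
  by_cases hl : l ≤ k
  · refine Prod.ext (funext fun j => ?_) rfl
    change prM 𝔥 𝔪 hc ((hVec 𝔥 k l y).1 j) = 0
    rw [hVec_fst 𝔥 hl]
    split_ifs
    · exact (prM_eq_zero_iff 𝔥 𝔪 hc).2 y.2
    · exact map_zero _
  · rw [hVec, dif_neg (by omega), if_neg (by omega)]
    exact Prod.ext (funext fun j => map_zero _) rfl

variable [CharZero K]

/-- The derivative in the direction of the `𝔥`-component in position `l`, normalized. -/
def hDer (k l : ℕ) : SymmetricAlgebra K (Slots 𝔥 k) →ₗ[K] SymmetricAlgebra K (Slots 𝔥 k) ⊗[K] 𝔥 :=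
  der (hCoord 𝔥 𝔪 hc k l) ∘ₗ ninv (slotPr 𝔥 𝔪 hc k)

/-- Substitutions commute with the normalization, and the derivative at position `l` after a face is
the derivative at the position feeding `l`; if no position feeds it, the derivative is zero, as in
`zface`. -/
theorem hDer_cob (k : ℕ) {l : ℕ} (hl : l ≤ k + 1) (w : SymmetricAlgebra K (Slots 𝔥 k)) :
    hDer 𝔥 𝔪 hc (k + 1) l (cob 𝔥 k w) = zd 𝔥 k (fun l => hDer 𝔥 𝔪 hc k l w) l := by
  rw [cob, LinearMap.sum_apply, map_sum, zd]
  refine Finset.sum_congr rfl fun i hi => ?_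
  have hi := Finset.mem_range.1 hi
  rw [LinearMap.smul_apply, map_zsmul, AlgHom.toLinearMap_apply, hDer, LinearMap.comp_apply,
    ninv_smap (slotPr_slotMap 𝔥 𝔪 hc k (k + 1) (face k i)), der_smap,
    hCoord_slotMap 𝔥 𝔪 hc hl (by grind [face])]
  congr 1
  by_cases h : face k i l ≤ k
  · rw [zface_of_le 𝔥 h]; rfl
  · rw [hCoord_gt 𝔥 𝔪 hc (not_le.1 h), der_zero, map_zero, zface, if_neg h]

end Coord

variable [CharZero K]

/-- The sum of the products of the members of a family with the vectors in the respective
positions. -/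
def hMul (k : ℕ) (z : Fam 𝔥 k) : SymmetricAlgebra K (Slots 𝔥 k) :=
  ∑ l ∈ Finset.range (k + 1), mulBy (hVec 𝔥 k l) (z l)

theorem hMul_congr {k : ℕ} {z z' : Fam 𝔥 k} (h : ∀ l ≤ k, z l = z' l) : hMul 𝔥 k z = hMul 𝔥 k z' :=
  Finset.sum_congr rfl fun l hl => by rw [h l (Nat.lt_succ_iff.1 (Finset.mem_range.1 hl))]

theorem hMul_add (k : ℕ) (z z' : Fam 𝔥 k) :
    hMul 𝔥 k (fun l => z l + z' l) = hMul 𝔥 k z + hMul 𝔥 k z' := by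
  simp only [hMul, map_add, Finset.sum_add_distrib]

theorem hMul_smul (k : ℕ) (c : K) (z : Fam 𝔥 k) :
    hMul 𝔥 k (fun l => c • z l) = c • hMul 𝔥 k z := by
  simp only [hMul, map_smul, Finset.smul_sum]

/-- A face copies a vector at position `m` to all positions fed by `m`, so the sum over target
positions groups into the fibres of the face. -/
theorem hMul_zd (k : ℕ) (z : Fam 𝔥 k) : hMul 𝔥 (k + 1) (zd 𝔥 k z) = cob 𝔥 k (hMul 𝔥 k z) := by
  have h : ∀ i ∈ Finset.range (k + 2), ∑ l ∈ Finset.range (k + 2),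
      mulBy (hVec 𝔥 (k + 1) l) (zface 𝔥 k i z l) =
        smap (slotMap 𝔥 k (k + 1) (face k i)) (hMul 𝔥 k z) := by
    intro i hi
    have hi := Finset.mem_range.1 hi
    have h1 : ∀ m ∈ Finset.range (k + 1), smap (slotMap 𝔥 k (k + 1) (face k i))
        (mulBy (hVec 𝔥 k m) (z m)) = ∑ l ∈ Finset.range (k + 2), if face k i l = m then
          mulBy (hVec 𝔥 (k + 1) l) (zmap 𝔥 k (k + 1) (face k i) (z m)) else 0 := by
      intro m hm
      have : slotMap 𝔥 k (k + 1) (face k i) ∘ₗ hVec 𝔥 k m =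
          ∑ l ∈ Finset.range (k + 2), if face k i l = m then hVec 𝔥 (k + 1) l else 0 := by
        refine LinearMap.ext fun y => ?_
        rw [LinearMap.comp_apply, slotMap_hVec 𝔥 (Nat.lt_succ_iff.1 (Finset.mem_range.1 hm))
          (by grind [face]), LinearMap.sum_apply]
        refine Finset.sum_congr rfl fun l _ => ?_
        split_ifs <;> rfl
      rw [smap_mulBy, this, mulBy_sum]
      refine Finset.sum_congr rfl fun l _ => ?_
      split_ifs
      · rfl
      · exact mulBy_zero _
    rw [hMul, map_sum, Finset.sum_congr rfl h1, Finset.sum_comm]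
    refine Finset.sum_congr rfl fun l _ => ?_
    rw [Finset.sum_ite_eq]
    by_cases hl : face k i l ≤ k
    · rw [if_pos (Finset.mem_range.2 (Nat.lt_succ_of_le hl)), zface_of_le 𝔥 hl]
    · rw [if_neg (fun h => hl (Nat.lt_succ_iff.1 (Finset.mem_range.1 h))), zface, if_neg hl, map_zero]
  rw [hMul, cob, LinearMap.sum_apply]
  simp only [zd, map_sum, map_zsmul]
  rw [Finset.sum_comm]
  refine Finset.sum_congr rfl fun i hi => ?_
  rw [← Finset.smul_sum, h i hi]
  rfl

theorem zinv_congr {k : ℕ} {z z' : Fam 𝔥 k} {l : ℕ} (h : ∀ m ≤ l, z m = z' m) :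
    zinv 𝔥 k z l = zinv 𝔥 k z' l := by
  induction l with
  | zero => exact h 0 le_rfl
  | succ l ih => rw [zinv, zinv, ih fun m hm => h m (hm.trans l.le_succ), h _ le_rfl]

/-- `zinv` and `zs` commute with natural operations. -/
theorem zs_zinv_map {k : ℕ} (T : SymmetricAlgebra K (Slots 𝔥 (k + 1)) ⊗[K] 𝔥 →ₗ[K]
      SymmetricAlgebra K (Slots 𝔥 (k + 1)) ⊗[K] 𝔥)
    (T' : SymmetricAlgebra K (Slots 𝔥 k) ⊗[K] 𝔥 →ₗ[K] SymmetricAlgebra K (Slots 𝔥 k) ⊗[K] 𝔥)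
    (h : ∀ f z, T (zmap 𝔥 (k + 1) (k + 1) f z) = zmap 𝔥 (k + 1) (k + 1) f (T z))
    (h' : ∀ f z, T' (zmap 𝔥 (k + 1) k f z) = zmap 𝔥 (k + 1) k f (T z)) (z : Fam 𝔥 (k + 1)) (l : ℕ) :
    zs 𝔥 k (zinv 𝔥 (k + 1) (fun l => T (z l))) l = T' (zs 𝔥 k (zinv 𝔥 (k + 1) z) l) := by
  have : zinv 𝔥 (k + 1) (fun l => T (z l)) l = T (zinv 𝔥 (k + 1) z l) := by
    induction l with
    | zero => rfl
    | succ l ih => rw [zinv, zinv, ih, map_add, map_sub, h]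
  rw [zs, zs, this, map_zsmul, h']

theorem zinv_add (k : ℕ) (z z' : Fam 𝔥 k) (l : ℕ) :
    zinv 𝔥 k (fun l => z l + z' l) l = zinv 𝔥 k z l + zinv 𝔥 k z' l := by
  induction l with
  | zero => rfl
  | succ l ih => rw [zinv, zinv, zinv, ih, map_add]; abel

variable (𝔪 : Submodule K 𝔤) (hc : IsCompl 𝔥.toSubmodule 𝔪)

/-- The contracting homotopy. -/
def contr (k : ℕ) :
    SymmetricAlgebra K (Slots 𝔥 (k + 1)) →ₗ[K] SymmetricAlgebra K (Slots 𝔥 k) where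
  toFun w := -hMul 𝔥 k (zs 𝔥 k (zinv 𝔥 (k + 1) fun l => hDer 𝔥 𝔪 hc (k + 1) l w))
  map_add' w w' := by
    rw [← neg_add, ← hMul_add]
    congr 2
    funext l
    simp only [zs, map_add, zinv_add, smul_add]
  map_smul' c w := by
    rw [RingHom.id_apply, smul_neg, ← hMul_smul]
    congr 2
    funext l
    simp only [map_smul]
    exact zs_zinv_map 𝔥 (c • LinearMap.id) (c • LinearMap.id) (fun f z => (map_smul (zmap 𝔥 _ _ f) c z).symm)
      (fun f z => (map_smul (zmap 𝔥 _ _ f) c z).symm) _ l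

theorem contr_apply (k : ℕ) (w : SymmetricAlgebra K (Slots 𝔥 (k + 1))) : contr 𝔥 𝔪 hc k w =
    -hMul 𝔥 k (zs 𝔥 k (zinv 𝔥 (k + 1) fun l => hDer 𝔥 𝔪 hc (k + 1) l w)) := rfl

theorem hMul_hDer (k : ℕ) (w : SymmetricAlgebra K (Slots 𝔥 k)) :
    hMul 𝔥 k (fun l => hDer 𝔥 𝔪 hc k l w) = w - smap (slotPr 𝔥 𝔪 hc k) w :=
  sum_mulBy_der_ninv (slotPr_slotPr 𝔥 𝔪 hc k) _ (hCoord 𝔥 𝔪 hc k) (hVec 𝔥 k)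
    (fun l v hv => by rw [← hv, hCoord_slotPr]) (sum_hVec_hCoord 𝔥 𝔪 hc k) w

theorem contr_cob (k : ℕ) (w : SymmetricAlgebra K (Slots 𝔥 k)) : contr 𝔥 𝔪 hc k (cob 𝔥 k w) =
    -hMul 𝔥 k (zs 𝔥 k (zd 𝔥 k (zinv 𝔥 k fun l => hDer 𝔥 𝔪 hc k l w))) := by
  rw [contr_apply]
  congr 1
  refine hMul_congr 𝔥 fun l hl => ?_
  rw [zs, zs, zd_zinv 𝔥 k _ (by omega)]
  congr 2
  exact zinv_congr 𝔥 fun m hm => hDer_cob 𝔥 𝔪 hc k (by omega) w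

/-- Both `hMul` and `hDer` are compatible with the coboundaries. In between, `zs zd + zd zs = znu -
1` is applied to `zinv`, the inverse of `1 - znu`; with the minus sign in `contr` this leaves the
Euler decomposition `hMul_hDer`. -/
theorem cob_contr_add (k : ℕ) (w : SymmetricAlgebra K (Slots 𝔥 (k + 1))) :
    cob 𝔥 k (contr 𝔥 𝔪 hc k w) + contr 𝔥 𝔪 hc (k + 1) (cob 𝔥 (k + 1) w) =
      w - smap (slotPr 𝔥 𝔪 hc (k + 1)) w := by
  rw [contr_cob, contr_apply, map_neg, ← hMul_zd, ← neg_add, ← hMul_add, ← hMul_hDer, neg_eq_iff_add_eq_zero,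
    ← hMul_add]
  refine Finset.sum_eq_zero fun l hl => ?_
  have h := zs_zd 𝔥 k (zinv 𝔥 (k + 1) fun l => hDer 𝔥 𝔪 hc (k + 1) l w)
    (Nat.lt_succ_iff.1 (Finset.mem_range.1 hl))
  have e : _ = hDer 𝔥 𝔪 hc (k + 1) l w :=
    zinv_sub_znu 𝔥 (k + 1) (fun l => hDer 𝔥 𝔪 hc (k + 1) l w) l
  refine (congrArg _ ?_).trans (map_zero _)
  dsimp only
  rw [← e]
  refine (congrArg₂ (· + ·) ((add_comm _ _).trans h) rfl).trans ?_
  abel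

theorem contr_cob_zero (w : SymmetricAlgebra K (Slots 𝔥 0)) :
    contr 𝔥 𝔪 hc 0 (cob 𝔥 0 w) = w - smap (slotPr 𝔥 𝔪 hc 0) w := by
  rw [contr_cob, ← hMul_hDer, hMul, hMul, Finset.sum_range_one, Finset.sum_range_one, zs_zd_zero,
    map_neg, neg_neg, zinv]

/-- Every term of the homotopy has a factor from `𝔥`, which the projection kills. -/
theorem smap_slotPr_contr (k : ℕ) (w : SymmetricAlgebra K (Slots 𝔥 (k + 1))) :
    smap (slotPr 𝔥 𝔪 hc k) (contr 𝔥 𝔪 hc k w) = 0 := by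
  rw [contr_apply, map_neg, neg_eq_zero, hMul, map_sum]
  refine Finset.sum_eq_zero fun l _ => ?_
  rw [smap_mulBy, slotPr_hVec, mulBy_zero]

/-- Each ingredient commutes with the adjoint action: normalization and coordinates because the
splitting is invariant, position maps because they only copy entries. -/
theorem contr_deriv (hm : ∀ x ∈ 𝔥, ∀ y ∈ 𝔪, ⁅x, y⁆ ∈ 𝔪) (k : ℕ) (y : 𝔥)
    (w : SymmetricAlgebra K (Slots 𝔥 (k + 1))) :
    contr 𝔥 𝔪 hc k (deriv (slotAd 𝔥 (k + 1) y) w) = deriv (slotAd 𝔥 k y) (contr 𝔥 𝔪 hc k w) := by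
  have h1 : ∀ l, hDer 𝔥 𝔪 hc (k + 1) l (deriv (slotAd 𝔥 (k + 1) y) w) =
      derivT (slotAd 𝔥 (k + 1) y) (LieAlgebra.ad K 𝔥 y) (hDer 𝔥 𝔪 hc (k + 1) l w) := fun l => by
    rw [hDer, LinearMap.comp_apply, LinearMap.comp_apply,
      ninv_deriv (slotPr_slotAd 𝔥 𝔪 hc hm (k + 1) y),
      der_deriv (hCoord_slotAd 𝔥 𝔪 hc hm (k + 1) l y)]
  rw [contr_apply, contr_apply, map_neg, hMul, hMul, map_sum]
  congr 1
  refine Finset.sum_congr rfl fun l hl => ?_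
  simp only [h1]
  rw [zs_zinv_map 𝔥 _ (derivT (slotAd 𝔥 k y) (LieAlgebra.ad K 𝔥 y))
    (fun f z => derivT_rTensor_smap _ (slotAd_slotMap 𝔥 _ _ f y) z)
    (fun f z => derivT_rTensor_smap _ (slotAd_slotMap 𝔥 _ _ f y) z),
    mulBy_derivT (slotAd_hVec 𝔥 (Nat.lt_succ_iff.1 (Finset.mem_range.1 hl)) y)]

/-! ### The homotopy on `ADT` -/

/-- The contracting homotopy on `⊗ᵏ⁺¹ U𝔤 ⊗ U𝔥`. -/
def degHtpy (k : ℕ) : ADT K 𝔥 (k + 1) →ₗ[K] ADT K 𝔥 k :=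
  Psi 𝔥 𝔪 hc k ∘ₗ contr 𝔥 𝔪 hc k ∘ₗ
    (LinearEquiv.ofBijective _ (Psi_bijective 𝔥 𝔪 hc (k + 1))).symm.toLinearMap

theorem degHtpy_Psi (k : ℕ) (w : SymmetricAlgebra K (Slots 𝔥 (k + 1))) :
    degHtpy 𝔥 𝔪 hc k (Psi 𝔥 𝔪 hc (k + 1) w) = Psi 𝔥 𝔪 hc k (contr 𝔥 𝔪 hc k w) := by
  rw [degHtpy, LinearMap.comp_apply, LinearMap.comp_apply]
  congr 2
  exact (LinearEquiv.ofBijective _ (Psi_bijective 𝔥 𝔪 hc (k + 1))).symm_apply_apply w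

/-- The contracting homotopy on `ADT`. -/
def htpyTot : ADTTot K 𝔥 →ₗ[K] ADTTot K 𝔥 :=
  DirectSum.toModule K ℕ _ fun k => match k with
    | 0 => 0
    | k + 1 => (-1 : ℤ) ^ (k + 1) • (DirectSum.lof K ℕ (ADT K 𝔥) k ∘ₗ degHtpy 𝔥 𝔪 hc k)

theorem htpyTot_lf_zero (P : ADT K 𝔥 0) : htpyTot 𝔥 𝔪 hc (lf 𝔥 0 P) = 0 :=
  DirectSum.toModule_lof K 0 P

theorem htpyTot_lf (k : ℕ) (P : ADT K 𝔥 (k + 1)) :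
    htpyTot 𝔥 𝔪 hc (lf 𝔥 (k + 1) P) = (-1 : ℤ) ^ (k + 1) • lf 𝔥 k (degHtpy 𝔥 𝔪 hc k P) :=
  DirectSum.toModule_lof K (k + 1) P

theorem dTot_htpyTot (x : ADTTot K 𝔥) :
    dTot K 𝔥 (htpyTot 𝔥 𝔪 hc x) + htpyTot 𝔥 𝔪 hc (dTot K 𝔥 x) = x - projTot K 𝔥 𝔪 x := by
  induction x using tot_induction with
  | zero => simp
  | add a b ha hb =>
    simp only [map_add]
    rw [add_sub_add_comm, ← ha, ← hb]
    abel
  | lf k P =>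
    obtain ⟨w, rfl⟩ := (Psi_bijective 𝔥 𝔪 hc k).2 P
    rw [projTot_lf, degPr_Psi, dTot_lf, map_zsmul, htpyTot_lf, smul_smul, b_Psi, degHtpy_Psi]
    cases k with
    | zero =>
      rw [htpyTot_lf_zero, map_zero, zero_add, contr_cob_zero, map_sub, map_sub]
      simp
    | succ k =>
      rw [htpyTot_lf, map_zsmul, dTot_lf, smul_smul, degHtpy_Psi, b_Psi, negOne_pow_mul_self,
        negOne_pow_mul_self, one_smul, one_smul, ← map_add, ← map_add, cob_contr_add, map_sub, map_sub]

theorem projTot_htpyTot (x : ADTTot K 𝔥) : projTot K 𝔥 𝔪 (htpyTot 𝔥 𝔪 hc x) = 0 := by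
  induction x using tot_induction with
  | zero => simp
  | add a b ha hb => rw [map_add, map_add, ha, hb, add_zero]
  | lf k P =>
    cases k with
    | zero => rw [htpyTot_lf_zero, map_zero]
    | succ k =>
      obtain ⟨w, rfl⟩ := (Psi_bijective 𝔥 𝔪 hc (k + 1)).2 P
      rw [htpyTot_lf, map_zsmul, projTot_lf, degHtpy_Psi, degPr_Psi, smap_slotPr_contr, map_zero,
        map_zero, smul_zero]

theorem htpyTot_mem_invariants (hm : ∀ x ∈ 𝔥, ∀ y ∈ 𝔪, ⁅x, y⁆ ∈ 𝔪) {x : ADTTot K 𝔥}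
    (hx : x ∈ invariants K 𝔥) : htpyTot 𝔥 𝔪 hc x ∈ invariants K 𝔥 := by
  refine inv_induction 𝔥 (p := fun x => htpyTot 𝔥 𝔪 hc x ∈ invariants K 𝔥)
    (by rw [map_zero]; exact zero_mem _)
    (fun a b ha hb => by rw [map_add]; exact add_mem ha hb) (fun k P hP => ?_) hx
  cases k with
  | zero => rw [htpyTot_lf_zero]; exact zero_mem _
  | succ k =>
    rw [htpyTot_lf]
    refine zsmul_mem (lf_mem_invariants 𝔥 ?_) _
    obtain ⟨w, rfl⟩ := (Psi_bijective 𝔥 𝔪 hc (k + 1)).2 P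
    rw [inv_Psi_iff 𝔥 𝔪 hc hm] at hP
    rw [degHtpy_Psi, inv_Psi_iff 𝔥 𝔪 hc hm]
    intro y
    rw [← contr_deriv 𝔥 𝔪 hc hm, hP y, map_zero]

theorem HomDeg.htpyTot {n : ℤ} {x : ADTTot K 𝔥} (hx : HomDeg 𝔥 n x) :
    HomDeg 𝔥 (n - 1) (htpyTot 𝔥 𝔪 hc x) := by
  rcases hx.cases with rfl | ⟨p, rfl, h⟩
  · rw [map_zero]; exact fun _ _ => rfl
  · rw [h]
    cases p with
    | zero => rw [htpyTot_lf_zero]; exact fun _ _ => rfl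
    | succ p =>
      rw [htpyTot_lf]
      exact (homDeg_lf 𝔥 (by push_cast; ring) _).zsmul 𝔥 _

end

section

set_option linter.unusedSectionVars false

/-! ## The filtration by the degree in `U𝔥` -/

variable {K : Type*} [Field K] {𝔤 : Type*} [LieRing 𝔤] [LieAlgebra K 𝔤] (𝔥 : LieSubalgebra K 𝔤)

theorem iterCoproduct_ι (n : ℕ) (y : 𝔥) :
    iterCoproduct K 𝔥 n (UniversalEnvelopingAlgebra.ι K y) =
      ∑ i, PiTensorProduct.tprod K (Pi.mulSingle i (UniversalEnvelopingAlgebra.ι K y)) := by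
  rw [iterCoproduct, UniversalEnvelopingAlgebra.lift_ι_apply]
  change (∑ i, (PiTensorProduct.singleAlgHom (R := K)
        (A := fun _ : Fin n => UniversalEnvelopingAlgebra K 𝔥) i).toLinearMap ∘ₗ
          (UniversalEnvelopingAlgebra.ι K : 𝔥 →ₗ⁅K⁆ _).toLinearMap) y = _
  rw [LinearMap.sum_apply]
  exact Finset.sum_congr rfl fun i _ => PiTensorProduct.singleAlgHom_apply ..

/-- The span of the pure tensors with at most `m` entries different from `1`. -/
def spanEntries (n m : ℕ) : Submodule K (⨂[K] _ : Fin n, UniversalEnvelopingAlgebra K 𝔥) :=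
  Submodule.span K {x | ∃ (S : Finset (Fin n)) (u : Fin n → UniversalEnvelopingAlgebra K 𝔥),
    S.card ≤ m ∧ (∀ i ∉ S, u i = 1) ∧ x = PiTensorProduct.tprod K u}

theorem mulSingle_mul_mem_spanEntries {n m : ℕ} (i : Fin n) (v : UniversalEnvelopingAlgebra K 𝔥)
    {x : ⨂[K] _ : Fin n, UniversalEnvelopingAlgebra K 𝔥} (hx : x ∈ spanEntries 𝔥 n m) :
    PiTensorProduct.tprod K (Pi.mulSingle i v) * x ∈ spanEntries 𝔥 n (m + 1) := by
  refine Submodule.span_induction (p := fun x _ => PiTensorProduct.tprod K (Pi.mulSingle i v) * x ∈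
    spanEntries 𝔥 n (m + 1)) ?_ (by rw [mul_zero]; exact zero_mem _)
    (fun a b _ _ ha hb => by rw [mul_add]; exact add_mem ha hb)
    (fun c a _ ha => by rw [mul_smul_comm]; exact Submodule.smul_mem _ c ha) hx
  rintro _ ⟨S, u, hS, hu, rfl⟩
  rw [PiTensorProduct.tprod_mul_tprod]
  refine Submodule.subset_span ⟨insert i S, _, (Finset.card_insert_le _ _).trans (by omega), ?_, rfl⟩
  intro j hj
  rw [Finset.mem_insert, not_or] at hj
  rw [Pi.mul_apply, hu j hj.2, mul_one, Pi.mulSingle_eq_of_ne hj.1]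

/-- A letter is primitive, so each factor of a product changes at most one more tensor entry. -/
theorem iterCoproduct_mem_spanEntries (n : ℕ) {m : ℕ} {v : UniversalEnvelopingAlgebra K 𝔥}
    (hv : v ∈ ueaLE K 𝔥 m) : iterCoproduct K 𝔥 n v ∈ spanEntries 𝔥 n m := by
  induction m generalizing v with
  | zero =>
    refine ueaLE_zero_induction (p := fun v => iterCoproduct K 𝔥 n v ∈ spanEntries 𝔥 n 0)
      (fun r => ?_) hv
    rw [AlgHom.commutes, Algebra.algebraMap_eq_smul_one]
    exact Submodule.smul_mem _ r (Submodule.subset_span ⟨∅, 1, le_rfl, fun _ _ => rfl, rfl⟩)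
  | succ m ih =>
    refine ueaLE_succ_induction (p := fun v => iterCoproduct K 𝔥 n v ∈ spanEntries 𝔥 n (m + 1))
      (fun x y hx hy => by rw [map_add]; exact add_mem hx hy) (fun v hv => ?_) (fun y v hv => ?_) hv
    · refine Submodule.span_mono ?_ (ih hv)
      rintro _ ⟨S, u, hS, h⟩
      exact ⟨S, u, hS.trans m.le_succ, h⟩
    · rw [map_mul, iterCoproduct_ι, Finset.sum_mul]
      exact sum_mem fun i _ => mulSingle_mul_mem_spanEntries 𝔥 i _ (ih hv)

/-- With `n` letters and `n + 1` tensor factors some entry remains `1` and is killed by `id - η ε`.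
Only this inclusion between the two filtrations is needed. -/
theorem ueaLE_le_filtU (n : ℕ) : ueaLE K 𝔥 n ≤ filtU K 𝔥 n := by
  intro v hv
  rw [filtU, LinearMap.mem_ker, LinearMap.comp_apply, AlgHom.toLinearMap_apply]
  refine Submodule.span_induction (p := fun x _ => PiTensorProduct.map (fun _ : Fin (n + 1) =>
        (LinearMap.id - (unitCounit K 𝔥).toLinearMap :
          UniversalEnvelopingAlgebra K 𝔥 →ₗ[K] UniversalEnvelopingAlgebra K 𝔥)) x = 0)
    ?_ (map_zero _) (fun a b _ _ ha hb => by rw [map_add, ha, hb, add_zero])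
    (fun c a _ ha => by rw [map_smul, ha, smul_zero]) (iterCoproduct_mem_spanEntries 𝔥 (n + 1) hv)
  rintro _ ⟨S, u, hS, hu, rfl⟩
  obtain ⟨i, hi⟩ : ∃ i, i ∉ S := by
    by_contra! h
    have := Finset.card_le_card (fun i _ => h i : Finset.univ ⊆ S)
    rw [Finset.card_univ, Fintype.card_fin] at this
    omega
  rw [PiTensorProduct.map_tprod]
  refine MultilinearMap.map_coord_zero _ i ?_
  simp [hu i hi]

/-- The span of the tensors `u_1 ⊗ ⋯ ⊗ u_k ⊗ v` with `v` a product of at most `n` factors. -/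
def adtLE (k n : ℕ) : Submodule K (ADT K 𝔥 k) :=
  Submodule.span K {x | ∃ (u : Fin k → UniversalEnvelopingAlgebra K 𝔤), ∃ v ∈ ueaLE K 𝔥 n,
    x = toADT K 𝔥 k (PiTensorProduct.tprod K u ⊗ₜ[K] v)}

theorem tmul_mem_adtLE {k n : ℕ} (u : Fin k → UniversalEnvelopingAlgebra K 𝔤)
    {v : UniversalEnvelopingAlgebra K 𝔥} (hv : v ∈ ueaLE K 𝔥 n) :
    toADT K 𝔥 k (PiTensorProduct.tprod K u ⊗ₜ[K] v) ∈ adtLE 𝔥 k n :=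
  Submodule.subset_span ⟨u, v, hv, rfl⟩

theorem adtLE_le {k n : ℕ} {N : Submodule K (ADT K 𝔥 k)}
    (h : ∀ (u : Fin k → UniversalEnvelopingAlgebra K 𝔤), ∀ v ∈ ueaLE K 𝔥 n,
      toADT K 𝔥 k (PiTensorProduct.tprod K u ⊗ₜ[K] v) ∈ N) : adtLE 𝔥 k n ≤ N := by
  refine Submodule.span_le.2 ?_
  rintro _ ⟨u, v, hv, rfl⟩
  exact h u v hv

theorem adtLE_mono {k m n : ℕ} (h : m ≤ n) : adtLE 𝔥 k m ≤ adtLE 𝔥 k n :=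
  adtLE_le 𝔥 fun u _ hv => tmul_mem_adtLE 𝔥 u (ueaLE_mono h hv)

theorem mul_mem_adtLE {k m n : ℕ} {P Q : ADT K 𝔥 k} (hP : P ∈ adtLE 𝔥 k m)
    (hQ : Q ∈ adtLE 𝔥 k n) : P * Q ∈ adtLE 𝔥 k (m + n) := by
  have h1 : adtLE 𝔥 k m ≤ (adtLE 𝔥 k (m + n)).comap (LinearMap.mulRight K Q) := by
    refine adtLE_le 𝔥 fun u v hv => ?_
    have h2 : adtLE 𝔥 k n ≤ (adtLE 𝔥 k (m + n)).comap
        (LinearMap.mulLeft K (toADT K 𝔥 k (PiTensorProduct.tprod K u ⊗ₜ[K] v))) := by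
      refine adtLE_le 𝔥 fun u' v' hv' => ?_
      rw [Submodule.mem_comap, LinearMap.mulLeft_apply, tmul_mul_tmul]
      exact tmul_mem_adtLE 𝔥 _ (mul_mem_ueaLE hv hv')
    exact h2 hQ
  exact h1 hP

theorem one_mem_adtLE (k n : ℕ) : (1 : ADT K 𝔥 k) ∈ adtLE 𝔥 k n :=
  tmul_mem_adtLE 𝔥 1 (one_mem_ueaLE n)

theorem leg_mem_adtLE {k : ℕ} (i : Fin k) (u : UniversalEnvelopingAlgebra K 𝔤) :
    leg K 𝔥 i u ∈ adtLE 𝔥 k 0 := by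
  rw [leg_eq_tmul]
  exact tmul_mem_adtLE 𝔥 _ (one_mem_ueaLE 0)

theorem tail_mem_adtLE {k n : ℕ} {v : UniversalEnvelopingAlgebra K 𝔥} (hv : v ∈ ueaLE K 𝔥 n) :
    tail K 𝔥 k v ∈ adtLE 𝔥 k n := by
  rw [tail_eq_tmul]
  exact tmul_mem_adtLE 𝔥 _ hv

theorem mul_mem_adtLE_of_zero {k n : ℕ} {P Q : ADT K 𝔥 k} (hP : P ∈ adtLE 𝔥 k 0)
    (hQ : Q ∈ adtLE 𝔥 k n) : P * Q ∈ adtLE 𝔥 k n := by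
  have := mul_mem_adtLE 𝔥 hP hQ
  rwa [zero_add] at this

theorem pow_mem_adtLE {k n : ℕ} {P : ADT K 𝔥 k} (hP : P ∈ adtLE 𝔥 k n) (j : ℕ) :
    P ^ j ∈ adtLE 𝔥 k (j * n) := by
  induction j with
  | zero => rw [pow_zero]; exact one_mem_adtLE 𝔥 k _
  | succ j ih => rw [pow_succ, add_mul, one_mul]; exact mul_mem_adtLE 𝔥 ih hP

theorem list_prod_mem_adtLE {k : ℕ} {l : List (ADT K 𝔥 k)} (h : ∀ P ∈ l, P ∈ adtLE 𝔥 k 0) :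
    l.prod ∈ adtLE 𝔥 k 0 := by
  induction l with
  | nil => exact one_mem_adtLE 𝔥 k 0
  | cons P l ih =>
    rw [List.prod_cons]
    exact mul_mem_adtLE_of_zero 𝔥 (h P List.mem_cons_self) (ih fun Q hQ => h Q (List.mem_cons_of_mem P hQ))

theorem spread_mem_adtLE {k : ℕ} (I : Finset (Fin k)) (u : UniversalEnvelopingAlgebra K 𝔤) :
    spread K 𝔥 I u ∈ adtLE 𝔥 k 0 := by
  induction u using uea_induction with
  | algebraMap r =>
    rw [AlgHom.commutes, Algebra.algebraMap_eq_smul_one]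
    exact Submodule.smul_mem _ r (one_mem_adtLE 𝔥 k 0)
  | ι x => rw [spread_ι]; exact sum_mem fun i _ => leg_mem_adtLE 𝔥 i _
  | mul a b ha hb => rw [map_mul]; exact mul_mem_adtLE_of_zero 𝔥 ha hb
  | add a b ha hb => rw [map_add]; exact add_mem ha hb

theorem spreadTail_mem_adtLE {k n : ℕ} (I : Finset (Fin k)) {v : UniversalEnvelopingAlgebra K 𝔥}
    (hv : v ∈ ueaLE K 𝔥 n) : spreadTail K 𝔥 I v ∈ adtLE 𝔥 k n := by
  induction n generalizing v with
  | zero =>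
    refine ueaLE_zero_induction (p := fun v => spreadTail K 𝔥 I v ∈ adtLE 𝔥 k 0) (fun r => ?_) hv
    rw [AlgHom.commutes, Algebra.algebraMap_eq_smul_one]
    exact Submodule.smul_mem _ r (one_mem_adtLE 𝔥 k 0)
  | succ n ih =>
    refine ueaLE_succ_induction (p := fun v => spreadTail K 𝔥 I v ∈ adtLE 𝔥 k (n + 1))
      (fun x y hx hy => by rw [map_add]; exact add_mem hx hy)
      (fun v hv => adtLE_mono 𝔥 n.le_succ (ih hv)) (fun y v hv => ?_) hv
    rw [map_mul, spreadTail_ι, add_comm n]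
    refine mul_mem_adtLE 𝔥 (add_mem ?_ (tail_mem_adtLE 𝔥 (ι_mem_ueaLE y))) (ih hv)
    exact sum_mem fun i _ => adtLE_mono 𝔥 zero_le_one (leg_mem_adtLE 𝔥 i _)

/-- Spreading never adds letters to the last factor: the legs do not reach it, and each of its
letters leaves one copy there. -/
theorem pull_mem_adtLE {k m n : ℕ} (f : ℕ → ℕ) {P : ADT K 𝔥 k} (hP : P ∈ adtLE 𝔥 k n) :
    pull 𝔥 k m f P ∈ adtLE 𝔥 m n := by
  have h : adtLE 𝔥 k n ≤ (adtLE 𝔥 m n).comap (pull 𝔥 k m f).toLinearMap := by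
    refine adtLE_le 𝔥 fun u v hv => ?_
    rw [Submodule.mem_comap, AlgHom.toLinearMap_apply, tmul_eq_prod, map_mul, pull_tail,
      map_list_prod]
    refine mul_mem_adtLE_of_zero 𝔥 (list_prod_mem_adtLE 𝔥 fun P hP => ?_)
      (spreadTail_mem_adtLE 𝔥 _ hv)
    obtain ⟨Q, hQ, rfl⟩ := List.mem_map.1 hP
    obtain ⟨i, rfl⟩ := (List.mem_ofFn' _ _).1 hQ
    rw [pull_leg]
    exact spread_mem_adtLE 𝔥 _ _
  exact h hP

/-- The elements of `ADT` with components in `adtLE`. -/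
def totLE (n : ℕ) : Submodule K (ADTTot K 𝔥) where
  carrier := {x | ∀ k, x k ∈ adtLE 𝔥 k n}
  zero_mem' := fun _ => zero_mem _
  add_mem' := fun hx hy k => by rw [DirectSum.add_apply]; exact add_mem (hx k) (hy k)
  smul_mem' := fun c x hx k => by rw [DirectSum.smul_apply]; exact Submodule.smul_mem _ c (hx k)

theorem lf_mem_totLE {k n : ℕ} {P : ADT K 𝔥 k} (hP : P ∈ adtLE 𝔥 k n) : lf 𝔥 k P ∈ totLE 𝔥 n := by
  intro l
  by_cases h : k = l
  · subst h; rwa [lf_apply_self]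
  · rw [lf_apply_of_ne 𝔥 h]; exact zero_mem _

theorem totLE_induction {n : ℕ} {N : Submodule K (ADTTot K 𝔥)}
    (h : ∀ k, ∀ P ∈ adtLE 𝔥 k n, lf 𝔥 k P ∈ N) {x : ADTTot K 𝔥} (hx : x ∈ totLE 𝔥 n) : x ∈ N := by
  obtain ⟨s, hs⟩ := sum_lf 𝔥 x
  rw [hs]
  exact sum_mem fun k _ => h k _ (hx k)

theorem braceTot_lf_mem_totLE {p q m n : ℕ} {P : ADT K 𝔥 p} {Q : ADT K 𝔥 q}
    (hP : P ∈ adtLE 𝔥 p m) (hQ : Q ∈ adtLE 𝔥 q n) :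
    braceTot 𝔥 (lf 𝔥 p P) (lf 𝔥 q Q) ∈ totLE 𝔥 (m + n) := by
  rw [braceTot_lf]
  exact sum_mem fun i _ => zsmul_mem
    (lf_mem_totLE 𝔥 (mul_mem_adtLE 𝔥 (pull_mem_adtLE 𝔥 _ hP) (pull_mem_adtLE 𝔥 _ hQ))) _

theorem bracketTot_mem_totLE {m n : ℕ} {x y : ADTTot K 𝔥} (hx : x ∈ totLE 𝔥 m)
    (hy : y ∈ totLE 𝔥 n) : bracketTot K 𝔥 x y ∈ totLE 𝔥 (m + n) := by
  refine totLE_induction 𝔥 (N := (totLE 𝔥 (m + n)).comap ((bracketTot K 𝔥).flip y))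
    (fun p P hP => ?_) hx
  refine totLE_induction 𝔥 (N := (totLE 𝔥 (m + n)).comap (bracketTot K 𝔥 (lf 𝔥 p P)))
    (fun q Q hQ => ?_) hy
  rw [Submodule.mem_comap, bracketTot_eq]
  refine sub_mem (braceTot_lf_mem_totLE 𝔥 hP hQ) (zsmul_mem ?_ _)
  rw [add_comm]
  exact braceTot_lf_mem_totLE 𝔥 hQ hP

theorem totLE_le_filtADT (n : ℕ) : totLE 𝔥 n ≤ filtADT K 𝔥 n := by
  intro x hx k
  refine adtLE_le 𝔥 (fun u v hv => ?_) (hx k)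
  exact ⟨PiTensorProduct.tprod K u ⊗ₜ[K] ⟨v, ueaLE_le_filtU 𝔥 n hv⟩, rfl⟩

theorem TUm_le_totLE (𝔪 : Submodule K 𝔤) : TUm K 𝔥 𝔪 ≤ totLE 𝔥 0 := by
  intro x hx k
  obtain ⟨t, ht⟩ := (mem_TUm 𝔥 𝔪).1 hx k
  rw [← ht]
  clear ht
  induction t using PiTensorProduct.induction_on with
  | smul_tprod r u =>
    rw [map_smul]
    refine Submodule.smul_mem _ r ?_
    simp only [LinearMap.comp_apply, PiTensorProduct.map_tprod]
    exact tmul_mem_adtLE 𝔥 _ (one_mem_ueaLE 0)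
  | add a b ha hb => rw [map_add]; exact add_mem ha hb

end

section

set_option linter.unusedSectionVars false

/-! ### The degree of the homotopy in the last tensor factor -/

section DegBy

open SymmetricAlgebra (ι)

variable {K : Type*} [Field K] [CharZero K] {V V' W : Type*} [AddCommGroup V] [Module K V]
  [AddCommGroup V'] [Module K V'] [AddCommGroup W] [Module K W]

/-- The elements of `S V` of degree at most `n` in the kernel of the projection `ρ`. -/
def degBy (ρ : V →ₗ[K] V) (n : ℕ) : Submodule K (SymmetricAlgebra K V) where
  carrier := {w | (family ρ (compl ρ) w).natDegree ≤ n}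
  zero_mem' := by simp
  add_mem' {w w'} hw hw' := by
    rw [Set.mem_ofPred_eq, map_add]
    exact Polynomial.natDegree_add_le_of_degree_le hw hw'
  smul_mem' c w hw := by
    rw [Set.mem_ofPred_eq, map_smul]
    exact (Polynomial.natDegree_smul_le c _).trans hw

variable {ρ : V →ₗ[K] V} {ρ' : V' →ₗ[K] V'}

theorem mem_degBy {n : ℕ} {w : SymmetricAlgebra K V} :
    w ∈ degBy ρ n ↔ (family ρ (compl ρ) w).natDegree ≤ n := Iff.rfl

theorem degBy_mono {m n : ℕ} (h : m ≤ n) : degBy ρ m ≤ degBy ρ n := fun _ hw => le_trans hw h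

theorem mul_mem_degBy {m n : ℕ} {w w' : SymmetricAlgebra K V} (hw : w ∈ degBy ρ m)
    (hw' : w' ∈ degBy ρ n) : w * w' ∈ degBy ρ (m + n) := by
  rw [mem_degBy, map_mul]
  exact Polynomial.natDegree_mul_le_of_le hw hw'

theorem ι_mem_degBy (v : V) : ι K V v ∈ degBy ρ 1 := by
  rw [mem_degBy, family_ι]
  refine Polynomial.natDegree_add_le_of_degree_le (by simp) ?_
  exact (Polynomial.natDegree_C_mul_le _ _).trans Polynomial.natDegree_X_le

theorem ι_mem_degBy_zero {v : V} (hv : ρ v = v) : ι K V v ∈ degBy ρ 0 := by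
  rw [mem_degBy, family_ι]
  simp [hv]

theorem pow_mem_degBy {n : ℕ} {w : SymmetricAlgebra K V} (hw : w ∈ degBy ρ n) (j : ℕ) :
    w ^ j ∈ degBy ρ (j * n) := by
  rw [mem_degBy, map_pow]
  exact Polynomial.natDegree_pow_le_of_le j hw

theorem pow_mul_pow_mem_degBy {x : V} (hx : ρ x = x) (y : V) (i : ℕ) {j n : ℕ} (hj : j ≤ n) :
    ι K V x ^ i * ι K V y ^ j ∈ degBy ρ n := by
  have h1 := pow_mem_degBy (ι_mem_degBy_zero (K := K) hx) i
  have h2 := pow_mem_degBy (ι_mem_degBy (K := K) (ρ := ρ) y) j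
  have := mul_mem_degBy h1 h2
  rw [mul_zero, zero_add, mul_one] at this
  exact degBy_mono hj this

/-- The element is recovered from its scaling family at `t = 1`, hence is the sum of its homogeneous
parts of degree at most `n`, and each of these is spanned by products `x^i y^j`. -/
theorem degBy_le (hρ : ∀ v, ρ (ρ v) = ρ v) {n : ℕ} {N : Submodule K (SymmetricAlgebra K V)}
    (h : ∀ x y i j, ρ x = x → ρ y = 0 → j ≤ n → ι K V x ^ i * ι K V y ^ j ∈ N) :
    degBy ρ n ≤ N := by
  intro w hw
  have key : ∀ j ≤ n, (family ρ (compl ρ) w).coeff j ∈ N := by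
    intro j hj
    refine split_pow_induction hρ (p := fun w => (family ρ (compl ρ) w).coeff j ∈ N)
      (by rw [map_zero]; exact zero_mem _)
      (fun a b ha hb => by rw [map_add, Polynomial.coeff_add]; exact add_mem ha hb)
      (fun c a ha => by rw [map_smul, Polynomial.coeff_smul]; exact Submodule.smul_mem _ c ha)
      (fun x y i m hx hy => ?_) w
    have : family ρ (compl ρ) (ι K V x ^ i * ι K V y ^ m) =
        Polynomial.C (ι K V x ^ i * ι K V y ^ m) * Polynomial.X ^ m := by
      rw [map_mul, map_pow, map_pow, family_ι, family_ι]
      simp only [LinearMap.sub_apply, LinearMap.id_apply, hx, hy, sub_self, map_zero, zero_mul,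
        add_zero, zero_add, sub_zero, mul_pow, map_mul, map_pow, mul_assoc]
    rw [this, Polynomial.coeff_C_mul_X_pow]
    split_ifs with hm
    · subst hm; exact h x y i j hx hy hj
    · exact zero_mem _
  have h1 := evalAt_family (V' := V) ρ (compl ρ) (1 : K) w
  rw [one_smul, show ρ + compl ρ = LinearMap.id by ext v; simp, smap_id, evalAt_eq_sum] at h1
  rw [← h1]
  refine sum_mem fun j hj => Submodule.smul_mem _ _ (key j ?_)
  exact (Nat.lt_succ_iff.1 (Finset.mem_range.1 hj)).trans hw

theorem smap_mem_degBy (hρ : ∀ v, ρ (ρ v) = ρ v) {f : V →ₗ[K] V'}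
    (h : ∀ v, ρ v = v → ρ' (f v) = f v) {n : ℕ} {w : SymmetricAlgebra K V} (hw : w ∈ degBy ρ n) :
    smap f w ∈ degBy ρ' n := by
  refine degBy_le (N := (degBy ρ' n).comap (smap f).toLinearMap) hρ (fun x y i j hx hy hj => ?_) hw
  rw [Submodule.mem_comap, AlgHom.toLinearMap_apply, map_mul, map_pow, map_pow, smap_ι, smap_ι]
  exact pow_mul_pow_mem_degBy (h x hx) _ _ hj

variable (W) in
/-- The analogue of `degBy` for `S V ⊗ W`. -/
def degByT (ρ : V →ₗ[K] V) (n : ℕ) : Submodule K (SymmetricAlgebra K V ⊗[K] W) :=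
  Submodule.span K {z | ∃ w ∈ degBy ρ n, ∃ y : W, z = w ⊗ₜ[K] y}

theorem tmul_mem_degByT {n : ℕ} {w : SymmetricAlgebra K V} (hw : w ∈ degBy ρ n) (y : W) :
    w ⊗ₜ[K] y ∈ degByT W ρ n := Submodule.subset_span ⟨w, hw, y, rfl⟩

theorem degByT_le {n : ℕ} {N : Submodule K (SymmetricAlgebra K V ⊗[K] W)}
    (h : ∀ w ∈ degBy ρ n, ∀ y : W, w ⊗ₜ[K] y ∈ N) : degByT W ρ n ≤ N := by
  refine Submodule.span_le.2 ?_
  rintro _ ⟨w, hw, y, rfl⟩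
  exact h w hw y

theorem rTensor_smap_mem_degByT (hρ : ∀ v, ρ (ρ v) = ρ v) {f : V →ₗ[K] V'}
    (h : ∀ v, ρ v = v → ρ' (f v) = f v) {n : ℕ} {z : SymmetricAlgebra K V ⊗[K] W}
    (hz : z ∈ degByT W ρ n) : LinearMap.rTensor W (smap f).toLinearMap z ∈ degByT W ρ' n := by
  refine degByT_le (N := (degByT W ρ' n).comap (LinearMap.rTensor W (smap f).toLinearMap))
    (fun w hw y => ?_) hz
  rw [Submodule.mem_comap, LinearMap.rTensor_tmul]
  exact tmul_mem_degByT (smap_mem_degBy hρ h hw) y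

theorem mulBy_mem_degBy (e : W →ₗ[K] V) {n : ℕ} {z : SymmetricAlgebra K V ⊗[K] W}
    (hz : z ∈ degByT W ρ n) : mulBy e z ∈ degBy ρ (n + 1) := by
  refine degByT_le (N := (degBy ρ (n + 1)).comap (mulBy e)) (fun w hw y => ?_) hz
  rw [Submodule.mem_comap, mulBy_tmul]
  exact mul_mem_degBy hw (ι_mem_degBy _)

theorem der_mem_degByT (hρ : ∀ v, ρ (ρ v) = ρ v) (c : V →ₗ[K] W) {n : ℕ}
    {w : SymmetricAlgebra K V} (hw : w ∈ degBy ρ n) : der c w ∈ degByT W ρ n := by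
  refine degBy_le (N := (degByT W ρ n).comap (der c)) hρ (fun x y i j hx hy hj => ?_) hw
  rw [Submodule.mem_comap, der_mul]
  refine add_mem ?_ ?_
  · cases j with
    | zero => rw [pow_zero, der_one, smul_zero]; exact zero_mem _
    | succ j =>
      rw [der_pow, smul_comm, TensorProduct.smul_tmul', smul_eq_mul]
      exact Submodule.smul_mem _ _ (tmul_mem_degByT (pow_mul_pow_mem_degBy hx y i (by omega)) _)
  · cases i with
    | zero => rw [pow_zero, der_one, smul_zero]; exact zero_mem _
    | succ i =>
      rw [der_pow, smul_comm, TensorProduct.smul_tmul', smul_eq_mul, mul_comm]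
      exact Submodule.smul_mem _ _ (tmul_mem_degByT (pow_mul_pow_mem_degBy hx y i hj) _)

end DegBy

open SymmetricAlgebra (ι)

variable {K : Type*} [Field K] {𝔤 : Type*} [LieRing 𝔤] [LieAlgebra K 𝔤] (𝔥 : LieSubalgebra K 𝔤)

/-- The projection of `𝔤ᵏ × 𝔥` onto `𝔤ᵏ`. -/
def legPart (k : ℕ) : Slots 𝔥 k →ₗ[K] Slots 𝔥 k := LinearMap.inl K _ _ ∘ₗ LinearMap.fst K _ _

theorem legPart_apply (k : ℕ) (v : Slots 𝔥 k) : legPart 𝔥 k v = (v.1, 0) := rfl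

theorem legPart_legPart (k : ℕ) (v : Slots 𝔥 k) : legPart 𝔥 k (legPart 𝔥 k v) = legPart 𝔥 k v := rfl

theorem legPart_eq_self_iff {k : ℕ} {v : Slots 𝔥 k} : legPart 𝔥 k v = v ↔ v.2 = 0 := by
  rw [legPart_apply, Prod.ext_iff]
  exact ⟨fun h => h.2.symm, fun h => ⟨rfl, h.symm⟩⟩

variable [CharZero K] (𝔪 : Submodule K 𝔤) (hc : IsCompl 𝔥.toSubmodule 𝔪)

theorem zmap_mem_degByT {k n m : ℕ} (f : ℕ → ℕ) {z : SymmetricAlgebra K (Slots 𝔥 k) ⊗[K] 𝔥}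
    (hz : z ∈ degByT 𝔥 (legPart 𝔥 k) m) : zmap 𝔥 k n f z ∈ degByT 𝔥 (legPart 𝔥 n) m :=
  rTensor_smap_mem_degByT (legPart_legPart 𝔥 k) (fun v hv => (legPart_eq_self_iff 𝔥).2
    ((slotMap_snd 𝔥 k n f v).trans ((legPart_eq_self_iff 𝔥).1 hv))) hz

theorem zinv_mem_degByT {k m : ℕ} {z : Fam 𝔥 k} (hz : ∀ l, z l ∈ degByT 𝔥 (legPart 𝔥 k) m)
    (l : ℕ) : zinv 𝔥 k z l ∈ degByT 𝔥 (legPart 𝔥 k) m := by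
  induction l with
  | zero => exact hz 0
  | succ l ih => exact add_mem (hz _) (sub_mem ih (zmap_mem_degByT 𝔥 _ ih))

theorem ninv_mem_degBy {k n : ℕ} {w : SymmetricAlgebra K (Slots 𝔥 k)}
    (hw : w ∈ degBy (legPart 𝔥 k) n) : ninv (slotPr 𝔥 𝔪 hc k) w ∈ degBy (legPart 𝔥 k) n := by
  refine ninv_mem _ fun t => smap_mem_degBy (legPart_legPart 𝔥 k) (fun v hv => ?_) hw
  rw [legPart_eq_self_iff] at hv ⊢
  change 0 + t • (v.2 - 0) = 0
  rw [hv, sub_zero, smul_zero, add_zero]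

/-- Derivatives, normalization and substitutions do not raise the degree in the last slot; only the
final multiplication by a letter can, and by at most one. -/
theorem contr_mem_degBy {k n : ℕ} {w : SymmetricAlgebra K (Slots 𝔥 (k + 1))}
    (hw : w ∈ degBy (legPart 𝔥 (k + 1)) n) :
    contr 𝔥 𝔪 hc k w ∈ degBy (legPart 𝔥 k) (n + 1) := by
  rw [contr_apply]
  refine neg_mem (sum_mem fun l _ => mulBy_mem_degBy _ (zsmul_mem (zmap_mem_degByT 𝔥 _
    (zinv_mem_degByT 𝔥 (fun l => ?_) l)) _))
  exact der_mem_degByT (legPart_legPart 𝔥 _) _ (ninv_mem_degBy 𝔥 𝔪 hc hw)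

end

section

set_option linter.unusedSectionVars false

/-! ### Symmetrization and the filtration of `ADT` -/

section SymPow

open SymmetricAlgebra (ι)

theorem linPow_coeff_of_commute {A : Type*} [Ring A] {a b : A} (h : Commute a b) (i j : ℕ) :
    (linPow a b (i + j)).coeff j = (i + j).choose i • (a ^ i * b ^ j) := by
  have hc : Commute (Polynomial.C a) (Polynomial.C b * Polynomial.X) :=
    (h.map Polynomial.C).mul_right (Polynomial.commute_X _).symm
  have hm : ∀ m, (Polynomial.C b * Polynomial.X) ^ m = Polynomial.C (b ^ m) * Polynomial.X ^ m :=
    fun m => by rw [(Polynomial.commute_X _).symm.mul_pow, map_pow]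
  rw [linPow, hc.add_pow, Polynomial.finsetSum_coeff, Finset.sum_eq_single_of_mem i (by simp)]
  · rw [Nat.add_sub_cancel_left, hm, ← map_pow, ← mul_assoc, ← map_mul, ← nsmul_eq_mul',
      Polynomial.coeff_smul, Polynomial.coeff_C_mul_X_pow, if_pos rfl]
  · intro m hm' hmi
    rw [Finset.mem_range] at hm'
    rw [hm, ← map_pow, ← mul_assoc, ← map_mul, ← nsmul_eq_mul',
      Polynomial.coeff_smul, Polynomial.coeff_C_mul_X_pow, if_neg (by omega), smul_zero]

/-- Commuting letters obey the ordinary binomial theorem, so comparing the coefficients of `t^j` in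
`(x + t y)^(i + j)` on both sides gives the claim up to a binomial coefficient, invertible in
characteristic `0`. -/
theorem sym_pow_mul_pow {K : Type*} [Field K] [CharZero K] {V A : Type*} [AddCommGroup V]
    [Module K V] [Ring A] [Algebra K A] (a : V →ₗ[K] A) {x y : V} (h : Commute (a x) (a y))
    (i j : ℕ) : sym a (ι K V x ^ i * ι K V y ^ j) = a x ^ i * a y ^ j := by
  have key := map_coeff_eq (K := K) (sym a) (LinearMap.id : A →ₗ[K] A)
    (p := linPow (ι K V x) (ι K V y) (i + j)) (q := linPow (a x) (a y) (i + j)) (fun t => by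
      rw [evalAt_linPow, evalAt_linPow, ← map_smul, ← map_add, sym_pow, map_add, map_smul]; rfl) j
  rw [linPow_coeff_of_commute (Commute.all _ _), linPow_coeff_of_commute h, map_nsmul,
    LinearMap.id_apply, ← Nat.cast_smul_eq_nsmul K, ← Nat.cast_smul_eq_nsmul K] at key
  exact smul_right_injective A
    (Nat.cast_ne_zero.2 (Nat.choose_pos (Nat.le_add_right i j)).ne' : ((i + j).choose i : K) ≠ 0) key

variable {K : Type*} [Field K] [CharZero K] {V : Type*} [AddCommGroup V] [Module K V]

theorem smap_self_mem_degBy {ρ : V →ₗ[K] V} (hρ : ∀ v, ρ (ρ v) = ρ v) (w : SymmetricAlgebra K V) :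
    smap ρ w ∈ degBy ρ 0 := by
  induction w using pow_induction with
  | zero => rw [map_zero]; exact zero_mem _
  | add x y hx hy => rw [map_add]; exact add_mem hx hy
  | smul c x hx => rw [map_smul]; exact Submodule.smul_mem _ c hx
  | pow v i =>
    rw [map_pow, smap_ι]
    exact pow_mem_degBy (ι_mem_degBy_zero (hρ v)) i

end SymPow

open SymmetricAlgebra (ι)

variable {K : Type*} [Field K] {𝔤 : Type*} [LieRing 𝔤] [LieAlgebra K 𝔤] (𝔥 : LieSubalgebra K 𝔤)

theorem letter_legPart_mem {k : ℕ} (v : Slots 𝔥 k) : letter 𝔥 k (legPart 𝔥 k v) ∈ adtLE 𝔥 k 0 := by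
  rw [letter_apply, legPart_apply, map_zero, map_zero, add_zero]
  exact sum_mem fun i _ => leg_mem_adtLE 𝔥 i _

theorem letter_legPart_commute {k : ℕ} (v : Slots 𝔥 k) (y : 𝔥) :
    Commute (letter 𝔥 k (legPart 𝔥 k v)) (letter 𝔥 k (tailVec 𝔥 k y)) := by
  rw [letter_tailVec, letter_apply, legPart_apply, map_zero, map_zero, add_zero]
  exact Commute.sum_left _ _ _ fun i _ => leg_tail_commute K 𝔥 i _ _

variable [CharZero K] (𝔪 : Submodule K 𝔤) (hc : IsCompl 𝔥.toSubmodule 𝔪)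

theorem slotPr_legPart (k : ℕ) (v : Slots 𝔥 k) :
    slotPr 𝔥 𝔪 hc k (legPart 𝔥 k v) = legPart 𝔥 k (slotPr 𝔥 𝔪 hc k v) := rfl

theorem slotPr_tailVec (k : ℕ) (y : 𝔥) : slotPr 𝔥 𝔪 hc k (tailVec 𝔥 k y) = 0 :=
  Prod.ext (funext fun _ => map_zero (prM 𝔥 𝔪 hc)) rfl

theorem Psi_pow_tailVec (k : ℕ) {a z : Slots 𝔥 k} (ha : slotPr 𝔥 𝔪 hc k a = a)
    (hz : slotPr 𝔥 𝔪 hc k z = 0) (y : 𝔥) (i s j : ℕ) :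
    Psi 𝔥 𝔪 hc k (ι K _ (legPart 𝔥 k a) ^ i * ι K _ (legPart 𝔥 k z) ^ s * ι K _ (tailVec 𝔥 k y) ^ j) =
      letter 𝔥 k (legPart 𝔥 k a) ^ i * letter 𝔥 k (legPart 𝔥 k z) ^ s *
        letter 𝔥 k (tailVec 𝔥 k y) ^ j := by
  rw [mul_assoc, Psi, psi_mul_of (slotPr_slotPr 𝔥 𝔪 hc k), sym_pow,
    sym_pow_mul_pow _ (letter_legPart_commute 𝔥 z y), mul_assoc]
  · rw [map_pow, smap_ι, slotPr_legPart, ha]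
  · rw [map_mul, map_pow, map_pow, smap_ι, smap_ι, LinearMap.sub_apply, LinearMap.sub_apply,
      slotPr_legPart, hz, slotPr_tailVec, map_zero, sub_zero, sub_zero]
    rfl

/-- Letters of the last slot commute with those of all legs, so their powers split off from the
symmetrization as a right factor. -/
theorem Psi_legPart_mul (k : ℕ) (w : SymmetricAlgebra K (Slots 𝔥 k)) (y : 𝔥) (j : ℕ) :
    Psi 𝔥 𝔪 hc k (smap (legPart 𝔥 k) w * ι K _ (tailVec 𝔥 k y) ^ j) =
      Psi 𝔥 𝔪 hc k (smap (legPart 𝔥 k) w) * tail K 𝔥 k (UniversalEnvelopingAlgebra.ι K y) ^ j := by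
  refine split_pow_induction (slotPr_slotPr 𝔥 𝔪 hc k)
    (p := fun w => Psi 𝔥 𝔪 hc k (smap (legPart 𝔥 k) w * ι K _ (tailVec 𝔥 k y) ^ j) =
      Psi 𝔥 𝔪 hc k (smap (legPart 𝔥 k) w) * tail K 𝔥 k (UniversalEnvelopingAlgebra.ι K y) ^ j)
    (by simp) (fun a b ha hb => ?_) (fun c a ha => ?_) (fun a z i s ha hz => ?_) w
  · rw [map_add, add_mul, map_add, map_add, add_mul, ha, hb]
  · rw [map_smul, smul_mul_assoc, map_smul, map_smul, smul_mul_assoc, ha]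
  · have h0 := Psi_pow_tailVec 𝔥 𝔪 hc k ha hz y i s 0
    rw [pow_zero, mul_one, pow_zero, mul_one] at h0
    rw [map_mul (smap _), map_pow (smap _), map_pow (smap _), smap_ι, smap_ι, h0,
      Psi_pow_tailVec 𝔥 𝔪 hc k ha hz y i s j, letter_tailVec]

theorem Psi_legPart_mem (k : ℕ) (w : SymmetricAlgebra K (Slots 𝔥 k)) :
    Psi 𝔥 𝔪 hc k (smap (legPart 𝔥 k) w) ∈ adtLE 𝔥 k 0 := by
  refine split_pow_induction (slotPr_slotPr 𝔥 𝔪 hc k)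
    (p := fun w => Psi 𝔥 𝔪 hc k (smap (legPart 𝔥 k) w) ∈ adtLE 𝔥 k 0)
    (by rw [map_zero, map_zero]; exact zero_mem _)
    (fun a b ha hb => by rw [map_add, map_add]; exact add_mem ha hb)
    (fun c a ha => by rw [map_smul, map_smul]; exact Submodule.smul_mem _ c ha)
    (fun a z i s ha hz => ?_) w
  have h0 := Psi_pow_tailVec 𝔥 𝔪 hc k ha hz 0 i s 0
  rw [pow_zero, mul_one, pow_zero, mul_one] at h0
  rw [map_mul (smap _), map_pow (smap _), map_pow (smap _), smap_ι, smap_ι, h0]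
  exact mul_mem_adtLE_of_zero 𝔥 (pow_mem_adtLE 𝔥 (letter_legPart_mem 𝔥 a) i)
    (pow_mem_adtLE 𝔥 (letter_legPart_mem 𝔥 z) s)

theorem Psi_mem_adtLE {k n : ℕ} {w : SymmetricAlgebra K (Slots 𝔥 k)}
    (hw : w ∈ degBy (legPart 𝔥 k) n) : Psi 𝔥 𝔪 hc k w ∈ adtLE 𝔥 k n := by
  refine degBy_le (N := (adtLE 𝔥 k n).comap (Psi 𝔥 𝔪 hc k)) (legPart_legPart 𝔥 k)
    (fun x y i j hx hy hj => ?_) hw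
  obtain ⟨y, rfl⟩ : ∃ y', y = tailVec 𝔥 k y' :=
    ⟨y.2, Prod.ext ((congrArg Prod.fst hy : (legPart 𝔥 k y).1 = 0)) rfl⟩
  have h := Psi_legPart_mul 𝔥 𝔪 hc k (ι K _ x ^ i) y j
  have h' := Psi_legPart_mem 𝔥 𝔪 hc k (ι K _ x ^ i)
  rw [map_pow (smap _), smap_ι, hx] at h h'
  rw [Submodule.mem_comap]
  refine (congrArg (· ∈ adtLE 𝔥 k n) h).mpr (mul_mem_adtLE_of_zero 𝔥 h' ?_)
  rw [← map_pow]
  exact tail_mem_adtLE 𝔥 (ueaLE_mono hj (pow_mem_ueaLE _ j))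

/-- The counit in the last tensor factor. -/
def counitTail (k : ℕ) : ADT K 𝔥 k →ₐ[K] ADT K 𝔥 k :=
  adtLift 𝔥 (fun i => leg K 𝔥 i) ((tail K 𝔥 k).comp (unitCounit K 𝔥))
    (fun _ _ hij u v => leg_commute K 𝔥 hij u v) (fun i u _ => leg_tail_commute K 𝔥 i u _)

theorem counitTail_leg {k : ℕ} (i : Fin k) (u : UniversalEnvelopingAlgebra K 𝔤) :
    counitTail 𝔥 k (leg K 𝔥 i u) = leg K 𝔥 i u := adtLift_leg ..

theorem counitTail_tail (k : ℕ) (v : UniversalEnvelopingAlgebra K 𝔥) :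
    counitTail 𝔥 k (tail K 𝔥 k v) = tail K 𝔥 k (unitCounit K 𝔥 v) := adtLift_tail ..

theorem unitCounit_ι (y : 𝔥) : unitCounit K 𝔥 (UniversalEnvelopingAlgebra.ι K y) = 0 := by
  rw [unitCounit, AlgHom.comp_apply, UniversalEnvelopingAlgebra.lift_ι_apply]
  exact map_zero _

/-- By naturality the counit in the last factor corresponds to the substitution that drops the last
slot. This produces preimages of the tensors `u ⊗ 1` that do not involve that slot. -/
theorem counitTail_Psi (k : ℕ) (w : SymmetricAlgebra K (Slots 𝔥 k)) :
    counitTail 𝔥 k (Psi 𝔥 𝔪 hc k w) = Psi 𝔥 𝔪 hc k (smap (legPart 𝔥 k) w) := by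
  rw [Psi, map_psi, psi_smap _ (slotPr_legPart 𝔥 𝔪 hc k)]
  congr 2
  refine LinearMap.ext fun v => ?_
  rw [LinearMap.comp_apply, LinearMap.comp_apply, AlgHom.toLinearMap_apply, letter_apply,
    letter_apply, map_add, map_sum]
  simp only [counitTail_leg, counitTail_tail, unitCounit_ι, legPart_apply,
    map_zero]

theorem exists_Psi_legPart {k : ℕ} (u : Fin k → UniversalEnvelopingAlgebra K 𝔤) :
    ∃ w, Psi 𝔥 𝔪 hc k (smap (legPart 𝔥 k) w) =
      toADT K 𝔥 k (PiTensorProduct.tprod K u ⊗ₜ[K] 1) := by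
  obtain ⟨w, hw⟩ := (Psi_bijective 𝔥 𝔪 hc k).2 (toADT K 𝔥 k (PiTensorProduct.tprod K u ⊗ₜ[K] 1))
  refine ⟨w, ?_⟩
  rw [← counitTail_Psi, hw, tmul_eq_prod, map_one]
  refine (congrArg _ (mul_one _)).trans ?_
  rw [map_list_prod, List.map_ofFn, mul_one]
  congr 2
  funext i
  exact counitTail_leg 𝔥 i (u i)

/-- The converse of `Psi_mem_adtLE`, so that `Psi` identifies the two filtrations. The last factor
is treated by filtered surjectivity of the symmetrization for `𝔥`, the legs by `exists_Psi_legPart`.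
-/
theorem adtLE_le_map_Psi (k n : ℕ) :
    adtLE 𝔥 k n ≤ (degBy (legPart 𝔥 k) n).map (Psi 𝔥 𝔪 hc k) := by
  refine adtLE_le 𝔥 fun u v hv => ?_
  obtain ⟨w, hw⟩ := exists_Psi_legPart 𝔥 𝔪 hc u
  obtain ⟨κ, e⟩ : Σ κ, Module.Basis κ K 𝔥 := ⟨_, Module.Free.chooseBasis K 𝔥⟩
  have hπ : ∀ v : 𝔥, (0 : 𝔥 →ₗ[K] 𝔥) ((0 : 𝔥 →ₗ[K] 𝔥) v) = (0 : 𝔥 →ₗ[K] 𝔥) v := fun _ => rfl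
  obtain ⟨w', hw', rfl⟩ := ueaLE_le_map_psi hπ e n hv
  have hsplit : ∀ v, toADT K 𝔥 k (PiTensorProduct.tprod K u ⊗ₜ[K] v) =
      Psi 𝔥 𝔪 hc k (smap (legPart 𝔥 k) w) * tail K 𝔥 k v := fun v => by
    rw [hw, tail_eq_tmul, tmul_mul_tmul, one_mul]
    congr 3
    funext i
    exact (mul_one _).symm
  rw [hsplit]
  refine degLE_pow_induction e (p := fun w' => Psi 𝔥 𝔪 hc k (smap (legPart 𝔥 k) w) *
    tail K 𝔥 k (psi 0 ιU w') ∈ (degBy (legPart 𝔥 k) n).map (Psi 𝔥 𝔪 hc k))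
    (by rw [map_zero, map_zero, mul_zero]; exact zero_mem _)
    (fun a b ha hb => by rw [map_add, map_add, mul_add]; exact add_mem ha hb)
    (fun c a ha => by rw [map_smul, map_smul, mul_smul_comm]; exact Submodule.smul_mem _ c ha)
    (fun y m hm => ?_) hw'
  have h := psi_pow hπ (ιU (K := K) (L := 𝔥)) (x := 0) (y := y) rfl rfl 0 m
  rw [pow_zero, one_mul, pow_zero, one_mul] at h
  rw [h, map_pow]
  refine ⟨_, ?_, Psi_legPart_mul 𝔥 𝔪 hc k w y m⟩
  have h1 := smap_self_mem_degBy (legPart_legPart 𝔥 k) w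
  have h2 := pow_mem_degBy (ι_mem_degBy (K := K) (ρ := legPart 𝔥 k) (tailVec 𝔥 k y)) m
  have := mul_mem_degBy h1 h2
  rw [zero_add, mul_one] at this
  exact degBy_mono hm this

end

/-! ### The contraction of `𝔤₂[1]` onto `(T^*U𝔪)^𝔥[1]` -/

section

set_option linter.unusedSectionVars false

variable {K : Type*} [Field K] [CharZero K] {𝔤 : Type*} [LieRing 𝔤] [LieAlgebra K 𝔤]
  (𝔥 : LieSubalgebra K 𝔤) (𝔪 : Submodule K 𝔤) (hc : IsCompl 𝔥.toSubmodule 𝔪)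

theorem degHtpy_mem_adtLE {k n : ℕ} {P : ADT K 𝔥 (k + 1)} (hP : P ∈ adtLE 𝔥 (k + 1) n) :
    degHtpy 𝔥 𝔪 hc k P ∈ adtLE 𝔥 k (n + 1) := by
  obtain ⟨w, hw, rfl⟩ := adtLE_le_map_Psi 𝔥 𝔪 hc (k + 1) n hP
  rw [degHtpy_Psi]
  exact Psi_mem_adtLE 𝔥 𝔪 hc (contr_mem_degBy 𝔥 𝔪 hc hw)

theorem htpyTot_mem_totLE {n : ℕ} {x : ADTTot K 𝔥} (hx : x ∈ totLE 𝔥 n) :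
    htpyTot 𝔥 𝔪 hc x ∈ totLE 𝔥 (n + 1) := by
  refine totLE_induction 𝔥 (N := (totLE 𝔥 (n + 1)).comap (htpyTot 𝔥 𝔪 hc)) (fun k P hP => ?_) hx
  rw [Submodule.mem_comap]
  cases k with
  | zero => rw [htpyTot_lf_zero]; exact zero_mem _
  | succ k =>
    rw [htpyTot_lf]
    exact zsmul_mem (lf_mem_totLE 𝔥 (degHtpy_mem_adtLE 𝔥 𝔪 hc hP)) _

variable (hm : ∀ x ∈ 𝔥, ∀ y ∈ 𝔪, ⁅x, y⁆ ∈ 𝔪)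

/-- The contraction of `𝔤₂[1]` onto `(T^*U𝔪)^𝔥[1]`. -/
def contraction : StrictContraction (dglaTUmInv 𝔥 𝔪 hc hm) (dglaInvariants (K := K) 𝔥) where
  incl := Submodule.inclusion inf_le_right
  pr := (projTot K 𝔥 𝔪).restrict fun _ hx => projTot_mem_TUmInv 𝔥 𝔪 hc hm hx
  htpy := (htpyTot 𝔥 𝔪 hc).restrict fun _ hx => htpyTot_mem_invariants 𝔥 𝔪 hc hm hx
  incl_mem _ _ hx := hx
  htpy_mem _ _ hw := HomDeg.htpyTot 𝔥 𝔪 hc hw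
  incl_d _ := rfl
  pr_incl x := Subtype.ext (projTot_of_mem 𝔥 𝔪 hc x.2.1)
  pr_htpy w := Subtype.ext (projTot_htpyTot 𝔥 𝔪 hc w)
  pr_br w w' := Subtype.ext <| by
    refine Eq.trans ?_ (projTot_bracketTot_left 𝔥 𝔪 hc (x := (w : ADTTot K 𝔥))
      (projTot_mem_invariants 𝔥 𝔪 hc hm w'.2)).symm
    exact (projTot_bracketTot_right 𝔥 𝔪 hc (y := (w' : ADTTot K 𝔥)) w.2).symm
  d_htpy w := Subtype.ext (dTot_htpyTot 𝔥 𝔪 hc w)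

end

end DynTwist

end

theorem proposition2p4 {K : Type*} [Field K] [CharZero K] {𝔤 : Type*} [LieRing 𝔤] [LieAlgebra K 𝔤]
    (𝔥 : LieSubalgebra K 𝔤) (𝔪 : Submodule K 𝔤) (hc : IsCompl 𝔥.toSubmodule 𝔪)
    (hm : ∀ x ∈ 𝔥, ∀ y ∈ 𝔪, ⁅x, y⁆ ∈ 𝔪) :
    IsCompl (DynTwist.Um K 𝔪) (DynTwist.Ugh K 𝔥) ∧
    ∃ (A : DynTwist.DGLA K (DynTwist.TUmInv K 𝔥 𝔪)) (B : DynTwist.DGLA K (DynTwist.g₂ K 𝔥)),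
      (A.deg = DynTwist.shiftedDeg K 𝔥 (DynTwist.TUmInv K 𝔥 𝔪) ∧
        (∀ P, (A.d P : DynTwist.ADTTot K 𝔥) = DynTwist.dTot K 𝔥 P) ∧
        ∀ P Q, (A.br P Q : DynTwist.ADTTot K 𝔥) =
          DynTwist.projTot K 𝔥 𝔪 (DynTwist.bracketTot K 𝔥 P Q)) ∧
      (B.deg = DynTwist.shiftedDeg K 𝔥 (DynTwist.g₂ K 𝔥) ∧
        (∀ P, (B.d P : DynTwist.ADTTot K 𝔥) = DynTwist.dTot K 𝔥 P) ∧
        ∀ P Q, (B.br P Q : DynTwist.ADTTot K 𝔥) = DynTwist.bracketTot K 𝔥 P Q) ∧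
      ∃ Q₂ : DynTwist.LInftyHom A B, Q₂.IsQuasiIso ∧
        (∀ P, (Q₂.map 1 ![P] : DynTwist.ADTTot K 𝔥) = P) ∧
        ∀ n, 1 ≤ n → ∀ P : Fin n → DynTwist.TUmInv K 𝔥 𝔪,
          (Q₂.map n P : DynTwist.ADTTot K 𝔥) ∈ DynTwist.filtADT K 𝔥 (n - 1) := by
  let C := DynTwist.contraction 𝔥 𝔪 hc hm
  refine ⟨DynTwist.isCompl_Um_Ugh 𝔥 𝔪 hc, DynTwist.dglaTUmInv 𝔥 𝔪 hc hm, DynTwist.dglaInvariants 𝔥,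
    ⟨rfl, fun _ => rfl, fun _ _ => rfl⟩, ⟨rfl, fun _ => rfl, fun _ _ => rfl⟩,
    C.lInftyHom, C.lInftyHom_isQuasiIso,
    fun P => congrArg Subtype.val (DynTwist.transferMap_one C P), fun n _ P => ?_⟩
  -- The estimates are made for the filtration by word length in `U𝔥`, which is visibly compatible
  -- with brackets and the homotopy, and passed to the coproduct filtration at the end.
  exact DynTwist.totLE_le_filtADT 𝔥 (n - 1) (C.lInftyHom_mem_filtration
    (F := fun n => (DynTwist.totLE 𝔥 n).comap (DynTwist.g₂ K 𝔥).subtype)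
    (fun x => DynTwist.TUm_le_totLE 𝔥 𝔪 x.2.1)
    (fun _ _ _ _ hx hy => DynTwist.bracketTot_mem_totLE 𝔥 hx hy)
    (fun _ _ hx => DynTwist.htpyTot_mem_totLE 𝔥 𝔪 hc hx) n P)
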